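/- Let $G$ be a locally compact (Hausdorff) group and let $X$ be a $G$-manifold, i.e. a complete Riemannian manifold (smooth, second countable, without boundary) with distance $\rho$ and with a continuous action of $G$ by isometric diffeomorphisms. Let $p:E\to X$ be a smooth locally trivial bundle of C*-algebras (with fibre a C*-algebra $A$, not necessarily unital) which is $G$-equivariant: $G$ acts continuously on $E$, covering the action on $X$, by isomorphisms of C*-algebras on the fibres, and every $g\in G$ acts on $E$ by a smooth map. A geodesic segment from $x$ to $y$ is a geodesic $\gamma:[0,1]\to X$ from $x$ to $y$ of length $\rho(x,y)$. Let $r:X\to(0,\infty)$ be a continuous $G$-invariant function such that any $x,y$ with $\rho(x,y)<r(x)$ are joined by a unique geodesic segment $\gamma_{x,y}$. Put $U=\{(x,y)\in X\times X:\rho(x,y)<r(x)\}$, $P:U\times[0,1]\to X$, $P(x,y,t)=\gamma_{x,y}(t)$, and $P_0(x,y,t)=\gamma_{x,y}(0)=x$. The bundle $E$ is called *feasible* if for every such $r$ the map $P$ is continuous and there is a $G$-equivariant isomorphism $\varphi:P^*E\to P_0^*E$ of bundles of C*-algebras which fixes the base $U\times[0,1]$. A Hermitian connection on $E$ is a map $(V,a)\mapsto\nabla_V(a)$,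 $\Gamma^\infty(TX)\times\Gamma^\infty(E)\to\Gamma^\infty(E)$, which is additive in $V$, $\mathbb C$-linear in $a$, and satisfies $\nabla_{fV}(a)=f\nabla_V(a)$, $\nabla_V(fa)=f\nabla_V(a)+V(f)a$, $\nabla_V(ab)=a\nabla_V(b)+\nabla_V(a)b$ and $\nabla_V(a^*)=\nabla_V(a)^*$ for all real $f\in C^\infty(X)$, $V\in\Gamma^\infty(TX)$, $a,b\in\Gamma^\infty(E)$. It is $G$-invariant if $\nabla_{gV}(ga)=g(\nabla_V(a))$ for all $g\in G$. 1. If $\nabla$ is a $G$-invariant Hermitian connection on $E$, then $E$ is feasible. More precisely, for every $r$ as above the isomorphism $\varphi$ can be chosen such that parallel transport $E_x\to E_{\gamma_{x,y}(t)}$ along $\gamma_{x,y}$ with respect to $\nabla$ is well defined for all $(x,y,t)\in U\times[0,1]$, and the restriction $\varphi_{x,y,t}:E_{\gamma_{x,y}(t)}\to E_x$ of $\varphi$ to the fibre at $(x,y,t)$ is its inverse. 2. If $G$ is compact, or if $G$ is discrete and acts properly on $X$, then there is a $G$-invariant Hermitian connection on $E$. In particular, $E$ is feasible. -/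

import Mathlib

open Bundle Set Manifold
open scoped ContDiff

noncomputable section

/-! ### Geodesics on a Riemannian manifold -/

section Geodesics

variable {n : ℕ} {X : Type*} [EMetricSpace X] [ChartedSpace (EuclideanSpace ℝ (Fin n)) X]
  [IsManifold (𝓡 n) ∞ X] [RiemannianBundle (fun x : X => TangentSpace (𝓡 n) x)]

/-- The Riemannian metric read in the chart at `p`: the bilinear form at the point `u` of the
model space, evaluated at the vectors `v` and `w`. -/
def coordMetric (p : X) (u v w : EuclideanSpace ℝ (Fin n)) : ℝ :=
  inner ℝ
    (mfderiv 𝓘(ℝ, EuclideanSpace ℝ (Fin n)) (𝓡 n) (extChartAt (𝓡 n) p).symm u v)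
    (mfderiv 𝓘(ℝ, EuclideanSpace ℝ (Fin n)) (𝓡 n) (extChartAt (𝓡 n) p).symm u w)

/-- Riemannian geodesics `γ : [0,1] → X` (only the restriction of `γ` to `[0,1]` matters):
smooth curves that satisfy the geodesic equation. Writing `c` for the curve and `g` for the metric
in the chart at `γ t₀`, the equation is used in its Euler-Lagrange form
`d/dt (g_c(c', w)) = 1/2 * (∂_w g)_c(c', c')` for all constant vectors `w`, which is the usual
equation `c'' + Γ(c', c') = 0` with its index lowered. -/
structure IsGeodesic (γ : ℝ → X) : Prop where
  contMDiffOn : ContMDiffOn 𝓘(ℝ, ℝ) (𝓡 n) ∞ γ (Icc 0 1)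
  eulerLagrange : ∀ t₀ ∈ Icc (0 : ℝ) 1, ∀ w : EuclideanSpace ℝ (Fin n),
    let c : ℝ → EuclideanSpace ℝ (Fin n) := fun t => extChartAt (𝓡 n) (γ t₀) (γ t)
    let c' : ℝ → EuclideanSpace ℝ (Fin n) := fun t => derivWithin c (Icc 0 1) t
    HasDerivWithinAt (fun t => coordMetric (γ t₀) (c t) (c' t) w)
      ((1 / 2 : ℝ) * fderiv ℝ (fun u => coordMetric (γ t₀) u (c' t₀) (c' t₀)) (c t₀) w)
      (Icc 0 1) t₀

/-- `γ : [0,1] → X` is a geodesic segment from `x` to `y`, i.e. a geodesic from `x` to `y` whose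
length is the distance of `x` and `y`. -/
structure IsGeodesicSegment (γ : ℝ → X) (x y : X) : Prop where
  isGeodesic : IsGeodesic (n := n) γ
  source : γ 0 = x
  target : γ 1 = y
  length : pathELength (𝓡 n) γ 0 1 = edist x y

open Classical in
/-- A geodesic segment `γ_{x,y}` from `x` to `y`, if there is one. -/
def geodesicSegment (n : ℕ) {X : Type*} [EMetricSpace X]
    [ChartedSpace (EuclideanSpace ℝ (Fin n)) X] [IsManifold (𝓡 n) ∞ X]
    [RiemannianBundle (fun x : X => TangentSpace (𝓡 n) x)] (x y : X) : ℝ → X :=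
  if h : ∃ γ : ℝ → X, IsGeodesicSegment (n := n) γ x y then h.choose else fun _ => x

/-- The neighbourhood `U = {(x, y) | ρ(x, y) < r(x)}` of the diagonal. -/
def shortPairs (r : X → ℝ) : Set (X × X) :=
  {p | edist p.1 p.2 < ENNReal.ofReal (r p.1)}

/-- The functions `r` used to define `U`: continuous, positive, `G`-invariant, and such that any
points `x`, `y` with `ρ(x, y) < r(x)` are joined by a unique geodesic segment. -/
structure IsGeodesicRadius (n : ℕ) (G : Type*) [Group G] {X : Type*} [EMetricSpace X]
    [ChartedSpace (EuclideanSpace ℝ (Fin n)) X] [IsManifold (𝓡 n) ∞ X]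
    [RiemannianBundle (fun x : X => TangentSpace (𝓡 n) x)] [MulAction G X]
    (r : X → ℝ) : Prop where
  continuous : Continuous r
  pos : ∀ x, 0 < r x
  invariant : ∀ (g : G) (x : X), r (g • x) = r x
  exists_segment : ∀ p ∈ shortPairs r, ∃ γ : ℝ → X, IsGeodesicSegment (n := n) γ p.1 p.2
  unique_segment : ∀ p ∈ shortPairs r, ∀ γ₁ γ₂ : ℝ → X,
    IsGeodesicSegment (n := n) γ₁ p.1 p.2 → IsGeodesicSegment (n := n) γ₂ p.1 p.2 →
      EqOn γ₁ γ₂ (Icc 0 1)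

/-- The homotopy `P : U × [0,1] → X`, `P(x, y, t) = γ_{x,y}(t)`. -/
def geodesicHomotopy (n : ℕ) {X : Type*} [EMetricSpace X]
    [ChartedSpace (EuclideanSpace ℝ (Fin n)) X] [IsManifold (𝓡 n) ∞ X]
    [RiemannianBundle (fun x : X => TangentSpace (𝓡 n) x)] (r : X → ℝ)
    (b : shortPairs r × unitInterval) : X :=
  geodesicSegment n b.1.1.1 b.1.1.2 b.2

/-- The map `P₀ : U × [0,1] → X`, `P₀(x, y, t) = γ_{x,y}(0) = x`. -/
def geodesicHomotopyZero (r : X → ℝ) (b : shortPairs r × unitInterval) : X :=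
  b.1.1.1

/-- The action of `G` on `X` is by isometric diffeomorphisms. -/
structure IsIsometricAction (n : ℕ) (G X : Type*) [Group G] [EMetricSpace X]
    [ChartedSpace (EuclideanSpace ℝ (Fin n)) X] [IsManifold (𝓡 n) ∞ X]
    [RiemannianBundle (fun x : X => TangentSpace (𝓡 n) x)] [MulAction G X] : Prop where
  contMDiff_smul : ∀ g : G, ContMDiff (𝓡 n) (𝓡 n) ∞ (fun x : X => g • x)
  inner_mfderiv_smul : ∀ (g : G) (x : X) (v w : TangentSpace (𝓡 n) x),
    inner ℝ (mfderiv (𝓡 n) (𝓡 n) (fun x : X => g • x) x v)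
      (mfderiv (𝓡 n) (𝓡 n) (fun x : X => g • x) x w) = inner ℝ v w

end Geodesics

/-! ### Bundles of C*-algebras -/

/-- A locally trivial real vector bundle with typical fibre `A` whose fibres are C*-algebras is a
locally trivial bundle of C*-algebras if the trivializations of its atlas are fibrewise isomorphisms
of C*-algebras. (Together with `ContMDiffVectorBundle ∞ A E (𝓡 n)`, which says that the transition
functions are smooth, this is a smooth locally trivial bundle of C*-algebras.) -/
def IsCStarBundle {X : Type*} [TopologicalSpace X] (A : Type*) [NonUnitalCStarAlgebra A]
    (E : X → Type*) [∀ x, NonUnitalCStarAlgebra (E x)] [TopologicalSpace (TotalSpace A E)]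
    [FiberBundle A E] : Prop :=
  ∀ (e : Trivialization A (π A E)) [MemTrivializationAtlas e], ∀ x ∈ e.baseSet,
    ∃ φ : E x ≃⋆ₐ[ℂ] A, ∀ v : E x, (e ⟨x, v⟩).2 = φ v

/-- The action of `G` on the total space of the smooth bundle `E` covers the action on the base,
is by isomorphisms of C*-algebras on the fibres, and each group element acts by a smooth map. -/
structure IsSmoothEquivariantBundle (n : ℕ) (G : Type*) [Group G] {X : Type*} [TopologicalSpace X]
    [ChartedSpace (EuclideanSpace ℝ (Fin n)) X] [MulAction G X]
    (A : Type*) [NonUnitalCStarAlgebra A]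
    (E : X → Type*) [∀ x, NonUnitalCStarAlgebra (E x)] [TopologicalSpace (TotalSpace A E)]
    [FiberBundle A E] [VectorBundle ℝ A E] [MulAction G (TotalSpace A E)] : Prop where
  smul_fibre : ∀ (g : G) (x : X), ∃ φ : E x ≃⋆ₐ[ℂ] E (g • x), ∀ v : E x,
    g • (⟨x, v⟩ : TotalSpace A E) = ⟨g • x, φ v⟩
  contMDiff_smul : ∀ g : G, ContMDiff ((𝓡 n).prod 𝓘(ℝ, A)) ((𝓡 n).prod 𝓘(ℝ, A)) ∞
    (fun v : TotalSpace A E => g • v)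

/-- An isomorphism `f₀^* E ≅ f₁^* E` of bundles of C*-algebras over `B` which fixes the base. -/
structure PullbackIso {B X : Type*} [TopologicalSpace B] [TopologicalSpace X]
    (A : Type*) [NonUnitalCStarAlgebra A] (E : X → Type*) [∀ x, NonUnitalCStarAlgebra (E x)]
    [TopologicalSpace (TotalSpace A E)] (f₀ f₁ : B → X) where
  fibre : ∀ b : B, E (f₀ b) ≃⋆ₐ[ℂ] E (f₁ b)
  continuous_toFun : Continuous
    (fun v : TotalSpace A (f₀ *ᵖ E) => (⟨v.1, fibre v.1 v.2⟩ : TotalSpace A (f₁ *ᵖ E)))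
  continuous_invFun : Continuous
    (fun v : TotalSpace A (f₁ *ᵖ E) => (⟨v.1, (fibre v.1).symm v.2⟩ : TotalSpace A (f₀ *ᵖ E)))

section Feasible

variable {n : ℕ} {X : Type*} [EMetricSpace X] [ChartedSpace (EuclideanSpace ℝ (Fin n)) X]
  [IsManifold (𝓡 n) ∞ X] [RiemannianBundle (fun x : X => TangentSpace (𝓡 n) x)]
  {A : Type*} [NonUnitalCStarAlgebra A] {E : X → Type*} [∀ x, NonUnitalCStarAlgebra (E x)]
  [TopologicalSpace (TotalSpace A E)]

/-- `φ : P^* E ≅ P₀^* E` is equivariant for the actions `g (x, y, t, v) = (g x, g y, t, g v)`.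
It is part of the claim that these actions make sense, i.e. that `U` is invariant and that
`g v` lies in the fibre over `P(g x, g y, t)` if `v` lies in the fibre over `P(x, y, t)`. -/
def PullbackIso.IsEquivariant (G : Type*) [Group G] [MulAction G X]
    [MulAction G (TotalSpace A E)] {r : X → ℝ}
    (φ : PullbackIso A E (geodesicHomotopy n r) (geodesicHomotopyZero r)) : Prop :=
  ∀ (g : G) (p : shortPairs r), ∃ q : shortPairs r,
    q.1 = (g • p.1.1, g • p.1.2) ∧
    ∀ (t : unitInterval) (v : E (geodesicHomotopy n r (p, t))),
      ∃ w : E (geodesicHomotopy n r (q, t)),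
        (⟨geodesicHomotopy n r (q, t), w⟩ : TotalSpace A E) =
          g • (⟨geodesicHomotopy n r (p, t), v⟩ : TotalSpace A E) ∧
        (⟨geodesicHomotopyZero r (q, t), φ.fibre (q, t) w⟩ : TotalSpace A E) =
          g • (⟨geodesicHomotopyZero r (p, t), φ.fibre (p, t) v⟩ : TotalSpace A E)

/-- The `G`-bundle `E` is feasible: `P^* E` and `P₀^* E` are bundles (i.e. `P` is continuous) and
there is a `G`-equivariant isomorphism `P^* E ≅ P₀^* E` which fixes the base `U × [0,1]`. -/
def IsFeasible (n : ℕ) (G : Type*) [Group G] {X : Type*} [EMetricSpace X]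
    [ChartedSpace (EuclideanSpace ℝ (Fin n)) X] [IsManifold (𝓡 n) ∞ X]
    [RiemannianBundle (fun x : X => TangentSpace (𝓡 n) x)] [MulAction G X]
    (A : Type*) [NonUnitalCStarAlgebra A] (E : X → Type*) [∀ x, NonUnitalCStarAlgebra (E x)]
    [TopologicalSpace (TotalSpace A E)] [MulAction G (TotalSpace A E)] : Prop :=
  ∀ r : X → ℝ, IsGeodesicRadius n G r →
    Continuous (geodesicHomotopy n r) ∧
    ∃ φ : PullbackIso A E (geodesicHomotopy n r) (geodesicHomotopyZero r), φ.IsEquivariant G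

end Feasible

/-! ### Hermitian connections and parallel transport -/

/-- Smooth vector fields on `X`. -/
abbrev SmoothVectorField (n : ℕ) (X : Type*) [TopologicalSpace X]
    [ChartedSpace (EuclideanSpace ℝ (Fin n)) X] [IsManifold (𝓡 n) ∞ X] :=
  ContMDiffSection (𝓡 n) (EuclideanSpace ℝ (Fin n)) ∞ (fun x : X => TangentSpace (𝓡 n) x)

/-- The derivative `V(f)` of a function `f` along a vector field `V`. -/
def SmoothVectorField.deriveFunction {n : ℕ} {X : Type*} [TopologicalSpace X]
    [ChartedSpace (EuclideanSpace ℝ (Fin n)) X] [IsManifold (𝓡 n) ∞ X]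
    (V : SmoothVectorField n X) (f : X → ℝ) (x : X) : ℝ :=
  mfderiv (𝓡 n) 𝓘(ℝ, ℝ) f x (V x)

/-- Smooth sections of `E`. -/
abbrev SmoothSection (n : ℕ) {X : Type*} [TopologicalSpace X]
    [ChartedSpace (EuclideanSpace ℝ (Fin n)) X] (A : Type*) [NonUnitalCStarAlgebra A]
    (E : X → Type*) [∀ x, NonUnitalCStarAlgebra (E x)] [TopologicalSpace (TotalSpace A E)]
    [FiberBundle A E] [VectorBundle ℝ A E] :=
  ContMDiffSection (𝓡 n) A ∞ E

/-- A Hermitian connection on the smooth bundle `E` of C*-algebras over `X`: a map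
`(V, a) ↦ ∇_V a` from smooth vector fields and smooth sections to smooth sections with
`∇_{V + W} a = ∇_V a + ∇_W a`, `∇_{f V} a = f ∇_V a`, `∇_V (a + b) = ∇_V a + ∇_V b`,
`∇_V (z a) = z ∇_V a` for `z ∈ ℂ`, `∇_V (f a) = f ∇_V a + V(f) a`,
`∇_V (a b) = a ∇_V b + (∇_V a) b` and `∇_V (a^*) = (∇_V a)^*`. -/
structure HermitianConnection (n : ℕ) {X : Type*} [TopologicalSpace X]
    [ChartedSpace (EuclideanSpace ℝ (Fin n)) X] [IsManifold (𝓡 n) ∞ X]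
    (A : Type*) [NonUnitalCStarAlgebra A] (E : X → Type*) [∀ x, NonUnitalCStarAlgebra (E x)]
    [TopologicalSpace (TotalSpace A E)] [FiberBundle A E] [VectorBundle ℝ A E] where
  toFun : SmoothVectorField n X → SmoothSection n A E → SmoothSection n A E
  add_field : ∀ (V W : SmoothVectorField n X) (a : SmoothSection n A E) (x : X),
    toFun (V + W) a x = toFun V a x + toFun W a x
  smul_field : ∀ (f : X → ℝ) (V W : SmoothVectorField n X) (a : SmoothSection n A E),
    ContMDiff (𝓡 n) 𝓘(ℝ, ℝ) ∞ f → (∀ x, W x = f x • V x) →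
      ∀ x, toFun W a x = f x • toFun V a x
  add_section : ∀ (V : SmoothVectorField n X) (a b : SmoothSection n A E) (x : X),
    toFun V (a + b) x = toFun V a x + toFun V b x
  smul_section : ∀ (z : ℂ) (V : SmoothVectorField n X) (a b : SmoothSection n A E),
    (∀ x, b x = z • a x) → ∀ x, toFun V b x = z • toFun V a x
  leibniz : ∀ (f : X → ℝ) (V : SmoothVectorField n X) (a b : SmoothSection n A E),
    ContMDiff (𝓡 n) 𝓘(ℝ, ℝ) ∞ f → (∀ x, b x = f x • a x) →
      ∀ x, toFun V b x =
        f x • toFun V a x + SmoothVectorField.deriveFunction V f x • a x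
  mul_section : ∀ (V : SmoothVectorField n X) (a b c : SmoothSection n A E),
    (∀ x, c x = a x * b x) →
      ∀ x, toFun V c x = a x * toFun V b x + toFun V a x * b x
  star_section : ∀ (V : SmoothVectorField n X) (a b : SmoothSection n A E),
    (∀ x, b x = star (a x)) → ∀ x, toFun V b x = star (toFun V a x)

section Connection

variable {n : ℕ} {X : Type*} [EMetricSpace X] [ChartedSpace (EuclideanSpace ℝ (Fin n)) X]
  [IsManifold (𝓡 n) ∞ X]
  {A : Type*} [NonUnitalCStarAlgebra A] {E : X → Type*} [∀ x, NonUnitalCStarAlgebra (E x)]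
  [TopologicalSpace (TotalSpace A E)] [FiberBundle A E] [VectorBundle ℝ A E]

/-- The connection `∇` is `G`-invariant: `∇_{gV}(g a) = g (∇_V a)`, where `gV` and `g a` denote the
translates `(gV)(g x) = dg (V x)` and `(g a)(g x) = g (a x)` of vector fields and sections. -/
def HermitianConnection.IsInvariant (G : Type*) [Group G] [MulAction G X]
    [MulAction G (TotalSpace A E)] (D : HermitianConnection n A E) : Prop :=
  ∀ (g : G) (V V' : SmoothVectorField n X) (a a' : SmoothSection n A E),
    (∀ x, V' (g • x) = mfderiv (𝓡 n) (𝓡 n) (fun x : X => g • x) x (V x)) →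
    (∀ x, (⟨g • x, a' (g • x)⟩ : TotalSpace A E) = g • (⟨x, a x⟩ : TotalSpace A E)) →
      ∀ x, (⟨g • x, D.toFun V' a' (g • x)⟩ : TotalSpace A E) =
        g • (⟨x, D.toFun V a x⟩ : TotalSpace A E)

/-- The section `s(t) ∈ E_{γ(t)}` along the curve `γ : [0,1] → X` is parallel. At each time `t₀`,
compare `s` with a smooth section `σ` with `σ(γ(t₀)) = s(t₀)`: the covariant derivative of `s` at
`t₀` is `∇_{γ'(t₀)} σ + (s - σ ∘ γ)'(t₀)`, where the derivative of `s - σ ∘ γ`, which vanishes at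
`t₀`, does not depend on the local trivialization used to define it. -/
def HermitianConnection.IsParallelAlong (D : HermitianConnection n A E) (γ : ℝ → X)
    (s : ∀ t : ℝ, E (γ t)) : Prop :=
  ∀ t₀ ∈ Icc (0 : ℝ) 1, ∀ (V : SmoothVectorField n X) (σ : SmoothSection n A E),
    V (γ t₀) = mfderivWithin 𝓘(ℝ, ℝ) (𝓡 n) γ (Icc 0 1) t₀ (1 : ℝ) →
    σ (γ t₀) = s t₀ →
      HasDerivWithinAt
        (fun t => (trivializationAt A E (γ t₀) ⟨γ t, s t⟩).2 -
          (trivializationAt A E (γ t₀) ⟨γ t, σ (γ t)⟩).2)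
        (-(trivializationAt A E (γ t₀) ⟨γ t₀, D.toFun V σ (γ t₀)⟩).2) (Icc 0 1) t₀

/-- `φ : P^* E ≅ P₀^* E` is, at `(x, y, t)`, the inverse of the parallel transport
`E_x → E_{γ(t)}` along `γ = γ_{x,y}`: every `a ∈ E_x` is the initial value of a parallel section
along `γ`, and `φ_{x,y,t}` maps `s(t)` to `s(0)` for every parallel section `s` along `γ`. -/
def PullbackIso.IsInverseParallelTransport
    [RiemannianBundle (fun x : X => TangentSpace (𝓡 n) x)] {r : X → ℝ}
    (φ : PullbackIso A E (geodesicHomotopy n r) (geodesicHomotopyZero r))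
    (D : HermitianConnection n A E) : Prop :=
  ∀ p : shortPairs r,
    (∀ a : E p.1.1, ∃ s : ∀ t : ℝ, E (geodesicSegment n p.1.1 p.1.2 t),
      D.IsParallelAlong (geodesicSegment n p.1.1 p.1.2) s ∧
      (⟨geodesicSegment n p.1.1 p.1.2 0, s 0⟩ : TotalSpace A E) = ⟨p.1.1, a⟩) ∧
    (∀ s : ∀ t : ℝ, E (geodesicSegment n p.1.1 p.1.2 t),
      D.IsParallelAlong (geodesicSegment n p.1.1 p.1.2) s → ∀ t : unitInterval,
        (⟨p.1.1, φ.fibre (p, t) (s t)⟩ : TotalSpace A E) =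
          ⟨geodesicSegment n p.1.1 p.1.2 0, s 0⟩)

end Connection

end

/-!
The first part is parallel transport along the geodesic segments, the second part is the patching
and averaging of local trivial connections. Both need some care since the fibres are
infinite-dimensional and, in the second part, since the group acts only strongly continuously.

*Continuity of the geodesics.* In a chart, geodesics are the integral curves of the smooth
Hamiltonian vector field of the kinetic energy (`IsGeodesic.hasDerivWithinAt_phaseCurve`), and
their speed is constant. If the endpoints of unique segments converge, then the segments have
bounded speed; along an ultrafilter they converge at all times by completeness and local
compactness of `X` (`exists_tendsto_geodesics`), the limit is again a geodesic of the right length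
(`geodesic_limit`), and therefore it is the unique segment between the limits. This proves the
continuity of `P(x, y, t)` and of the velocities (`tendsto_geodesicSegment`,
`continuousAt_velocity`) without the exponential map and without smooth dependence on initial
values.

*Parallel transport.* Connections are local, so a Hermitian connection has the form `d + Γ` in a
trivialization: by Hadamard's lemma a section is, near `x`, a section with constant coordinates
plus a combination of sections whose coefficients vanish at `x` (`exists_christoffel`). The
operators `Γ(v)` are *-derivations which are defined on all of `A`, so they are bounded
(`continuous_of_star_derivation`). They depend on the base point only strongly continuously, but
they are locally uniformly bounded by the theorem of Banach and Steinhaus. Hence parallel sections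
are the solutions of linear differential equations (`isParallelAt_iff_hasDerivWithinAt`), which
are uniquely solvable on short intervals, and the interval `[0, 1]` is exhausted by a
connectedness argument. Since the coefficients are *-derivations, transport is an isomorphism of
C*-algebras (`exists_transport`). It depends continuously on all parameters by an a priori
estimate (`tendsto_parallel`), and for an invariant connection it is equivariant because
translates of parallel sections are parallel (`isParallelAlong_smul_group`). This gives the first
part, `exists_pullbackIso_of_isInvariant`.

*Invariant connections.* An operator that satisfies the axioms of a connection, except that the
Leibniz rule has a weight `w` (`IsWeightedConnection`), can be translated by the group and summed,
and it is a connection if the weights add up to one. The basic examples are the trivial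
connections of trivializations, multiplied with cutoff functions. For a proper action of a
discrete group, there are functions `ρ i` such that the translates of all of them are a locally
finite partition of unity (`exists_translate_partition`), and the sum over all `i` and all
translates is invariant. For a compact group, the translates are averaged over the Haar measure.

*Smoothness of the averages.* The action on `E` is assumed to be continuous, and smooth for every
single `g`, so differentiation under the integral over `G` has to be justified. The following
argument in the spirit of Bochner and Montgomery does this (`contDiffOn_family`). Strongly
continuous families of operators indexed by `G` are bounded operators into `C(G, A)`. To be of
class `C¹` with a given constant is a closed condition on the values of a function
(`contDiffOn_one_of_interpolation`), and it holds for every single `g` with some constant. By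
Baire's theorem it holds with a uniform constant for the parameters in a nonempty open subset of
`G`, for finitely many points of an orbit at once. The translates of a trivialization are permuted
by the group up to smooth changes of coordinates, so finitely many translates of this open subset
give the uniform estimate for all parameters. Iteration yields smoothness as a function with
values in `C(G, A)`, with which the integral commutes.
-/

open Bundle Set Manifold
open scoped ContDiff

noncomputable section

set_option maxSynthPendingDepth 3
set_option linter.unusedSectionVars false

/-! ### Boundedness of everywhere defined *-derivations -/

section Kaplansky
open Filter Topology

variable {A : Type*} [NonUnitalCStarAlgebra A]

/-- A spectral point `t₀` of the selfadjoint element `x` with `|t₀| = ‖x‖` gives elements `z`, bump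
functions of `x` around `t₀`, which almost multiply `x` to `t₀` from both sides. The function
`t - t₀⁻¹ t²` vanishes at `0` and at `t₀`, hence so do the square roots of its positive and negative
parts; these are the elements `u` and `v`, which `z` almost annihilates. -/
theorem exists_localizing_element (x : A) (hx : IsSelfAdjoint x) (hx0 : x ≠ 0) :
    ∃ t₀ : ℝ, t₀ ≠ 0 ∧ ∃ u v : A, x - t₀⁻¹ • (x * x) = u * u - v * v ∧
      ∀ η > 0, ∃ z : A, ‖z‖ ≤ 1 ∧ ‖x‖ ≤ ‖z * x * z‖ ∧ ‖z * u‖ ≤ η ∧ ‖u * z‖ ≤ η ∧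
        ‖z * v‖ ≤ η ∧ ‖v * z‖ ≤ η ∧ ‖z * x - t₀ • z‖ ≤ η ∧ ‖x * z - t₀ • z‖ ≤ η := by
  obtain ⟨⟨t₀, ht₀, htn⟩, -⟩ :=
    NonUnitalIsometricContinuousFunctionalCalculus.isGreatest_norm_quasispectrum (𝕜 := ℝ) x hx
  have hxn : 0 < ‖x‖ := norm_pos_iff.2 hx0
  have h0 : t₀ ≠ 0 := by rintro rfl; simp at htn; exact hx0 (norm_eq_zero.1 htn.symm)
  refine ⟨t₀, h0, ?_⟩
  -- `fu` and `fv` are the square roots of the positive and the negative part of `t - t₀⁻¹ t²`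
  set fu : ℝ → ℝ := fun t => √(max (t - t₀⁻¹ * (t * t)) 0) with hfu
  set fv : ℝ → ℝ := fun t => √(max (-(t - t₀⁻¹ * (t * t))) 0) with hfv
  have cu : Continuous fu := by fun_prop
  have cv : Continuous fv := by fun_prop
  have u0 : fu 0 = 0 := by simp [hfu]
  have v0 : fv 0 = 0 := by simp [hfv]
  have ut : fu t₀ = 0 := by simp [hfu, h0]
  have vt : fv t₀ = 0 := by simp [hfv, h0]
  have cx : x = cfcₙ (fun t : ℝ => t) x := (cfcₙ_id' ℝ x).symm
  refine ⟨cfcₙ fu x, cfcₙ fv x, ?_, fun η hη => ?_⟩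
  · rw [← cfcₙ_mul fu fu x (by fun_prop) u0 (by fun_prop) u0,
      ← cfcₙ_mul fv fv x (by fun_prop) v0 (by fun_prop) v0,
      ← cfcₙ_sub _ _ x (by fun_prop) (by simp [u0]) (by fun_prop) (by simp [v0])]
    conv_lhs => rw [cx]
    rw [← cfcₙ_mul (fun t : ℝ => t) (fun t : ℝ => t) x (by fun_prop) rfl (by fun_prop) rfl,
      ← cfcₙ_smul t₀⁻¹ _ x (by fun_prop) (by simp),
      ← cfcₙ_sub _ _ x (by fun_prop) (by simp) (by fun_prop) (by simp)]
    congr 1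
    ext t
    simp only [hfu, hfv, Real.mul_self_sqrt (le_max_right _ _), smul_eq_mul]
    rcases le_total 0 (t - t₀⁻¹ * (t * t)) with h | h
    · rw [max_eq_left h, max_eq_right (by linarith)]; ring
    · rw [max_eq_right h, max_eq_left (by linarith)]; ring
  · have hev : ∀ᶠ t in 𝓝 t₀, |fu t| < η ∧ |fv t| < η ∧ |t - t₀| < η := by
      have a1 : Tendsto (fun t => |fu t|) (𝓝 t₀) (𝓝 0) := by
        have := (cu.abs).tendsto t₀; simpa [ut] using this
      have a2 : Tendsto (fun t => |fv t|) (𝓝 t₀) (𝓝 0) := by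
        have := (cv.abs).tendsto t₀; simpa [vt] using this
      have a3 : Tendsto (fun t => |t - t₀|) (𝓝 t₀) (𝓝 0) := by
        have := ((continuous_id.sub (continuous_const (y := t₀))).abs).tendsto t₀
        simpa using this
      exact (a1.eventually_lt_const hη).and
        ((a2.eventually_lt_const hη).and (a3.eventually_lt_const hη))
    obtain ⟨ε, hε, hball⟩ := Metric.eventually_nhds_iff.1 hev
    -- `f` is a tent around `t₀`, so narrow that `fu`, `fv` and `t - t₀` are small on its support
    -- and that it vanishes at `0`, as the non-unital functional calculus requires
    set d := min ε |t₀| with hd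
    have hdpos : 0 < d := lt_min hε (abs_pos.2 h0)
    set f : ℝ → ℝ := fun t => max 0 (1 - |t - t₀| / d) with hf
    have cf : Continuous f := by fun_prop
    have f0 : f 0 = 0 := by
      simp only [hf, zero_sub, abs_neg]
      apply max_eq_left
      have : 1 ≤ |t₀| / d := by rw [one_le_div hdpos]; exact min_le_right _ _
      linarith
    have ft : f t₀ = 1 := by simp [hf]
    have fnn : ∀ t, 0 ≤ f t := fun t => le_max_left _ _
    have fle : ∀ t, f t ≤ 1 := fun t => max_le zero_le_one (by
      have : 0 ≤ |t - t₀| / d := by positivity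
      linarith)
    have fsupp : ∀ t, f t ≠ 0 → dist t t₀ < ε := by
      intro t ht
      by_contra hcon
      apply ht
      apply max_eq_left
      have : 1 ≤ |t - t₀| / d := by
        rw [one_le_div hdpos]
        exact (min_le_left _ _).trans (by rw [Real.dist_eq] at hcon; linarith)
      linarith
    have key : ∀ k : ℝ → ℝ, (∀ t, dist t t₀ < ε → |k t| ≤ η) → ∀ t, ‖f t * k t‖ ≤ η := by
      intro k hk t
      by_cases h : f t = 0
      · simp [h, hη.le]
      · rw [norm_mul, Real.norm_of_nonneg (fnn t)]
        calc f t * ‖k t‖ ≤ 1 * η :=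
              mul_le_mul (fle t) (hk t (fsupp t h)) (norm_nonneg _) zero_le_one
          _ = η := one_mul _
    have efx : cfcₙ f x * x = cfcₙ (fun t => f t * t) x := by
      conv_lhs => enter [2]; rw [cx]
      rw [cfcₙ_mul f (fun t => t) x (by fun_prop) f0 (by fun_prop) rfl]
    have exf : x * cfcₙ f x = cfcₙ (fun t => t * f t) x := by
      conv_lhs => enter [1]; rw [cx]
      rw [cfcₙ_mul (fun t => t) f x (by fun_prop) rfl (by fun_prop) f0]
    refine ⟨cfcₙ f x, norm_cfcₙ_le (fun t _ => ?_), ?_, ?_, ?_, ?_, ?_, ?_, ?_⟩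
    · rw [Real.norm_of_nonneg (fnn t)]; exact fle t
    · rw [efx, ← cfcₙ_mul _ f x (by fun_prop) (by simp) (by fun_prop) f0]
      refine le_trans ?_ (norm_apply_le_norm_cfcₙ (𝕜 := ℝ) (fun t => f t * t * f t) x ht₀ (by fun_prop) (by simp))
      simp [ft, ← htn]
    · rw [← cfcₙ_mul f fu x (by fun_prop) f0 (by fun_prop) u0]
      exact norm_cfcₙ_le fun t _ => key fu (fun s hs => (hball hs).1.le) t
    · rw [← cfcₙ_mul fu f x (by fun_prop) u0 (by fun_prop) f0]
      exact norm_cfcₙ_le fun t _ => by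
        rw [mul_comm]; exact key fu (fun s hs => (hball hs).1.le) t
    · rw [← cfcₙ_mul f fv x (by fun_prop) f0 (by fun_prop) v0]
      exact norm_cfcₙ_le fun t _ => key fv (fun s hs => (hball hs).2.1.le) t
    · rw [← cfcₙ_mul fv f x (by fun_prop) v0 (by fun_prop) f0]
      exact norm_cfcₙ_le fun t _ => by
        rw [mul_comm]; exact key fv (fun s hs => (hball hs).2.1.le) t
    · have : cfcₙ f x * x - t₀ • cfcₙ f x = cfcₙ (fun t => f t * (t - t₀)) x := by
        rw [efx, ← cfcₙ_smul t₀ f x (by fun_prop) f0,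
          ← cfcₙ_sub _ _ x (by fun_prop) (by simp) (by fun_prop) (by simp [f0])]
        congr 1; ext t; simp only [smul_eq_mul]; ring
      rw [this]
      exact norm_cfcₙ_le fun t _ => key _ (fun s hs => (hball hs).2.2.le) t
    · have : x * cfcₙ f x - t₀ • cfcₙ f x = cfcₙ (fun t => f t * (t - t₀)) x := by
        rw [exf, ← cfcₙ_smul t₀ f x (by fun_prop) f0,
          ← cfcₙ_sub _ _ x (by fun_prop) (by simp) (by fun_prop) (by simp [f0])]
        congr 1; ext t; simp only [smul_eq_mul]; ring
      rw [this]
      exact norm_cfcₙ_le fun t _ => key _ (fun s hs => (hball hs).2.2.le) t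

/-- Derivations of a C*-algebra are dissipative, in both directions, at selfadjoint elements. For
the localizing elements `z` of `x`, the Leibniz rule for `x - t₀⁻¹ x² = u² - v²` shows that
`z (δ x) z` is small, while `‖z x z‖ ≥ ‖x‖`. No continuity of `δ` is used. -/
theorem norm_le_norm_add_smul_derivation (δ : A →ₗ[ℂ] A)
    (hmul : ∀ a b, δ (a * b) = a * δ b + δ a * b) (x : A) (hx : IsSelfAdjoint x) (s : ℝ) :
    ‖x‖ ≤ ‖x + s • δ x‖ := by
  rcases eq_or_ne x 0 with rfl | hx0
  · simp
  obtain ⟨t₀, ht₀, u, v, huv, hz⟩ := exists_localizing_element x hx hx0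
  have hreal : ∀ (r : ℝ) (a : A), δ (r • a) = r • δ a := fun r a => LinearMap.map_smul_of_tower δ r a
  set C : ℝ := 2 * (‖δ u‖ + ‖δ v‖) + 2 * |t₀⁻¹| * ‖δ x‖ with hC
  have hCnn : 0 ≤ C := by positivity
  have main : ∀ η > 0, ‖x‖ ≤ ‖x + s • δ x‖ + |s| * (C * η) := by
    intro η hη
    obtain ⟨z, z1, z2, z3, z4, z5, z6, z7, z8⟩ := hz η hη
    have e1 : δ (x - t₀⁻¹ • (x * x)) = δ x - t₀⁻¹ • (x * δ x + δ x * x) := by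
      rw [map_sub, hreal, hmul]
    have e2 : δ (x - t₀⁻¹ • (x * x)) = u * δ u + δ u * u - (v * δ v + δ v * v) := by
      rw [huv, map_sub, hmul, hmul]
    -- the two expressions for `δ (x - t₀⁻¹ x²)`, multiplied by `z` on both sides; as
    -- `z x ≈ t₀ z ≈ x z`, the Leibniz terms of `t₀⁻¹ x²` are twice the term of `x`
    have e3 : z * δ x * z = -(z * u * (δ u * z) + z * δ u * (u * z)
        - (z * v * (δ v * z) + z * δ v * (v * z)))
        - t₀⁻¹ • ((z * x - t₀ • z) * (δ x * z) + z * δ x * (x * z - t₀ • z)) := by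
      have e4 : z * (δ x - t₀⁻¹ • (x * δ x + δ x * x)) * z =
          z * (u * δ u + δ u * u - (v * δ v + δ v * v)) * z := by rw [← e1, e2]
      have e5 : z * u * (δ u * z) + z * δ u * (u * z)
        - (z * v * (δ v * z) + z * δ v * (v * z)) =
          z * (u * δ u + δ u * u - (v * δ v + δ v * v)) * z := by
        noncomm_ring
      rw [e5, ← e4]
      simp only [mul_sub, sub_mul, mul_add, add_mul, smul_add, smul_sub, mul_smul_comm,
        smul_mul_assoc, smul_smul, inv_mul_cancel₀ ht₀, one_smul, mul_assoc]
      abel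
    have b1 : ‖z * δ x * z‖ ≤ C * η := by
      rw [e3]
      have n1 : ∀ a b c : A, ‖a‖ ≤ η → ‖c‖ ≤ 1 → ‖a * (b * c)‖ ≤ ‖b‖ * η := fun a b c ha hc =>
        calc ‖a * (b * c)‖ ≤ ‖a‖ * (‖b‖ * ‖c‖) :=
              (norm_mul_le _ _).trans (mul_le_mul_of_nonneg_left (norm_mul_le _ _) (norm_nonneg _))
          _ ≤ η * (‖b‖ * 1) := by gcongr
          _ = ‖b‖ * η := by ring
      have n2 : ∀ a b c : A, ‖a‖ ≤ η → ‖c‖ ≤ 1 → ‖c * b * a‖ ≤ ‖b‖ * η := fun a b c ha hc =>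
        calc ‖c * b * a‖ ≤ (‖c‖ * ‖b‖) * ‖a‖ :=
              (norm_mul_le _ _).trans (mul_le_mul_of_nonneg_right (norm_mul_le _ _) (norm_nonneg _))
          _ ≤ (1 * ‖b‖) * η := by gcongr
          _ = ‖b‖ * η := by ring
      calc _ ≤ (‖δ u‖ * η + ‖δ u‖ * η + (‖δ v‖ * η + ‖δ v‖ * η)) +
            |t₀⁻¹| * (‖δ x‖ * η + ‖δ x‖ * η) := by
            refine (norm_sub_le _ _).trans (add_le_add ?_ ?_)
            · rw [norm_neg]
              refine (norm_sub_le _ _).trans (add_le_add ((norm_add_le _ _).trans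
                (add_le_add (n1 _ _ _ z3 z1) (n2 _ _ _ z4 z1))) ((norm_add_le _ _).trans
                (add_le_add (n1 _ _ _ z5 z1) (n2 _ _ _ z6 z1))))
            · rw [norm_smul, Real.norm_eq_abs]
              gcongr
              exact (norm_add_le _ _).trans (add_le_add (n1 _ _ _ z7 z1) (n2 _ _ _ z8 z1))
        _ = C * η := by rw [hC]; ring
    have b2 : ‖z * (x + s • δ x) * z‖ ≤ ‖x + s • δ x‖ :=
      calc ‖z * (x + s • δ x) * z‖ ≤ ‖z‖ * ‖x + s • δ x‖ * ‖z‖ :=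
            (norm_mul_le _ _).trans (mul_le_mul_of_nonneg_right (norm_mul_le _ _) (norm_nonneg _))
        _ ≤ 1 * ‖x + s • δ x‖ * 1 := by gcongr
        _ = _ := by ring
    have e6 : z * x * z = z * (x + s • δ x) * z - s • (z * δ x * z) := by
      simp only [mul_add, add_mul, mul_smul_comm, smul_mul_assoc, add_sub_cancel_right]
    calc ‖x‖ ≤ ‖z * x * z‖ := z2
      _ ≤ ‖z * (x + s • δ x) * z‖ + ‖s • (z * δ x * z)‖ := by rw [e6]; exact norm_sub_le _ _
      _ ≤ _ := by
          rw [norm_smul, Real.norm_eq_abs]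
          gcongr
  refine le_of_forall_pos_le_add fun ε hε => ?_
  have h2 := main (ε / (|s| * C + 1)) (by positivity)
  refine h2.trans (add_le_add le_rfl ?_)
  rw [← mul_assoc, mul_div_assoc', div_le_iff₀ (by positivity)]
  nlinarith [abs_nonneg s]

/-- A `*`-derivation which is defined everywhere on a C*-algebra is continuous. -/
theorem continuous_of_star_derivation (δ : A →ₗ[ℂ] A)
    (hmul : ∀ a b, δ (a * b) = a * δ b + δ a * b) (hstar : ∀ a, δ (star a) = star (δ a)) :
    Continuous δ := by
  have hreal : ∀ (r : ℝ) (a : A), δ (r • a) = r • δ a := fun r a => LinearMap.map_smul_of_tower δ r a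
  -- the closed graph criterion for selfadjoint sequences: dissipativity at `h k - t y` yields
  -- `‖y‖ ≤ t ‖δ y‖` for all `t > 0` in the limit
  have step : ∀ (h : ℕ → A) (y : A), (∀ k, IsSelfAdjoint (h k)) → Tendsto h atTop (𝓝 0) →
      Tendsto (fun k => δ (h k)) atTop (𝓝 y) → y = 0 := by
    intro h y hsa h0 hy
    have ysa : IsSelfAdjoint y := by
      have : Tendsto (fun k => star (δ (h k))) atTop (𝓝 (star y)) := hy.star
      refine tendsto_nhds_unique this (hy.congr fun k => ?_)
      rw [← hstar, (hsa k).star_eq]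
    have ineq : ∀ t : ℝ, 0 < t → ‖y‖ ≤ t * ‖δ y‖ := by
      intro t ht
      have l1 : ∀ k, ‖h k + t • (-y)‖ ≤ ‖h k + t • (-y) + t • δ (h k + t • (-y))‖ := fun k =>
        norm_le_norm_add_smul_derivation δ hmul _
          ((hsa k).add ((IsSelfAdjoint.all t).smul ysa.neg)) t
      have l2 : Tendsto (fun k => ‖h k + t • (-y)‖) atTop (𝓝 ‖0 + t • (-y)‖) :=
        (h0.add_const _).norm
      have l3 : Tendsto (fun k => ‖h k + t • (-y) + t • δ (h k + t • (-y))‖) atTop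
          (𝓝 ‖0 + t • (-y) + t • (y + t • δ (-y))‖) := by
        refine ((h0.add_const _).add ?_).norm
        refine Tendsto.const_smul ?_ t
        simp only [map_add, hreal]
        exact hy.add_const _
      have l4 := le_of_tendsto_of_tendsto' l2 l3 l1
      have e : 0 + t • (-y) + t • (y + t • δ (-y)) = t • (t • δ (-y)) := by
        rw [smul_add, zero_add, smul_neg]; abel
      rw [e, zero_add, norm_smul, norm_smul, norm_smul, map_neg, norm_neg, norm_neg,
        Real.norm_of_nonneg ht.le] at l4
      exact le_of_mul_le_mul_left l4 ht
    have l5 : Tendsto (fun t : ℝ => t * ‖δ y‖) (𝓝[>] 0) (𝓝 (0 * ‖δ y‖)) :=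
      (tendsto_id.mul_const _).mono_left nhdsWithin_le_nhds
    rw [zero_mul] at l5
    have := ge_of_tendsto l5 (eventually_nhdsWithin_of_forall fun t ht => ineq t ht)
    exact norm_le_zero_iff.1 this
  -- for general sequences, the selfadjoint part of the limit vanishes; applied to the sequence and
  -- to its multiple by the imaginary unit
  have step2 : ∀ (h : ℕ → A) (y : A), Tendsto h atTop (𝓝 0) →
      Tendsto (fun k => δ (h k)) atTop (𝓝 y) → y + star y = 0 := by
    intro h y h0 hy
    refine step (fun k => h k + star (h k)) _ (fun k => IsSelfAdjoint.add_star_self _) ?_ ?_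
    · have := h0.add h0.star; simpa using this
    · simp only [map_add, hstar]; exact hy.add hy.star
  refine LinearMap.continuous_of_seq_closed_graph δ fun w a b hw hb => ?_
  have hw0 : Tendsto (fun k => w k - a) atTop (𝓝 0) := by simpa using hw.sub_const a
  have hb0 : Tendsto (fun k => δ (w k - a)) atTop (𝓝 (b - δ a)) := by
    simp only [map_sub]; exact hb.sub_const _
  have s1 := step2 _ _ hw0 hb0
  have s2 : Complex.I • (b - δ a) + star (Complex.I • (b - δ a)) = 0 := by
    refine step2 (fun k => Complex.I • (w k - a)) _ ?_ ?_
    · simpa using hw0.const_smul Complex.I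
    · simp only [map_smul]; exact hb0.const_smul _
  have s3 : (b - δ a) - star (b - δ a) = 0 := by
    have : Complex.I • ((b - δ a) - star (b - δ a)) = 0 := by
      rw [star_smul, Complex.star_def, Complex.conj_I, neg_smul] at s2
      rw [smul_sub, sub_eq_add_neg]
      exact s2
    exact (smul_eq_zero.1 this).resolve_left Complex.I_ne_zero
  have s4 : (2 : ℂ) • (b - δ a) = 0 := by
    rw [two_smul]
    have := congrArg₂ (· + ·) s1 s3
    simp only [add_zero] at this
    rw [← this]; abel
  exact sub_eq_zero.1 ((smul_eq_zero.1 s4).resolve_left two_ne_zero)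

end Kaplansky

/-! ### Limits of solutions of ordinary differential equations -/

section Calculus
open Filter Topology MeasureTheory

theorem hasDerivWithinAt_of_quadratic {F : Type*} [NormedAddCommGroup F] [NormedSpace ℝ F]
    {z : ℝ → F} {d : F} {S : Set ℝ} {s C : ℝ}
    (h : ∀ t ∈ S, ‖z t - z s - (t - s) • d‖ ≤ C * |t - s| ^ 2) : HasDerivWithinAt z d S s := by
  rw [hasDerivWithinAt_iff_isLittleO]
  have h1 : (fun t => z t - z s - (t - s) • d) =O[𝓝[S] s] fun t => |t - s| ^ 2 := by
    refine Asymptotics.IsBigO.of_bound C ?_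
    filter_upwards [self_mem_nhdsWithin] with t ht
    simpa using h t ht
  refine h1.trans_isLittleO ?_
  have h2 : (fun t : ℝ => |t - s| ^ 2) =o[𝓝 s] fun t => t - s := by
    have h3 : (fun x : ℝ => x ^ 2) =o[𝓝 0] fun x => x ^ 1 :=
      Asymptotics.isLittleO_pow_pow (by norm_num)
    have h4 : Tendsto (fun t : ℝ => t - s) (𝓝 s) (𝓝 0) := by
      have := (continuous_sub_right s).tendsto s
      rwa [sub_self] at this
    have := h3.comp_tendsto h4
    refine this.congr (fun t => ?_) (fun t => ?_) <;> simp [Function.comp]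
  exact h2.mono nhdsWithin_le_nhds

/-- A pointwise limit of solutions of an autonomous ordinary differential equation is again a
solution, if the solutions stay in a closed set on which the right hand side is bounded and
Lipschitz continuous: the estimate `‖z t - z s - (t - s) Z (z s)‖ ≤ Λ M |t - s|²` passes to the
limit. -/
theorem hasDerivWithinAt_of_tendsto_solutions {W ι : Type*} [NormedAddCommGroup W]
    [NormedSpace ℝ W] {Z : W → W} {K : Set W} {Λ M : ℝ} (hΛ0 : 0 ≤ Λ)
    (hΛ : ∀ u ∈ K, ∀ w ∈ K, ‖Z u - Z w‖ ≤ Λ * ‖u - w‖) (hM : ∀ u ∈ K, ‖Z u‖ ≤ M)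
    (hK : IsClosed K) {S : Set ℝ} (hS : Convex ℝ S) {l : Filter ι} [l.NeBot] {z : ι → ℝ → W}
    {y : ℝ → W}
    (hz : ∀ᶠ i in l, ∀ t ∈ S, z i t ∈ K ∧ HasDerivWithinAt (z i) (Z (z i t)) S t)
    (hy : ∀ t ∈ S, Tendsto (fun i => z i t) l (𝓝 (y t))) :
    ∀ t ∈ S, y t ∈ K ∧ HasDerivWithinAt y (Z (y t)) S t := by
  have hyK : ∀ t ∈ S, y t ∈ K := fun t ht => hK.mem_of_tendsto (hy t ht) (hz.mono fun i hi => (hi t ht).1)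
  have hZc : ContinuousOn Z K := by
    have : LipschitzOnWith Λ.toNNReal Z K := LipschitzOnWith.of_dist_le_mul fun u hu w hw => by
      rw [dist_eq_norm, dist_eq_norm, Real.coe_toNNReal _ hΛ0]; exact hΛ u hu w hw
    exact this.continuousOn
  intro s hs
  refine ⟨hyK s hs, hasDerivWithinAt_of_quadratic (C := Λ * M) fun t ht => ?_⟩
  -- the mean value inequality, first for `z i` and then for `z i - u • Z (z i s)`
  have hlip : ∀ᶠ i in l, ‖z i t - z i s - (t - s) • Z (z i s)‖ ≤ Λ * M * |t - s| ^ 2 := by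
    filter_upwards [hz] with i hi
    have hseg : segment ℝ s t ⊆ S := hS.segment_subset hs ht
    have hMn : ∀ u ∈ segment ℝ s t, ‖z i u - z i s‖ ≤ M * ‖u - s‖ := fun u hu =>
      (convex_segment s t).norm_image_sub_le_of_norm_hasDerivWithin_le
        (fun v hv => ((hi v (hseg hv)).2).mono hseg) (fun v hv => hM _ (hi v (hseg hv)).1)
        (left_mem_segment ℝ s t) hu
    have hdist : ∀ u ∈ segment ℝ s t, ‖u - s‖ ≤ |t - s| := by
      intro u hu
      rw [segment_eq_uIcc] at hu
      have := abs_sub_left_of_mem_uIcc hu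
      rwa [Real.norm_eq_abs]
    have hM0 : 0 ≤ M := (norm_nonneg _).trans (hM _ (hi s hs).1)
    have := (convex_segment s t).norm_image_sub_le_of_norm_hasDerivWithin_le
      (f := fun u => z i u - u • Z (z i s)) (f' := fun u => Z (z i u) - (1 : ℝ) • Z (z i s))
      (C := Λ * (M * |t - s|))
      (fun v hv => (((hi v (hseg hv)).2).mono hseg).sub ((hasDerivWithinAt_id v _).smul_const _))
      (fun v hv => by
        rw [one_smul]
        refine (hΛ _ (hi v (hseg hv)).1 _ (hi s hs).1).trans (mul_le_mul_of_nonneg_left ?_ hΛ0)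
        exact (hMn v hv).trans (mul_le_mul_of_nonneg_left (hdist v hv) hM0))
      (left_mem_segment ℝ s t) (right_mem_segment ℝ s t)
    calc ‖z i t - z i s - (t - s) • Z (z i s)‖
        = ‖z i t - t • Z (z i s) - (z i s - s • Z (z i s))‖ := by congr 1; rw [sub_smul]; abel
      _ ≤ _ := this
      _ = _ := by rw [Real.norm_eq_abs]; ring
  have hlim : Tendsto (fun i => ‖z i t - z i s - (t - s) • Z (z i s)‖) l
      (𝓝 ‖y t - y s - (t - s) • Z (y s)‖) := by
    refine (((hy t ht).sub (hy s hs)).sub (Tendsto.const_smul ?_ _)).norm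
    have h1 : Tendsto (fun i => z i s) l (𝓝[K] (y s)) :=
      tendsto_nhdsWithin_iff.2 ⟨hy s hs, hz.mono fun i hi => (hi s hs).1⟩
    exact (hZc (y s) (hyK s hs)).tendsto.comp h1
  exact le_of_tendsto hlim hlip

/-! ### Linear differential equations with strongly continuous coefficients -/

section LinearODE
variable {A : Type*} [NormedAddCommGroup A] [NormedSpace ℝ A]

/-- An a priori estimate for linear equations on a short interval, from the mean value inequality at
a point where `‖w‖` is maximal; no measurability of `L` or `f` is needed. -/
theorem norm_le_of_linear_ode {L : ℝ → A →L[ℝ] A} {α β M ε : ℝ} (hM : 0 ≤ M)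
    (hsmall : M * (β - α) ≤ 1 / 2) (hL : ∀ t ∈ Icc α β, ‖L t‖ ≤ M) {w f : ℝ → A}
    (hw : ∀ t ∈ Icc α β, HasDerivWithinAt w (L t (w t) + f t) (Icc α β) t)
    (hf : ∀ t ∈ Icc α β, ‖f t‖ ≤ ε) {t₁ : ℝ} (ht₁ : t₁ ∈ Icc α β) :
    ∀ t ∈ Icc α β, ‖w t‖ ≤ 2 * (‖w t₁‖ + (β - α) * ε) := by
  have hab : 0 ≤ β - α := sub_nonneg.2 (ht₁.1.trans ht₁.2)
  have hcont : ContinuousOn (fun t => ‖w t‖) (Icc α β) :=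
    fun t ht => ((hw t ht).continuousWithinAt).norm
  obtain ⟨τ, hτ, hmax⟩ := isCompact_Icc.exists_isMaxOn ⟨t₁, ht₁⟩ hcont
  have hmax' : ∀ t ∈ Icc α β, ‖w t‖ ≤ ‖w τ‖ := fun t ht => hmax ht
  have hε : 0 ≤ ε := (norm_nonneg _).trans (hf t₁ ht₁)
  have h1 := (convex_Icc α β).norm_image_sub_le_of_norm_hasDerivWithin_le
    (f := w) (C := M * ‖w τ‖ + ε) hw (fun t ht => by
      refine (norm_add_le _ _).trans (add_le_add ?_ (hf t ht))
      refine ((L t).le_opNorm _).trans ?_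
      exact mul_le_mul (hL t ht) (hmax' t ht) (norm_nonneg _) hM) ht₁ hτ
  have h2 : ‖τ - t₁‖ ≤ β - α := by
    rw [Real.norm_eq_abs, abs_le]; constructor <;> linarith [hτ.1, hτ.2, ht₁.1, ht₁.2]
  have h3 : ‖w τ‖ ≤ ‖w t₁‖ + (M * ‖w τ‖ + ε) * (β - α) := by
    have : ‖w τ‖ ≤ ‖w t₁‖ + ‖w τ - w t₁‖ := by
      have := norm_add_le (w t₁) (w τ - w t₁); rwa [add_sub_cancel] at this
    refine this.trans (add_le_add le_rfl (h1.trans ?_))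
    exact mul_le_mul_of_nonneg_left h2 (by positivity)
  intro t ht
  have := hmax' t ht
  nlinarith [norm_nonneg (w τ)]

/-- On a short interval, the Picard-Lindelöf theorem solves a linear equation whose coefficients are
bounded and only strongly continuous in time. -/
theorem exists_linear_ode_solution [CompleteSpace A] {L : ℝ → A →L[ℝ] A} {α β M : ℝ}
    (hM : 0 ≤ M) (hsmall : M * (β - α) ≤ 1 / 2) (hL : ∀ t ∈ Icc α β, ‖L t‖ ≤ M)
    (hLc : ∀ a, ContinuousOn (fun t => L t a) (Icc α β)) {t₁ : ℝ} (ht₁ : t₁ ∈ Icc α β) (a : A) :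
    ∃ s : ℝ → A, s t₁ = a ∧ ∀ t ∈ Icc α β, HasDerivWithinAt s (L t (s t)) (Icc α β) t := by
  obtain ⟨R, hR⟩ : ∃ R : NNReal, (R : ℝ) = ‖a‖ := ⟨⟨‖a‖, norm_nonneg a⟩, rfl⟩
  obtain ⟨K, hK⟩ : ∃ K : NNReal, (K : ℝ) = M := ⟨⟨M, hM⟩, rfl⟩
  have hpl : IsPicardLindelof (fun t x => L t x) (⟨t₁, ht₁⟩ : Icc α β) a R 0 (2 * K * R) K := by
    refine ⟨fun t ht => ?_, fun x _ => hLc x, fun t ht x hx => ?_, ?_⟩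
    · refine LipschitzOnWith.of_dist_le_mul fun x _ y _ => ?_
      rw [dist_eq_norm, dist_eq_norm, ← map_sub]
      rw [hK]
      exact ((L t).le_opNorm _).trans (mul_le_mul_of_nonneg_right (hL t ht) (norm_nonneg _))
    · have hx' : ‖x‖ ≤ 2 * ‖a‖ := by
        have h1 := norm_add_le a (x - a)
        rw [add_sub_cancel] at h1
        have h2 : ‖x - a‖ ≤ ‖a‖ := by simpa [dist_eq_norm, hR] using hx
        linarith
      calc ‖L t x‖ ≤ ‖L t‖ * ‖x‖ := (L t).le_opNorm _
        _ ≤ M * (2 * ‖a‖) := mul_le_mul (hL t ht) hx' (norm_nonneg _) hM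
        _ = _ := by push_cast; rw [hR, hK]; ring
    · have : max (β - t₁) (t₁ - α) ≤ β - α := max_le (by linarith [ht₁.1]) (by linarith [ht₁.2])
      have h2 : (0:ℝ) ≤ 2 * M * ‖a‖ := by positivity
      push_cast
      rw [hR, hK, sub_zero]
      calc 2 * M * ‖a‖ * max (β - t₁) (t₁ - α) ≤ 2 * M * ‖a‖ * (β - α) :=
            mul_le_mul_of_nonneg_left this h2
        _ = 2 * (M * (β - α)) * ‖a‖ := by ring
        _ ≤ 2 * (1 / 2) * ‖a‖ := by gcongr
        _ = ‖a‖ := by ring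
  obtain ⟨s, hs, hs'⟩ := hpl.exists_eq_forall_mem_Icc_hasDerivWithinAt₀
  exact ⟨s, hs, hs'⟩

end LinearODE

/-! ### Differentiation under the integral sign and Hadamard's lemma -/

section Hadamard
variable {V F : Type*} [NormedAddCommGroup V] [NormedSpace ℝ V] [FiniteDimensional ℝ V]
  [NormedAddCommGroup F] [NormedSpace ℝ F]

theorem hasFDerivAt_integral_unitInterval {H : V × ℝ → F} (hH : ContDiff ℝ 1 H) (x : V) :
    HasFDerivAt (fun y => ∫ t in (0 : ℝ)..1, H (y, t))
      (∫ t in (0 : ℝ)..1, (fderiv ℝ H (x, t)).comp (ContinuousLinearMap.inl ℝ V ℝ)) x := by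
  have hc : Continuous fun p : V × ℝ => (fderiv ℝ H p).comp (ContinuousLinearMap.inl ℝ V ℝ) :=
    (hH.continuous_fderiv (by norm_num)).clm_comp continuous_const
  obtain ⟨C, hC⟩ := ((isCompact_closedBall x 1).prod (isCompact_Icc (a := (0:ℝ)) (b := 1))).exists_bound_of_continuousOn hc.continuousOn
  refine intervalIntegral.hasFDerivAt_integral_of_dominated_of_fderiv_le
    (F' := fun y t => (fderiv ℝ H (y, t)).comp (ContinuousLinearMap.inl ℝ V ℝ))
    (bound := fun _ => C) (Metric.ball_mem_nhds x one_pos) ?_ ?_ ?_ ?_ ?_ ?_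
  · exact Eventually.of_forall fun y =>
      (hH.continuous.comp (by fun_prop : Continuous fun t : ℝ => (y, t))).aestronglyMeasurable
  · exact (hH.continuous.comp (by fun_prop : Continuous fun t : ℝ => (x, t))).intervalIntegrable _ _
  · exact (hc.comp (by fun_prop : Continuous fun t : ℝ => (x, t))).aestronglyMeasurable
  · refine Eventually.of_forall fun t ht y hy => hC (y, t) ⟨Metric.ball_subset_closedBall hy, ?_⟩
    rw [uIoc_of_le zero_le_one] at ht
    exact ⟨ht.1.le, ht.2⟩
  · exact intervalIntegrable_const
  · refine Eventually.of_forall fun t ht y hy => ?_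
    have h1 : HasFDerivAt H (fderiv ℝ H (y, t)) (y, t) :=
      (hH.differentiable (by norm_num) _).hasFDerivAt
    have h2 : HasFDerivAt (fun y : V => (y, t)) (ContinuousLinearMap.inl ℝ V ℝ) y :=
      hasFDerivAt_prodMk_left y t
    exact h1.comp y h2

theorem contDiff_integral_unitInterval [CompleteSpace F] (k : ℕ) {H : V × ℝ → F}
    (hH : ContDiff ℝ ∞ H) : ContDiff ℝ k (fun y => ∫ t in (0 : ℝ)..1, H (y, t)) := by
  induction k generalizing H with
  | zero =>
    exact contDiff_zero.2 (continuous_iff_continuousAt.2 fun x =>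
      (hasFDerivAt_integral_unitInterval (hH.of_le (by exact_mod_cast le_top)) x).continuousAt)
  | succ k ih =>
    have h1 : ∀ x, HasFDerivAt _ _ x := fun x =>
      hasFDerivAt_integral_unitInterval (hH.of_le (by exact_mod_cast le_top)) x
    rw [Nat.cast_add, Nat.cast_one, contDiff_succ_iff_fderiv_apply]
    refine ⟨fun x => (h1 x).differentiableAt, by simp, fun v => ?_⟩
    have h2 : (fun x => fderiv ℝ (fun y => ∫ t in (0 : ℝ)..1, H (y, t)) x v) =
        fun x => ∫ t in (0 : ℝ)..1, fderiv ℝ H (x, t) (v, 0) := by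
      ext x
      rw [(h1 x).fderiv, ContinuousLinearMap.intervalIntegral_apply]
      · simp
      · have hc : Continuous fun p : V × ℝ => (fderiv ℝ H p).comp (ContinuousLinearMap.inl ℝ V ℝ) :=
          (hH.continuous_fderiv (by simp)).clm_comp continuous_const
        exact (hc.comp (by fun_prop : Continuous fun t : ℝ => (x, t))).intervalIntegrable _ _
    rw [h2]
    exact ih (H := fun p => fderiv ℝ H p (v, 0))
      ((hH.fderiv_right (m := ∞) (by simp)).clm_apply contDiff_const)

/-- **Hadamard's lemma**. -/
theorem exists_contDiff_hadamard [CompleteSpace F] {h : V → F} (hh : ContDiff ℝ ∞ h) (x : V) :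
    ∃ τ : V → V →L[ℝ] F, ContDiff ℝ ∞ τ ∧ (∀ y, h y = h x + τ y (y - x)) ∧ τ x = fderiv ℝ h x := by
  set H : V × ℝ → V →L[ℝ] F := fun p => fderiv ℝ h (x + p.2 • (p.1 - x)) with hHdef
  have hH : ContDiff ℝ ∞ H := (hh.fderiv_right (m := ∞) (by simp)).comp (by fun_prop)
  refine ⟨fun y => ∫ t in (0 : ℝ)..1, H (y, t), ?_, fun y => ?_, ?_⟩
  · exact contDiff_infty.2 fun k => contDiff_integral_unitInterval k hH
  · have hint : IntervalIntegrable (fun t => H (y, t)) volume 0 1 :=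
      (hH.continuous.comp (by fun_prop : Continuous fun t : ℝ => (y, t))).intervalIntegrable _ _
    rw [ContinuousLinearMap.intervalIntegral_apply hint]
    have hd : ∀ t ∈ uIcc (0 : ℝ) 1, HasDerivAt (fun t : ℝ => h (x + t • (y - x)))
        (H (y, t) (y - x)) t := by
      intro t _
      have h1 : HasFDerivAt h (fderiv ℝ h (x + t • (y - x))) (x + t • (y - x)) :=
        (hh.differentiable (by simp) _).hasFDerivAt
      have h2 : HasDerivAt (fun t : ℝ => x + t • (y - x)) (y - x) t := by
        simpa using ((hasDerivAt_id t).smul_const (y - x)).const_add x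
      exact h1.comp_hasDerivAt t h2
    rw [intervalIntegral.integral_eq_sub_of_hasDerivAt hd]
    · simp
    · exact ((hH.clm_apply contDiff_const).continuous.comp (by fun_prop : Continuous fun t : ℝ => (y, t))).intervalIntegrable _ _
  · simp [hHdef]

end Hadamard
end Calculus

/-! ### A criterion for continuous differentiability in terms of values -/

section SmoothnessCriterion
open Filter Topology

variable {W Y : Type*} [NormedAddCommGroup W] [NormedSpace ℝ W] [NormedAddCommGroup Y]
  [NormedSpace ℝ Y]

/-- A map with linear approximations of uniformly quadratic error is continuously differentiable:
comparing the approximations at two points shows that the derivative is Lipschitz continuous. -/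
theorem contDiffOn_one_of_quadratic {f : W → Y} {D : W → W →L[ℝ] Y} {U : Set W} (hU : IsOpen U)
    {M : ℝ} (h : ∀ w ∈ U, ∀ w' ∈ U, ‖f w' - f w - D w (w' - w)‖ ≤ M * ‖w' - w‖ ^ 2) :
    ContDiffOn ℝ 1 f U := by
  have hd : ∀ w ∈ U, HasFDerivAt f (D w) w := by
    intro w hw
    rw [hasFDerivAt_iff_isLittleO]
    have h1 : (fun w' => f w' - f w - D w (w' - w)) =O[𝓝 w] fun w' => ‖w' - w‖ ^ 2 := by
      refine Asymptotics.IsBigO.of_bound M ?_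
      filter_upwards [hU.mem_nhds hw] with w' hw'
      simpa using h w hw w' hw'
    refine h1.trans_isLittleO ?_
    have h3 : (fun x : W => ‖x‖ ^ 2) =o[𝓝 0] fun x => x := Asymptotics.isLittleO_norm_pow_id one_lt_two
    have h4 : Tendsto (fun t : W => t - w) (𝓝 w) (𝓝 0) := by
      have := (continuous_sub_right w).tendsto w
      rwa [sub_self] at this
    exact h3.comp_tendsto h4
  have hcont : ContinuousOn D U := by
    intro w hw
    obtain ⟨r, hr, hball⟩ := Metric.isOpen_iff.1 hU w hw
    refine ContinuousAt.continuousWithinAt ?_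
    have hM : ∀ w' ∈ Metric.ball w (r / 2), ‖D w' - D w‖ ≤ 6 * |M| * ‖w' - w‖ := by
      intro w' hw'
      rcases eq_or_ne w' w with rfl | hne
      · simp
      have hδ : 0 < ‖w' - w‖ := norm_pos_iff.2 (sub_ne_zero.2 hne)
      have hw'' : ‖w' - w‖ < r / 2 := by rwa [Metric.mem_ball, dist_eq_norm] at hw'
      refine ContinuousLinearMap.opNorm_le_of_unit_norm (by positivity) fun x hx => ?_
      set k := ‖w' - w‖ • x with hk
      have hkn : ‖k‖ = ‖w' - w‖ := by rw [hk, norm_smul, hx, norm_norm, mul_one]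
      have m1 : w' ∈ U := hball (by rw [Metric.mem_ball, dist_eq_norm]; linarith)
      have m2 : w' + k ∈ U := hball (by
        rw [Metric.mem_ball, dist_eq_norm]
        have : w' + k - w = (w' - w) + k := by abel
        rw [this]
        exact (norm_add_le _ _).trans_lt (by rw [hkn]; linarith))
      have a1 := h w' m1 (w' + k) m2
      have a2 := h w hw (w' + k) m2
      have a3 := h w hw w' m1
      rw [add_sub_cancel_left] at a1
      have n1 : ‖w' + k - w‖ ≤ 2 * ‖w' - w‖ := by
        have : w' + k - w = (w' - w) + k := by abel
        rw [this]; exact (norm_add_le _ _).trans (by rw [hkn]; linarith)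
      have e : (D w' - D w) k = -(f (w' + k) - f w' - D w' k) + (f (w' + k) - f w - D w (w' + k - w))
          - (f w' - f w - D w (w' - w)) := by
        have : w' + k - w = (w' - w) + k := by abel
        rw [this, map_add, sub_apply]; abel
      have a4 : ‖(D w' - D w) k‖ ≤ 6 * |M| * ‖w' - w‖ ^ 2 := by
        rw [e]
        refine (norm_sub_le _ _).trans ((add_le_add (norm_add_le _ _) le_rfl).trans ?_)
        rw [norm_neg]
        have b1 : M * ‖k‖ ^ 2 ≤ |M| * ‖w' - w‖ ^ 2 := by
          rw [hkn]; exact mul_le_mul_of_nonneg_right (le_abs_self M) (by positivity)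
        have b2 : M * ‖w' + k - w‖ ^ 2 ≤ |M| * (2 * ‖w' - w‖) ^ 2 :=
          mul_le_mul (le_abs_self M) (pow_le_pow_left₀ (norm_nonneg _) n1 2) (by positivity)
            (abs_nonneg _)
        have b3 : M * ‖w' - w‖ ^ 2 ≤ |M| * ‖w' - w‖ ^ 2 :=
          mul_le_mul_of_nonneg_right (le_abs_self M) (by positivity)
        nlinarith
      rw [hk, map_smul, norm_smul, norm_norm] at a4
      have : ‖w' - w‖ * ‖(D w' - D w) x‖ ≤ ‖w' - w‖ * (6 * |M| * ‖w' - w‖) := by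
        refine a4.trans (le_of_eq ?_); ring
      exact le_of_mul_le_mul_left this hδ
    refine tendsto_iff_norm_sub_tendsto_zero.2 ?_
    have h5 : Tendsto (fun w' => 6 * |M| * ‖w' - w‖) (𝓝 w) (𝓝 0) := by
      have : Continuous fun w' => 6 * |M| * ‖w' - w‖ := by fun_prop
      simpa using this.tendsto w
    refine squeeze_zero' (Eventually.of_forall fun _ => norm_nonneg _) ?_ h5
    filter_upwards [Metric.ball_mem_nhds w (half_pos hr)] with w' hw' using hM w' hw'
  intro w hw
  exact (contDiffAt_one_iff.2 ⟨D, U, hU.mem_nhds hw, hcont, fun x hx => hd x hx⟩).contDiffWithinAt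

/-- A bounded function which is, up to a quadratic error, affine on segments is continuously
differentiable. The hypothesis involves only values of `f`, so it is a closed condition with
respect to pointwise convergence. -/
theorem contDiffOn_one_of_interpolation [CompleteSpace Y] {f : W → Y} {U : Set W} (hU : IsOpen U)
    {C M : ℝ} (hC : ∀ w ∈ U, ‖f w‖ ≤ C)
    (h : ∀ w ∈ U, ∀ k, w + k ∈ U → ∀ s ∈ Icc (0 : ℝ) 1,
      ‖f (w + s • k) - f w - s • (f (w + k) - f w)‖ ≤ M * s * ‖k‖ ^ 2) :
    ContDiffOn ℝ 1 f U := by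
  -- small multiples of a vector stay in `U`
  have hsmall : ∀ w ∈ U, ∀ k : W, ∀ᶠ s in 𝓝[>] (0 : ℝ), w + s • k ∈ U := by
    intro w hw k
    have : Tendsto (fun s : ℝ => w + s • k) (𝓝[>] 0) (𝓝 w) := by
      have : Continuous fun s : ℝ => w + s • k := by fun_prop
      simpa using (this.tendsto 0).mono_left nhdsWithin_le_nhds
    exact this (hU.mem_nhds hw)
  -- the difference quotients in a direction `k` are Cauchy, by the hypothesis for multiples of `k`;
  -- this is where completeness is used
  have hcauchy : ∀ w ∈ U, ∀ k, w + k ∈ U → ∃ d : Y, ∀ s ∈ Ioc (0 : ℝ) 1,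
      w + s • k ∈ U → ‖f (w + s • k) - f w - s • d‖ ≤ M * s ^ 2 * ‖k‖ ^ 2 := by
    intro w hw k hk
    set q : ℝ → Y := fun s => s⁻¹ • (f (w + s • k) - f w) with hq
    have hqq : ∀ s ∈ Ioc (0 : ℝ) 1, w + s • k ∈ U → ∀ s' ∈ Ioc (0 : ℝ) s,
        ‖q s' - q s‖ ≤ M * s * ‖k‖ ^ 2 := by
      intro s hs hsU s' hs'
      have h1 := h w hw (s • k) hsU (s' / s) ⟨by have := hs'.1; have := hs.1; positivity,
        (div_le_one hs.1).2 hs'.2⟩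
      rw [smul_smul, div_mul_cancel₀ _ hs.1.ne'] at h1
      have e : q s' - q s = s'⁻¹ • (f (w + s' • k) - f w - (s' / s) • (f (w + s • k) - f w)) := by
        rw [hq, smul_sub s'⁻¹ (f (w + s' • k) - f w), smul_smul]
        congr 2
        have := hs'.1.ne'
        field_simp
      rw [e, norm_smul, norm_inv, Real.norm_of_nonneg hs'.1.le]
      rw [norm_smul, Real.norm_of_nonneg hs.1.le] at h1
      rw [inv_mul_le_iff₀ hs'.1]
      refine h1.trans (le_of_eq ?_)
      have := hs.1.ne'
      field_simp
    obtain ⟨c, hc0, hc1, hcU⟩ : ∃ c : ℝ, 0 < c ∧ c ≤ 1 ∧ ∀ s ∈ Ioc (0:ℝ) c, w + s • k ∈ U := by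
      obtain ⟨c, hc, hcc⟩ := mem_nhdsGT_iff_exists_Ioc_subset.1 (hsmall w hw k)
      exact ⟨min c 1, lt_min hc one_pos, min_le_right _ _, fun s hs =>
        hcc ⟨hs.1, hs.2.trans (min_le_left _ _)⟩⟩
    have hcs : CauchySeq fun m : ℕ => q (c / (m + 1)) := by
      refine cauchySeq_of_le_tendsto_0 (fun m : ℕ => 2 * (M * (c / (m + 1)) * ‖k‖ ^ 2)) ?_ ?_
      · intro a b N ha hb
        have hmem : ∀ a : ℕ, N ≤ a → c / ((a : ℝ) + 1) ∈ Ioc (0 : ℝ) (c / (N + 1)) := fun a ha =>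
          ⟨by positivity, by gcongr⟩
        have hN : c / ((N : ℝ) + 1) ∈ Ioc (0 : ℝ) c := ⟨by positivity, div_le_self hc0.le (by
          have : (0:ℝ) ≤ N := Nat.cast_nonneg _
          linarith)⟩
        have b1 := hqq _ ⟨hN.1, hN.2.trans hc1⟩ (hcU _ hN) _ (hmem a ha)
        have b2 := hqq _ ⟨hN.1, hN.2.trans hc1⟩ (hcU _ hN) _ (hmem b hb)
        rw [← dist_eq_norm] at b1 b2
        exact (dist_triangle_right _ _ _).trans (by linarith)
      · have h6 : Tendsto (fun m : ℕ => c / ((m : ℝ) + 1)) atTop (𝓝 0) :=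
          tendsto_const_div_atTop_nhds_zero_nat c |>.comp (tendsto_add_atTop_nat 1) |>.congr
            (fun m => by simp)
        have := (((h6.const_mul M).mul_const (‖k‖ ^ 2)).const_mul 2)
        simpa using this
    obtain ⟨d, hd⟩ := cauchySeq_tendsto_of_complete hcs
    have h6 : Tendsto (fun m : ℕ => c / ((m : ℝ) + 1)) atTop (𝓝 0) :=
          tendsto_const_div_atTop_nhds_zero_nat c |>.comp (tendsto_add_atTop_nat 1) |>.congr
            (fun m => by simp)
    refine ⟨d, fun s hs hsU => ?_⟩
    have h7 : ‖d - q s‖ ≤ M * s * ‖k‖ ^ 2 := by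
      refine le_of_tendsto ((hd.sub_const (q s)).norm) ?_
      filter_upwards [h6.eventually_le_const hs.1] with m hm
      exact hqq s hs hsU _ ⟨by positivity, hm⟩
    have e : f (w + s • k) - f w - s • d = -(s • (d - q s)) := by
      rw [hq, smul_sub, smul_smul, mul_inv_cancel₀ hs.1.ne', one_smul]; abel
    rw [e, norm_neg, norm_smul, Real.norm_of_nonneg hs.1.le]
    calc s * ‖d - q s‖ ≤ s * (M * s * ‖k‖ ^ 2) := mul_le_mul_of_nonneg_left h7 hs.1.le
      _ = _ := by ring
  -- directional derivatives
  have hdir : ∀ w : W, ∃ D : W → Y, w ∈ U → ∀ k,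
      Tendsto (fun s : ℝ => s⁻¹ • (f (w + s • k) - f w)) (𝓝[>] 0) (𝓝 (D k)) := by
    intro w
    by_cases hw : w ∈ U
    · have : ∀ k, ∃ d, Tendsto (fun s : ℝ => s⁻¹ • (f (w + s • k) - f w)) (𝓝[>] 0) (𝓝 d) := by
        intro k
        obtain ⟨c, hc, hcc⟩ := mem_nhdsGT_iff_exists_Ioc_subset.1 (hsmall w hw k)
        have hc : 0 < c := hc
        obtain ⟨d, hd⟩ := hcauchy w hw (c • k) (hcc ⟨hc, le_rfl⟩)
        refine ⟨c⁻¹ • d, ?_⟩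
        refine tendsto_iff_norm_sub_tendsto_zero.2 ?_
        have h5 : Tendsto (fun s : ℝ => M * s * ‖k‖ ^ 2) (𝓝[>] 0) (𝓝 0) := by
          have : Continuous fun s : ℝ => M * s * ‖k‖ ^ 2 := by fun_prop
          simpa using (this.tendsto 0).mono_left nhdsWithin_le_nhds
        refine squeeze_zero' (Eventually.of_forall fun _ => norm_nonneg _) ?_ h5
        filter_upwards [Ioc_mem_nhdsGT hc] with s hs
        have h1 := hd (s / c) ⟨div_pos hs.1 hc, (div_le_one hc).2 hs.2⟩
        rw [smul_smul, div_mul_cancel₀ _ hc.ne', norm_smul, Real.norm_of_nonneg hc.le] at h1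
        have h2 := h1 (hcc hs)
        have e : s⁻¹ • (f (w + s • k) - f w) - c⁻¹ • d =
            s⁻¹ • (f (w + s • k) - f w - (s / c) • d) := by
          rw [smul_sub s⁻¹ (f (w + s • k) - f w), smul_smul]
          congr 2
          have := hs.1.ne'
          field_simp
        rw [e, norm_smul, norm_inv, Real.norm_of_nonneg hs.1.le, inv_mul_le_iff₀ hs.1]
        refine h2.trans (le_of_eq ?_)
        field_simp
      choose D hD using this
      exact ⟨D, fun _ => hD⟩
    · exact ⟨0, fun h => absurd h hw⟩
  choose D hD using hdir
  have hq : ∀ w ∈ U, ∀ k, w + k ∈ U → ‖f (w + k) - f w - D w k‖ ≤ M * ‖k‖ ^ 2 := by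
    intro w hw k hk
    have l1 := ((tendsto_const_nhds (x := f (w + k) - f w)).sub (hD w hw k)).norm
    refine le_of_tendsto l1 ?_
    filter_upwards [Ioc_mem_nhdsGT (one_pos (α := ℝ))] with s hs
    have h1 := h w hw k hk s ⟨hs.1.le, hs.2⟩
    have e : f (w + k) - f w - s⁻¹ • (f (w + s • k) - f w) =
        -(s⁻¹ • (f (w + s • k) - f w - s • (f (w + k) - f w))) := by
      rw [smul_sub s⁻¹ (f (w + s • k) - f w), smul_smul, inv_mul_cancel₀ hs.1.ne', one_smul]; abel
    rw [e, norm_neg, norm_smul, norm_inv, Real.norm_of_nonneg hs.1.le, inv_mul_le_iff₀ hs.1]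
    refine h1.trans (le_of_eq ?_); ring
  -- the directional derivatives are linear in the direction; additivity follows from the hypothesis
  -- with `s = 1 / 2` on the segments from `w + s k` to `w + s l` and from `w` to `w + s (k + l)`,
  -- which have the same midpoint
  have hhom : ∀ w ∈ U, ∀ k, ∀ c : ℝ, 0 < c → D w (c • k) = c • D w k := by
    intro w hw k c hc
    have l1 := hD w hw (c • k)
    have l2 : Tendsto (fun s : ℝ => s * c) (𝓝[>] 0) (𝓝[>] 0) := by
      refine tendsto_nhdsWithin_iff.2 ⟨?_, ?_⟩
      · have : Continuous fun s : ℝ => s * c := by fun_prop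
        simpa using (this.tendsto 0).mono_left nhdsWithin_le_nhds
      · filter_upwards [self_mem_nhdsWithin] with s hs using mul_pos hs hc
    have l3 := ((hD w hw k).comp l2).const_smul c
    refine tendsto_nhds_unique l1 (l3.congr fun s => ?_)
    simp only [Function.comp, smul_smul]
    rw [mul_inv, mul_comm s⁻¹, ← mul_assoc, mul_inv_cancel₀ hc.ne', one_mul]
  have hadd : ∀ w ∈ U, ∀ k l, D w (k + l) = D w k + D w l := by
    intro w hw k l
    have e1 : ∀ᶠ s in 𝓝[>] (0:ℝ), ‖s⁻¹ • (f (w + s • k) - f w) + s⁻¹ • (f (w + s • l) - f w)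
        - s⁻¹ • (f (w + s • (k + l)) - f w)‖ ≤ s * (M * ‖l - k‖ ^ 2 + M * ‖k + l‖ ^ 2) := by
      filter_upwards [hsmall w hw k, hsmall w hw l, hsmall w hw (k + l), self_mem_nhdsWithin]
        with s hk hl hkl hs
      have hs : 0 < s := hs
      have a1 := h (w + s • k) hk (s • (l - k)) (by convert hl using 1; module) (1 / 2)
        ⟨by norm_num, by norm_num⟩
      have a2 := h w hw (s • (k + l)) hkl (1 / 2) ⟨by norm_num, by norm_num⟩
      have p1 : w + s • k + (1 / 2 : ℝ) • s • (l - k) = w + (1 / 2 : ℝ) • s • (k + l) := by module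
      have p2 : w + s • k + s • (l - k) = w + s • l := by module
      rw [p1, p2] at a1
      rw [norm_smul, Real.norm_of_nonneg hs.le] at a1 a2
      set m := f (w + (1 / 2 : ℝ) • s • (k + l))
      have e : s⁻¹ • (f (w + s • k) - f w) + s⁻¹ • (f (w + s • l) - f w)
          - s⁻¹ • (f (w + s • (k + l)) - f w) =
          (s⁻¹ * 2) • ((m - f w - (1 / 2 : ℝ) • (f (w + s • (k + l)) - f w)) -
            (m - f (w + s • k) - (1 / 2 : ℝ) • (f (w + s • l) - f (w + s • k)))) := by
        module
      rw [e, norm_smul, Real.norm_of_nonneg (by positivity)]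
      have := (norm_sub_le (m - f w - (1 / 2 : ℝ) • (f (w + s • (k + l)) - f w))
            (m - f (w + s • k) - (1 / 2 : ℝ) • (f (w + s • l) - f (w + s • k)))).trans
            (add_le_add a2 a1)
      calc s⁻¹ * 2 * _ ≤ s⁻¹ * 2 * _ := mul_le_mul_of_nonneg_left this (by positivity)
        _ = _ := by field_simp; ring
    have l1 := (((hD w hw k).add (hD w hw l)).sub (hD w hw (k + l))).norm
    have l2 : Tendsto (fun s : ℝ => s * (M * ‖l - k‖ ^ 2 + M * ‖k + l‖ ^ 2)) (𝓝[>] 0) (𝓝 0) := by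
      have : Continuous fun s : ℝ => s * (M * ‖l - k‖ ^ 2 + M * ‖k + l‖ ^ 2) := by fun_prop
      simpa using (this.tendsto 0).mono_left nhdsWithin_le_nhds
    have := le_of_tendsto_of_tendsto l1 l2 e1
    exact (sub_eq_zero.1 (norm_le_zero_iff.1 this)).symm
  have hlin : ∀ w, ∃ L : W →L[ℝ] Y, w ∈ U → ∀ k, L k = D w k := by
    intro w
    by_cases hw : w ∈ U
    · have h0 : D w 0 = 0 := by simpa using hadd w hw 0 0
      have hneg : ∀ k, D w (-k) = -D w k := fun k => by
        have := hadd w hw k (-k)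
        rw [add_neg_cancel, h0] at this
        exact (neg_eq_of_add_eq_zero_right this.symm).symm
      let L : W →ₗ[ℝ] Y :=
        { toFun := D w
          map_add' := hadd w hw
          map_smul' := fun c k => by
            rcases lt_trichotomy c 0 with hc | rfl | hc
            · have := hhom w hw k (-c) (by linarith)
              rw [neg_smul, hneg, neg_smul] at this
              simpa using neg_injective this
            · simp [h0]
            · exact hhom w hw k c hc }
      obtain ⟨r, hr, hball⟩ := Metric.isOpen_iff.1 hU w hw
      -- the bound on `f` makes the derivative a bounded operator
      refine ⟨L.mkContinuousOfExistsBound ⟨(2 / r) * (2 * C + M * (r / 2) ^ 2), fun k => ?_⟩, fun _ k => rfl⟩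
      rcases eq_or_ne k 0 with rfl | hk
      · simp
      have hkn : 0 < ‖k‖ := norm_pos_iff.2 hk
      set k' := (r / 2 / ‖k‖) • k with hk'
      have hkn' : ‖k'‖ = r / 2 := by
        rw [hk', norm_smul, Real.norm_of_nonneg (by positivity), div_mul_cancel₀ _ hkn.ne']
      have hU' : w + k' ∈ U := hball (by
        rw [Metric.mem_ball, dist_eq_norm, add_sub_cancel_left, hkn']; linarith)
      have b1 := hq w hw k' hU'
      have b2 : ‖D w k'‖ ≤ 2 * C + M * (r / 2) ^ 2 := by
        have e : D w k' = f (w + k') - f w - (f (w + k') - f w - D w k') := by abel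
        rw [e]
        refine (norm_sub_le _ _).trans (add_le_add ((norm_sub_le _ _).trans ?_) (by rwa [hkn'] at b1))
        linarith [hC _ hU', hC _ hw]
      have b3 : D w k' = (r / 2 / ‖k‖) • D w k := hhom w hw k _ (by positivity)
      rw [b3, norm_smul, Real.norm_of_nonneg (by positivity)] at b2
      change ‖D w k‖ ≤ _
      have : ‖D w k‖ = (2 / r * ‖k‖) * (r / 2 / ‖k‖ * ‖D w k‖) := by field_simp
      rw [this]
      calc (2 / r * ‖k‖) * (r / 2 / ‖k‖ * ‖D w k‖) ≤ (2 / r * ‖k‖) * (2 * C + M * (r / 2) ^ 2) :=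
            mul_le_mul_of_nonneg_left b2 (by positivity)
        _ = _ := by ring
    · exact ⟨0, fun h => absurd h hw⟩
  choose L hL using hlin
  refine contDiffOn_one_of_quadratic (D := L) (M := M) hU fun w hw w' hw' => ?_
  have := hq w hw (w' - w) (by rwa [add_sub_cancel])
  rwa [add_sub_cancel, ← hL w hw] at this

/-- A map is of class `C^(k+1)` if its `k`-th derivative is of class `C¹`. For `k = 0` no regularity
of `f` is presupposed, since `ContDiffOn ℝ 0` would already be continuity. -/
theorem contDiffOn_succ_of_iteratedFDeriv {f : W → Y} {U : Set W} (hU : IsOpen U) (k : ℕ)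
    (hk : k ≠ 0 → ContDiffOn ℝ k f U) (h1 : ContDiffOn ℝ 1 (iteratedFDeriv ℝ k f) U) :
    ContDiffOn ℝ (k + 1 : ℕ) f U := by
  have hcongr : ∀ m : ℕ, EqOn (iteratedFDerivWithin ℝ m f U) (iteratedFDeriv ℝ m f) U :=
    fun m => iteratedFDerivWithin_of_isOpen m hU
  have hlt : ∀ m : ℕ, m < k → DifferentiableOn ℝ (iteratedFDerivWithin ℝ m f U) U := fun m hm =>
    (hk (by omega)).differentiableOn_iteratedFDerivWithin (by exact_mod_cast hm) hU.uniqueDiffOn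
  have heq : DifferentiableOn ℝ (iteratedFDerivWithin ℝ k f U) U :=
    (h1.differentiableOn (by norm_num)).congr (hcongr k)
  have hd : ∀ m : ℕ, m < k + 1 → DifferentiableOn ℝ (iteratedFDerivWithin ℝ m f U) U := by
    intro m hm
    rcases Nat.lt_succ_iff_lt_or_eq.1 hm with h | rfl
    · exact hlt m h
    · exact heq
  rw [contDiffOn_nat_iff_continuousOn_differentiableOn hU.uniqueDiffOn]
  refine ⟨fun m hm => ?_, fun m hm => hd m (by exact_mod_cast hm)⟩
  have hm : m ≤ k + 1 := by exact_mod_cast hm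
  rcases Nat.lt_or_ge m (k + 1) with h | h
  · exact (hd m h).continuousOn
  · obtain rfl : m = k + 1 := le_antisymm hm h
    have : ContinuousOn (fderiv ℝ (iteratedFDeriv ℝ k f)) U := h1.continuousOn_fderiv_of_isOpen hU le_rfl
    refine ContinuousOn.congr (f := iteratedFDeriv ℝ (k + 1) f) ?_ (hcongr _)
    have e : iteratedFDeriv ℝ (k + 1) f =
      (continuousMultilinearCurryLeftEquiv ℝ (fun _ : Fin (k + 1) => W) Y).symm ∘
        fderiv ℝ (iteratedFDeriv ℝ k f) := iteratedFDeriv_succ_eq_comp_left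
    rw [e]
    exact (LinearIsometryEquiv.continuous _).comp_continuousOn this

/-- A `C²` function on a convex compact set is affine on segments up to a quadratic error. -/
theorem exists_interpolation_bound {f : W → Y} {K U : Set W} (hK : IsCompact K) (hKc : Convex ℝ K)
    (hU : IsOpen U) (hKU : K ⊆ U) (hf : ContDiffOn ℝ 2 f U) :
    ∃ M : ℝ, 0 ≤ M ∧ ∀ w ∈ K, ∀ k, w + k ∈ K → ∀ s ∈ Icc (0 : ℝ) 1,
      ‖f (w + s • k) - f w - s • (f (w + k) - f w)‖ ≤ M * s * ‖k‖ ^ 2 := by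
  have hdiff : ∀ w ∈ U, DifferentiableAt ℝ f w := fun w hw =>
    (hf.contDiffAt (hU.mem_nhds hw)).differentiableAt (by norm_num)
  have hf1 : ContDiffOn ℝ 1 (fderiv ℝ f) U := hf.fderiv_of_isOpen hU (by norm_num)
  have hdiff1 : ∀ w ∈ U, DifferentiableAt ℝ (fderiv ℝ f) w := fun w hw =>
    (hf1.contDiffAt (hU.mem_nhds hw)).differentiableAt (by norm_num)
  obtain ⟨C, hC⟩ := hK.exists_bound_of_continuousOn
    ((hf1.continuousOn_fderiv_of_isOpen hU le_rfl).mono hKU)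
  have hlip : ∀ w ∈ K, ∀ w' ∈ K, ‖fderiv ℝ f w' - fderiv ℝ f w‖ ≤ C * ‖w' - w‖ := fun w hw w' hw' =>
    hKc.norm_image_sub_le_of_norm_fderiv_le (fun x hx => hdiff1 x (hKU hx)) hC hw hw'
  have hquad : ∀ w ∈ K, ∀ k, w + k ∈ K → ‖f (w + k) - f w - fderiv ℝ f w k‖ ≤ |C| * ‖k‖ ^ 2 := by
    intro w hw k hk
    have hseg : segment ℝ w (w + k) ⊆ K := hKc.segment_subset hw hk
    have := (convex_segment w (w + k)).norm_image_sub_le_of_norm_fderiv_le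
      (f := fun x => f x - fderiv ℝ f w x) (C := |C| * ‖k‖) (𝕜 := ℝ)
      (fun x hx => (hdiff x (hKU (hseg hx))).sub (fderiv ℝ f w).differentiableAt)
      (fun x hx => by
        rw [fderiv_fun_sub (hdiff x (hKU (hseg hx))) (fderiv ℝ f w).differentiableAt,
          ContinuousLinearMap.fderiv]
        refine (hlip w hw x (hseg hx)).trans (mul_le_mul (le_abs_self C) ?_ (norm_nonneg _)
          (abs_nonneg C))
        obtain ⟨θ, hθ, rfl⟩ := (mem_segment_iff_wbtw.1 hx)
        rw [AffineMap.lineMap_apply]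
        simp only [vsub_eq_sub, add_sub_cancel_left, vadd_eq_add, add_sub_cancel_right]
        rw [norm_smul, Real.norm_of_nonneg hθ.1]
        exact mul_le_of_le_one_left (norm_nonneg _) hθ.2)
      (left_mem_segment ℝ w (w + k)) (right_mem_segment ℝ w (w + k))
    rw [add_sub_cancel_left] at this
    calc ‖f (w + k) - f w - fderiv ℝ f w k‖ = ‖f (w + k) - fderiv ℝ f w (w + k) - (f w - fderiv ℝ f w w)‖ := by
          rw [map_add]; congr 1; abel
      _ ≤ _ := this
      _ = _ := by ring
  refine ⟨2 * |C|, by positivity, fun w hw k hk s hs => ?_⟩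
  have hsk : w + s • k ∈ K := by
    have := hKc.add_smul_sub_mem hw hk hs
    rwa [add_sub_cancel_left] at this
  have a1 := hquad w hw k hk
  have a2 := hquad w hw (s • k) hsk
  have e : f (w + s • k) - f w - s • (f (w + k) - f w) =
      (f (w + s • k) - f w - fderiv ℝ f w (s • k)) - s • (f (w + k) - f w - fderiv ℝ f w k) := by
    rw [map_smul, smul_sub s (f (w + k) - f w)]; abel
  rw [e]
  refine (norm_sub_le _ _).trans ?_
  rw [norm_smul, Real.norm_of_nonneg hs.1]
  rw [norm_smul, Real.norm_of_nonneg hs.1] at a2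
  have a3 := mul_le_mul_of_nonneg_left a1 hs.1
  have a4 : |C| * (s * ‖k‖) ^ 2 ≤ |C| * s * ‖k‖ ^ 2 := by
    have : s ^ 2 ≤ s := by nlinarith [hs.1, hs.2]
    calc |C| * (s * ‖k‖) ^ 2 = |C| * ‖k‖ ^ 2 * s ^ 2 := by ring
      _ ≤ |C| * ‖k‖ ^ 2 * s := mul_le_mul_of_nonneg_left this (by positivity)
      _ = _ := by ring
  linarith

end SmoothnessCriterion

/-! ### Naturality of the Euler-Lagrange equations -/

section EulerLagrange
open Filter Topology

theorem hasDerivWithinAt_clm_of_apply {V F : Type*} [NormedAddCommGroup V] [NormedSpace ℝ V]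
    [FiniteDimensional ℝ V] [NormedAddCommGroup F] [NormedSpace ℝ F] {p : ℝ → V →L[ℝ] F}
    {p' : V →L[ℝ] F} {S : Set ℝ} {t : ℝ}
    (h : ∀ v, HasDerivWithinAt (fun s => p s v) (p' v) S t) : HasDerivWithinAt p p' S t := by
  let b := Module.finBasis ℝ V
  have hrep : ∀ q : V →L[ℝ] F, q = ∑ i, ((b.coord i).toContinuousLinearMap).smulRight (q (b i)) := by
    intro q
    ext v
    calc q v = q (∑ i, b.repr v i • b i) := by rw [b.sum_repr]
      _ = _ := by rw [map_sum]; simp only [map_smul, sum_apply]; rfl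
  have h1 : HasDerivWithinAt (fun s => ∑ i, ((b.coord i).toContinuousLinearMap).smulRight (p s (b i)))
      (∑ i, ((b.coord i).toContinuousLinearMap).smulRight (p' (b i))) S t := by
    refine HasDerivWithinAt.fun_sum fun i _ => ?_
    exact (ContinuousLinearMap.smulRightL ℝ V F
      ((b.coord i).toContinuousLinearMap)).hasFDerivAt.comp_hasDerivWithinAt t (h (b i))
  rw [hrep p']
  exact h1.congr_of_eventuallyEq (Eventually.of_forall fun s => hrep (p s)) (hrep (p t))

/-- The Euler-Lagrange equations of the energy are natural: a curve satisfies them for a pulled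
back metric if its image satisfies them for the original metric. -/
theorem euler_lagrange_pullback {V : Type*} [NormedAddCommGroup V] [NormedSpace ℝ V]
    [FiniteDimensional ℝ V] {G G' : V → V →L[ℝ] V →L[ℝ] ℝ} {Φ : V → V} {c c₂ : ℝ → V}
    {S : Set ℝ} {t₀ : ℝ} (ht₀ : t₀ ∈ S) (hS : UniqueDiffOn ℝ S)
    (hG' : DifferentiableAt ℝ G' (Φ (c t₀)))
    (hsymm : ∀ v w, G' (Φ (c t₀)) v w = G' (Φ (c t₀)) w v)
    (hΦ : ContDiffAt ℝ 2 Φ (c t₀)) (hc : ∀ᶠ t in 𝓝[S] t₀, DifferentiableWithinAt ℝ c S t)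
    (hpull : ∀ᶠ u in 𝓝 (c t₀), ∀ v w, G u v w = G' (Φ u) (fderiv ℝ Φ u v) (fderiv ℝ Φ u w))
    (hc₂ : ∀ᶠ t in 𝓝[S] t₀, c₂ t = Φ (c t))
    (hEL : ∀ w, HasDerivWithinAt (fun t => G' (c₂ t) (derivWithin c₂ S t) w)
      ((1 / 2 : ℝ) * fderiv ℝ (fun u => G' u (derivWithin c₂ S t₀) (derivWithin c₂ S t₀)) (c₂ t₀) w)
      S t₀) (w : V) :
    HasDerivWithinAt (fun t => G (c t) (derivWithin c S t) w)
      ((1 / 2 : ℝ) * fderiv ℝ (fun u => G u (derivWithin c S t₀) (derivWithin c S t₀)) (c t₀) w)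
      S t₀ := by
  have hc0 : DifferentiableWithinAt ℝ c S t₀ := hc.self_of_nhdsWithin ht₀
  have hcc : Tendsto c (𝓝[S] t₀) (𝓝 (c t₀)) := hc0.continuousWithinAt
  have hΦe : ∀ᶠ u in 𝓝 (c t₀), DifferentiableAt ℝ Φ u :=
    (hΦ.eventually (by simp)).mono fun u hu => hu.differentiableAt (by norm_num)
  have hd2 : ∀ᶠ t in 𝓝[S] t₀, derivWithin c₂ S t = fderiv ℝ Φ (c t) (derivWithin c S t) := by
    filter_upwards [eventually_eventually_nhdsWithin.2 hc₂, hc, hcc.eventually hΦe,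
      self_mem_nhdsWithin] with t h1 h2 h3 h4
    have h5 : derivWithin c₂ S t = derivWithin (fun t => Φ (c t)) S t :=
      Filter.EventuallyEq.derivWithin_eq h1 (h1.self_of_nhdsWithin h4)
    rw [h5]
    exact (h3.hasFDerivAt.comp_hasDerivWithinAt t h2.hasDerivWithinAt).derivWithin (hS t h4)
  set c₀ := derivWithin c S t₀ with hc₀
  have hd20 : derivWithin c₂ S t₀ = fderiv ℝ Φ (c t₀) c₀ := hd2.self_of_nhdsWithin ht₀
  have hc20 : c₂ t₀ = Φ (c t₀) := hc₂.self_of_nhdsWithin ht₀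
  set T := fderiv ℝ (fun u => G' u (derivWithin c₂ S t₀) (derivWithin c₂ S t₀)) (c₂ t₀) with hT
  have hp : HasDerivWithinAt (fun t => G' (c₂ t) (derivWithin c₂ S t)) ((1 / 2 : ℝ) • T) S t₀ :=
    hasDerivWithinAt_clm_of_apply fun w => hEL w
  have hDΦ : DifferentiableAt ℝ (fderiv ℝ Φ) (c t₀) :=
    (hΦ.fderiv_right (m := 1) (by norm_num)).differentiableAt (by norm_num)
  have hu : HasDerivWithinAt (fun t => fderiv ℝ Φ (c t) w)
      (fderiv ℝ (fderiv ℝ Φ) (c t₀) c₀ w) S t₀ := by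
    have := (hDΦ.hasFDerivAt.comp_hasDerivWithinAt t₀ hc0.hasDerivWithinAt).clm_apply
      (hasDerivWithinAt_const t₀ S w)
    simpa using this
  have hmain := hp.clm_apply hu
  have hfun : (fun t => G (c t) (derivWithin c S t) w) =ᶠ[𝓝[S] t₀]
      fun t => G' (c₂ t) (derivWithin c₂ S t) (fderiv ℝ Φ (c t) w) := by
    filter_upwards [hc₂, hd2, hcc.eventually hpull] with t h1 h2 h3
    rw [h1, h2, h3]
  refine (hmain.congr_of_eventuallyEq hfun (hfun.self_of_nhdsWithin ht₀)).congr_deriv ?_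
  -- compare the derivatives
  have hG'd : HasFDerivAt (fun u => G' (Φ u)) ((fderiv ℝ G' (Φ (c t₀))).comp (fderiv ℝ Φ (c t₀)))
      (c t₀) := HasFDerivAt.comp (g := G') (f := Φ) (c t₀) hG'.hasFDerivAt
        (hΦ.differentiableAt (by norm_num)).hasFDerivAt
  have hv : HasFDerivAt (fun u => fderiv ℝ Φ u c₀) ((fderiv ℝ (fderiv ℝ Φ) (c t₀)).flip c₀)
      (c t₀) := by
    have := hDΦ.hasFDerivAt.clm_apply (hasFDerivAt_const c₀ (c t₀))
    simpa using this
  have hfull := (hG'd.clm_apply hv).clm_apply hv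
  have hfe : fderiv ℝ (fun u => G u c₀ c₀) (c t₀) =
      fderiv ℝ (fun u => G' (Φ u) (fderiv ℝ Φ u c₀) (fderiv ℝ Φ u c₀)) (c t₀) :=
    Filter.EventuallyEq.fderiv_eq (hpull.mono fun u hu => hu c₀ c₀)
  rw [hfe, hfull.fderiv]
  have hTe : T (fderiv ℝ Φ (c t₀) w) = fderiv ℝ G' (Φ (c t₀)) (fderiv ℝ Φ (c t₀) w)
      (fderiv ℝ Φ (c t₀) c₀) (fderiv ℝ Φ (c t₀) c₀) := by
    rw [hT, hc20, hd20]
    set b := fderiv ℝ Φ (c t₀) c₀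
    have := (hG'.hasFDerivAt.clm_apply (hasFDerivAt_const b (Φ (c t₀)))).clm_apply
      (hasFDerivAt_const b (Φ (c t₀)))
    rw [this.fderiv]
    simp
  have hsd : fderiv ℝ (fderiv ℝ Φ) (c t₀) c₀ w = fderiv ℝ (fderiv ℝ Φ) (c t₀) w c₀ :=
    hΦ.isSymmSndFDerivAt (by simp) c₀ w
  simp only [_root_.smul_apply, smul_eq_mul, hTe, hc20, hd20, hsd]
  simp
  rw [hsymm (fderiv ℝ (fderiv ℝ Φ) (c t₀) w c₀)]
  ring

end EulerLagrange

/-! ### The metric in a chart -/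

section ChartMetric
open Filter Topology

variable {n : ℕ} {X : Type*} [EMetricSpace X] [ChartedSpace (EuclideanSpace ℝ (Fin n)) X]
  [IsManifold (𝓡 n) ∞ X]

/-- The derivative of the chart at `a`, as an endomorphism of the model space. -/
def dChart (n : ℕ) {X : Type*} [EMetricSpace X] [ChartedSpace (EuclideanSpace ℝ (Fin n)) X]
    (a y : X) : EuclideanSpace ℝ (Fin n) →L[ℝ] EuclideanSpace ℝ (Fin n) :=
  mfderiv (𝓡 n) 𝓘(ℝ, EuclideanSpace ℝ (Fin n)) (extChartAt (𝓡 n) a) y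

/-- The derivative of the inverse of the chart at `a`, as an endomorphism of the model space. -/
def dChartSymm (a : X) (u : EuclideanSpace ℝ (Fin n)) :
    EuclideanSpace ℝ (Fin n) →L[ℝ] EuclideanSpace ℝ (Fin n) :=
  mfderiv 𝓘(ℝ, EuclideanSpace ℝ (Fin n)) (𝓡 n) (extChartAt (𝓡 n) a).symm u

theorem dChart_comp_dChartSymm {a : X} {u : EuclideanSpace ℝ (Fin n)}
    (hu : u ∈ (extChartAt (𝓡 n) a).target) :
    (dChart n a ((extChartAt (𝓡 n) a).symm u)).comp (dChartSymm a u) =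
      ContinuousLinearMap.id ℝ (EuclideanSpace ℝ (Fin n)) := by
  have := mfderiv_extChartAt_comp_mfderivWithin_extChartAt_symm (I := 𝓡 n) hu
  rw [ModelWithCorners.range_eq_univ, mfderivWithin_univ] at this
  exact this

theorem dChartSymm_comp_dChart {a y : X} (hy : y ∈ (extChartAt (𝓡 n) a).source) :
    (dChartSymm a (extChartAt (𝓡 n) a y)).comp (dChart n a y) =
      ContinuousLinearMap.id ℝ (EuclideanSpace ℝ (Fin n)) := by
  have := mfderivWithin_extChartAt_symm_comp_mfderiv_extChartAt' (I := 𝓡 n) hy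
  rw [ModelWithCorners.range_eq_univ, mfderivWithin_univ] at this
  exact this

theorem contMDiffAt_extChartAt_symm_of_mem {a : X} {u : EuclideanSpace ℝ (Fin n)}
    (hu : u ∈ (extChartAt (𝓡 n) a).target) :
    ContMDiffAt 𝓘(ℝ, EuclideanSpace ℝ (Fin n)) (𝓡 n) ∞ (extChartAt (𝓡 n) a).symm u :=
  (contMDiffOn_extChartAt_symm a).contMDiffAt ((isOpen_extChartAt_target a).mem_nhds hu)

theorem contMDiffAt_extChartAt_of_mem {a y : X} (hy : y ∈ (extChartAt (𝓡 n) a).source) :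
    ContMDiffAt (𝓡 n) 𝓘(ℝ, EuclideanSpace ℝ (Fin n)) ∞ (extChartAt (𝓡 n) a) y :=
  contMDiffAt_extChartAt' (by rwa [extChartAt_source] at hy)

/-- The smooth section of the tangent bundle along the inverse chart with constant coordinates. -/
theorem contMDiffOn_dChartSymm (a : X) (v : EuclideanSpace ℝ (Fin n)) :
    ContMDiffOn 𝓘(ℝ, EuclideanSpace ℝ (Fin n)) (𝓡 n).tangent ∞
      (fun u => (⟨(extChartAt (𝓡 n) a).symm u, dChartSymm a u v⟩ : TangentBundle (𝓡 n) X))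
      (extChartAt (𝓡 n) a).target := by
  have hsrc : ∀ u ∈ (extChartAt (𝓡 n) a).target,
      (extChartAt (𝓡 n) a).symm u ∈ (chartAt (EuclideanSpace ℝ (Fin n)) a).source := by
    intro u hu
    rw [← extChartAt_source (𝓡 n)]
    exact (extChartAt (𝓡 n) a).map_target hu
  refine ((trivializationAt (EuclideanSpace ℝ (Fin n)) (TangentSpace (𝓡 n)) a).contMDiffOn_iff
    fun u hu => ?_).2 ⟨contMDiffOn_extChartAt_symm a, ?_⟩
  · rw [TangentBundle.trivializationAt_source]; exact hsrc u hu
  · refine (contMDiffOn_const (c := v)).congr fun u hu => ?_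
    have h1 := TangentBundle.continuousLinearMapAt_trivializationAt (I := 𝓡 n) (hsrc u hu)
    have h2 : (trivializationAt (EuclideanSpace ℝ (Fin n)) (TangentSpace (𝓡 n)) a).continuousLinearMapAt
        ℝ ((extChartAt (𝓡 n) a).symm u) (dChartSymm a u v) = v := by
      rw [h1]
      exact DFunLike.congr_fun (dChart_comp_dChartSymm hu) v
    exact ((trivializationAt (EuclideanSpace ℝ (Fin n)) (TangentSpace (𝓡 n))
      a).continuousLinearMapAt_apply_of_mem (R := ℝ) (hsrc u hu) _).symm.trans h2

variable [RiemannianBundle (fun x : X => TangentSpace (𝓡 n) x)]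

/-- The Riemannian inner product at `y`, on the model space. -/
def tangentInner (n : ℕ) {X : Type*} [EMetricSpace X] [ChartedSpace (EuclideanSpace ℝ (Fin n)) X]
    [IsManifold (𝓡 n) ∞ X] [RiemannianBundle (fun x : X => TangentSpace (𝓡 n) x)]
    (y : X) (v w : EuclideanSpace ℝ (Fin n)) : ℝ :=
  inner ℝ (show TangentSpace (𝓡 n) y from v) (show TangentSpace (𝓡 n) y from w)

theorem coordMetric_eq (a : X) (u v w : EuclideanSpace ℝ (Fin n)) :
    coordMetric a u v w =
      tangentInner n ((extChartAt (𝓡 n) a).symm u) (dChartSymm a u v) (dChartSymm a u w) := rfl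

/-- The metric in the chart at `a`, as a family of continuous bilinear forms. -/
def metricCLM (a : X) (u : EuclideanSpace ℝ (Fin n)) :
    EuclideanSpace ℝ (Fin n) →L[ℝ] EuclideanSpace ℝ (Fin n) →L[ℝ] ℝ :=
  (LinearMap.mk₂ ℝ (coordMetric a u)
    (fun v v' w => by
      simp only [coordMetric_eq, map_add]; exact inner_add_left _ _ _)
    (fun r v w => by
      simp only [coordMetric_eq, map_smul]; exact real_inner_smul_left _ _ _)
    (fun v w w' => by
      simp only [coordMetric_eq, map_add]; exact inner_add_right _ _ _)
    (fun r v w => by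
      simp only [coordMetric_eq, map_smul]; exact real_inner_smul_right _ _ _)).toContinuousBilinearMap

theorem metricCLM_apply (a : X) (u v w : EuclideanSpace ℝ (Fin n)) :
    metricCLM a u v w = coordMetric a u v w := rfl

theorem metricCLM_symm (a : X) (u v w : EuclideanSpace ℝ (Fin n)) :
    metricCLM a u v w = metricCLM a u w v :=
  real_inner_comm (F := TangentSpace (𝓡 n) ((extChartAt (𝓡 n) a).symm u)) _ _

theorem metricCLM_self_pos {a : X} {u : EuclideanSpace ℝ (Fin n)}
    (hu : u ∈ (extChartAt (𝓡 n) a).target) {v : EuclideanSpace ℝ (Fin n)} (hv : v ≠ 0) :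
    0 < metricCLM a u v v := by
  refine (real_inner_self_pos (F := TangentSpace (𝓡 n) ((extChartAt (𝓡 n) a).symm u))).2 fun h => hv ?_
  have h1 := DFunLike.congr_fun (dChart_comp_dChartSymm hu) v
  have h2 : dChartSymm a u v = 0 := h
  rw [ContinuousLinearMap.comp_apply, h2, map_zero] at h1
  exact h1.symm

theorem contDiffOn_metricCLM [IsContMDiffRiemannianBundle (𝓡 n) ∞ (EuclideanSpace ℝ (Fin n))
      (fun x : X => TangentSpace (𝓡 n) x)] (a : X) :
    ContDiffOn ℝ ∞ (metricCLM a) (extChartAt (𝓡 n) a).target := by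
  refine contDiffOn_clm_apply.2 fun v => contDiffOn_clm_apply.2 fun w => ?_
  have h := ContMDiffOn.inner_bundle (IB := 𝓡 n) (E := fun x : X => TangentSpace (𝓡 n) x)
    (contMDiffOn_dChartSymm a v) (contMDiffOn_dChartSymm a w)
  exact h.contDiffOn

end ChartMetric

/-! ### Velocities and independence of the geodesic equation of the chart -/

section Velocity

theorem two_le_smooth : (2 : WithTop ℕ∞) ≤ ∞ := by
  have : ((2 : ℕ∞) : WithTop ℕ∞) ≤ ((⊤ : ℕ∞) : WithTop ℕ∞) := by
    exact WithTop.coe_le_coe.2 le_top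
  exact this

open Filter Topology

variable {n : ℕ} {X : Type*} [EMetricSpace X] [ChartedSpace (EuclideanSpace ℝ (Fin n)) X]
  [IsManifold (𝓡 n) ∞ X]

/-- The velocity of a curve `γ : [0,1] → X`, with the tangent space identified with the model
space. -/
def velocity (n : ℕ) {X : Type*} [EMetricSpace X] [ChartedSpace (EuclideanSpace ℝ (Fin n)) X]
    (γ : ℝ → X) (t : ℝ) : EuclideanSpace ℝ (Fin n) :=
  mfderivWithin 𝓘(ℝ, ℝ) (𝓡 n) γ (Icc 0 1) t (1 : ℝ)

theorem uniqueDiffOn_unitInterval : UniqueDiffOn ℝ (Icc (0 : ℝ) 1) := uniqueDiffOn_Icc zero_lt_one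

theorem hasDerivWithinAt_extChartAt_comp {γ : ℝ → X} {t : ℝ} {a : X}
    (hγ : MDifferentiableWithinAt 𝓘(ℝ, ℝ) (𝓡 n) γ (Icc 0 1) t)
    (ha : γ t ∈ (extChartAt (𝓡 n) a).source) :
    HasDerivWithinAt (fun s => extChartAt (𝓡 n) a (γ s)) (dChart n a (γ t) (velocity n γ t))
      (Icc 0 1) t := by
  have h1 := ((contMDiffAt_extChartAt_of_mem ha).mdifferentiableAt (by simp)).hasMFDerivAt
  have h2 : HasFDerivWithinAt (fun s => extChartAt (𝓡 n) a (γ s)) ((dChart n a (γ t)).comp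
      (show ℝ →L[ℝ] EuclideanSpace ℝ (Fin n) from
        mfderivWithin 𝓘(ℝ, ℝ) (𝓡 n) γ (Icc 0 1) t)) (Icc 0 1) t :=
    (h1.comp_hasMFDerivWithinAt t hγ.hasMFDerivWithinAt).hasFDerivWithinAt
  exact h2.hasDerivWithinAt

theorem derivWithin_extChartAt_comp {γ : ℝ → X} {t : ℝ} {a : X} (ht : t ∈ Icc (0 : ℝ) 1)
    (hγ : MDifferentiableWithinAt 𝓘(ℝ, ℝ) (𝓡 n) γ (Icc 0 1) t)
    (ha : γ t ∈ (extChartAt (𝓡 n) a).source) :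
    derivWithin (fun s => extChartAt (𝓡 n) a (γ s)) (Icc 0 1) t =
      dChart n a (γ t) (velocity n γ t) :=
  (hasDerivWithinAt_extChartAt_comp hγ ha).derivWithin (uniqueDiffOn_unitInterval t ht)

theorem eventually_mem_extChartAt_source {γ : ℝ → X} {t : ℝ} {a : X} {S : Set ℝ}
    (hγ : ContinuousWithinAt γ S t)
    (ha : γ t ∈ (extChartAt (𝓡 n) a).source) :
    ∀ᶠ s in 𝓝[S] t, γ s ∈ (extChartAt (𝓡 n) a).source :=
  hγ.eventually ((isOpen_extChartAt_source a).mem_nhds ha)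

variable [RiemannianBundle (fun x : X => TangentSpace (𝓡 n) x)]

theorem coordMetric_extChartAt {a y : X} (hy : y ∈ (extChartAt (𝓡 n) a).source)
    (v w : EuclideanSpace ℝ (Fin n)) :
    coordMetric a (extChartAt (𝓡 n) a y) (dChart n a y v) (dChart n a y w) =
      tangentInner n y v w := by
  rw [coordMetric_eq, (extChartAt (𝓡 n) a).left_inv hy]
  have h := fun v => DFunLike.congr_fun (dChartSymm_comp_dChart hy) v
  have h1 : ∀ v, dChartSymm a (extChartAt (𝓡 n) a y) (dChart n a y v) = v := h
  rw [h1, h1]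

theorem tangentInner_self_eq_norm (y : X) (v : EuclideanSpace ℝ (Fin n)) :
    tangentInner n y v v = ‖(show TangentSpace (𝓡 n) y from v)‖ ^ 2 :=
  real_inner_self_eq_norm_sq (F := TangentSpace (𝓡 n) y) _

/-- The Euler-Lagrange equation of the energy at time `t₀` for a curve `γ`, read in the chart
at `a`. -/
def EulerLagrangeAt (n : ℕ) {X : Type*} [EMetricSpace X]
    [ChartedSpace (EuclideanSpace ℝ (Fin n)) X] [IsManifold (𝓡 n) ∞ X]
    [RiemannianBundle (fun x : X => TangentSpace (𝓡 n) x)] (a : X) (γ : ℝ → X) (t₀ : ℝ) : Prop :=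
  ∀ w : EuclideanSpace ℝ (Fin n),
    HasDerivWithinAt (fun t => metricCLM a (extChartAt (𝓡 n) a (γ t))
        (derivWithin (fun s => extChartAt (𝓡 n) a (γ s)) (Icc 0 1) t) w)
      ((1 / 2 : ℝ) * fderiv ℝ (fun u => metricCLM a u
        (derivWithin (fun s => extChartAt (𝓡 n) a (γ s)) (Icc 0 1) t₀)
        (derivWithin (fun s => extChartAt (𝓡 n) a (γ s)) (Icc 0 1) t₀))
        (extChartAt (𝓡 n) a (γ t₀)) w)
      (Icc 0 1) t₀

theorem IsGeodesic.eulerLagrangeAt {γ : ℝ → X} (h : IsGeodesic (n := n) γ) {t₀ : ℝ}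
    (ht₀ : t₀ ∈ Icc (0 : ℝ) 1) : EulerLagrangeAt n (γ t₀) γ t₀ := h.eulerLagrange t₀ ht₀

theorem isGeodesic_of_eulerLagrangeAt {γ : ℝ → X}
    (h1 : ContMDiffOn 𝓘(ℝ, ℝ) (𝓡 n) ∞ γ (Icc 0 1))
    (h2 : ∀ t₀ ∈ Icc (0 : ℝ) 1, EulerLagrangeAt n (γ t₀) γ t₀) : IsGeodesic (n := n) γ :=
  ⟨h1, h2⟩

/-- The differential of a smooth self-map, as an endomorphism of the model space. -/
def dMap (n : ℕ) {X : Type*} [EMetricSpace X] [ChartedSpace (EuclideanSpace ℝ (Fin n)) X]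
    (ψ : X → X) (y : X) : EuclideanSpace ℝ (Fin n) →L[ℝ] EuclideanSpace ℝ (Fin n) :=
  mfderiv (𝓡 n) (𝓡 n) ψ y

theorem mem_source_of_mem_target {a : X} {u : EuclideanSpace ℝ (Fin n)}
    (hu : u ∈ (extChartAt (𝓡 n) a).target) :
    (extChartAt (𝓡 n) a).symm u ∈ (extChartAt (𝓡 n) a).source :=
  (extChartAt (𝓡 n) a).map_target hu

/-- The coordinate expression of a smooth map, and its derivative in terms of the differential of
the map. -/
theorem fderiv_coordinate_map {ψ : X → X} (hψ : ContMDiff (𝓡 n) (𝓡 n) ∞ ψ) {a b : X}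
    {u : EuclideanSpace ℝ (Fin n)} (hu : u ∈ (extChartAt (𝓡 n) a).target)
    (hb : ψ ((extChartAt (𝓡 n) a).symm u) ∈ (extChartAt (𝓡 n) b).source) :
    ContDiffAt ℝ ∞ (fun u => extChartAt (𝓡 n) b (ψ ((extChartAt (𝓡 n) a).symm u))) u ∧
    fderiv ℝ (fun u => extChartAt (𝓡 n) b (ψ ((extChartAt (𝓡 n) a).symm u))) u =
      (dChart n b (ψ ((extChartAt (𝓡 n) a).symm u))).comp
        ((dMap n ψ ((extChartAt (𝓡 n) a).symm u)).comp (dChartSymm a u)) := by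
  have h1 := contMDiffAt_extChartAt_of_mem hb
  have h2 := hψ.contMDiffAt (x := (extChartAt (𝓡 n) a).symm u)
  have h3 := contMDiffAt_extChartAt_symm_of_mem hu
  refine ⟨(h1.comp u (h2.comp u h3)).contDiffAt, ?_⟩
  have k1 := (h1.mdifferentiableAt (by simp)).hasMFDerivAt
  have k2 := (h2.mdifferentiableAt (by simp)).hasMFDerivAt
  have k3 := (h3.mdifferentiableAt (by simp)).hasMFDerivAt
  have k : HasFDerivAt (fun u => extChartAt (𝓡 n) b (ψ ((extChartAt (𝓡 n) a).symm u)))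
      ((dChart n b (ψ ((extChartAt (𝓡 n) a).symm u))).comp
        ((dMap n ψ ((extChartAt (𝓡 n) a).symm u)).comp (dChartSymm a u))) u :=
    (k1.comp u (k2.comp u k3)).hasFDerivAt
  exact k.fderiv

variable [IsContMDiffRiemannianBundle (𝓡 n) ∞ (EuclideanSpace ℝ (Fin n))
      (fun x : X => TangentSpace (𝓡 n) x)]

/-- Local isometries preserve the geodesic equation; for the identity map this says that the
equation does not depend on the chart. -/
theorem EulerLagrangeAt.of_comp {ψ : X → X} (hψ : ContMDiff (𝓡 n) (𝓡 n) ∞ ψ)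
    (hinner : ∀ y v w, tangentInner n (ψ y) (dMap n ψ y v) (dMap n ψ y w) = tangentInner n y v w)
    {γ₁ γ₂ : ℝ → X} (hγ₁ : ContMDiffOn 𝓘(ℝ, ℝ) (𝓡 n) ∞ γ₁ (Icc 0 1)) {t₀ : ℝ}
    (ht₀ : t₀ ∈ Icc (0 : ℝ) 1) (hγ : ∀ t ∈ Icc (0 : ℝ) 1, γ₂ t = ψ (γ₁ t)) {a b : X}
    (ha : γ₁ t₀ ∈ (extChartAt (𝓡 n) a).source) (hb : γ₂ t₀ ∈ (extChartAt (𝓡 n) b).source)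
    (h : EulerLagrangeAt n b γ₂ t₀) : EulerLagrangeAt n a γ₁ t₀ := by
  have hca := (extChartAt (𝓡 n) a).left_inv ha
  have hta := (extChartAt (𝓡 n) a).map_source ha
  have hb' : ψ ((extChartAt (𝓡 n) a).symm (extChartAt (𝓡 n) a (γ₁ t₀))) ∈
      (extChartAt (𝓡 n) b).source := by rw [hca, ← hγ t₀ ht₀]; exact hb
  have hcont : ContinuousAt (fun u => ψ ((extChartAt (𝓡 n) a).symm u))
      (extChartAt (𝓡 n) a (γ₁ t₀)) :=
    ContinuousAt.comp (g := ψ) hψ.continuous.continuousAt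
      (contMDiffAt_extChartAt_symm_of_mem hta).continuousAt
  have hγc : ContinuousWithinAt γ₁ (Icc 0 1) t₀ := hγ₁.continuousOn t₀ ht₀
  have hmd : ∀ t ∈ Icc (0 : ℝ) 1, MDifferentiableWithinAt 𝓘(ℝ, ℝ) (𝓡 n) γ₁ (Icc 0 1) t :=
    fun t ht => (hγ₁ t ht).mdifferentiableWithinAt (by simp)
  refine euler_lagrange_pullback (G := metricCLM a) (G' := metricCLM b)
    (Φ := fun u => extChartAt (𝓡 n) b (ψ ((extChartAt (𝓡 n) a).symm u)))
    (c₂ := fun t => extChartAt (𝓡 n) b (γ₂ t)) ht₀ uniqueDiffOn_unitInterval ?_ ?_ ?_ ?_ ?_ ?_ h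
  · refine ((contDiffOn_metricCLM b).contDiffAt
      ((isOpen_extChartAt_target b).mem_nhds ?_)).differentiableAt (by simp)
    exact (extChartAt (𝓡 n) b).map_source hb'
  · exact fun v w => metricCLM_symm _ _ _ _
  · exact (fderiv_coordinate_map hψ hta hb').1.of_le two_le_smooth
  · filter_upwards [eventually_mem_extChartAt_source hγc ha, self_mem_nhdsWithin] with t h1 h2
    exact (hasDerivWithinAt_extChartAt_comp (hmd t h2) h1).differentiableWithinAt
  · filter_upwards [hcont.eventually ((isOpen_extChartAt_source b).mem_nhds hb'),
      (isOpen_extChartAt_target a).mem_nhds hta] with u h1 h2 v w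
    rw [(fderiv_coordinate_map hψ h2 h1).2]
    simp only [ContinuousLinearMap.comp_apply, metricCLM_apply]
    rw [coordMetric_extChartAt h1, hinner, coordMetric_eq]
  · filter_upwards [eventually_mem_extChartAt_source hγc ha, self_mem_nhdsWithin] with t h1 h2
    rw [(extChartAt (𝓡 n) a).left_inv h1, hγ t h2]

theorem EulerLagrangeAt.change_chart {γ : ℝ → X}
    (hγ : ContMDiffOn 𝓘(ℝ, ℝ) (𝓡 n) ∞ γ (Icc 0 1)) {t₀ : ℝ}
    (ht₀ : t₀ ∈ Icc (0 : ℝ) 1) {a b : X}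
    (ha : γ t₀ ∈ (extChartAt (𝓡 n) a).source) (hb : γ t₀ ∈ (extChartAt (𝓡 n) b).source)
    (h : EulerLagrangeAt n b γ t₀) : EulerLagrangeAt n a γ t₀ := by
  have hid : ∀ (y : X) v, dMap n (fun y : X => y) y v = v := fun y v => by
    have : mfderiv (𝓡 n) (𝓡 n) (fun y : X => y) y = ContinuousLinearMap.id ℝ (TangentSpace (𝓡 n) y) :=
      mfderiv_id
    exact DFunLike.congr_fun this v
  exact h.of_comp contMDiff_id (fun y v w => by erw [hid, hid]; rfl) hγ ht₀ (fun t _ => rfl) ha hb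

theorem IsGeodesic.eulerLagrangeAt_of_mem {γ : ℝ → X} (h : IsGeodesic (n := n) γ) {t₀ : ℝ}
    (ht₀ : t₀ ∈ Icc (0 : ℝ) 1) {a : X} (ha : γ t₀ ∈ (extChartAt (𝓡 n) a).source) :
    EulerLagrangeAt n a γ t₀ :=
  (h.eulerLagrangeAt ht₀).change_chart h.contMDiffOn ht₀ ha (mem_extChartAt_source (γ t₀))

end Velocity

/-! ### Hamilton's equations and conservation of energy -/

section Hamilton
open Filter Topology

theorem hasDerivWithinAt_fst {E F : Type*} [NormedAddCommGroup E] [NormedSpace ℝ E]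
    [NormedAddCommGroup F] [NormedSpace ℝ F] {z : ℝ → E × F} {z' : E × F} {S : Set ℝ} {t : ℝ}
    (h : HasDerivWithinAt z z' S t) : HasDerivWithinAt (fun s => (z s).1) z'.1 S t :=
  (ContinuousLinearMap.fst ℝ E F).hasFDerivAt.comp_hasDerivWithinAt t h

theorem hasDerivWithinAt_snd {E F : Type*} [NormedAddCommGroup E] [NormedSpace ℝ E]
    [NormedAddCommGroup F] [NormedSpace ℝ F] {z : ℝ → E × F} {z' : E × F} {S : Set ℝ} {t : ℝ}
    (h : HasDerivWithinAt z z' S t) : HasDerivWithinAt (fun s => (z s).2) z'.2 S t :=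
  (ContinuousLinearMap.snd ℝ E F).hasFDerivAt.comp_hasDerivWithinAt t h

/-- The energy is conserved along solutions of Hamilton's equations. -/
theorem hasDerivWithinAt_energy {V : Type*} [NormedAddCommGroup V] [NormedSpace ℝ V]
    {g : V → V →L[ℝ] V →L[ℝ] ℝ} {c v : ℝ → V} {p : ℝ → V →L[ℝ] ℝ} {p' : V →L[ℝ] ℝ} {k : V}
    {S : Set ℝ} {t₀ : ℝ} (ht₀ : t₀ ∈ S) (hS : UniqueDiffWithinAt ℝ S t₀)
    (hg : DifferentiableAt ℝ g (c t₀)) (hsymm : ∀ v w, g (c t₀) v w = g (c t₀) w v)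
    (hc : HasDerivWithinAt c (v t₀) S t₀) (hp : HasDerivWithinAt p p' S t₀)
    (hv : HasDerivWithinAt v k S t₀)
    (hp' : p' (v t₀) = (1 / 2 : ℝ) * fderiv ℝ g (c t₀) (v t₀) (v t₀) (v t₀))
    (hpg : ∀ᶠ t in 𝓝[S] t₀, p t = g (c t) (v t)) :
    HasDerivWithinAt (fun t => p t (v t)) 0 S t₀ := by
  have he1 := hp.clm_apply hv
  have he2 := ((hg.hasFDerivAt.comp_hasDerivWithinAt t₀ hc).clm_apply hv).clm_apply hv
  have e2 : (fun t => p t (v t)) =ᶠ[𝓝[S] t₀] fun t => (g ∘ c) t (v t) (v t) :=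
    hpg.mono fun t ht => by simp [ht]
  have he2' := he2.congr_of_eventuallyEq e2 (e2.self_of_nhdsWithin ht₀)
  have huniq := hS.eq_deriv _ he1 he2'
  refine he1.congr_deriv ?_
  have hp0 := hpg.self_of_nhdsWithin ht₀
  simp only [hp0, Function.comp_apply, _root_.add_apply, hp'] at huniq ⊢
  have hs := hsymm k (v t₀)
  linarith

/-- The Hamiltonian vector field of the kinetic energy of a metric `g` is smooth, since inversion of
linear maps is. -/
theorem contDiffAt_hamiltonian {V : Type*} [NormedAddCommGroup V] [NormedSpace ℝ V]
    [CompleteSpace V] {g : V → V →L[ℝ] V →L[ℝ] ℝ} {z : V × (V →L[ℝ] ℝ)}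
    (hg : ContDiffAt ℝ ∞ g z.1) {e : V ≃L[ℝ] (V →L[ℝ] ℝ)} (he : (e : V →L[ℝ] V →L[ℝ] ℝ) = g z.1) :
    ContDiffAt ℝ ∞ (fun z : V × (V →L[ℝ] ℝ) => ((g z.1).inverse z.2,
      (1 / 2 : ℝ) • ((fderiv ℝ g z.1).flip ((g z.1).inverse z.2)).flip
        ((g z.1).inverse z.2))) z := by
  have hinv : ContDiffAt ℝ ∞ (fun z : V × (V →L[ℝ] ℝ) => (g z.1).inverse z.2) z := by
    have h1 : ContDiffAt ℝ ∞ ContinuousLinearMap.inverse (g z.1) := by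
      rw [← he]; exact contDiffAt_map_inverse e
    exact ((h1.comp z.1 hg).comp z contDiffAt_fst).clm_apply contDiffAt_snd
  have hd : ContDiffAt ℝ ∞ (fun z : V × (V →L[ℝ] ℝ) => fderiv ℝ g z.1) z :=
    (hg.fderiv_right (m := ∞) (by simp)).comp z contDiffAt_fst
  have hflip1 : ContDiffAt ℝ ∞ (fun z : V × (V →L[ℝ] ℝ) => (fderiv ℝ g z.1).flip) z :=
    (ContinuousLinearMap.flipₗᵢ ℝ V V (V →L[ℝ] ℝ)).contDiff.contDiffAt.comp z hd
  have h2 := hflip1.clm_apply hinv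
  have h3 := ((ContinuousLinearMap.flipₗᵢ ℝ V V ℝ).contDiff.contDiffAt.comp z h2).clm_apply hinv
  exact hinv.prodMk (h3.const_smul (1 / 2 : ℝ))

variable {n : ℕ} {X : Type*} [EMetricSpace X] [ChartedSpace (EuclideanSpace ℝ (Fin n)) X]
  [IsManifold (𝓡 n) ∞ X] [RiemannianBundle (fun x : X => TangentSpace (𝓡 n) x)]

/-- The Hamiltonian vector field of the geodesic flow in the chart at `a`, on pairs of a position
and a momentum. -/
def hamiltonField (a : X) (z : EuclideanSpace ℝ (Fin n) × (EuclideanSpace ℝ (Fin n) →L[ℝ] ℝ)) :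
    EuclideanSpace ℝ (Fin n) × (EuclideanSpace ℝ (Fin n) →L[ℝ] ℝ) :=
  ((metricCLM a z.1).inverse z.2,
    (1 / 2 : ℝ) • ((fderiv ℝ (metricCLM a) z.1).flip ((metricCLM a z.1).inverse z.2)).flip
      ((metricCLM a z.1).inverse z.2))

/-- Position and momentum of a curve in the chart at `a`. -/
def phaseCurve (a : X) (γ : ℝ → X) (t : ℝ) :
    EuclideanSpace ℝ (Fin n) × (EuclideanSpace ℝ (Fin n) →L[ℝ] ℝ) :=
  (extChartAt (𝓡 n) a (γ t),
    metricCLM a (extChartAt (𝓡 n) a (γ t)) (dChart n a (γ t) (velocity n γ t)))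

theorem exists_equiv_metricCLM {a : X} {u : EuclideanSpace ℝ (Fin n)}
    (hu : u ∈ (extChartAt (𝓡 n) a).target) :
    ∃ e : EuclideanSpace ℝ (Fin n) ≃L[ℝ] (EuclideanSpace ℝ (Fin n) →L[ℝ] ℝ),
      (e : EuclideanSpace ℝ (Fin n) →L[ℝ] _) = metricCLM a u := by
  have hinj : Function.Injective (metricCLM a u).toLinearMap := by
    refine (injective_iff_map_eq_zero _).2 fun v hv => ?_
    by_contra h
    have h1 := metricCLM_self_pos hu h
    have h2 : metricCLM a u v = 0 := hv
    rw [h2] at h1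
    exact lt_irrefl _ h1
  have hdim : Module.finrank ℝ (EuclideanSpace ℝ (Fin n)) =
      Module.finrank ℝ (EuclideanSpace ℝ (Fin n) →L[ℝ] ℝ) :=
    (LinearEquiv.finrank_eq (InnerProductSpace.toDual ℝ (EuclideanSpace ℝ (Fin n))).toLinearEquiv)
  refine ⟨(LinearEquiv.ofInjectiveOfFinrankEq (metricCLM a u).toLinearMap hinj
    hdim).toContinuousLinearEquiv, ?_⟩
  ext v w
  rfl

theorem metricCLM_inverse_apply {a : X} {u : EuclideanSpace ℝ (Fin n)}
    (hu : u ∈ (extChartAt (𝓡 n) a).target) (v : EuclideanSpace ℝ (Fin n)) :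
    (metricCLM a u).inverse (metricCLM a u v) = v := by
  obtain ⟨e, he⟩ := exists_equiv_metricCLM hu
  rw [← he, ContinuousLinearMap.inverse_equiv]
  exact e.symm_apply_apply v

theorem metricCLM_apply_inverse {a : X} {u : EuclideanSpace ℝ (Fin n)}
    (hu : u ∈ (extChartAt (𝓡 n) a).target) (p : EuclideanSpace ℝ (Fin n) →L[ℝ] ℝ) :
    metricCLM a u ((metricCLM a u).inverse p) = p := by
  obtain ⟨e, he⟩ := exists_equiv_metricCLM hu
  rw [← he, ContinuousLinearMap.inverse_equiv]
  exact e.apply_symm_apply p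

variable [IsContMDiffRiemannianBundle (𝓡 n) ∞ (EuclideanSpace ℝ (Fin n))
      (fun x : X => TangentSpace (𝓡 n) x)]

theorem contDiffOn_hamiltonField (a : X) :
    ContDiffOn ℝ ∞ (hamiltonField (n := n) a) ((extChartAt (𝓡 n) a).target ×ˢ univ) := by
  have ht := isOpen_extChartAt_target (I := 𝓡 n) a
  intro z hz
  have hg : ContDiffAt ℝ ∞ (metricCLM a) z.1 :=
    (contDiffOn_metricCLM a).contDiffAt (ht.mem_nhds hz.1)
  obtain ⟨e, he⟩ := exists_equiv_metricCLM hz.1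
  exact (contDiffAt_hamiltonian hg he).contDiffWithinAt

theorem fderiv_metricCLM_apply₂ {a : X} {u : EuclideanSpace ℝ (Fin n)}
    (hu : u ∈ (extChartAt (𝓡 n) a).target) (v w : EuclideanSpace ℝ (Fin n)) :
    fderiv ℝ (fun u => metricCLM a u v v) u w = fderiv ℝ (metricCLM a) u w v v := by
  have hg : HasFDerivAt (metricCLM a) _ u := (((contDiffOn_metricCLM a).contDiffAt
    ((isOpen_extChartAt_target a).mem_nhds hu)).differentiableAt (by simp)).hasFDerivAt
  have := (hg.clm_apply (hasFDerivAt_const v u)).clm_apply (hasFDerivAt_const v u)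
  rw [this.fderiv]
  simp

theorem IsGeodesic.mdifferentiableWithinAt {γ : ℝ → X} (h : IsGeodesic (n := n) γ) {t : ℝ}
    (ht : t ∈ Icc (0 : ℝ) 1) : MDifferentiableWithinAt 𝓘(ℝ, ℝ) (𝓡 n) γ (Icc 0 1) t :=
  (h.contMDiffOn t ht).mdifferentiableWithinAt (by simp)

theorem IsGeodesic.eventually_source {γ : ℝ → X} (h : IsGeodesic (n := n) γ) {t : ℝ}
    (ht : t ∈ Icc (0 : ℝ) 1) {a : X} (ha : γ t ∈ (extChartAt (𝓡 n) a).source) :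
    ∀ᶠ s in 𝓝[Icc 0 1] t, γ s ∈ (extChartAt (𝓡 n) a).source :=
  eventually_mem_extChartAt_source (h.contMDiffOn.continuousOn t ht) ha

/-- Geodesics are the integral curves of the Hamiltonian vector field. -/
theorem IsGeodesic.hasDerivWithinAt_phaseCurve {γ : ℝ → X} (h : IsGeodesic (n := n) γ) {t : ℝ}
    (ht : t ∈ Icc (0 : ℝ) 1) {a : X} (ha : γ t ∈ (extChartAt (𝓡 n) a).source) :
    HasDerivWithinAt (phaseCurve (n := n) a γ) (hamiltonField (n := n) a (phaseCurve a γ t)) (Icc 0 1) t := by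
  have hta := (extChartAt (𝓡 n) a).map_source ha
  have hinv := metricCLM_inverse_apply hta (dChart n a (γ t) (velocity n γ t))
  have hev : ∀ᶠ s in 𝓝[Icc 0 1] t, derivWithin (fun s => extChartAt (𝓡 n) a (γ s)) (Icc 0 1) s =
      dChart n a (γ s) (velocity n γ s) := by
    filter_upwards [h.eventually_source ht ha, self_mem_nhdsWithin] with s h1 h2
    exact derivWithin_extChartAt_comp h2 (h.mdifferentiableWithinAt h2) h1
  have h1 : HasDerivWithinAt (fun s => extChartAt (𝓡 n) a (γ s))
      (hamiltonField (n := n) a (phaseCurve a γ t)).1 (Icc 0 1) t := by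
    have : (hamiltonField (n := n) a (phaseCurve a γ t)).1 = dChart n a (γ t) (velocity n γ t) := hinv
    rw [this]
    exact hasDerivWithinAt_extChartAt_comp (h.mdifferentiableWithinAt ht) ha
  refine h1.prodMk (hasDerivWithinAt_clm_of_apply fun w => ?_)
  have h2 := h.eulerLagrangeAt_of_mem ht ha w
  have h3 : (fun s => metricCLM a (extChartAt (𝓡 n) a (γ s)) (dChart n a (γ s) (velocity n γ s)) w)
      =ᶠ[𝓝[Icc 0 1] t] fun s => metricCLM a (extChartAt (𝓡 n) a (γ s))
        (derivWithin (fun s => extChartAt (𝓡 n) a (γ s)) (Icc 0 1) s) w :=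
    hev.mono fun s hs => by simp only [hs]
  refine (h2.congr_of_eventuallyEq h3 (h3.self_of_nhdsWithin ht)).congr_deriv ?_
  rw [hev.self_of_nhdsWithin ht, fderiv_metricCLM_apply₂ hta]
  change _ = (1 / 2 : ℝ) * fderiv ℝ (metricCLM a) (extChartAt (𝓡 n) a (γ t)) w
    ((metricCLM a (extChartAt (𝓡 n) a (γ t))).inverse (metricCLM a (extChartAt (𝓡 n) a (γ t))
      (dChart n a (γ t) (velocity n γ t)))) ((metricCLM a (extChartAt (𝓡 n) a (γ t))).inverse
      (metricCLM a (extChartAt (𝓡 n) a (γ t)) (dChart n a (γ t) (velocity n γ t))))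
  rw [hinv]

theorem metricCLM_extChartAt {a y : X} (hy : y ∈ (extChartAt (𝓡 n) a).source)
    (v : EuclideanSpace ℝ (Fin n)) :
    metricCLM a (extChartAt (𝓡 n) a y) (dChart n a y v) (dChart n a y v) = tangentInner n y v v :=
  coordMetric_extChartAt hy v v

/-- Geodesics have constant speed. -/
theorem IsGeodesic.tangentInner_velocity {γ : ℝ → X} (h : IsGeodesic (n := n) γ) {s t : ℝ}
    (hs : s ∈ Icc (0 : ℝ) 1) (ht : t ∈ Icc (0 : ℝ) 1) :
    tangentInner n (γ s) (velocity n γ s) (velocity n γ s) =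
      tangentInner n (γ t) (velocity n γ t) (velocity n γ t) := by
  -- the squared speed is twice the energy in any chart, so its derivative vanishes
  have key : ∀ t₀ ∈ Icc (0 : ℝ) 1, HasDerivWithinAt
      (fun t => tangentInner n (γ t) (velocity n γ t) (velocity n γ t)) 0 (Icc 0 1) t₀ := by
    intro t₀ ht₀
    set a := γ t₀
    have ha : γ t₀ ∈ (extChartAt (𝓡 n) a).source := mem_extChartAt_source a
    have hta := (extChartAt (𝓡 n) a).map_source ha
    have hz := h.hasDerivWithinAt_phaseCurve ht₀ ha
    set z₀ := phaseCurve (n := n) a γ t₀ with hz₀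
    set c' := dChart n a (γ t₀) (velocity n γ t₀) with hc'
    have hinv : (metricCLM a z₀.1).inverse z₀.2 = c' := metricCLM_inverse_apply hta _
    have hH : HasFDerivAt (hamiltonField (n := n) a) (fderiv ℝ (hamiltonField (n := n) a) z₀) z₀ :=
      (((contDiffOn_hamiltonField a).contDiffAt (((isOpen_extChartAt_target a).prod
        isOpen_univ).mem_nhds ⟨hta, mem_univ _⟩)).differentiableAt (by simp)).hasFDerivAt
    have hz1 : HasDerivWithinAt (fun t => (phaseCurve (n := n) a γ t).1) c' (Icc 0 1) t₀ := by
      rw [← hinv]; exact (hasDerivWithinAt_fst hz)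
    have hz2 : HasDerivWithinAt (fun t => (phaseCurve (n := n) a γ t).2)
      (hamiltonField (n := n) a z₀).2 (Icc 0 1) t₀ := hasDerivWithinAt_snd hz
    have hz3 := hasDerivWithinAt_fst (hH.comp_hasDerivWithinAt t₀ hz)
    have hev : ∀ᶠ s in 𝓝[Icc 0 1] t₀, (hamiltonField (n := n) a (phaseCurve (n := n) a γ s)).1 =
        dChart n a (γ s) (velocity n γ s) := by
      filter_upwards [h.eventually_source ht₀ ha] with s h1
      exact metricCLM_inverse_apply ((extChartAt (𝓡 n) a).map_source h1) _
    have hg : DifferentiableAt ℝ (metricCLM a) z₀.1 :=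
      ((contDiffOn_metricCLM a).contDiffAt
        ((isOpen_extChartAt_target a).mem_nhds hta)).differentiableAt (by simp)
    have hv0 : (hamiltonField (n := n) a (phaseCurve (n := n) a γ t₀)).1 = c' := hinv
    have hE := hasDerivWithinAt_energy (g := metricCLM a)
      (c := fun t => (phaseCurve (n := n) a γ t).1) (p := fun t => (phaseCurve (n := n) a γ t).2)
      (v := fun t => (hamiltonField (n := n) a (phaseCurve (n := n) a γ t)).1) ht₀
      (uniqueDiffOn_unitInterval t₀ ht₀) hg (metricCLM_symm a _) (by rw [hv0]; exact hz1) hz2 hz3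
      rfl (hev.mono fun s hs => by rw [hs]; rfl)
    have e1 : (fun t => tangentInner n (γ t) (velocity n γ t) (velocity n γ t)) =ᶠ[𝓝[Icc 0 1] t₀]
        fun t => (phaseCurve (n := n) a γ t).2
          (hamiltonField (n := n) a (phaseCurve (n := n) a γ t)).1 := by
      filter_upwards [hev, h.eventually_source ht₀ ha] with s h1 h2
      rw [h1]
      exact (metricCLM_extChartAt h2 _).symm
    exact hE.congr_of_eventuallyEq e1 (e1.self_of_nhdsWithin ht₀)
  have hd : DifferentiableOn ℝ (fun t => tangentInner n (γ t) (velocity n γ t) (velocity n γ t))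
      (Icc 0 1) := fun t ht => (key t ht).differentiableWithinAt
  exact (convex_Icc (0 : ℝ) 1).is_const_of_fderivWithin_eq_zero (𝕜 := ℝ) hd (fun t ht => by
    ext
    rw [fderivWithin_derivWithin, (key t ht).derivWithin (uniqueDiffOn_unitInterval t ht)]
    rfl) hs ht

end Hamilton

/-! ### Speed and length of geodesics -/

section Length
open Filter Topology MeasureTheory

variable {n : ℕ} {X : Type*} [EMetricSpace X] [ChartedSpace (EuclideanSpace ℝ (Fin n)) X]
  [IsManifold (𝓡 n) ∞ X] [RiemannianBundle (fun x : X => TangentSpace (𝓡 n) x)]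

/-- The speed of a curve, as an extended nonnegative real. -/
def espeed (n : ℕ) {X : Type*} [EMetricSpace X] [ChartedSpace (EuclideanSpace ℝ (Fin n)) X]
    [IsManifold (𝓡 n) ∞ X] [RiemannianBundle (fun x : X => TangentSpace (𝓡 n) x)]
    (γ : ℝ → X) (t : ℝ) : ENNReal :=
  ENNReal.ofReal (Real.sqrt (tangentInner n (γ t) (velocity n γ t) (velocity n γ t)))

theorem enorm_tangent (y : X) (v : TangentSpace (𝓡 n) y) :
    ‖v‖ₑ = ENNReal.ofReal (Real.sqrt (tangentInner n y v v)) := by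
  have h : Real.sqrt (tangentInner n y v v) = ‖v‖ := by
    have h1 : tangentInner n y v v = ‖v‖ ^ 2 := tangentInner_self_eq_norm y v
    rw [h1, Real.sqrt_sq (norm_nonneg _)]
  rw [h, ofReal_norm]

theorem pathELength_eq_lintegral_espeed (γ : ℝ → X) {s t : ℝ} (hs : 0 ≤ s) (ht : t ≤ 1) :
    pathELength (𝓡 n) γ s t = ∫⁻ u in Ioo s t, espeed n γ u := by
  rw [pathELength_eq_lintegral_mfderiv_Ioo]
  refine setLIntegral_congr_fun measurableSet_Ioo fun u hu => ?_
  have : Icc (0 : ℝ) 1 ∈ 𝓝 u := Icc_mem_nhds (hs.trans_lt hu.1) (hu.2.trans_le ht)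
  have h1 : ‖mfderiv 𝓘(ℝ, ℝ) (𝓡 n) γ u (1 : ℝ)‖ₑ = espeed n γ u := by
    rw [← mfderivWithin_of_mem_nhds this]
    exact enorm_tangent _ _
  exact h1

theorem pathELength_comp_of_isometric {ψ : X → X} (hψ : ContMDiff (𝓡 n) (𝓡 n) ∞ ψ)
    (hinner : ∀ y v w, tangentInner n (ψ y) (dMap n ψ y v) (dMap n ψ y w) = tangentInner n y v w)
    {γ : ℝ → X} (hγ : MDifferentiableOn 𝓘(ℝ, ℝ) (𝓡 n) γ (Icc 0 1)) :
    pathELength (𝓡 n) (fun t => ψ (γ t)) 0 1 = pathELength (𝓡 n) γ 0 1 := by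
  rw [pathELength_eq_lintegral_espeed _ le_rfl le_rfl,
    pathELength_eq_lintegral_espeed _ le_rfl le_rfl]
  refine setLIntegral_congr_fun measurableSet_Ioo fun u hu => ?_
  have hu' := Ioo_subset_Icc_self hu
  have h1 : velocity n (fun t => ψ (γ t)) u = dMap n ψ (γ u) (velocity n γ u) := by
    have := mfderiv_comp_mfderivWithin (I := 𝓘(ℝ, ℝ)) (I' := 𝓡 n) (I'' := 𝓡 n) u (g := ψ) (f := γ)
      (s := Icc 0 1) (hψ.mdifferentiableAt (by simp)) (hγ u hu')
      (uniqueDiffOn_unitInterval u hu').uniqueMDiffWithinAt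
    exact DFunLike.congr_fun this (1 : ℝ)
  simp only [espeed, h1, hinner]

theorem edist_le_of_isometric [IsRiemannianManifold (𝓡 n) X] {ψ : X → X}
    (hψ : ContMDiff (𝓡 n) (𝓡 n) ∞ ψ)
    (hinner : ∀ y v w, tangentInner n (ψ y) (dMap n ψ y v) (dMap n ψ y w) = tangentInner n y v w)
    (x y : X) : edist (ψ x) (ψ y) ≤ edist x y := by
  rw [IsRiemannianManifold.out (I := 𝓡 n) x y, IsRiemannianManifold.out (I := 𝓡 n) (ψ x)]
  refine le_of_forall_gt fun r hr => ?_
  obtain ⟨γ, h0, h1, hγ, hl⟩ := exists_lt_of_riemannianEDist_lt hr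
  refine lt_of_le_of_lt ?_ hl
  rw [← pathELength_comp_of_isometric hψ hinner (hγ.mdifferentiableOn (by simp))]
  refine riemannianEDist_le_pathELength (γ := fun t => ψ (γ t)) ?_ (by rw [h0]) (by rw [h1])
    zero_le_one
  exact (hψ.of_le (by exact_mod_cast le_top)).comp_contMDiffOn hγ

variable [IsContMDiffRiemannianBundle (𝓡 n) ∞ (EuclideanSpace ℝ (Fin n))
      (fun x : X => TangentSpace (𝓡 n) x)]

theorem IsGeodesic.espeed_eq {γ : ℝ → X} (h : IsGeodesic (n := n) γ) {s t : ℝ}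
    (hs : s ∈ Icc (0 : ℝ) 1) (ht : t ∈ Icc (0 : ℝ) 1) : espeed n γ s = espeed n γ t := by
  rw [espeed, espeed, h.tangentInner_velocity hs ht]

theorem IsGeodesic.pathELength_eq {γ : ℝ → X} (h : IsGeodesic (n := n) γ) {s t u : ℝ}
    (hs : 0 ≤ s) (ht : t ≤ 1) (hu : u ∈ Icc (0 : ℝ) 1) :
    pathELength (𝓡 n) γ s t = espeed n γ u * ENNReal.ofReal (t - s) := by
  rw [pathELength_eq_lintegral_espeed γ hs ht]
  have : ∫⁻ u in Ioo s t, espeed n γ u = ∫⁻ _ in Ioo s t, espeed n γ u :=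
    setLIntegral_congr_fun measurableSet_Ioo fun v hv =>
      h.espeed_eq ⟨hs.trans hv.1.le, hv.2.le.trans ht⟩ hu
  rw [this, setLIntegral_const, Real.volume_Ioo]

/-- The speed of a geodesic segment is constant, and therefore equal to its length. -/
theorem IsGeodesicSegment.espeed_eq {γ : ℝ → X} {x y : X}
    (h : IsGeodesicSegment (n := n) γ x y) {t : ℝ} (ht : t ∈ Icc (0 : ℝ) 1) :
    espeed n γ t = edist x y := by
  have := h.isGeodesic.pathELength_eq le_rfl le_rfl ht
  rw [h.length] at this
  rw [this]
  simp

theorem IsGeodesic.edist_le [IsRiemannianManifold (𝓡 n) X] {γ : ℝ → X}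
    (h : IsGeodesic (n := n) γ) {s t u : ℝ}
    (hs : s ∈ Icc (0 : ℝ) 1) (ht : t ∈ Icc (0 : ℝ) 1) (hu : u ∈ Icc (0 : ℝ) 1) :
    edist (γ s) (γ t) ≤ espeed n γ u * ENNReal.ofReal |t - s| := by
  wlog hst : s ≤ t generalizing s t
  · have := this ht hs (not_le.1 hst).le
    rwa [edist_comm, abs_sub_comm]
  rw [abs_of_nonneg (sub_nonneg.2 hst), ← h.pathELength_eq hs.1 ht.2 hu,
    IsRiemannianManifold.out (I := 𝓡 n)]
  refine riemannianEDist_le_pathELength ?_ rfl rfl hst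
  exact (h.contMDiffOn.of_le (by exact_mod_cast le_top)).mono (Icc_subset_Icc hs.1 ht.2)

/-- Isometric diffeomorphisms map geodesic segments to geodesic segments. -/
theorem IsGeodesicSegment.map [IsRiemannianManifold (𝓡 n) X] {ψ ψ' : X → X}
    (hψ : ContMDiff (𝓡 n) (𝓡 n) ∞ ψ)
    (hinner : ∀ y v w, tangentInner n (ψ y) (dMap n ψ y v) (dMap n ψ y w) = tangentInner n y v w)
    (hψ' : ContMDiff (𝓡 n) (𝓡 n) ∞ ψ')
    (hinner' : ∀ y v w,
      tangentInner n (ψ' y) (dMap n ψ' y v) (dMap n ψ' y w) = tangentInner n y v w)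
    (hinv : ∀ x, ψ' (ψ x) = x) {γ : ℝ → X} {x y : X} (h : IsGeodesicSegment (n := n) γ x y) :
    IsGeodesicSegment (n := n) (fun t => ψ (γ t)) (ψ x) (ψ y) := by
  have hs : ContMDiffOn 𝓘(ℝ, ℝ) (𝓡 n) ∞ (fun t => ψ (γ t)) (Icc 0 1) :=
    hψ.comp_contMDiffOn h.isGeodesic.contMDiffOn
  refine ⟨isGeodesic_of_eulerLagrangeAt hs fun t ht => ?_, by rw [h.source], by rw [h.target], ?_⟩
  · exact (h.isGeodesic.eulerLagrangeAt ht).of_comp hψ' hinner' hs ht (fun s _ => (hinv _).symm)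
      (mem_extChartAt_source _) (mem_extChartAt_source _)
  · rw [pathELength_comp_of_isometric hψ hinner
      (h.isGeodesic.contMDiffOn.mdifferentiableOn (by simp)), h.length]
    refine le_antisymm ?_ (edist_le_of_isometric hψ hinner x y)
    have := edist_le_of_isometric hψ' hinner' (ψ x) (ψ y)
    rwa [hinv, hinv] at this

end Length

/-! ### Limits of geodesics are geodesics -/

section GeodesicLimit
open Filter Topology

/-- Solutions of a smooth autonomous differential equation are smooth. -/
theorem contDiffOn_of_hasDerivWithinAt {W : Type*} [NormedAddCommGroup W] [NormedSpace ℝ W]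
    {Z : W → W} {O : Set W} (hZ : ContDiffOn ℝ ∞ Z O) {S : Set ℝ} (hS : UniqueDiffOn ℝ S)
    {y : ℝ → W} (hy : ∀ t ∈ S, y t ∈ O ∧ HasDerivWithinAt y (Z (y t)) S t) :
    ContDiffOn ℝ ∞ y S := by
  have hd : DifferentiableOn ℝ y S := fun t ht => (hy t ht).2.differentiableWithinAt
  refine contDiffOn_infty.2 fun k => ?_
  induction k with
  | zero => exact contDiffOn_zero.2 hd.continuousOn
  | succ k ih =>
    have h := (contDiffOn_succ_iff_derivWithin (n := k) hS).2 ⟨hd, by simp, ?_⟩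
    · exact_mod_cast h
    · exact ((hZ.of_le (by exact_mod_cast le_top)).comp ih fun t ht => (hy t ht).1).congr
        fun t ht => (hy t ht).2.derivWithin (hS t ht)

variable {n : ℕ} {X : Type*} [EMetricSpace X] [ChartedSpace (EuclideanSpace ℝ (Fin n)) X]
  [IsManifold (𝓡 n) ∞ X] [RiemannianBundle (fun x : X => TangentSpace (𝓡 n) x)]
  [IsContMDiffRiemannianBundle (𝓡 n) ∞ (EuclideanSpace ℝ (Fin n))
      (fun x : X => TangentSpace (𝓡 n) x)]

/-- Curves that solve Hamilton's equations near `t₀` are geodesics near `t₀`. -/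
theorem geodesic_of_hamilton {a : X} {γ : ℝ → X} {t₀ : ℝ} {S : Set ℝ}
    (hS : UniqueDiffOn ℝ S) (hSI : S ⊆ Icc 0 1) (hSn : S ∈ 𝓝[Icc 0 1] t₀)
    (ht₀ : t₀ ∈ S) {y : ℝ → EuclideanSpace ℝ (Fin n) × (EuclideanSpace ℝ (Fin n) →L[ℝ] ℝ)}
    (hy : ∀ t ∈ S, (y t).1 ∈ (extChartAt (𝓡 n) a).target ∧
      HasDerivWithinAt y (hamiltonField a (y t)) S t)
    (hγ : ∀ t ∈ S, γ t = (extChartAt (𝓡 n) a).symm (y t).1) :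
    ContMDiffWithinAt 𝓘(ℝ, ℝ) (𝓡 n) ∞ γ (Icc 0 1) t₀ ∧
    EulerLagrangeAt n a γ t₀ ∧ phaseCurve a γ t₀ = y t₀ := by
  have hchart : ∀ t ∈ S, extChartAt (𝓡 n) a (γ t) = (y t).1 := fun t ht => by
    rw [hγ t ht, (extChartAt (𝓡 n) a).right_inv (hy t ht).1]
  have hsrc : ∀ t ∈ S, γ t ∈ (extChartAt (𝓡 n) a).source := fun t ht => by
    rw [hγ t ht]; exact mem_source_of_mem_target (hy t ht).1
  have hsmooth : ContDiffOn ℝ ∞ y S := contDiffOn_of_hasDerivWithinAt (contDiffOn_hamiltonField a) hS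
    fun t ht => ⟨⟨(hy t ht).1, mem_univ _⟩, (hy t ht).2⟩
  have hγs : ContMDiffWithinAt 𝓘(ℝ, ℝ) (𝓡 n) ∞ γ (Icc 0 1) t₀ := by
    have h1 : ContMDiffWithinAt 𝓘(ℝ, ℝ) 𝓘(ℝ, EuclideanSpace ℝ (Fin n)) ∞ (fun t => (y t).1) S t₀ :=
      (contDiff_fst.comp_contDiffOn hsmooth t₀ ht₀).contMDiffWithinAt
    have h2 := (contMDiffAt_extChartAt_symm_of_mem (hy t₀ ht₀).1).comp_contMDiffWithinAt t₀ h1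
    exact (h2.congr (fun t ht => hγ t ht) (hγ t₀ ht₀)).mono_of_mem_nhdsWithin hSn
  have hcd : ∀ᶠ t in 𝓝[Icc 0 1] t₀, t ∈ S ∧ derivWithin (fun s => extChartAt (𝓡 n) a (γ s))
      (Icc 0 1) t = (hamiltonField a (y t)).1 := by
    filter_upwards [eventually_eventually_nhdsWithin.2 hSn, hSn] with t h1 h2
    have h3 := (hasDerivWithinAt_fst (hy t h2).2).mono_of_mem_nhdsWithin h1
    have h4 : (fun s => extChartAt (𝓡 n) a (γ s)) =ᶠ[𝓝[Icc 0 1] t] fun s => (y s).1 :=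
      h1.mono fun s hs => hchart s hs
    exact ⟨h2, (h3.congr_of_eventuallyEq h4 (hchart t h2)).derivWithin
      (uniqueDiffOn_unitInterval t (hSI h2))⟩
  have hcd₀ := (hcd.self_of_nhdsWithin (hSI ht₀)).2
  refine ⟨hγs, fun w => ?_, ?_⟩
  · have h1 := ((hasDerivWithinAt_snd (hy t₀ ht₀).2).clm_apply
      (hasDerivWithinAt_const t₀ S w)).mono_of_mem_nhdsWithin hSn
    have h2 : (fun t => metricCLM a (extChartAt (𝓡 n) a (γ t))
        (derivWithin (fun s => extChartAt (𝓡 n) a (γ s)) (Icc 0 1) t) w) =ᶠ[𝓝[Icc 0 1] t₀]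
        fun t => (y t).2 w := by
      filter_upwards [hcd] with t ht
      rw [ht.2, hchart t ht.1]
      exact DFunLike.congr_fun (metricCLM_apply_inverse (hy t ht.1).1 (y t).2) w
    refine (h1.congr_of_eventuallyEq h2 (h2.self_of_nhdsWithin (hSI ht₀))).congr_deriv ?_
    rw [hcd₀, hchart t₀ ht₀, fderiv_metricCLM_apply₂ (hy t₀ ht₀).1]
    simp only [map_zero, add_zero]
    rfl
  · have h1 := derivWithin_extChartAt_comp (hSI ht₀) (hγs.mdifferentiableWithinAt (by simp))
      (hsrc t₀ ht₀)
    rw [phaseCurve, ← h1, hcd₀, hchart t₀ ht₀]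
    exact Prod.ext rfl (metricCLM_apply_inverse (hy t₀ ht₀).1 (y t₀).2)

/-- The metric in a chart is uniformly positive definite on compact sets. -/
theorem exists_coercive_metricCLM {a : X} {K : Set (EuclideanSpace ℝ (Fin n))} (hK : IsCompact K)
    (hKt : K ⊆ (extChartAt (𝓡 n) a).target) :
    ∃ m > 0, ∀ u ∈ K, ∀ v, m * ‖v‖ ^ 2 ≤ metricCLM a u v v := by
  have hcont : ContinuousOn (fun q : EuclideanSpace ℝ (Fin n) × EuclideanSpace ℝ (Fin n) =>
      metricCLM a q.1 q.2 q.2) (K ×ˢ Metric.sphere 0 1) := by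
    have h1 : ContinuousOn (fun q : EuclideanSpace ℝ (Fin n) × EuclideanSpace ℝ (Fin n) =>
        metricCLM a q.1) (K ×ˢ Metric.sphere 0 1) :=
      (contDiffOn_metricCLM a).continuousOn.comp continuousOn_fst fun q hq => hKt hq.1
    exact (h1.clm_apply continuousOn_snd).clm_apply continuousOn_snd
  obtain ⟨m, hm, h⟩ := (hK.prod (isCompact_sphere 0 1)).exists_forall_le' hcont (a := 0)
    fun q hq => metricCLM_self_pos (hKt hq.1) (ne_zero_of_mem_unit_sphere ⟨q.2, hq.2⟩)
  refine ⟨m, hm, fun u hu v => ?_⟩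
  rcases eq_or_ne v 0 with rfl | hv
  · simp
  have hv' : ‖v‖ ≠ 0 := norm_ne_zero_iff.2 hv
  have h1 := h (u, ‖v‖⁻¹ • v) ⟨hu, by simp [norm_smul, hv']⟩
  simp only [map_smul, _root_.smul_apply, smul_eq_mul] at h1
  calc m * ‖v‖ ^ 2 ≤ (‖v‖⁻¹ * (‖v‖⁻¹ * metricCLM a u v v)) * ‖v‖ ^ 2 := by gcongr
    _ = metricCLM a u v v := by field_simp

/-- In a chart, the phase curves of geodesics of bounded speed stay in a compact convex set. -/
theorem exists_compact_phase {a x : X} (hx : x ∈ (extChartAt (𝓡 n) a).source) (C : ℝ) : ∃ ρ > 0,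
    Metric.closedBall (extChartAt (𝓡 n) a x) ρ ⊆ (extChartAt (𝓡 n) a).target ∧
    ∃ K : Set (EuclideanSpace ℝ (Fin n) × (EuclideanSpace ℝ (Fin n) →L[ℝ] ℝ)),
      IsCompact K ∧ Convex ℝ K ∧ K ⊆ (extChartAt (𝓡 n) a).target ×ˢ univ ∧
      ∀ u ∈ Metric.closedBall (extChartAt (𝓡 n) a x) ρ, ∀ v, metricCLM a u v v ≤ C →
        (u, metricCLM a u v) ∈ K := by
  obtain ⟨ρ, hρ, hball⟩ := Metric.nhds_basis_closedBall.mem_iff.1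
    ((isOpen_extChartAt_target (I := 𝓡 n) a).mem_nhds ((extChartAt (𝓡 n) a).map_source hx))
  have hc : IsCompact (Metric.closedBall (extChartAt (𝓡 n) a x) ρ) := isCompact_closedBall _ _
  obtain ⟨m, hm, hcoer⟩ := exists_coercive_metricCLM hc hball
  obtain ⟨B, hB⟩ := hc.exists_bound_of_continuousOn ((contDiffOn_metricCLM a).continuousOn.mono hball)
  refine ⟨ρ, hρ, hball, Metric.closedBall (extChartAt (𝓡 n) a x) ρ ×ˢ
    Metric.closedBall 0 (B * Real.sqrt (C / m)), hc.prod (isCompact_closedBall _ _),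
    (convex_closedBall _ _).prod (convex_closedBall _ _), fun q hq => ⟨hball hq.1, mem_univ _⟩,
    fun u hu v hv => ⟨hu, ?_⟩⟩
  rw [mem_closedBall_zero_iff]
  have h1 : ‖v‖ ≤ Real.sqrt (C / m) := by
    refine Real.le_sqrt_of_sq_le ?_
    rw [le_div_iff₀ hm, mul_comm]
    exact (hcoer u hu v).trans hv
  exact ((metricCLM a u).le_opNorm v).trans (mul_le_mul (hB u hu) h1 (norm_nonneg _)
    ((norm_nonneg _).trans (hB u hu)))

theorem exists_lipschitz_hamiltonField {a : X}
    {K : Set (EuclideanSpace ℝ (Fin n) × (EuclideanSpace ℝ (Fin n) →L[ℝ] ℝ))}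
    (hK : IsCompact K) (hKt : K ⊆ (extChartAt (𝓡 n) a).target ×ˢ univ) :
    ∃ Λ : ℝ, 0 ≤ Λ ∧ ∀ u ∈ K, ∀ w ∈ K, ‖hamiltonField a u - hamiltonField a w‖ ≤ Λ * ‖u - w‖ := by
  have hloc : LocallyLipschitzOn K (hamiltonField (n := n) a) := by
    intro z hz
    have h1 : ContDiffAt ℝ ∞ (hamiltonField (n := n) a) z :=
      (contDiffOn_hamiltonField a).contDiffAt (((isOpen_extChartAt_target a).prod
        isOpen_univ).mem_nhds (hKt hz))
    obtain ⟨Λ, t, ht, hΛ⟩ := (h1.of_le (m := 1) (by exact_mod_cast le_top)).exists_lipschitzOnWith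
    exact ⟨Λ, t, mem_nhdsWithin_of_mem_nhds ht, hΛ⟩
  obtain ⟨Λ, hΛ⟩ := hloc.exists_lipschitzOnWith_of_compact hK
  refine ⟨Λ, Λ.2, fun u hu w hw => ?_⟩
  rw [← dist_eq_norm, ← dist_eq_norm]
  exact hΛ.dist_le_mul u hu w hw

/-- Limits of geodesics of bounded speed along an ultrafilter are geodesics, and positions and
momenta converge. -/
theorem geodesic_limit [IsRiemannianManifold (𝓡 n) X] {ι : Type*} (l : Ultrafilter ι)
    {γ : ι → ℝ → X} {γ' : ℝ → X} {C : NNReal}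
    (hgeo : ∀ᶠ i in l, IsGeodesic (n := n) (γ i) ∧ espeed n (γ i) 0 ≤ C)
    (hlim : ∀ t ∈ Icc (0 : ℝ) 1, Tendsto (fun i => γ i t) l (𝓝 (γ' t))) {t₀ : ℝ}
    (ht₀ : t₀ ∈ Icc (0 : ℝ) 1) {a : X} (ha : γ' t₀ ∈ (extChartAt (𝓡 n) a).source) :
    ContMDiffWithinAt 𝓘(ℝ, ℝ) (𝓡 n) ∞ γ' (Icc 0 1) t₀ ∧ EulerLagrangeAt n a γ' t₀ ∧
    ∀ τ : ι → ℝ, (∀ᶠ i in l, τ i ∈ Icc (0 : ℝ) 1) → Tendsto τ l (𝓝 t₀) →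
      Tendsto (fun i => phaseCurve (n := n) a (γ i) (τ i)) l
        (𝓝 (phaseCurve a γ' t₀)) := by
  obtain ⟨ρ, hρ, hball, K, hKc, hKconv, hKt, hK⟩ := exists_compact_phase (n := n) ha ((C : ℝ) ^ 2)
  obtain ⟨Λ, hΛ0, hΛ⟩ := exists_lipschitz_hamiltonField hKc hKt
  obtain ⟨M, hM⟩ := hKc.exists_bound_of_continuousOn
    ((contDiffOn_hamiltonField (n := n) a).continuousOn.mono hKt)
  -- near `t₀` all the curves stay in the chart
  obtain ⟨ε, hε, hεball⟩ : ∃ ε > 0, ∀ y : X, edist y (γ' t₀) < ε → y ∈ (extChartAt (𝓡 n) a).source ∧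
      extChartAt (𝓡 n) a y ∈ Metric.closedBall (extChartAt (𝓡 n) a (γ' t₀)) ρ := by
    have h1 : ∀ᶠ y in 𝓝 (γ' t₀), y ∈ (extChartAt (𝓡 n) a).source ∧
        extChartAt (𝓡 n) a y ∈ Metric.closedBall (extChartAt (𝓡 n) a (γ' t₀)) ρ :=
      Filter.Eventually.and (extChartAt_source_mem_nhds' (I := 𝓡 n) ha) ((continuousAt_extChartAt' (I := 𝓡 n) ha).eventually
        (Metric.closedBall_mem_nhds _ hρ))
    obtain ⟨ε, hε, h2⟩ := Metric.nhds_basis_eball.eventually_iff.1 h1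
    exact ⟨ε, hε, fun y hy => h2 hy⟩
  obtain ⟨δ, hδ, hδε⟩ : ∃ δ : ℝ, 0 < δ ∧ (C : ENNReal) * ENNReal.ofReal δ ≤ ε / 2 := by
    obtain ⟨e, he0, he⟩ := ENNReal.lt_iff_exists_nnreal_btwn.1 (ENNReal.half_pos hε.ne')
    have he0' : (0 : ℝ) < e := by exact_mod_cast he0
    have hC1 : (0 : ℝ) < C + 1 := by positivity
    refine ⟨e / (C + 1), div_pos he0' hC1, le_trans ?_ he.le⟩
    rw [← ENNReal.ofReal_coe_nnreal, ← ENNReal.ofReal_coe_nnreal,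
      ← ENNReal.ofReal_mul (NNReal.coe_nonneg C)]
    refine ENNReal.ofReal_le_ofReal ?_
    rw [mul_div_assoc', div_le_iff₀ hC1]
    nlinarith
  -- on the interval `S` the phase curves stay in the compact set `K`, hence they converge along the
  -- ultrafilter, to a solution `y` of Hamilton's equations
  set S := Icc (0 : ℝ) 1 ∩ Icc (t₀ - δ) (t₀ + δ) with hSdef
  have hSn : S ∈ 𝓝[Icc 0 1] t₀ := Filter.inter_mem self_mem_nhdsWithin
    (mem_nhdsWithin_of_mem_nhds (Icc_mem_nhds (by linarith) (by linarith)))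
  have ht₀S : t₀ ∈ S := ⟨ht₀, by constructor <;> linarith⟩
  have hSu : UniqueDiffOn ℝ S := by
    rw [hSdef, Icc_inter_Icc]
    refine uniqueDiffOn_Icc ?_
    have h1 := ht₀.1
    have h2 := ht₀.2
    refine max_lt (lt_min zero_lt_one (by linarith)) (lt_min (by linarith) (by linarith))
  have hSconv : Convex ℝ S := (convex_Icc _ _).inter (convex_Icc _ _)
  have hnear : ∀ᶠ i in l, IsGeodesic (n := n) (γ i) ∧ ∀ t ∈ S, γ i t ∈ (extChartAt (𝓡 n) a).source ∧
      phaseCurve (n := n) a (γ i) t ∈ K := by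
    filter_upwards [hgeo, (hlim t₀ ht₀).eventually (Metric.eball_mem_nhds _ (ENNReal.half_pos hε.ne'))]
      with i hi hi2
    refine ⟨hi.1, fun t ht => ?_⟩
    have h1 : edist (γ i t) (γ' t₀) < ε := by
      have h2 : edist (γ i t) (γ i t₀) ≤ C * ENNReal.ofReal δ := by
        refine (hi.1.edist_le ht.1 ht₀ (left_mem_Icc.2 zero_le_one)).trans
          (mul_le_mul' hi.2 (ENNReal.ofReal_le_ofReal ?_))
        rw [abs_le]
        constructor <;> linarith [ht.2.1, ht.2.2]
      calc edist (γ i t) (γ' t₀) ≤ edist (γ i t) (γ i t₀) + edist (γ i t₀) (γ' t₀) := edist_triangle _ _ _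
        _ < ε / 2 + ε / 2 := by
          refine (add_le_add_left h2 _).trans_lt ?_
          exact ENNReal.add_lt_add_of_le_of_lt
            (ENNReal.mul_ne_top ENNReal.coe_ne_top ENNReal.ofReal_ne_top) hδε hi2
        _ = ε := ENNReal.add_halves ε
    obtain ⟨h2, h3⟩ := hεball _ h1
    refine ⟨h2, hK _ h3 _ ?_⟩
    rw [metricCLM_extChartAt h2]
    have h4 : espeed n (γ i) t ≤ C := (hi.1.espeed_eq ht.1 (left_mem_Icc.2 zero_le_one)).trans_le hi.2
    rw [espeed, ← ENNReal.ofReal_coe_nnreal, ENNReal.ofReal_le_ofReal_iff (NNReal.coe_nonneg C)] at h4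
    exact (Real.sqrt_le_iff.1 h4).2
  have hsol : ∀ᶠ i in l, ∀ t ∈ S, phaseCurve (n := n) a (γ i) t ∈ K ∧
      HasDerivWithinAt (phaseCurve (n := n) a (γ i)) (hamiltonField (n := n) a (phaseCurve (n := n) a (γ i) t)) S t :=
    hnear.mono fun i hi t ht => ⟨(hi.2 t ht).2,
      (hi.1.hasDerivWithinAt_phaseCurve ht.1 (hi.2 t ht).1).mono inter_subset_left⟩
  obtain ⟨y, hy⟩ : ∃ y : ℝ → EuclideanSpace ℝ (Fin n) × (EuclideanSpace ℝ (Fin n) →L[ℝ] ℝ),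
      ∀ t ∈ S, Tendsto (fun i => phaseCurve (n := n) a (γ i) t) l (𝓝 (y t)) := by
    have h1 : ∀ t, ∃ z, t ∈ S → Tendsto (fun i => phaseCurve (n := n) a (γ i) t) l (𝓝 z) := by
      intro t
      by_cases ht : t ∈ S
      · obtain ⟨z, -, hz⟩ := hKc.ultrafilter_le_nhds' (l.map fun i => phaseCurve (n := n) a (γ i) t)
          (hsol.mono fun i hi => (hi t ht).1)
        exact ⟨z, fun _ => hz⟩
      · exact ⟨0, fun h => absurd h ht⟩
    choose y hy using h1
    exact ⟨y, hy⟩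
  have hysol := hasDerivWithinAt_of_tendsto_solutions hΛ0 hΛ hM hKc.isClosed hSconv hsol hy
  have hγ' : ∀ t ∈ S, γ' t = (extChartAt (𝓡 n) a).symm (y t).1 := by
    intro t ht
    have h1 : Tendsto (fun i => (extChartAt (𝓡 n) a).symm (phaseCurve (n := n) a (γ i) t).1) l
        (𝓝 ((extChartAt (𝓡 n) a).symm (y t).1)) :=
      (contMDiffAt_extChartAt_symm_of_mem (hKt (hysol t ht).1).1).continuousAt.tendsto.comp
        ((continuous_fst.tendsto _).comp (hy t ht))
    refine tendsto_nhds_unique ((hlim t ht.1).congr' ?_) h1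
    filter_upwards [hnear] with i hi
    exact ((extChartAt (𝓡 n) a).left_inv (hi.2 t ht).1).symm
  obtain ⟨r1, r2, r3⟩ := geodesic_of_hamilton hSu inter_subset_left hSn ht₀S
    (fun t ht => ⟨(hKt (hysol t ht).1).1, (hysol t ht).2⟩) hγ'
  refine ⟨r1, r2, fun τ hτ1 hτ2 => ?_⟩
  rw [r3]
  have hτS : ∀ᶠ i in l, τ i ∈ S := by
    have := tendsto_nhdsWithin_iff.2 ⟨hτ2, hτ1⟩
    exact this.eventually hSn
  have hdiff : Tendsto (fun i => phaseCurve (n := n) a (γ i) (τ i) - phaseCurve (n := n) a (γ i) t₀) l (𝓝 0) := by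
    refine squeeze_zero_norm' (a := fun i => M * ‖τ i - t₀‖) ?_ ?_
    · filter_upwards [hsol, hτS] with i h1 h2
      exact hSconv.norm_image_sub_le_of_norm_hasDerivWithin_le (fun t ht => (h1 t ht).2)
        (fun t ht => hM _ (h1 t ht).1) ht₀S h2
    · have := (tendsto_iff_norm_sub_tendsto_zero.1 hτ2).const_mul M
      simpa using this
  have := hdiff.add (hy t₀ ht₀S)
  simpa using this

end GeodesicLimit

/-! ### Continuity of the geodesic homotopy -/

section GeodesicContinuity
open Filter Topology

variable {n : ℕ} {X : Type*} [EMetricSpace X] [ChartedSpace (EuclideanSpace ℝ (Fin n)) X]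
  [IsManifold (𝓡 n) ∞ X] [RiemannianBundle (fun x : X => TangentSpace (𝓡 n) x)]
  [IsContMDiffRiemannianBundle (𝓡 n) ∞ (EuclideanSpace ℝ (Fin n))
      (fun x : X => TangentSpace (𝓡 n) x)] [IsRiemannianManifold (𝓡 n) X]

/-- Geodesics of bounded speed whose initial points converge along an ultrafilter converge at all
times: in place of the Hopf-Rinow theorem, completeness and local compactness are used directly. -/
theorem exists_tendsto_geodesics [CompleteSpace X] {ι : Type*} (l : Ultrafilter ι)
    {γ : ι → ℝ → X} {C : NNReal}
    (hgeo : ∀ᶠ i in l, IsGeodesic (n := n) (γ i) ∧ espeed n (γ i) 0 ≤ C) {x : X}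
    (h0 : Tendsto (fun i => γ i 0) l (𝓝 x)) {t : ℝ} (ht : t ∈ Icc (0 : ℝ) 1) :
    ∃ z, Tendsto (fun i => γ i t) l (𝓝 z) := by
  have : LocallyCompactSpace X := ChartedSpace.locallyCompactSpace (EuclideanSpace ℝ (Fin n)) X
  have hlip : ∀ s ∈ Icc (0 : ℝ) 1, ∀ t ∈ Icc (0 : ℝ) 1, ∀ᶠ i in l,
      edist (γ i s) (γ i t) ≤ C * ENNReal.ofReal |t - s| := fun s hs t ht =>
    hgeo.mono fun i hi => (hi.1.edist_le hs ht (left_mem_Icc.2 zero_le_one)).trans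
      (mul_le_mul_left hi.2 _)
  have hsmall : ∀ ε : ENNReal, 0 < ε → ∃ δ : ℝ, 0 < δ ∧
      ∀ s : ℝ, |s| < δ → (C : ENNReal) * ENNReal.ofReal |s| < ε := by
    intro ε hε
    have hc : Tendsto (fun s : ℝ => (C : ENNReal) * ENNReal.ofReal |s|) (𝓝 0) (𝓝 0) := by
      have h1 : Tendsto (fun s : ℝ => ENNReal.ofReal |s|) (𝓝 0) (𝓝 0) := by
        have := (ENNReal.continuous_ofReal.comp continuous_abs).tendsto (0 : ℝ)
        simpa [Function.comp_def] using this
      simpa using ENNReal.Tendsto.const_mul h1 (Or.inr ENNReal.coe_ne_top)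
    obtain ⟨δ, hδ, h⟩ := Metric.eventually_nhds_iff.1 (hc.eventually (Iio_mem_nhds hε))
    exact ⟨δ, hδ, fun s hs => h (by simpa using hs)⟩
  set T := {t : ℝ | ∃ z, Tendsto (fun i => γ i t) l (𝓝 z)} with hT
  suffices h : Icc (0 : ℝ) 1 ⊆ T from h ht
  -- the set of times at which the curves converge is closed by completeness, and open to the right
  -- since an ultrafilter converges in a compact neighbourhood of a limit point
  refine IsClosed.Icc_subset_of_forall_mem_nhdsWithin ?_ ⟨x, h0⟩ ?_
  · refine isClosed_of_closure_subset fun t ht => ?_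
    have htI : t ∈ Icc (0 : ℝ) 1 := by
      have := closure_mono (inter_subset_right (s := T) (t := Icc (0 : ℝ) 1)) ht
      rwa [isClosed_Icc.closure_eq] at this
    refine ⟨?_, htI⟩
    have hC : Cauchy (Filter.map (fun i => γ i t) l) := by
      refine EMetric.cauchy_iff.2 ⟨(inferInstance : (Filter.map (fun i => γ i t) (l : Filter ι)).NeBot).ne, fun ε hε => ?_⟩
      have hε4 : 0 < ε / 2 / 2 := ENNReal.half_pos (ENNReal.half_pos hε.ne').ne'
      obtain ⟨δ, hδ, hδε⟩ := hsmall (ε / 2 / 2) hε4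
      obtain ⟨s, ⟨⟨z, hz⟩, hsI⟩, hs⟩ := Metric.mem_closure_iff.1 ht δ hδ
      have hev : ∀ᶠ i in l, edist (γ i t) z < ε / 2 := by
        filter_upwards [hlip t htI s hsI, hz.eventually (Metric.eball_mem_nhds z hε4)] with i h1 h2
        have h3 : edist (γ i t) (γ i s) < ε / 2 / 2 := h1.trans_lt (hδε _ (by
          rw [Real.dist_eq, abs_sub_comm] at hs; exact hs))
        calc edist (γ i t) z ≤ edist (γ i t) (γ i s) + edist (γ i s) z := edist_triangle _ _ _
          _ < ε / 2 / 2 + ε / 2 / 2 := ENNReal.add_lt_add h3 h2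
          _ = ε / 2 := ENNReal.add_halves _
      refine ⟨Metric.eball z (ε / 2), hev, fun u hu v hv => ?_⟩
      calc edist u v ≤ edist u z + edist v z := edist_triangle_right _ _ _
        _ < ε / 2 + ε / 2 := ENNReal.add_lt_add hu hv
        _ = ε := ENNReal.add_halves _
    obtain ⟨z, hz⟩ := CompleteSpace.complete hC
    exact ⟨z, hz⟩
  · rintro t ⟨⟨z, hz⟩, htI⟩
    obtain ⟨N, hN, hNz⟩ := exists_compact_mem_nhds z
    obtain ⟨ε, hε, hεN⟩ := Metric.nhds_basis_eball.mem_iff.1 hNz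
    obtain ⟨δ, hδ, hδε⟩ := hsmall (ε / 2) (ENNReal.half_pos hε.ne')
    have h1 : Ioo t (min 1 (t + δ)) ∈ 𝓝[>] t := Ioo_mem_nhdsGT (lt_min htI.2 (by linarith))
    filter_upwards [h1] with s hs
    have hs2 := lt_min_iff.1 hs.2
    have hsI : s ∈ Icc (0 : ℝ) 1 := ⟨htI.1.trans hs.1.le, hs2.1.le⟩
    have hev : ∀ᶠ i in l, γ i s ∈ N := by
      filter_upwards [hlip s hsI t ⟨htI.1, htI.2.le⟩,
        hz.eventually (Metric.eball_mem_nhds z (ENNReal.half_pos hε.ne'))] with i h2 h3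
      refine hεN ?_
      have h4 := h2.trans_lt (hδε (t - s) (by rw [abs_lt]; constructor <;> linarith [hs.1, hs2.2]))
      calc edist (γ i s) z ≤ edist (γ i s) (γ i t) + edist (γ i t) z := edist_triangle _ _ _
        _ < ε / 2 + ε / 2 := ENNReal.add_lt_add h4 h3
        _ = ε := ENNReal.add_halves _
    obtain ⟨z', -, hz'⟩ := hN.ultrafilter_le_nhds' (l.map fun i => γ i s) hev
    exact ⟨z', hz'⟩

theorem IsGeodesicRadius.isGeodesicSegment {G : Type*} [Group G] [MulAction G X] {r : X → ℝ}
    (hr : IsGeodesicRadius n G r) {p : X × X} (hp : p ∈ shortPairs r) :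
    IsGeodesicSegment (n := n) (geodesicSegment n p.1 p.2) p.1 p.2 := by
  have h := hr.exists_segment p hp
  rw [geodesicSegment, dif_pos h]
  exact h.choose_spec

theorem velocity_congr {γ₁ γ₂ : ℝ → X} (h : EqOn γ₁ γ₂ (Icc 0 1)) {t : ℝ}
    (ht : t ∈ Icc (0 : ℝ) 1) : velocity n γ₁ t = velocity n γ₂ t := by
  have : mfderivWithin 𝓘(ℝ, ℝ) (𝓡 n) γ₁ (Icc 0 1) t = mfderivWithin 𝓘(ℝ, ℝ) (𝓡 n) γ₂ (Icc 0 1) t :=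
    mfderivWithin_congr h (h ht)
  exact DFunLike.congr_fun this (1 : ℝ)

theorem phaseCurve_congr {a : X} {γ₁ γ₂ : ℝ → X} (h : EqOn γ₁ γ₂ (Icc 0 1)) {t : ℝ}
    (ht : t ∈ Icc (0 : ℝ) 1) : phaseCurve (n := n) a γ₁ t = phaseCurve a γ₂ t := by
  rw [phaseCurve, phaseCurve, h ht, velocity_congr h ht]

theorem espeed_eq_phaseCurve {a : X} {γ : ℝ → X} {t : ℝ}
    (ha : γ t ∈ (extChartAt (𝓡 n) a).source) : espeed n γ t = ENNReal.ofReal (Real.sqrt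
      ((phaseCurve (n := n) a γ t).2 (hamiltonField (n := n) a (phaseCurve (n := n) a γ t)).1)) := by
  have h1 : (hamiltonField (n := n) a (phaseCurve (n := n) a γ t)).1 =
      dChart n a (γ t) (velocity n γ t) :=
    metricCLM_inverse_apply ((extChartAt (𝓡 n) a).map_source ha) _
  rw [h1, espeed, ← metricCLM_extChartAt ha]
  rfl

/-- Unique geodesic segments depend continuously on their endpoints, together with their
velocities. -/
theorem tendsto_geodesicSegment [CompleteSpace X] {G : Type*} [Group G] [MulAction G X] {r : X → ℝ}
    (hr : IsGeodesicRadius n G r) {q₀ : shortPairs r × unitInterval}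
    (l : Ultrafilter (shortPairs r × unitInterval)) (hl : l ≤ 𝓝 q₀) :
    Tendsto (geodesicHomotopy n r) l (𝓝 (geodesicHomotopy n r q₀)) ∧
    ∀ a : X, geodesicHomotopy n r q₀ ∈ (extChartAt (𝓡 n) a).source →
      Tendsto (fun q : shortPairs r × unitInterval =>
          phaseCurve (n := n) a (geodesicSegment n q.1.1.1 q.1.1.2) q.2) l
        (𝓝 (phaseCurve a (geodesicSegment n q₀.1.1.1 q₀.1.1.2) q₀.2)) := by
  set γ : shortPairs r × unitInterval → ℝ → X := fun q => geodesicSegment n q.1.1.1 q.1.1.2 with hγ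
  have hseg : ∀ q, IsGeodesicSegment (n := n) (γ q) q.1.1.1 q.1.1.2 :=
    fun q => hr.isGeodesicSegment q.1.2
  have h01 : (0 : ℝ) ∈ Icc (0 : ℝ) 1 := left_mem_Icc.2 zero_le_one
  have h11 : (1 : ℝ) ∈ Icc (0 : ℝ) 1 := right_mem_Icc.2 zero_le_one
  have hx : Tendsto (fun q : shortPairs r × unitInterval => q.1.1.1) l (𝓝 q₀.1.1.1) :=
    ((continuous_fst.comp (continuous_subtype_val.comp continuous_fst)).tendsto q₀).mono_left hl
  have hy : Tendsto (fun q : shortPairs r × unitInterval => q.1.1.2) l (𝓝 q₀.1.1.2) :=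
    ((continuous_snd.comp (continuous_subtype_val.comp continuous_fst)).tendsto q₀).mono_left hl
  have ht : Tendsto (fun q : shortPairs r × unitInterval => (q.2 : ℝ)) l (𝓝 q₀.2) :=
    ((continuous_subtype_val.comp continuous_snd).tendsto q₀).mono_left hl
  have hd : Tendsto (fun q : shortPairs r × unitInterval => edist q.1.1.1 q.1.1.2) l
      (𝓝 (edist q₀.1.1.1 q₀.1.1.2)) := hx.edist hy
  have hfin : edist q₀.1.1.1 q₀.1.1.2 ≠ ⊤ := (lt_of_lt_of_le q₀.1.2 le_top).ne
  obtain ⟨C, hC⟩ : ∃ C : NNReal, edist q₀.1.1.1 q₀.1.1.2 < C := by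
    obtain ⟨C, hC, -⟩ := ENNReal.lt_iff_exists_nnreal_btwn.1 hfin.lt_top
    exact ⟨C, hC⟩
  have hgeo : ∀ᶠ q in l, IsGeodesic (n := n) (γ q) ∧ espeed n (γ q) 0 ≤ C := by
    filter_upwards [hd.eventually (Iio_mem_nhds hC)] with q hq
    exact ⟨(hseg q).isGeodesic, ((hseg q).espeed_eq h01).trans_le hq.le⟩
  have h0 : Tendsto (fun q => γ q 0) l (𝓝 q₀.1.1.1) := by
    simpa only [(hseg _).source] using hx
  have h1 : Tendsto (fun q => γ q 1) l (𝓝 q₀.1.1.2) := by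
    simpa only [(hseg _).target] using hy
  have hex : ∀ t, ∃ z, t ∈ Icc (0 : ℝ) 1 → Tendsto (fun q => γ q t) l (𝓝 z) := fun t => by
    by_cases ht : t ∈ Icc (0 : ℝ) 1
    · obtain ⟨z, hz⟩ := exists_tendsto_geodesics l hgeo h0 ht
      exact ⟨z, fun _ => hz⟩
    · exact ⟨q₀.1.1.1, fun h => absurd h ht⟩
  choose γ' hγ' using hex
  have hlimit := fun {t₀} (ht₀ : t₀ ∈ Icc (0 : ℝ) 1) {a} ha =>
    geodesic_limit (n := n) (a := a) l hgeo (fun t ht => hγ' t ht) ht₀ ha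
  -- the limit curve is a geodesic of the right speed, hence the unique segment
  have hgeo' : IsGeodesic (n := n) γ' := isGeodesic_of_eulerLagrangeAt
    (fun t ht => (hlimit ht (mem_extChartAt_source _)).1)
    (fun t ht => (hlimit ht (mem_extChartAt_source _)).2.1)
  have hspeed : espeed n γ' 0 = edist q₀.1.1.1 q₀.1.1.2 := by
    have hs0 : γ' 0 ∈ (extChartAt (𝓡 n) (γ' 0)).source := mem_extChartAt_source _
    have hph := (hlimit h01 hs0).2.2 (fun _ => 0) (Eventually.of_forall fun _ => h01)
      tendsto_const_nhds
    have hsrc : ∀ᶠ q in l, γ q 0 ∈ (extChartAt (𝓡 n) (γ' 0)).source :=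
      (hγ' 0 h01).eventually (extChartAt_source_mem_nhds (I := 𝓡 n) (γ' 0))
    have hcont : ContinuousAt (hamiltonField (n := n) (γ' 0)) (phaseCurve (γ' 0) γ' 0) :=
      ((contDiffOn_hamiltonField (n := n) (γ' 0)).continuousOn).continuousAt
        (((isOpen_extChartAt_target (γ' 0)).prod isOpen_univ).mem_nhds
          ⟨(extChartAt (𝓡 n) (γ' 0)).map_source hs0, mem_univ _⟩)
    have h2 : Tendsto (fun q => espeed n (γ q) 0) l (𝓝 (espeed n γ' 0)) := by
      rw [espeed_eq_phaseCurve hs0]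
      refine Tendsto.congr' (hsrc.mono fun q hq => (espeed_eq_phaseCurve hq).symm) ?_
      refine (ENNReal.continuous_ofReal.tendsto _).comp ((Real.continuous_sqrt.tendsto _).comp ?_)
      have hc2 : ContinuousAt (fun z => z.2 (hamiltonField (n := n) (γ' 0) z).1)
          (phaseCurve (γ' 0) γ' 0) := continuousAt_snd.clm_apply (continuousAt_fst.comp hcont)
      exact hc2.tendsto.comp hph
    refine tendsto_nhds_unique (h2.congr fun q => (hseg q).espeed_eq h01) hd
  have hseg' : IsGeodesicSegment (n := n) γ' q₀.1.1.1 q₀.1.1.2 := by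
    refine ⟨hgeo', tendsto_nhds_unique (hγ' 0 h01) h0, tendsto_nhds_unique (hγ' 1 h11) h1, ?_⟩
    rw [hgeo'.pathELength_eq le_rfl le_rfl h01, hspeed]
    simp
  have heq : EqOn γ' (γ q₀) (Icc 0 1) := hr.unique_segment q₀.1.1 q₀.1.2 _ _ hseg' (hseg q₀)
  have hP : geodesicHomotopy n r q₀ = γ' q₀.2 := (heq q₀.2.2).symm
  have hphase : ∀ a : X, geodesicHomotopy n r q₀ ∈ (extChartAt (𝓡 n) a).source →
      Tendsto (fun q => phaseCurve (n := n) a (γ q) q.2) l (𝓝 (phaseCurve a (γ q₀) q₀.2)) := by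
    intro a ha
    rw [hP] at ha
    rw [← phaseCurve_congr heq q₀.2.2]
    exact (hlimit q₀.2.2 ha).2.2 (fun q => q.2) (Eventually.of_forall fun q => q.2.2) ht
  refine ⟨?_, hphase⟩
  -- the curves are uniformly Lipschitz, so that `γ_q(t)` and `γ_q(t₀)` have the same limit
  rw [hP, tendsto_iff_edist_tendsto_0]
  have hb : Tendsto (fun q : shortPairs r × unitInterval =>
      (C : ENNReal) * ENNReal.ofReal |(q₀.2 : ℝ) - q.2| + edist (γ q q₀.2) (γ' q₀.2)) l (𝓝 0) := by
    have h2 : Tendsto (fun q : shortPairs r × unitInterval => ENNReal.ofReal |(q₀.2 : ℝ) - q.2|) l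
        (𝓝 0) := by
      have := (ENNReal.continuous_ofReal.tendsto _).comp ((tendsto_const_nhds (x := (q₀.2 : ℝ))
        |>.sub ht).abs)
      simpa [Function.comp_def] using this
    have h3 := ENNReal.Tendsto.const_mul h2 (Or.inr (ENNReal.coe_ne_top (r := C)))
    have h4 := tendsto_iff_edist_tendsto_0.1 (hγ' q₀.2 q₀.2.2)
    simpa using h3.add h4
  refine tendsto_of_tendsto_of_tendsto_of_le_of_le' tendsto_const_nhds hb
    (Eventually.of_forall fun _ => zero_le) ?_
  filter_upwards [hgeo] with q hq
  exact (edist_triangle _ (γ q q₀.2) _).trans (add_le_add_left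
    ((hq.1.edist_le q.2.2 q₀.2.2 h01).trans (mul_le_mul_left hq.2 _)) _)

theorem continuous_geodesicHomotopy [CompleteSpace X] {G : Type*} [Group G] [MulAction G X]
    {r : X → ℝ} (hr : IsGeodesicRadius n G r) : Continuous (geodesicHomotopy n r) :=
  continuous_iff_continuousAt.2 fun _ => (tendsto_iff_ultrafilter _ _ _).2 fun l hl =>
    (tendsto_geodesicSegment hr l hl).1

/-- The velocity of the geodesic segments, in the chart at `a`, is jointly continuous in the
endpoints and the time. -/
theorem continuousAt_velocity [CompleteSpace X] {G : Type*} [Group G] [MulAction G X]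
    {r : X → ℝ} (hr : IsGeodesicRadius n G r) {q₀ : shortPairs r × unitInterval} {a : X}
    (ha : geodesicHomotopy n r q₀ ∈ (extChartAt (𝓡 n) a).source) :
    ContinuousAt (fun q : shortPairs r × unitInterval => dChart n a (geodesicHomotopy n r q)
      (velocity n (geodesicSegment n q.1.1.1 q.1.1.2) q.2)) q₀ := by
  have h1 : ContinuousAt (fun q : shortPairs r × unitInterval =>
      phaseCurve (n := n) a (geodesicSegment n q.1.1.1 q.1.1.2) q.2) q₀ :=
    (tendsto_iff_ultrafilter _ _ _).2 fun l hl => (tendsto_geodesicSegment hr l hl).2 a ha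
  have hcont : ContinuousAt (hamiltonField (n := n) a)
      (phaseCurve a (geodesicSegment n q₀.1.1.1 q₀.1.1.2) q₀.2) :=
    ((contDiffOn_hamiltonField (n := n) a).continuousOn).continuousAt
      (((isOpen_extChartAt_target a).prod isOpen_univ).mem_nhds
        ⟨(extChartAt (𝓡 n) a).map_source ha, mem_univ _⟩)
  have h2 : ContinuousAt (fun q : shortPairs r × unitInterval => (hamiltonField (n := n) a
      (phaseCurve (n := n) a (geodesicSegment n q.1.1.1 q.1.1.2) q.2)).1) q₀ :=
    (continuous_fst.tendsto _).comp (hcont.tendsto.comp h1.tendsto)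
  refine h2.congr ?_
  filter_upwards [(continuous_geodesicHomotopy hr).continuousAt.eventually
    ((isOpen_extChartAt_source a).mem_nhds ha)] with q hq
  exact metricCLM_inverse_apply ((extChartAt (𝓡 n) a).map_source hq) _

end GeodesicContinuity

/-! ### Isometric actions and geodesic segments -/

section IsometricAction
open Filter Topology

variable {n : ℕ} {G X : Type*} [Group G] [EMetricSpace X]
  [ChartedSpace (EuclideanSpace ℝ (Fin n)) X]
  [IsManifold (𝓡 n) ∞ X] [RiemannianBundle (fun x : X => TangentSpace (𝓡 n) x)]
  [IsContMDiffRiemannianBundle (𝓡 n) ∞ (EuclideanSpace ℝ (Fin n))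
      (fun x : X => TangentSpace (𝓡 n) x)] [IsRiemannianManifold (𝓡 n) X] [MulAction G X]

theorem IsIsometricAction.tangentInner_smul (h : IsIsometricAction n G X) (g : G) (y : X)
    (v w : EuclideanSpace ℝ (Fin n)) :
    tangentInner n (g • y) (dMap n (fun x : X => g • x) y v) (dMap n (fun x : X => g • x) y w) =
      tangentInner n y v w :=
  h.inner_mfderiv_smul g y v w

theorem IsIsometricAction.edist_smul_le (h : IsIsometricAction n G X) (g : G) (x y : X) :
    edist (g • x) (g • y) ≤ edist x y :=
  edist_le_of_isometric (h.contMDiff_smul g) (h.tangentInner_smul g) x y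

theorem IsIsometricAction.isGeodesicSegment_smul (h : IsIsometricAction n G X) (g : G)
    {γ : ℝ → X} {x y : X} (hγ : IsGeodesicSegment (n := n) γ x y) :
    IsGeodesicSegment (n := n) (fun t => g • γ t) (g • x) (g • y) :=
  hγ.map (h.contMDiff_smul g) (h.tangentInner_smul g) (h.contMDiff_smul g⁻¹)
    (h.tangentInner_smul g⁻¹) fun x => inv_smul_smul g x

theorem IsGeodesicRadius.smul_mem (h : IsIsometricAction n G X) {r : X → ℝ}
    (hr : IsGeodesicRadius n G r) (g : G) {p : X × X} (hp : p ∈ shortPairs r) :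
    (g • p.1, g • p.2) ∈ shortPairs r := by
  change edist (g • p.1) (g • p.2) < ENNReal.ofReal (r (g • p.1))
  rw [hr.invariant]
  exact (h.edist_smul_le g _ _).trans_lt hp

theorem IsGeodesicRadius.geodesicSegment_smul (h : IsIsometricAction n G X) {r : X → ℝ}
    (hr : IsGeodesicRadius n G r) (g : G) {p : X × X} (hp : p ∈ shortPairs r) {t : ℝ}
    (ht : t ∈ Icc (0 : ℝ) 1) :
    geodesicSegment n (g • p.1) (g • p.2) t = g • geodesicSegment n p.1 p.2 t :=
  hr.unique_segment _ (hr.smul_mem h g hp) _ _ (hr.isGeodesicSegment (hr.smul_mem h g hp))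
    (h.isGeodesicSegment_smul g (hr.isGeodesicSegment hp)) ht

end IsometricAction

/-! ### Local coordinates in a bundle of C*-algebras -/

section FibreCoordinates
open Filter Topology

variable {X : Type*} [TopologicalSpace X] {A : Type*} [NonUnitalCStarAlgebra A] {E : X → Type*}
  [∀ x, NonUnitalCStarAlgebra (E x)] [TopologicalSpace (TotalSpace A E)] [FiberBundle A E]

/-- The coordinate in `A` of a vector of `E`, with respect to the preferred trivialization at `p`. -/
def fibreCoord (A : Type*) [NonUnitalCStarAlgebra A] {X : Type*} [TopologicalSpace X]
    {E : X → Type*} [∀ x, NonUnitalCStarAlgebra (E x)] [TopologicalSpace (TotalSpace A E)]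
    [FiberBundle A E] (p : X) {x : X} (v : E x) : A :=
  (trivializationAt A E p ⟨x, v⟩).2

/-- The vector of `E` with a given coordinate in the preferred trivialization at `p`. -/
def ofFibreCoord {A : Type*} [NonUnitalCStarAlgebra A] {X : Type*} [TopologicalSpace X]
    (E : X → Type*) [∀ x, NonUnitalCStarAlgebra (E x)] [TopologicalSpace (TotalSpace A E)]
    [FiberBundle A E] (p x : X) (a : A) : E x :=
  (trivializationAt A E p).symm x a

/-- The domain of the preferred trivialization at `p`. -/
def trivSet (A : Type*) [NonUnitalCStarAlgebra A] {X : Type*} [TopologicalSpace X]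
    (E : X → Type*) [∀ x, NonUnitalCStarAlgebra (E x)] [TopologicalSpace (TotalSpace A E)]
    [FiberBundle A E] (p : X) : Set X :=
  (trivializationAt A E p).baseSet

theorem isOpen_trivSet (p : X) : IsOpen (trivSet A E p) := (trivializationAt A E p).open_baseSet

theorem mem_trivSet (p : X) : p ∈ trivSet A E p := mem_baseSet_trivializationAt A E p

theorem fibreCoord_ofFibreCoord {p x : X} (hx : x ∈ trivSet A E p) (a : A) :
    fibreCoord A p (ofFibreCoord E p x a) = a := by
  rw [fibreCoord, ofFibreCoord, Trivialization.apply_mk_symm _ hx]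

theorem ofFibreCoord_fibreCoord {p x : X} (hx : x ∈ trivSet A E p) (v : E x) :
    ofFibreCoord E p x (fibreCoord A p v) = v :=
  Trivialization.symm_apply_apply_mk _ hx v

/-- The preferred trivialization at `p`, as an isomorphism of C*-algebras of the fibre at `x`. -/
def coordEquiv (hE : IsCStarBundle A E) {p x : X} (hx : x ∈ trivSet A E p) : E x ≃⋆ₐ[ℂ] A :=
  (hE (trivializationAt A E p) x hx).choose

theorem coordEquiv_apply (hE : IsCStarBundle A E) {p x : X} (hx : x ∈ trivSet A E p) (v : E x) :
    coordEquiv hE hx v = fibreCoord A p v :=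
  ((hE (trivializationAt A E p) x hx).choose_spec v).symm

theorem coordEquiv_symm_apply (hE : IsCStarBundle A E) {p x : X} (hx : x ∈ trivSet A E p) (a : A) :
    (coordEquiv hE hx).symm a = ofFibreCoord E p x a := by
  rw [StarAlgEquiv.symm_apply_eq, coordEquiv_apply, fibreCoord_ofFibreCoord hx]

variable (hE : IsCStarBundle A E) {p x : X} (hx : x ∈ trivSet A E p)
include hE hx

theorem fibreCoord_zero : fibreCoord A p (0 : E x) = 0 := by
  rw [← coordEquiv_apply hE hx, map_zero]

theorem fibreCoord_add (v w : E x) :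
    fibreCoord A p (v + w) = fibreCoord A p v + fibreCoord A p w := by
  simp only [← coordEquiv_apply hE hx, map_add]

theorem fibreCoord_sub (v w : E x) :
    fibreCoord A p (v - w) = fibreCoord A p v - fibreCoord A p w := by
  simp only [← coordEquiv_apply hE hx, map_sub]

theorem fibreCoord_mul (v w : E x) :
    fibreCoord A p (v * w) = fibreCoord A p v * fibreCoord A p w := by
  simp only [← coordEquiv_apply hE hx, map_mul]

theorem fibreCoord_star (v : E x) : fibreCoord A p (star v) = star (fibreCoord A p v) := by
  simp only [← coordEquiv_apply hE hx, map_star]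

theorem fibreCoord_smul (z : ℂ) (v : E x) : fibreCoord A p (z • v) = z • fibreCoord A p v := by
  simp only [← coordEquiv_apply hE hx, map_smul]

theorem fibreCoord_real_smul (c : ℝ) (v : E x) : fibreCoord A p (c • v) = c • fibreCoord A p v :=
  fibreCoord_smul hE hx (c : ℂ) v

theorem ofFibreCoord_add (a b : A) :
    ofFibreCoord E p x (a + b) = ofFibreCoord E p x a + ofFibreCoord E p x b := by
  simp only [← coordEquiv_symm_apply hE hx, map_add]

theorem ofFibreCoord_mul (a b : A) :
    ofFibreCoord E p x (a * b) = ofFibreCoord E p x a * ofFibreCoord E p x b := by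
  simp only [← coordEquiv_symm_apply hE hx, map_mul]

theorem ofFibreCoord_star (a : A) :
    ofFibreCoord E p x (star a) = star (ofFibreCoord E p x a) := by
  simp only [← coordEquiv_symm_apply hE hx, map_star]

theorem ofFibreCoord_smul (z : ℂ) (a : A) :
    ofFibreCoord E p x (z • a) = z • ofFibreCoord E p x a := by
  simp only [← coordEquiv_symm_apply hE hx, map_smul]

theorem ofFibreCoord_real_smul (c : ℝ) (a : A) :
    ofFibreCoord E p x (c • a) = c • ofFibreCoord E p x a :=
  ofFibreCoord_smul hE hx (c : ℂ) a

omit hE in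
theorem fibreCoord_injective {v w : E x} (h : fibreCoord A p v = fibreCoord A p w) : v = w := by
  rw [← ofFibreCoord_fibreCoord hx v, h, ofFibreCoord_fibreCoord hx]

end FibreCoordinates

/-! ### Cutoff functions and global sections -/

section Cutoff
open Filter Topology

variable {n : ℕ} {X : Type*} [EMetricSpace X] [ChartedSpace (EuclideanSpace ℝ (Fin n)) X]
  [IsManifold (𝓡 n) ∞ X]

theorem exists_cutoff (n : ℕ) {X : Type*} [EMetricSpace X]
    [ChartedSpace (EuclideanSpace ℝ (Fin n)) X] [IsManifold (𝓡 n) ∞ X] {p : X} {O : Set X}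
    (hO : O ∈ 𝓝 p) :
    ∃ f : X → ℝ, ContMDiff (𝓡 n) 𝓘(ℝ, ℝ) ∞ f ∧ tsupport f ⊆ O ∧ HasCompactSupport f ∧
      (∀ᶠ x in 𝓝 p, f x = 1) ∧ ∀ x, f x ∈ Icc (0 : ℝ) 1 := by
  obtain ⟨f, -, hf⟩ := (SmoothBumpFunction.nhds_basis_tsupport (I := 𝓡 n) p).mem_iff.1 hO
  exact ⟨f, f.contMDiff, hf, f.hasCompactSupport, f.eventuallyEq_one, fun x => f.mem_Icc⟩

/-- The extension by zero of a function supported in a chart, read in the chart. -/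
theorem contDiff_zeroExtension {F : Type*} [NormedAddCommGroup F] [NormedSpace ℝ F] {g : X → F}
    (hg : ContMDiff (𝓡 n) 𝓘(ℝ, F) ∞ g) (hc : HasCompactSupport g) {p : X}
    (hs : tsupport g ⊆ (extChartAt (𝓡 n) p).source) :
    ContDiff ℝ ∞ ((extChartAt (𝓡 n) p).target.indicator fun u => g ((extChartAt (𝓡 n) p).symm u)) := by
  set K := extChartAt (𝓡 n) p '' tsupport g with hK
  have hKc : IsCompact K := hc.isCompact.image_of_continuousOn ((continuousOn_extChartAt p).mono hs)
  rw [contDiff_iff_contDiffAt]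
  intro u
  by_cases hu : u ∈ (extChartAt (𝓡 n) p).target
  · have h1 : ContDiffAt ℝ ∞ (fun u => g ((extChartAt (𝓡 n) p).symm u)) u :=
      (hg.contMDiffAt.comp u (contMDiffAt_extChartAt_symm_of_mem hu)).contDiffAt
    refine h1.congr_of_eventuallyEq ?_
    filter_upwards [(isOpen_extChartAt_target p).mem_nhds hu] with w hw
    rw [indicator_of_mem hw]
  · have huK : u ∉ K := by
      rintro ⟨x, hx, rfl⟩
      exact hu ((extChartAt (𝓡 n) p).map_source (hs hx))
    refine (contDiffAt_const (c := (0 : F))).congr_of_eventuallyEq ?_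
    filter_upwards [hKc.isClosed.isOpen_compl.mem_nhds huK] with w hw
    by_cases hw' : w ∈ (extChartAt (𝓡 n) p).target
    · rw [indicator_of_mem hw']
      refine image_eq_zero_of_notMem_tsupport fun h => hw ⟨_, h, ?_⟩
      exact (extChartAt (𝓡 n) p).right_inv hw'
    · rw [indicator_of_notMem hw']

/-- Local sections of a vector bundle, multiplied with a cutoff function, are global sections. -/
theorem contMDiff_cutoff_section {F : Type*} [NormedAddCommGroup F] [NormedSpace ℝ F]
    {W : X → Type*} [TopologicalSpace (TotalSpace F W)] [∀ x, TopologicalSpace (W x)]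
    [FiberBundle F W] [∀ x, AddCommGroup (W x)] [∀ x, Module ℝ (W x)] [VectorBundle ℝ F W]
    [ContMDiffVectorBundle ∞ F W (𝓡 n)] (e : Trivialization F (π F W)) [MemTrivializationAtlas e]
    {f : X → ℝ} (hf : ContMDiff (𝓡 n) 𝓘(ℝ, ℝ) ∞ f) {O : Set X} (hO : IsOpen O)
    (hOe : O ⊆ e.baseSet) (hfO : tsupport f ⊆ O) {h : X → F}
    (hh : ContMDiffOn (𝓡 n) 𝓘(ℝ, F) ∞ h O) :
    ContMDiff (𝓡 n) ((𝓡 n).prod 𝓘(ℝ, F)) ∞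
      (fun x => (⟨x, f x • e.symm x (h x)⟩ : TotalSpace F W)) := by
  have h1 : ContMDiffOn (𝓡 n) ((𝓡 n).prod 𝓘(ℝ, F)) ∞
      (fun x => (⟨x, e.symm x (h x)⟩ : TotalSpace F W)) O := by
    refine (e.contMDiffOn_section_iff hO hOe).2 (hh.congr fun x hx => ?_)
    rw [e.apply_mk_symm (hOe hx)]
  exact ContMDiffOn.smul_section_of_tsupport hf.contMDiffOn hO hfO h1

end Cutoff

/-! ### Locality of connections -/

section ConnectionLocality
open Filter Topology

variable {n : ℕ} {X : Type*} [EMetricSpace X] [ChartedSpace (EuclideanSpace ℝ (Fin n)) X]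
  [IsManifold (𝓡 n) ∞ X]
  {A : Type*} [NonUnitalCStarAlgebra A] {E : X → Type*} [∀ x, NonUnitalCStarAlgebra (E x)]
  [TopologicalSpace (TotalSpace A E)] [FiberBundle A E] [VectorBundle ℝ A E]

/-- Smooth functions with values in `A` define global sections, after multiplication with a cutoff
function. -/
theorem exists_cutoff_section [ContMDiffVectorBundle ∞ A E (𝓡 n)] {p : X} {f : X → ℝ}
    (hf : ContMDiff (𝓡 n) 𝓘(ℝ, ℝ) ∞ f) {O : Set X} (hO : IsOpen O)
    (hOe : O ⊆ trivSet A E p) (hfO : tsupport f ⊆ O) {h : X → A}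
    (hh : ContMDiffOn (𝓡 n) 𝓘(ℝ, A) ∞ h O) :
    ∃ σ : SmoothSection n A E, ∀ x, σ x = f x • ofFibreCoord E p x (h x) :=
  ⟨⟨fun x => f x • ofFibreCoord E p x (h x),
    contMDiff_cutoff_section (trivializationAt A E p) hf hO hOe hfO hh⟩, fun _ => rfl⟩

theorem trivializationAt_tangent_apply {p x : X} (hx : x ∈ (extChartAt (𝓡 n) p).source)
    (v : TangentSpace (𝓡 n) x) :
    (trivializationAt (EuclideanSpace ℝ (Fin n)) (TangentSpace (𝓡 n)) p ⟨x, v⟩).2 =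
      dChart n p x v := by
  rw [extChartAt_source] at hx
  have h1 := TangentBundle.continuousLinearMapAt_trivializationAt (I := 𝓡 n) hx
  have h2 := (trivializationAt (EuclideanSpace ℝ (Fin n)) (TangentSpace (𝓡 n))
    p).continuousLinearMapAt_apply_of_mem (R := ℝ) hx v
  rw [h1] at h2
  exact h2.symm

/-- The constant vector fields of a chart extend to global fields, after multiplication with a
cutoff function. -/
theorem exists_cutoff_field {p : X} {f : X → ℝ}
    (hf : ContMDiff (𝓡 n) 𝓘(ℝ, ℝ) ∞ f) (hfs : tsupport f ⊆ (extChartAt (𝓡 n) p).source)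
    (v : EuclideanSpace ℝ (Fin n)) :
    ∃ W : SmoothVectorField n X, (∀ x ∈ (extChartAt (𝓡 n) p).source,
      dChart n p x (W x) = f x • v) ∧ ∀ x, f x = 0 → W x = 0 := by
  have hs : (extChartAt (𝓡 n) p).source = (trivializationAt (EuclideanSpace ℝ (Fin n))
      (TangentSpace (𝓡 n)) p).baseSet := by
    rw [extChartAt_source]; rfl
  refine ⟨⟨fun x => f x • (trivializationAt (EuclideanSpace ℝ (Fin n)) (TangentSpace (𝓡 n)) p).symm
      x v, contMDiff_cutoff_section (trivializationAt (EuclideanSpace ℝ (Fin n))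
        (TangentSpace (𝓡 n)) p) hf (isOpen_extChartAt_source p) hs.le hfs
        (h := fun _ => v) contMDiffOn_const⟩, fun x hx => ?_, fun x hx => ?_⟩
  · change dChart n p x (f x • (trivializationAt (EuclideanSpace ℝ (Fin n)) (TangentSpace (𝓡 n))
      p).symm x v) = _
    have h1 : dChart n p x ((trivializationAt (EuclideanSpace ℝ (Fin n)) (TangentSpace (𝓡 n))
        p).symm x v) = v := by
      rw [← trivializationAt_tangent_apply hx, Trivialization.apply_mk_symm _ (hs ▸ hx)]
    exact (map_smul (dChart n p x) (f x) _).trans (congrArg _ h1)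
  · change f x • (trivializationAt (EuclideanSpace ℝ (Fin n)) (TangentSpace (𝓡 n))
      p).symm x v = 0
    rw [hx, zero_smul]

theorem dChart_injective {p x : X} (hx : x ∈ (extChartAt (𝓡 n) p).source)
    {v w : EuclideanSpace ℝ (Fin n)} (h : dChart n p x v = dChart n p x w) : v = w := by
  have h1 := fun v => DFunLike.congr_fun (dChartSymm_comp_dChart hx) v
  have h2 : ∀ v, dChartSymm p (extChartAt (𝓡 n) p x) (dChart n p x v) = v := h1
  rw [← h2 v, h, h2]

theorem contMDiffOn_dChart_apply (p : X) (V : SmoothVectorField n X) :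
    ContMDiffOn (𝓡 n) 𝓘(ℝ, EuclideanSpace ℝ (Fin n)) ∞ (fun x => dChart n p x (V x))
      (extChartAt (𝓡 n) p).source := by
  have hs : (extChartAt (𝓡 n) p).source = (trivializationAt (EuclideanSpace ℝ (Fin n))
      (TangentSpace (𝓡 n)) p).baseSet := by
    rw [extChartAt_source]; rfl
  have h1 := ((trivializationAt (EuclideanSpace ℝ (Fin n)) (TangentSpace (𝓡 n))
    p).contMDiffOn_section_iff (IB := 𝓡 n) (n := ∞) (s := fun x => V x)
    (isOpen_extChartAt_source (I := 𝓡 n) p) hs.le).1 V.contMDiff.contMDiffOn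
  exact h1.congr fun x hx => (trivializationAt_tangent_apply hx (V x)).symm

theorem deriveFunction_eq_zero {f : X → ℝ} {x : X} {c : ℝ} (h : ∀ᶠ y in 𝓝 x, f y = c)
    (V : SmoothVectorField n X) : SmoothVectorField.deriveFunction V f x = 0 := by
  have h1 : mfderiv (𝓡 n) 𝓘(ℝ, ℝ) f x = mfderiv (𝓡 n) 𝓘(ℝ, ℝ) (fun _ : X => c) x :=
    Filter.EventuallyEq.mfderiv_eq h
  rw [SmoothVectorField.deriveFunction, h1, mfderiv_const]
  rfl

namespace HermitianConnection

variable (D : HermitianConnection n A E)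

theorem toFun_sum_field {ι : Type*} (s : Finset ι) (V : ι → SmoothVectorField n X)
    (a : SmoothSection n A E) (x : X) :
    D.toFun (∑ i ∈ s, V i) a x = ∑ i ∈ s, D.toFun (V i) a x :=
  map_sum (AddMonoidHom.mk' (fun V => D.toFun V a x) fun V W => D.add_field V W a x) V s

theorem toFun_sum_section {ι : Type*} (s : Finset ι) (V : SmoothVectorField n X)
    (a : ι → SmoothSection n A E) (x : X) :
    D.toFun V (∑ i ∈ s, a i) x = ∑ i ∈ s, D.toFun V (a i) x :=
  map_sum (AddMonoidHom.mk' (fun a => D.toFun V a x) fun a b => D.add_section V a b x) a s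

/-- The covariant derivative at `x` in the direction of a field that vanishes at `x` is zero. -/
theorem toFun_eq_zero_of_field {V : SmoothVectorField n X} (a : SmoothSection n A E) {x : X}
    (hV : V x = 0) : D.toFun V a x = 0 := by
  obtain ⟨f, hf, hfs, -, hf1, -⟩ := exists_cutoff n (p := x)
    ((isOpen_extChartAt_source (I := 𝓡 n) x).mem_nhds (mem_extChartAt_source x))
  let b := Module.finBasis ℝ (EuclideanSpace ℝ (Fin n))
  choose W hW hW0 using fun i => exists_cutoff_field hf hfs (b i)
  set c : Fin _ → X → ℝ := fun i y => f y * (b.coord i).toContinuousLinearMap (dChart n x y (V y))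
    with hc
  have hcs : ∀ i, ContMDiff (𝓡 n) 𝓘(ℝ, ℝ) ∞ (c i) := by
    intro i
    refine contMDiff_of_tsupport fun y hy => ?_
    have hy' : y ∈ (extChartAt (𝓡 n) x).source := hfs (tsupport_smul_subset_left f
      (fun y => (b.coord i).toContinuousLinearMap (dChart n x y (V y))) hy)
    have h1 : ContMDiffAt (𝓡 n) 𝓘(ℝ, EuclideanSpace ℝ (Fin n)) ∞ (fun x' => dChart n x x' (V x')) y :=
      (contMDiffOn_dChart_apply x V).contMDiffAt ((isOpen_extChartAt_source x).mem_nhds hy')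
    exact hf.contMDiffAt.smul
      (((b.coord i).toContinuousLinearMap.contDiff.contMDiff.contMDiffAt).comp y h1)
  -- `f² V` is a combination of the coordinate fields
  have hsq : ContMDiff (𝓡 n) 𝓘(ℝ, ℝ) ∞ fun y => f y * f y := hf.smul hf
  let cW : Fin _ → SmoothVectorField n X := fun i => ⟨fun y => c i y • W i y,
    (hcs i).smul_section (W i).contMDiff⟩
  have hsum : ∀ y, (∑ i, cW i : SmoothVectorField n X) y = (f y * f y) • V y := by
    intro y
    have h1 : (∑ i, cW i : SmoothVectorField n X) y = ∑ i, c i y • W i y :=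
      map_sum (AddMonoidHom.mk' (fun V : SmoothVectorField n X => V y) fun _ _ => rfl) cW _
    rw [h1]
    by_cases hy : f y = 0
    · simp only [hy, zero_mul, zero_smul]
      exact Finset.sum_eq_zero fun i _ => by rw [hW0 i y hy, smul_zero]
    have hy' : y ∈ (extChartAt (𝓡 n) x).source := hfs (subset_tsupport f hy)
    refine dChart_injective hy' ?_
    have h2 : dChart n x y (∑ i, c i y • W i y) = ∑ i, c i y • (f y • b i) := by
      refine (map_sum (dChart n x y) _ _).trans (Finset.sum_congr rfl fun i _ => ?_)
      exact (map_smul (dChart n x y) _ _).trans (congrArg _ (hW i y hy'))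
    have key : ∀ w : EuclideanSpace ℝ (Fin n), ∑ i, (f y * b.repr w i) • (f y • b i) =
        (f y * f y) • w := fun w => by
      conv_rhs => rw [← b.sum_repr w]
      rw [Finset.smul_sum]
      refine Finset.sum_congr rfl fun i _ => ?_
      rw [smul_smul, smul_smul]
      congr 1
      ring
    exact h2.trans ((key _).trans (map_smul (dChart n x y) (f y * f y) (V y)).symm)
  have h1 := D.smul_field _ V (∑ i, cW i) a hsq hsum x
  have hfx : f x = 1 := hf1.self_of_nhds
  rw [hfx, one_mul, one_smul] at h1
  rw [← h1, D.toFun_sum_field]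
  refine Finset.sum_eq_zero fun i _ => ?_
  rw [D.smul_field (c i) (W i) (cW i) a (hcs i) (fun _ => rfl) x]
  have : c i x = 0 := by
    have h2 : dChart n x x (V x) = 0 := by rw [hV]; exact map_zero _
    simp only [hc, h2, map_zero, mul_zero]
  rw [this, zero_smul]

/-- The covariant derivative at `x` depends on the value of the field at `x` only. -/
theorem toFun_congr_field {V W : SmoothVectorField n X} (a : SmoothSection n A E) {x : X}
    (h : V x = W x) : D.toFun V a x = D.toFun W a x := by
  have h1 := D.add_field W (V - W) a x
  rw [add_sub_cancel] at h1
  rw [h1, D.toFun_eq_zero_of_field a (V := V - W) (by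
    change V x - W x = 0
    rw [h, sub_self]), add_zero]

/-- The covariant derivative at `x` depends on the germ of the section at `x` only. -/
theorem toFun_congr_section [ContMDiffVectorBundle ∞ A E (𝓡 n)] (V : SmoothVectorField n X)
    {a b : SmoothSection n A E} {x : X}
    (h : ∀ᶠ y in 𝓝 x, a y = b y) : D.toFun V a x = D.toFun V b x := by
  -- by the Leibniz rule, multiplication by a function that is one near `x` does not change the
  -- covariant derivative at `x`
  obtain ⟨f, hf, hfs, -, hf1, -⟩ := exists_cutoff n h
  have hfx : f x = 1 := hf1.self_of_nhds
  let c : SmoothSection n A E := ⟨fun y => f y • a y, hf.smul_section a.contMDiff⟩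
  have hcb : ∀ y, c y = f y • b y := fun y => by
    change f y • a y = f y • b y
    by_cases hy : f y = 0
    · rw [hy, zero_smul, zero_smul]
    · have : a y = b y := hfs (subset_tsupport f hy)
      rw [this]
  have h1 := D.leibniz f V a c hf (fun _ => rfl) x
  have h2 := D.leibniz f V b c hf hcb x
  rw [deriveFunction_eq_zero hf1, hfx, one_smul, zero_smul, add_zero] at h1 h2
  exact h1.symm.trans h2

end HermitianConnection

end ConnectionLocality

/-! ### Christoffel symbols -/

section Christoffel
open Filter Topology

variable {n : ℕ} {X : Type*} [EMetricSpace X] [ChartedSpace (EuclideanSpace ℝ (Fin n)) X]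
  [IsManifold (𝓡 n) ∞ X]
  {A : Type*} [NonUnitalCStarAlgebra A] {E : X → Type*} [∀ x, NonUnitalCStarAlgebra (E x)]
  [TopologicalSpace (TotalSpace A E)] [FiberBundle A E] [VectorBundle ℝ A E]
  [ContMDiffVectorBundle ∞ A E (𝓡 n)]

theorem contMDiffOn_fibreCoord (p : X) (σ : SmoothSection n A E) :
    ContMDiffOn (𝓡 n) 𝓘(ℝ, A) ∞ (fun x => fibreCoord A p (σ x)) (trivSet A E p) :=
  ((trivializationAt A E p).contMDiffOn_section_baseSet_iff (s := fun x => σ x)).1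
    σ.contMDiff.contMDiffOn

/-- The pointwise norms of a family of bounded operators that is strongly continuous on a compact
set are bounded. -/
theorem exists_bound_of_strong_continuousOn {F F' : Type*} [NormedAddCommGroup F]
    [NormedSpace ℝ F] [CompleteSpace F] [NormedAddCommGroup F'] [NormedSpace ℝ F'] {Y : Type*}
    [TopologicalSpace Y] {K : Set Y} (hK : IsCompact K) {L : Y → F →L[ℝ] F'}
    (hL : ∀ a, ContinuousOn (fun y => L y a) K) : ∃ C, ∀ y ∈ K, ‖L y‖ ≤ C := by
  obtain ⟨C, hC⟩ := banach_steinhaus (g := fun y : K => L y) fun a => by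
    obtain ⟨C, hC⟩ := hK.exists_bound_of_continuousOn (hL a)
    exact ⟨C, fun y => hC y y.2⟩
  exact ⟨C, fun y hy => hC ⟨y, hy⟩⟩

/-- The Christoffel symbols `Γ` of a Hermitian connection in a local trivialization: on an open set,
`∇_V σ = dσ(V) + Γ(V) σ`. The operators `Γ(v)` are *-derivations of `A`, hence bounded. -/
theorem exists_christoffel (hE : IsCStarBundle A E) (D : HermitianConnection n A E) (p : X) :
    ∃ N : Set X, IsOpen N ∧ p ∈ N ∧ N ⊆ trivSet A E p ∧ N ⊆ (extChartAt (𝓡 n) p).source ∧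
    ∃ Γ : X → EuclideanSpace ℝ (Fin n) →L[ℝ] A →L[ℝ] A,
      (∃ M, ∀ x ∈ N, ‖Γ x‖ ≤ M) ∧ (∀ v a, ContinuousOn (fun x => Γ x v a) N) ∧
      (∀ x ∈ N, ∀ v, (∀ a b, Γ x v (a * b) = a * Γ x v b + Γ x v a * b) ∧
        (∀ a, Γ x v (star a) = star (Γ x v a)) ∧ ∀ (z : ℂ) a, Γ x v (z • a) = z • Γ x v a) ∧
      ∀ x ∈ N, ∀ (V : SmoothVectorField n X) (σ : SmoothSection n A E),
        fibreCoord A p (D.toFun V σ x) =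
          fderiv ℝ (fun u => fibreCoord A p (σ ((extChartAt (𝓡 n) p).symm u)))
            (extChartAt (𝓡 n) p x) (dChart n p x (V x)) +
          Γ x (dChart n p x (V x)) (fibreCoord A p (σ x)) := by
  have hOopen : IsOpen (trivSet A E p ∩ (extChartAt (𝓡 n) p).source) :=
    (isOpen_trivSet p).inter (isOpen_extChartAt_source p)
  obtain ⟨f, hf, hfO, hfc, hf1, -⟩ := exists_cutoff n
    (hOopen.mem_nhds ⟨mem_trivSet p, mem_extChartAt_source p⟩)
  obtain ⟨N₀, hN₀f, hN₀open, hpN₀⟩ := eventually_nhds_iff.1 hf1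
  have hfev : ∀ x ∈ N₀, ∀ᶠ y in 𝓝 x, f y = 1 := fun x hx =>
    (hN₀open.mem_nhds hx : N₀ ∈ 𝓝 x) |> mem_of_superset <| fun y hy => hN₀f y hy
  have hN₀O : ∀ x ∈ N₀, x ∈ trivSet A E p ∧ x ∈ (extChartAt (𝓡 n) p).source := fun x hx =>
    hfO (subset_tsupport f (by rw [Function.mem_support, hN₀f x hx]; exact one_ne_zero))
  choose s hs using fun a : A => exists_cutoff_section (E := E) hf hOopen inter_subset_left hfO
    (h := fun _ => a) contMDiffOn_const
  choose W hW hW0 using exists_cutoff_field hf (hfO.trans inter_subset_right)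
  have hsx : ∀ x ∈ N₀, ∀ a, s a x = ofFibreCoord E p x a := fun x hx a => by
    rw [hs, hN₀f x hx, one_smul]
  have hWx : ∀ x ∈ N₀, ∀ v, dChart n p x (W v x) = v := fun x hx v => by
    rw [hW v x (hN₀O x hx).2, hN₀f x hx, one_smul]
  have hWV : ∀ x ∈ N₀, ∀ V : SmoothVectorField n X, V x = W (dChart n p x (V x)) x := fun x hx V =>
    dChart_injective (hN₀O x hx).2 (hWx x hx _).symm
  -- the Christoffel symbol at `x` in the direction `v`, a *-derivation
  have hder : ∀ x ∈ N₀, ∀ v, ∃ δ : A →L[ℝ] A,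
      (∀ a, δ a = fibreCoord A p (D.toFun (W v) (s a) x)) ∧
      (∀ a b, δ (a * b) = a * δ b + δ a * b) ∧ (∀ a, δ (star a) = star (δ a)) ∧
      ∀ (z : ℂ) a, δ (z • a) = z • δ a := by
    intro x hx v
    obtain ⟨hxt, hxs⟩ := hN₀O x hx
    let δ : A →ₗ[ℂ] A :=
      { toFun := fun a => fibreCoord A p (D.toFun (W v) (s a) x)
        map_add' := fun a b => by
          rw [← fibreCoord_add hE hxt, ← D.add_section, D.toFun_congr_section]
          filter_upwards [hN₀open.mem_nhds hx] with y hy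
          change _ = s a y + s b y
          rw [hsx y hy, hsx y hy, hsx y hy, ofFibreCoord_add hE (hN₀O y hy).1]
        map_smul' := fun z a => by
          rw [D.smul_section z (W v) (s a) (s (z • a)) (fun y => ?_) x, fibreCoord_smul hE hxt]
          · rfl
          rw [hs, hs]
          by_cases hy : f y = 0
          · rw [hy, zero_smul, zero_smul, smul_zero]
          · rw [ofFibreCoord_smul hE (hfO (subset_tsupport f hy)).1, smul_comm] }
    have hδmul : ∀ a b, δ (a * b) = a * δ b + δ a * b := by
      intro a b
      let c : SmoothSection n A E := ⟨fun y => f y • s (a * b) y, hf.smul_section (s (a * b)).contMDiff⟩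
      have hc : ∀ y, c y = s a y * s b y := fun y => by
        change f y • s (a * b) y = _
        rw [hs, hs, hs]
        by_cases hy : f y = 0
        · rw [hy, zero_smul, zero_smul, zero_mul]
        · rw [ofFibreCoord_mul hE (hfO (subset_tsupport f hy)).1, smul_mul_smul_comm, mul_smul]
      have h1 := D.mul_section (W v) (s a) (s b) c hc x
      have h2 : D.toFun (W v) c x = D.toFun (W v) (s (a * b)) x := by
        refine D.toFun_congr_section _ ?_
        filter_upwards [hfev x hx] with y hy
        change f y • s (a * b) y = _
        rw [hy, one_smul]
      change fibreCoord A p (D.toFun (W v) (s (a * b)) x) = a * fibreCoord A p (D.toFun (W v) (s b) x)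
        + fibreCoord A p (D.toFun (W v) (s a) x) * b
      rw [← h2, h1, fibreCoord_add hE hxt, fibreCoord_mul hE hxt, fibreCoord_mul hE hxt, hsx x hx,
        hsx x hx, fibreCoord_ofFibreCoord hxt, fibreCoord_ofFibreCoord hxt]
    have hδstar : ∀ a, δ (star a) = star (δ a) := by
      intro a
      change fibreCoord A p (D.toFun (W v) (s (star a)) x) = star (fibreCoord A p (D.toFun (W v) (s a) x))
      rw [D.star_section (W v) (s a) (s (star a)) (fun y => ?_) x, fibreCoord_star hE hxt]
      rw [hs, hs]
      by_cases hy : f y = 0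
      · rw [hy, zero_smul, zero_smul, star_zero]
      · rw [ofFibreCoord_star hE (hfO (subset_tsupport f hy)).1, star_smul, star_trivial (f y)]
    have hδc := continuous_of_star_derivation δ hδmul hδstar
    exact ⟨(⟨δ.restrictScalars ℝ, hδc⟩ : A →L[ℝ] A), fun a => rfl, hδmul, hδstar,
      fun z a => δ.map_smul z a⟩
  have hlin : ∀ x, ∃ Γ : EuclideanSpace ℝ (Fin n) →L[ℝ] A →L[ℝ] A, x ∈ N₀ →
      ∀ v, (∀ a, Γ v a = fibreCoord A p (D.toFun (W v) (s a) x)) ∧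
        (∀ a b, Γ v (a * b) = a * Γ v b + Γ v a * b) ∧ (∀ a, Γ v (star a) = star (Γ v a)) ∧
        ∀ (z : ℂ) a, Γ v (z • a) = z • Γ v a := by
    intro x
    by_cases hx : x ∈ N₀
    · obtain ⟨hxt, hxs⟩ := hN₀O x hx
      choose δ hδ using hder x hx
      let Γ : EuclideanSpace ℝ (Fin n) →ₗ[ℝ] A →L[ℝ] A :=
        { toFun := δ
          map_add' := fun v w => by
            ext a
            rw [_root_.add_apply, (hδ _).1, (hδ _).1, (hδ _).1, ← fibreCoord_add hE hxt, ← D.add_field]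
            refine congrArg _ (D.toFun_congr_field _ (dChart_injective hxs ?_))
            rw [hWx x hx]
            change _ = dChart n p x (W v x + W w x)
            refine (Eq.trans ?_ (map_add (dChart n p x) _ _).symm)
            exact congrArg₂ (· + ·) (hWx x hx v).symm (hWx x hx w).symm
          map_smul' := fun c v => by
            ext a
            rw [_root_.smul_apply, (hδ _).1, (hδ _).1, RingHom.id_apply, ← fibreCoord_real_smul hE hxt]
            let cW : SmoothVectorField n X := ⟨fun y => (fun _ => c) y • W v y,
              (contMDiff_const (c := c)).smul_section (W v).contMDiff⟩
            rw [← D.smul_field (fun _ => c) (W v) cW (s a) contMDiff_const (fun _ => rfl) x]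
            refine congrArg _ (D.toFun_congr_field _ (dChart_injective hxs ?_))
            rw [hWx x hx]
            exact (Eq.trans (congrArg (c • ·) (hWx x hx v).symm) (map_smul (dChart n p x) c _).symm) }
      exact ⟨Γ.toContinuousLinearMap, fun _ => hδ⟩
    · exact ⟨0, fun h => absurd h hx⟩
  choose Γ hΓ using hlin
  have hΓcont : ∀ v a, ContinuousOn (fun x => Γ x v a) N₀ := fun v a =>
    (((contMDiffOn_fibreCoord p (D.toFun (W v) (s a))).continuousOn).mono
      fun x hx => (hN₀O x hx).1).congr fun x hx => (hΓ x hx v).1 a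
  have : LocallyCompactSpace X := ChartedSpace.locallyCompactSpace (EuclideanSpace ℝ (Fin n)) X
  obtain ⟨K, hK, hKN₀, hKc⟩ := local_compact_nhds (hN₀open.mem_nhds hpN₀)
  -- the symbols are only strongly continuous; the uniform bound comes from the principle of uniform
  -- boundedness on a compact neighbourhood
  have hbound : ∃ M, ∀ x ∈ K, ‖Γ x‖ ≤ M := by
    obtain ⟨M, hM⟩ := banach_steinhaus (g := fun x : K => Γ x) fun v => by
      obtain ⟨C, hC⟩ := exists_bound_of_strong_continuousOn hKc (L := fun x => Γ x v)
        fun a => (hΓcont v a).mono hKN₀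
      exact ⟨C, fun x => hC x x.2⟩
    exact ⟨M, fun x hx => hM ⟨x, hx⟩⟩
  obtain ⟨M, hM⟩ := hbound
  have hNN₀ : interior K ⊆ N₀ := interior_subset.trans hKN₀
  refine ⟨interior K, isOpen_interior, mem_interior_iff_mem_nhds.2 hK,
    fun x hx => (hN₀O x (hNN₀ hx)).1, fun x hx => (hN₀O x (hNN₀ hx)).2, Γ,
    ⟨M, fun x hx => hM x (interior_subset hx)⟩, fun v a => (hΓcont v a).mono hNN₀,
    fun x hx v => (hΓ x (hNN₀ hx) v).2, fun x hx V σ => ?_⟩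
  replace hx := hNN₀ hx
  obtain ⟨hxt, hxs⟩ := hN₀O x hx
  set v := dChart n p x (V x) with hv
  rw [D.toFun_congr_field σ (hWV x hx V), ← hv]
  -- Hadamard's lemma for the local representative of `σ`
  set φ := extChartAt (𝓡 n) p with hφ
  have hg : ContMDiff (𝓡 n) 𝓘(ℝ, A) ∞ fun y => f y • fibreCoord A p (σ y) := by
    refine contMDiff_of_tsupport fun y hy => ?_
    have hy' := (hfO (tsupport_smul_subset_left f (fun y => fibreCoord A p (σ y)) hy)).1
    exact hf.contMDiffAt.smul ((contMDiffOn_fibreCoord p σ).contMDiffAt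
      ((isOpen_trivSet p).mem_nhds hy'))
  have hgc : HasCompactSupport fun y => f y • fibreCoord A p (σ y) :=
    HasCompactSupport.smul_right (f := f) (f' := fun y => fibreCoord A p (σ y)) hfc
  have hgs : tsupport (fun y => f y • fibreCoord A p (σ y)) ⊆ φ.source :=
    (tsupport_smul_subset_left f (fun y => fibreCoord A p (σ y))).trans
      (hfO.trans inter_subset_right)
  have hh := contDiff_zeroExtension hg hgc hgs
  set h := φ.target.indicator fun u => f (φ.symm u) • fibreCoord A p (σ (φ.symm u)) with hh_def
  obtain ⟨τ, hτ, hτ1, hτ2⟩ := exists_contDiff_hadamard hh (φ x)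
  have hhy : ∀ y ∈ N₀, h (φ y) = fibreCoord A p (σ y) := fun y hy => by
    rw [hh_def, indicator_of_mem (φ.map_source (hN₀O y hy).2), φ.left_inv (hN₀O y hy).2, hN₀f y hy,
      one_smul]
  let b := Module.finBasis ℝ (EuclideanSpace ℝ (Fin n))
  have hTs : ∀ i, ∃ T : SmoothSection n A E, ∀ y, T y = f y • ofFibreCoord E p y (τ (φ y) (b i)) := by
    intro i
    refine exists_cutoff_section hf hOopen inter_subset_left hfO ?_
    have h1 : ContDiff ℝ ∞ fun u => τ u (b i) := hτ.clm_apply contDiff_const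
    exact (h1.contMDiff.comp_contMDiffOn (contMDiffOn_extChartAt (x := p))).mono
      (fun y hy => by have := hy.2; rwa [hφ, extChartAt_source] at this)
  choose T hT using hTs
  set ℓ : Fin _ → EuclideanSpace ℝ (Fin n) →L[ℝ] ℝ := fun i => (b.coord i).toContinuousLinearMap
  have hℓ : ∀ w, ∑ i, ℓ i w • b i = w := fun w => b.sum_repr w
  set c : Fin _ → X → ℝ := fun i y => f y • ℓ i (φ y - φ x) with hc_def
  have hc : ∀ i, ContMDiff (𝓡 n) 𝓘(ℝ, ℝ) ∞ (c i) := by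
    intro i
    refine contMDiff_of_tsupport fun y hy => ?_
    have hy' := (hfO (tsupport_smul_subset_left f (fun y => ℓ i (φ y - φ x)) hy)).2
    have h1 : ContDiff ℝ ∞ fun u => ℓ i (u - φ x) := (ℓ i).contDiff.comp (contDiff_id.sub contDiff_const)
    exact hf.contMDiffAt.smul (h1.contMDiff.contMDiffAt.comp y (contMDiffAt_extChartAt_of_mem hy'))
  let cT : Fin _ → SmoothSection n A E := fun i => ⟨fun y => c i y • T i y,
    (hc i).smul_section (T i).contMDiff⟩
  -- near `x`, the section `σ` is a section with constant coordinates plus a combination of sections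
  -- whose coefficients `c i` vanish at `x`; of these only the derivatives of `c i` contribute
  have hloc : ∀ᶠ y in 𝓝 x, σ y = (s (h (φ x)) + ∑ i, cT i : SmoothSection n A E) y := by
    filter_upwards [hN₀open.mem_nhds hx] with y hy
    have hyt := (hN₀O y hy).1
    have h1 : (s (h (φ x)) + ∑ i, cT i : SmoothSection n A E) y =
        s (h (φ x)) y + ∑ i, c i y • T i y :=
      congrArg (s (h (φ x)) y + ·)
        (map_sum (AddMonoidHom.mk' (fun a : SmoothSection n A E => a y) fun _ _ => rfl) cT _)
    refine fibreCoord_injective hyt ?_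
    have hsum : fibreCoord A p (∑ i, c i y • T i y) = ∑ i, c i y • τ (φ y) (b i) := by
      simp only [← coordEquiv_apply hE hyt, map_sum]
      refine Finset.sum_congr rfl fun i _ => ?_
      rw [coordEquiv_apply, fibreCoord_real_smul hE hyt, hT, hN₀f y hy, one_smul,
        fibreCoord_ofFibreCoord hyt]
    rw [h1, fibreCoord_add hE hyt, hsx y hy, fibreCoord_ofFibreCoord hyt, hsum, ← hhy y hy, hτ1]
    congr 1
    conv_lhs => rw [← hℓ (φ y - φ x)]
    rw [map_sum]
    refine Finset.sum_congr rfl fun i _ => ?_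
    rw [map_smul, hc_def]
    simp only [hN₀f y hy, one_smul]
  rw [D.toFun_congr_section (W v) hloc, D.add_section, D.toFun_sum_section, fibreCoord_add hE hxt,
    hhy x hx, ← (hΓ x hx v).1, add_comm]
  congr 1
  have hterm : ∀ i, D.toFun (W v) (cT i) x = ℓ i v • ofFibreCoord E p x (τ (φ x) (b i)) := by
    intro i
    rw [D.leibniz (c i) (W v) (T i) (cT i) (hc i) (fun _ => rfl) x]
    have hc0 : c i x = 0 := by simp only [hc_def, sub_self, map_zero, smul_zero]
    have hdc : SmoothVectorField.deriveFunction (W v) (c i) x = ℓ i v := by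
      have h1 : c i =ᶠ[𝓝 x] fun y => ℓ i (φ y - φ x) := by
        filter_upwards [hfev x hx] with y hy
        simp only [hc_def, hy, one_smul]
      rw [SmoothVectorField.deriveFunction, h1.mfderiv_eq]
      have h2 : HasFDerivAt (fun u => ℓ i (u - φ x)) (ℓ i) (φ x) := by
        have h3 : HasFDerivAt (fun u => ℓ i (u - φ x)) ((ℓ i).comp (ContinuousLinearMap.id ℝ _))
          (φ x) := (ℓ i).hasFDerivAt.comp (φ x) ((hasFDerivAt_id (φ x)).sub_const (φ x))
        rwa [ContinuousLinearMap.comp_id] at h3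
      have h3 := ((contMDiffAt_extChartAt_of_mem hxs).mdifferentiableAt (by simp)).hasMFDerivAt
      have h4 := (h2.hasMFDerivAt.comp x h3).mfderiv
      refine (DFunLike.congr_fun h4 (W v x)).trans ?_
      change ℓ i (dChart n p x (W v x)) = _
      rw [hWx x hx]
    rw [hc0, hdc, zero_smul, zero_add, hT, hN₀f x hx, one_smul]
  have hfd : fderiv ℝ (fun u => fibreCoord A p (σ (φ.symm u))) (φ x) = fderiv ℝ h (φ x) := by
    refine Filter.EventuallyEq.fderiv_eq ?_
    have h1 : ContinuousAt φ.symm (φ x) := continuousAt_extChartAt_symm' hxs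
    have h2 : ∀ᶠ u in 𝓝 (φ x), φ.symm u ∈ N₀ := h1.eventually (by
      rw [φ.left_inv hxs]; exact hN₀open.mem_nhds hx)
    filter_upwards [h2, (isOpen_extChartAt_target p).mem_nhds (φ.map_source hxs)] with u hu hu2
    rw [← hhy _ hu, φ.right_inv hu2]
  rw [Finset.sum_congr rfl fun i _ => hterm i, hfd, ← hτ2]
  conv_rhs => rw [← hℓ v, map_sum]
  simp only [← coordEquiv_apply hE hxt, map_sum]
  refine Finset.sum_congr rfl fun i _ => ?_
  rw [coordEquiv_apply, fibreCoord_real_smul hE hxt, fibreCoord_ofFibreCoord hxt, map_smul]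

end Christoffel

/-! ### The parallel equation in a trivialization -/

section ParallelEquation
open Filter Topology

variable {n : ℕ} {X : Type*} [EMetricSpace X] [ChartedSpace (EuclideanSpace ℝ (Fin n)) X]
  [IsManifold (𝓡 n) ∞ X]
  {A : Type*} [NonUnitalCStarAlgebra A] {E : X → Type*} [∀ x, NonUnitalCStarAlgebra (E x)]
  [TopologicalSpace (TotalSpace A E)] [FiberBundle A E] [VectorBundle ℝ A E]
  [ContMDiffVectorBundle ∞ A E (𝓡 n)]

theorem fibreCoord_neg (hE : IsCStarBundle A E) {p x : X} (hx : x ∈ trivSet A E p) (v : E x) :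
    fibreCoord A p (-v) = -fibreCoord A p v := by
  simp only [← coordEquiv_apply hE hx, map_neg]

/-- The derivative of a section along a curve at a zero of the section does not depend on the
trivialization. -/
theorem hasDerivWithinAt_change_triv (n : ℕ) {X : Type*} [EMetricSpace X]
    [ChartedSpace (EuclideanSpace ℝ (Fin n)) X] [IsManifold (𝓡 n) ∞ X]
    {A : Type*} [NonUnitalCStarAlgebra A] {E : X → Type*} [∀ x, NonUnitalCStarAlgebra (E x)]
    [TopologicalSpace (TotalSpace A E)] [FiberBundle A E] [VectorBundle ℝ A E]
    [ContMDiffVectorBundle ∞ A E (𝓡 n)] (hE : IsCStarBundle A E)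
    {γ : ℝ → X} {S : Set ℝ} {t₀ : ℝ}
    (hγ : MDifferentiableWithinAt 𝓘(ℝ, ℝ) (𝓡 n) γ S t₀) {p q : X} (hp : γ t₀ ∈ trivSet A E p)
    (hq : γ t₀ ∈ trivSet A E q) {u : ∀ t, E (γ t)} (hu : u t₀ = 0) {w : E (γ t₀)}
    (h : HasDerivWithinAt (fun t => fibreCoord A p (u t)) (fibreCoord A p w) S t₀) :
    HasDerivWithinAt (fun t => fibreCoord A q (u t)) (fibreCoord A q w) S t₀ := by
  set C : X → A →L[ℝ] A := fun y =>
    ((trivializationAt A E p).coordChangeL ℝ (trivializationAt A E q) y : A →L[ℝ] A)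
  have hC : ∀ y, y ∈ trivSet A E p → y ∈ trivSet A E q → ∀ v : E y,
      C y (fibreCoord A p v) = fibreCoord A q v := by
    intro y h1 h2 v
    have h3 := Trivialization.coordChangeL_apply (R := ℝ) (trivializationAt A E p)
      (trivializationAt A E q) (b := y) ⟨h1, h2⟩ (fibreCoord A p v)
    exact h3.trans (congrArg (fun v => fibreCoord A q v) (ofFibreCoord_fibreCoord h1 v))
  have hCd : DifferentiableWithinAt ℝ (fun t => C (γ t)) S t₀ := by
    have h1 : MDifferentiableAt (𝓡 n) 𝓘(ℝ, A →L[ℝ] A) C (γ t₀) :=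
      (contMDiffAt_coordChangeL (IB := 𝓡 n) (n := ∞) hp hq).mdifferentiableAt (by simp)
    exact (h1.comp_mdifferentiableWithinAt t₀ hγ).differentiableWithinAt
  have h1 := hCd.hasDerivWithinAt.clm_apply h
  rw [hu, fibreCoord_zero hE hp, map_zero, zero_add, hC _ hp hq] at h1
  refine h1.congr_of_eventuallyEq ?_ ?_
  · filter_upwards [hγ.continuousWithinAt.eventually ((isOpen_trivSet p).mem_nhds hp),
      hγ.continuousWithinAt.eventually ((isOpen_trivSet q).mem_nhds hq)] with t h2 h3
    exact (hC _ h2 h3 _).symm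
  · change _ = C (γ t₀) (fibreCoord A p (u t₀))
    rw [hC _ hp hq]

/-- The condition of being parallel, at a single time. -/
def HermitianConnection.IsParallelAt (D : HermitianConnection n A E) (γ : ℝ → X)
    (s : ∀ t : ℝ, E (γ t)) (t₀ : ℝ) : Prop :=
  ∀ (V : SmoothVectorField n X) (σ : SmoothSection n A E),
    V (γ t₀) = mfderivWithin 𝓘(ℝ, ℝ) (𝓡 n) γ (Icc 0 1) t₀ (1 : ℝ) →
    σ (γ t₀) = s t₀ →
      HasDerivWithinAt
        (fun t => (trivializationAt A E (γ t₀) ⟨γ t, s t⟩).2 -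
          (trivializationAt A E (γ t₀) ⟨γ t, σ (γ t)⟩).2)
        (-(trivializationAt A E (γ t₀) ⟨γ t₀, D.toFun V σ (γ t₀)⟩).2) (Icc 0 1) t₀

theorem HermitianConnection.IsParallelAt.congr {D : HermitianConnection n A E} {γ : ℝ → X}
    {s s' : ∀ t : ℝ, E (γ t)} {t₀ : ℝ} (ht₀ : t₀ ∈ Icc (0 : ℝ) 1) (h : D.IsParallelAt γ s t₀)
    (hs : ∀ᶠ t in 𝓝[Icc 0 1] t₀, s' t = s t) : D.IsParallelAt γ s' t₀ := by
  intro V σ hV hσ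
  have h0 := hs.self_of_nhdsWithin ht₀
  refine (h V σ hV (hσ.trans h0)).congr_of_eventuallyEq (hs.mono fun t ht => ?_) ?_
  · simp only [ht]
  · simp only [h0]

/-- In a local trivialization, parallel sections are the solutions of a linear differential
equation. -/
theorem isParallelAt_iff_hasDerivWithinAt (hE : IsCStarBundle A E) (D : HermitianConnection n A E)
    {p : X} {γ : ℝ → X} {t₀ : ℝ} (ht₀ : t₀ ∈ Icc (0 : ℝ) 1)
    (hγ : MDifferentiableWithinAt 𝓘(ℝ, ℝ) (𝓡 n) γ (Icc 0 1) t₀)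
    (hp : γ t₀ ∈ trivSet A E p) (hps : γ t₀ ∈ (extChartAt (𝓡 n) p).source)
    {Γ : EuclideanSpace ℝ (Fin n) →L[ℝ] A →L[ℝ] A}
    (hΓ : ∀ (V : SmoothVectorField n X) (σ : SmoothSection n A E),
        fibreCoord A p (D.toFun V σ (γ t₀)) =
          fderiv ℝ (fun u => fibreCoord A p (σ ((extChartAt (𝓡 n) p).symm u)))
            (extChartAt (𝓡 n) p (γ t₀)) (dChart n p (γ t₀) (V (γ t₀))) +
          Γ (dChart n p (γ t₀) (V (γ t₀))) (fibreCoord A p (σ (γ t₀))))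
    (s : ∀ t : ℝ, E (γ t)) :
    D.IsParallelAt γ s t₀ ↔ HasDerivWithinAt (fun t => fibreCoord A p (s t))
      (-Γ (dChart n p (γ t₀) (velocity n γ t₀)) (fibreCoord A p (s t₀))) (Icc 0 1) t₀ := by
  set φ := extChartAt (𝓡 n) p
  have hq := mem_trivSet (A := A) (E := E) (γ t₀)
  have hev : ∀ r : X, γ t₀ ∈ trivSet A E r → ∀ᶠ t in 𝓝[Icc 0 1] t₀, γ t ∈ trivSet A E r :=
    fun r hr => hγ.continuousWithinAt.eventually ((isOpen_trivSet r).mem_nhds hr)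
  have hσd : ∀ σ : SmoothSection n A E, HasDerivWithinAt (fun t => fibreCoord A p (σ (γ t)))
      (fderiv ℝ (fun u => fibreCoord A p (σ (φ.symm u))) (φ (γ t₀))
        (dChart n p (γ t₀) (velocity n γ t₀))) (Icc 0 1) t₀ := by
    intro σ
    have h1 := hasDerivWithinAt_extChartAt_comp hγ hps
    have h2 : DifferentiableAt ℝ (fun u => fibreCoord A p (σ (φ.symm u))) (φ (γ t₀)) := by
      have h3 : ContMDiffAt (𝓡 n) 𝓘(ℝ, A) ∞ (fun x => fibreCoord A p (σ x))
          (φ.symm (φ (γ t₀))) := by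
        rw [φ.left_inv hps]
        exact (contMDiffOn_fibreCoord p σ).contMDiffAt ((isOpen_trivSet p).mem_nhds hp)
      exact ((h3.comp _ (contMDiffAt_extChartAt_symm_of_mem (φ.map_source hps))).contDiffAt
        ).differentiableAt (by simp)
    refine (h2.hasFDerivAt.comp_hasDerivWithinAt t₀ h1).congr_of_eventuallyEq ?_ ?_
    · filter_upwards [eventually_mem_extChartAt_source hγ.continuousWithinAt hps] with t ht
      exact congrArg (fun y => fibreCoord A p (σ y)) (φ.left_inv ht).symm
    · exact congrArg (fun y => fibreCoord A p (σ y)) (φ.left_inv hps).symm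
  have hiff : ∀ (V : SmoothVectorField n X) (σ : SmoothSection n A E),
      V (γ t₀) = velocity n γ t₀ → σ (γ t₀) = s t₀ →
      (HasDerivWithinAt (fun t => fibreCoord A (γ t₀) (s t) - fibreCoord A (γ t₀) (σ (γ t)))
        (-(fibreCoord A (γ t₀) (D.toFun V σ (γ t₀)))) (Icc 0 1) t₀ ↔
      HasDerivWithinAt (fun t => fibreCoord A p (s t))
      (-Γ (dChart n p (γ t₀) (velocity n γ t₀)) (fibreCoord A p (s t₀))) (Icc 0 1) t₀) := by
    intro V σ hV hσ
    have hsub : ∀ r : X, γ t₀ ∈ trivSet A E r → ∀ w,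
        (HasDerivWithinAt (fun t => fibreCoord A r (s t) - fibreCoord A r (σ (γ t)))
          w (Icc 0 1) t₀ ↔
        HasDerivWithinAt (fun t => fibreCoord A r (s t - σ (γ t))) w (Icc 0 1) t₀) := by
      intro r hr w
      have h1 : (fun t => fibreCoord A r (s t) - fibreCoord A r (σ (γ t))) =ᶠ[𝓝[Icc 0 1] t₀]
          fun t => fibreCoord A r (s t - σ (γ t)) :=
        (hev r hr).mono fun t ht => (fibreCoord_sub hE ht _ _).symm
      exact h1.hasDerivWithinAt_iff (h1.self_of_nhdsWithin ht₀)
    have h0 : s t₀ - σ (γ t₀) = 0 := by rw [hσ, sub_self]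
    have hw := hΓ V σ
    have hw2 : fibreCoord A p (D.toFun V σ (γ t₀)) =
        fderiv ℝ (fun u => fibreCoord A p (σ (φ.symm u))) (φ (γ t₀))
          (dChart n p (γ t₀) (velocity n γ t₀)) +
        Γ (dChart n p (γ t₀) (velocity n γ t₀)) (fibreCoord A p (s t₀)) := by
      rw [hw, hσ]
      have : dChart n p (γ t₀) (V (γ t₀)) = dChart n p (γ t₀) (velocity n γ t₀) :=
        congrArg (dChart n p (γ t₀)) hV
      rw [this]
    rw [hsub _ hq, ← fibreCoord_neg hE hq]
    have hch : HasDerivWithinAt (fun t => fibreCoord A (γ t₀) (s t - σ (γ t)))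
        (fibreCoord A (γ t₀) (-D.toFun V σ (γ t₀))) (Icc 0 1) t₀ ↔
        HasDerivWithinAt (fun t => fibreCoord A p (s t - σ (γ t)))
        (fibreCoord A p (-D.toFun V σ (γ t₀))) (Icc 0 1) t₀ :=
      ⟨fun h => hasDerivWithinAt_change_triv n hE hγ hq hp (u := fun t => s t - σ (γ t)) h0 h,
       fun h => hasDerivWithinAt_change_triv n hE hγ hp hq (u := fun t => s t - σ (γ t)) h0 h⟩
    rw [hch, ← hsub _ hp, fibreCoord_neg hE hp, hw2]
    constructor
    · intro h
      refine ((h.add (hσd σ)).congr_deriv (by abel)).congr_of_eventuallyEq ?_ ?_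
      · exact Eventually.of_forall fun t => by simp
      · simp
    · intro h
      exact (h.sub (hσd σ)).congr_deriv (by abel)
  constructor
  · intro h
    -- realize the velocity and the value of `s` at `t₀` by a global field and a global section
    obtain ⟨f, hf, hfO, -, hf1, -⟩ := exists_cutoff n
      (((isOpen_trivSet (A := A) (E := E) p).inter (isOpen_extChartAt_source (I := 𝓡 n) p)).mem_nhds
        ⟨hp, hps⟩)
    have hf1' : f (γ t₀) = 1 := hf1.self_of_nhds
    obtain ⟨V, hV, -⟩ := exists_cutoff_field hf (hfO.trans inter_subset_right)
      (dChart n p (γ t₀) (velocity n γ t₀))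
    obtain ⟨σ, hσ⟩ := exists_cutoff_section (E := E) hf (isOpen_trivSet p) subset_rfl
      (hfO.trans inter_subset_left) (h := fun _ => fibreCoord A p (s t₀)) contMDiffOn_const
    have h1 : V (γ t₀) = velocity n γ t₀ := dChart_injective hps (by
      rw [hV _ hps, hf1', one_smul])
    have h2 : σ (γ t₀) = s t₀ := by rw [hσ, hf1', one_smul, ofFibreCoord_fibreCoord hp]
    exact (hiff V σ h1 h2).1 (h V σ h1 h2)
  · exact fun h V σ h1 h2 => (hiff V σ h1 h2).2 h

end ParallelEquation

/-! ### Translates of sections and vector fields -/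

section Translates
open Filter Topology

variable {n : ℕ} {G X : Type*} [Group G] [EMetricSpace X]
  [ChartedSpace (EuclideanSpace ℝ (Fin n)) X] [IsManifold (𝓡 n) ∞ X] [MulAction G X]
  {A : Type*} [NonUnitalCStarAlgebra A] {E : X → Type*} [∀ x, NonUnitalCStarAlgebra (E x)]
  [TopologicalSpace (TotalSpace A E)] [FiberBundle A E] [VectorBundle ℝ A E]
  [ContMDiffVectorBundle ∞ A E (𝓡 n)] [MulAction G (TotalSpace A E)]

/-- The isomorphism `E x ≃ E (g x)` given by the action of `g`. -/
def fibreSMul (hGE : IsSmoothEquivariantBundle n G A E) (g : G) (x : X) : E x ≃⋆ₐ[ℂ] E (g • x) :=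
  (hGE.smul_fibre g x).choose

theorem smul_mk (hGE : IsSmoothEquivariantBundle n G A E) (g : G) (x : X) (v : E x) :
    g • (⟨x, v⟩ : TotalSpace A E) = ⟨g • x, fibreSMul hGE g x v⟩ :=
  (hGE.smul_fibre g x).choose_spec v

theorem totalSpace_smul_proj (hGE : IsSmoothEquivariantBundle n G A E) (g : G)
    (v : TotalSpace A E) : (g • v).proj = g • v.proj := by
  rw [show v = ⟨v.proj, v.2⟩ from rfl, smul_mk hGE]

theorem exists_smul_eq (hGE : IsSmoothEquivariantBundle n G A E) (g : G) (y : X) (v : E (g⁻¹ • y)) :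
    ∃ w : E y, (⟨y, w⟩ : TotalSpace A E) = g • ⟨g⁻¹ • y, v⟩ := by
  have h : g • g⁻¹ • y = y := smul_inv_smul g y
  have h2 := smul_mk hGE g _ v
  rw [h2]
  generalize fibreSMul hGE g (g⁻¹ • y) v = w
  revert w
  rw [h]
  exact fun w => ⟨w, rfl⟩

/-- The translate `(g σ)(g x) = g (σ x)` of a smooth section. -/
theorem exists_smul_section (hG : ∀ g : G, ContMDiff (𝓡 n) (𝓡 n) ∞ (fun x : X => g • x))
    (hGE : IsSmoothEquivariantBundle n G A E) (g : G) (σ : SmoothSection n A E) :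
    ∃ σ' : SmoothSection n A E, ∀ x, (⟨g • x, σ' (g • x)⟩ : TotalSpace A E) = g • ⟨x, σ x⟩ := by
  choose w hw using fun y => exists_smul_eq hGE g y (σ (g⁻¹ • y))
  refine ⟨⟨w, ?_⟩, fun x => ?_⟩
  · have h1 := (hGE.contMDiff_smul g).comp (σ.contMDiff.comp (hG g⁻¹))
    refine h1.congr fun y => ?_
    exact hw y
  · refine (hw (g • x)).trans ?_
    rw [inv_smul_smul]

theorem tangent_mk_eq {x y : X} (h : x = y) (v : EuclideanSpace ℝ (Fin n)) :
    (⟨x, v⟩ : TangentBundle (𝓡 n) X) = ⟨y, v⟩ := by rw [h]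

/-- The translate `(g V)(g x) = dg (V x)` of a smooth vector field. -/
theorem exists_smul_field (hG : ∀ g : G, ContMDiff (𝓡 n) (𝓡 n) ∞ (fun x : X => g • x)) (g : G)
    (V : SmoothVectorField n X) :
    ∃ V' : SmoothVectorField n X,
      ∀ x, V' (g • x) = mfderiv (𝓡 n) (𝓡 n) (fun x : X => g • x) x (V x) := by
  refine ⟨⟨fun y => dMap n (fun x : X => g • x) (g⁻¹ • y) (V (g⁻¹ • y)), ?_⟩, fun x => ?_⟩
  · have h1 := ((hG g).contMDiff_tangentMap (m := ∞) (by simp)).comp (V.contMDiff.comp (hG g⁻¹))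
    refine h1.congr fun y => ?_
    exact (tangent_mk_eq (smul_inv_smul g y) _).symm
  · change dMap n (fun x : X => g • x) (g⁻¹ • g • x) (V (g⁻¹ • g • x)) =
      dMap n (fun x : X => g • x) x (V x)
    rw [inv_smul_smul]

/-- The action of `g` on the fibres, in local trivializations at the source and at the target. -/
theorem exists_smul_coord (hG : ∀ g : G, ContMDiff (𝓡 n) (𝓡 n) ∞ (fun x : X => g • x))
    (hE : IsCStarBundle A E)
    (hGE : IsSmoothEquivariantBundle n G A E) (g : G) (p q : X) :
    ∃ H : X → A →L[ℝ] A,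
      (∀ x ∈ trivSet A E p, g • x ∈ trivSet A E q → ∀ v : E x,
        H x (fibreCoord A p v) = fibreCoord A q (fibreSMul hGE g x v)) ∧
      ContMDiffOn (𝓡 n) 𝓘(ℝ, A →L[ℝ] A) ∞ H
        {x | x ∈ trivSet A E p ∧ g • x ∈ trivSet A E q} := by
  classical
  -- the action of `g` in the trivializations, as a linear isometry
  set Hx : ∀ x, x ∈ trivSet A E p → g • x ∈ trivSet A E q → (A ≃⋆ₐ[ℂ] A) := fun x h1 h2 =>
    ((coordEquiv hE h1).symm.trans (fibreSMul hGE g x)).trans (coordEquiv hE h2)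
  set H : X → A →L[ℝ] A := fun x =>
    if h : x ∈ trivSet A E p ∧ g • x ∈ trivSet A E q then
      LinearMap.mkContinuous
        { toFun := Hx x h.1 h.2
          map_add' := fun a b => map_add _ a b
          map_smul' := fun c a => map_smul (Hx x h.1 h.2) (c : ℂ) a } 1
        (fun a => by
          rw [one_mul]
          exact (StarAlgEquiv.norm_map (Hx x h.1 h.2) a).le)
    else 0 with hHdef
  have hH : ∀ x ∈ trivSet A E p, g • x ∈ trivSet A E q → ∀ v : E x,
        H x (fibreCoord A p v) = fibreCoord A q (fibreSMul hGE g x v) := by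
    intro x h1 h2 v
    simp only [hHdef, dif_pos (And.intro h1 h2)]
    change coordEquiv hE h2 (fibreSMul hGE g x ((coordEquiv hE h1).symm (fibreCoord A p v))) = _
    rw [coordEquiv_symm_apply, ofFibreCoord_fibreCoord h1, coordEquiv_apply]
  refine ⟨H, hH, ?_⟩
  set S := {x | x ∈ trivSet A E p ∧ g • x ∈ trivSet A E q} with hS
  have hSo : IsOpen S := (isOpen_trivSet p).inter ((isOpen_trivSet q).preimage (hG g).continuous)
  intro x₀ hx₀
  refine ContMDiffAt.contMDiffWithinAt ?_
  set φ := extChartAt (𝓡 n) x₀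
  set U := φ.target ∩ φ.symm ⁻¹' S with hU
  have hUo : IsOpen U := (continuousOn_extChartAt_symm x₀).isOpen_inter_preimage
    (isOpen_extChartAt_target x₀) hSo
  have hφs : ContMDiffOn 𝓘(ℝ, EuclideanSpace ℝ (Fin n)) (𝓡 n) ∞ φ.symm U :=
    (contMDiffOn_extChartAt_symm x₀).mono inter_subset_left
  -- the joint map `(u, a) ↦ H (φ⁻¹ u) a`, which is smooth since `g` acts smoothly on `E`
  set Θ : EuclideanSpace ℝ (Fin n) × A → A := fun z => H (φ.symm z.1) z.2
  have hΘ : ContDiffOn ℝ ∞ Θ (U ×ˢ univ) := by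
    have hpt : ContMDiffOn (𝓘(ℝ, EuclideanSpace ℝ (Fin n)).prod 𝓘(ℝ, A)) ((𝓡 n).prod 𝓘(ℝ, A)) ∞
        (fun z : EuclideanSpace ℝ (Fin n) × A => (φ.symm z.1, z.2)) (U ×ˢ univ) :=
      hφs.prodMap contMDiffOn_id
    have h1 := (trivializationAt A E p).contMDiffOn_symm (IB := 𝓡 n) (n := ∞)
    have h2 : ContMDiffOn (𝓘(ℝ, EuclideanSpace ℝ (Fin n)).prod 𝓘(ℝ, A)) ((𝓡 n).prod 𝓘(ℝ, A)) ∞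
        (fun z : EuclideanSpace ℝ (Fin n) × A =>
          g • (trivializationAt A E p).toOpenPartialHomeomorph.symm (φ.symm z.1, z.2))
          (U ×ˢ univ) := by
      refine (hGE.contMDiff_smul g).comp_contMDiffOn (h1.comp hpt fun z hz => ?_)
      rw [Trivialization.target_eq]
      exact ⟨hz.1.2.1, mem_univ _⟩
    have heq : ∀ z ∈ U ×ˢ (univ : Set A),
        (trivializationAt A E p).toOpenPartialHomeomorph.symm (φ.symm z.1, z.2) =
          (⟨φ.symm z.1, ofFibreCoord E p (φ.symm z.1) z.2⟩ : TotalSpace A E) := fun z hz =>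
      ((trivializationAt A E p).mk_symm hz.1.2.1 z.2).symm
    have h3 := (trivializationAt A E q).contMDiffOn (IB := 𝓡 n) (n := ∞)
    have h4 := h3.comp h2 fun z hz => by
      rw [mem_preimage, Trivialization.mem_source, heq z hz, totalSpace_smul_proj hGE]
      exact hz.1.2.2
    have h5 := contMDiff_snd.comp_contMDiffOn h4
    rw [← contMDiffOn_iff_contDiffOn, modelWithCornersSelf_prod, ← chartedSpaceSelf_prod]
    refine h5.congr fun z hz => ?_
    simp only [Function.comp]
    rw [heq z hz, smul_mk hGE]
    change H (φ.symm z.1) z.2 = fibreCoord A q _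
    rw [← hH _ hz.1.2.1 hz.1.2.2, fibreCoord_ofFibreCoord hz.1.2.1]
  have hUo' : IsOpen (U ×ˢ (univ : Set A)) := hUo.prod isOpen_univ
  have hfd : ContDiffOn ℝ ∞ (fun u => (fderiv ℝ Θ (u, 0)).comp
      (ContinuousLinearMap.inr ℝ (EuclideanSpace ℝ (Fin n)) A)) U := by
    have h1 : ContDiffOn ℝ ∞ (fderiv ℝ Θ) (U ×ˢ univ) :=
      hΘ.fderiv_of_isOpen hUo' (by simp)
    have h2 : ContDiffOn ℝ ∞ (fun u : EuclideanSpace ℝ (Fin n) => fderiv ℝ Θ (u, 0)) U :=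
      h1.comp (contDiff_id.prodMk contDiff_const).contDiffOn fun u hu => ⟨hu, mem_univ _⟩
    exact h2.clm_comp contDiffOn_const
  have hval : ∀ u ∈ U, H (φ.symm u) = (fderiv ℝ Θ (u, 0)).comp
      (ContinuousLinearMap.inr ℝ (EuclideanSpace ℝ (Fin n)) A) := by
    intro u hu
    ext a
    have h1 : HasFDerivAt Θ (fderiv ℝ Θ (u, 0)) (u, 0) :=
      ((hΘ.contDiffAt (hUo'.mem_nhds ⟨hu, mem_univ _⟩)).differentiableAt (by simp)).hasFDerivAt
    have h2 : HasFDerivAt (fun a : A => Θ (u, a)) ((fderiv ℝ Θ (u, 0)).comp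
      (ContinuousLinearMap.inr ℝ (EuclideanSpace ℝ (Fin n)) A)) 0 :=
      h1.comp (0 : A) (hasFDerivAt_prodMk_right u (0 : A))
    have h3 : HasFDerivAt (fun a : A => Θ (u, a)) (H (φ.symm u)) 0 := (H (φ.symm u)).hasFDerivAt
    rw [h3.unique h2]
  have hx₀U : φ x₀ ∈ U := ⟨mem_extChartAt_target x₀, by
    rw [mem_preimage, extChartAt_to_inv]; exact hx₀⟩
  have h6 : ContDiffAt ℝ ∞ (fun u => H (φ.symm u)) (φ x₀) :=
    (hfd.congr hval).contDiffAt (hUo.mem_nhds hx₀U)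
  have h7 := h6.contMDiffAt.comp x₀ (contMDiffAt_extChartAt (I := 𝓡 n) (x := x₀) (n := ∞))
  refine h7.congr_of_eventuallyEq ?_
  filter_upwards [extChartAt_source_mem_nhds (I := 𝓡 n) x₀] with x hx
  exact congrArg H (φ.left_inv hx).symm

end Translates

/-! ### The parallel equation along a family of geodesic segments -/

section ParallelODE
open Filter Topology

variable {n : ℕ} {X : Type*} [EMetricSpace X] [ChartedSpace (EuclideanSpace ℝ (Fin n)) X]
  [IsManifold (𝓡 n) ∞ X] [RiemannianBundle (fun x : X => TangentSpace (𝓡 n) x)]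
  [IsContMDiffRiemannianBundle (𝓡 n) ∞ (EuclideanSpace ℝ (Fin n))
      (fun x : X => TangentSpace (𝓡 n) x)] [IsRiemannianManifold (𝓡 n) X]
  {A : Type*} [NonUnitalCStarAlgebra A] {E : X → Type*} [∀ x, NonUnitalCStarAlgebra (E x)]
  [TopologicalSpace (TotalSpace A E)] [FiberBundle A E] [VectorBundle ℝ A E]
  [ContMDiffVectorBundle ∞ A E (𝓡 n)]

/-- The geodesic segment joining a pair of points of `U`. -/
def shortSegment (n : ℕ) {X : Type*} [EMetricSpace X] [ChartedSpace (EuclideanSpace ℝ (Fin n)) X]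
    [IsManifold (𝓡 n) ∞ X] [RiemannianBundle (fun x : X => TangentSpace (𝓡 n) x)] {r : X → ℝ}
    (b : shortPairs r) : ℝ → X :=
  geodesicSegment n b.1.1 b.1.2

/-- Over the pairs `b ∈ B` and the short interval `[α, β]`, the sections along the geodesic segments
are given, in the trivialization at `p`, by functions with values in `A`, and the parallel ones are
the solutions of the linear equation `s' = L b t s` whose coefficients are *-derivations of `A`. -/
structure ParallelODE (D : HermitianConnection n A E) {r : X → ℝ} (p : X) (B : Set (shortPairs r))
    (α β M : ℝ) (L : shortPairs r → ℝ → A →L[ℝ] A) : Prop where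
  subset : Icc α β ⊆ Icc 0 1
  mem_trivSet : ∀ b ∈ B, ∀ t ∈ Icc α β, shortSegment n b t ∈ trivSet A E p
  nonneg : 0 ≤ M
  small : M * (β - α) ≤ 1 / 2
  bound : ∀ b ∈ B, ∀ t ∈ Icc α β, ‖L b t‖ ≤ M
  iff : ∀ b ∈ B, ∀ t ∈ Icc α β, ∀ s : ∀ t, E (shortSegment n b t),
    D.IsParallelAt (shortSegment n b) s t ↔
      HasDerivWithinAt (fun t => fibreCoord A p (s t)) (L b t (fibreCoord A p (s t))) (Icc 0 1) t
  derivation : ∀ b ∈ B, ∀ t ∈ Icc α β, (∀ a c, L b t (a * c) = a * L b t c + L b t a * c) ∧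
    (∀ a, L b t (star a) = star (L b t a)) ∧ ∀ (z : ℂ) a, L b t (z • a) = z • L b t a
  continuousOn : ∀ a, ContinuousOn (fun q : shortPairs r × ℝ => L q.1 q.2 a) (B ×ˢ Icc α β)

/-- For families of operators, strong continuity and a uniform bound suffice for the joint
continuity of the evaluation at a varying vector. -/
theorem continuousOn_clm_apply_of_bound {Y V F F' : Type*} [TopologicalSpace Y]
    [NormedAddCommGroup V] [NormedSpace ℝ V] [NormedAddCommGroup F] [NormedSpace ℝ F]
    [NormedAddCommGroup F'] [NormedSpace ℝ F'] {S : Set Y} {Λ : Y → V →L[ℝ] F →L[ℝ] F'}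
    {M : ℝ} (hM : ∀ y ∈ S, ‖Λ y‖ ≤ M) (hΛ : ∀ v a, ContinuousOn (fun y => Λ y v a) S) {w : Y → V}
    (hw : ContinuousOn w S) (a : F) : ContinuousOn (fun y => Λ y (w y) a) S := by
  intro y₀ hy₀
  have h1 : Tendsto (fun y => Λ y (w y - w y₀) a) (𝓝[S] y₀) (𝓝 0) := by
    have h2 : Tendsto (fun y => M * ‖w y - w y₀‖ * ‖a‖) (𝓝[S] y₀) (𝓝 0) := by
      have h3 : Tendsto (fun y => w y - w y₀) (𝓝[S] y₀) (𝓝 0) := by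
        simpa using (hw y₀ hy₀).tendsto.sub_const (w y₀)
      simpa using (h3.norm.const_mul M).mul_const ‖a‖
    refine squeeze_zero_norm' ?_ h2
    filter_upwards [self_mem_nhdsWithin] with y hy
    refine (ContinuousLinearMap.le_opNorm _ _).trans ?_
    gcongr
    exact ((Λ y).le_opNorm _).trans (by gcongr; exact hM y hy)
  have h2 := h1.add (hΛ (w y₀) a y₀ hy₀).tendsto
  rw [zero_add] at h2
  refine h2.congr fun y => ?_
  rw [map_sub]
  simp

/-- Parallel transport along geodesic segments is locally given by linear differential equations. -/
theorem exists_parallelODE [CompleteSpace X] {G : Type*} [Group G] [MulAction G X]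
    (hE : IsCStarBundle A E) (D : HermitianConnection n A E) {r : X → ℝ}
    (hr : IsGeodesicRadius n G r) (b₀ : shortPairs r) {t₀ : ℝ} (ht₀ : t₀ ∈ Icc (0 : ℝ) 1) :
    ∃ (p : X) (B : Set (shortPairs r)) (α β M : ℝ) (L : shortPairs r → ℝ → A →L[ℝ] A),
      B ∈ 𝓝 b₀ ∧ (∀ᶠ t in 𝓝[Icc 0 1] t₀, Icc α β ∈ 𝓝[Icc 0 1] t) ∧
      ParallelODE D p B α β M L := by
  set P := geodesicHomotopy n r
  have hPc : Continuous P := continuous_geodesicHomotopy hr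
  set q₀ : shortPairs r × unitInterval := (b₀, ⟨t₀, ht₀⟩) with hq₀
  set p := P q₀
  obtain ⟨N, hNo, hpN, hNt, hNs, Γ, ⟨M₀, hM₀⟩, hΓc, hΓd, hΓ⟩ := exists_christoffel hE D p
  set w : shortPairs r × unitInterval → EuclideanSpace ℝ (Fin n) := fun q =>
    dChart n p (P q) (velocity n (shortSegment n q.1) q.2) with hw
  have hwc : ContinuousOn w (P ⁻¹' N) := fun q hq =>
    (continuousAt_velocity hr (hNs hq)).continuousWithinAt
  set R := ‖w q₀‖ + 1
  have hO : {q | q ∈ P ⁻¹' N ∧ ‖w q‖ < R} ∈ 𝓝 (b₀, (⟨t₀, ht₀⟩ : unitInterval)) := by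
    have h1 : P ⁻¹' N ∈ 𝓝 q₀ := (hNo.preimage hPc).mem_nhds hpN
    filter_upwards [h1, ((hwc.continuousAt h1).norm.eventually (Iio_mem_nhds (lt_add_one _)))]
      with q h2 h3 using ⟨h2, h3⟩
  rw [nhds_prod_eq] at hO
  obtain ⟨B, hB, T, hT, hBT⟩ := mem_prod_iff.1 hO
  obtain ⟨ε, hε, hεT⟩ := Metric.mem_nhds_iff.1 hT
  set M := |M₀| * R with hM
  have hR : 0 < R := by positivity
  have hM0 : 0 ≤ M := by positivity
  -- the interval has length at most `2 δ`, and `M * (2 δ) ≤ 1 / 2`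
  set δ := min (ε / 2) (1 / (4 * (M + 1))) with hδ
  have hδ0 : 0 < δ := lt_min (by positivity) (by positivity)
  set α := max 0 (t₀ - δ) with hα
  set β := min 1 (t₀ + δ) with hβ
  have hJI : Icc α β ⊆ Icc 0 1 := Icc_subset_Icc (le_max_left _ _) (min_le_left _ _)
  set pr : ℝ → unitInterval := projIcc 0 1 zero_le_one with hpr
  have hprI : ∀ t ∈ Icc (0 : ℝ) 1, (pr t : ℝ) = t := fun t ht => by
    rw [hpr, projIcc_of_mem _ ht]
  have hJT : ∀ t ∈ Icc α β, pr t ∈ T := by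
    intro t ht
    refine hεT ?_
    rw [Metric.mem_ball, Subtype.dist_eq, hprI t (hJI ht), Real.dist_eq]
    have h1 := (le_max_right _ _).trans ht.1
    have h2 := ht.2.trans (min_le_right _ _)
    have h3 : δ ≤ ε / 2 := min_le_left _ _
    rw [abs_lt]
    constructor <;> linarith
  have hJO : ∀ b ∈ B, ∀ t ∈ Icc α β, P (b, pr t) ∈ N ∧ ‖w (b, pr t)‖ < R := fun b hb t ht =>
    hBT ⟨hb, hJT t ht⟩
  have hPt : ∀ b : shortPairs r, ∀ t ∈ Icc (0 : ℝ) 1, P (b, pr t) = shortSegment n b t :=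
    fun b t ht => congrArg (shortSegment n b) (hprI t ht)
  refine ⟨p, B, α, β, M, fun b t => -Γ (P (b, pr t)) (w (b, pr t)), hB, ?_, hJI, ?_, hM0, ?_, ?_,
    ?_, ?_, ?_⟩
  · have h1 : ∀ᶠ t in 𝓝 t₀, t ∈ Ioo (t₀ - δ) (t₀ + δ) :=
      Ioo_mem_nhds (by linarith) (by linarith)
    filter_upwards [mem_nhdsWithin_of_mem_nhds h1] with t ht
    filter_upwards [mem_nhdsWithin_of_mem_nhds (Ioo_mem_nhds ht.1 ht.2), self_mem_nhdsWithin]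
      with s hs hsI
    exact ⟨max_le hsI.1 hs.1.le, le_min hsI.2 hs.2.le⟩
  · intro b hb t ht
    rw [← hPt b t (hJI ht)]
    exact hNt (hJO b hb t ht).1
  · have h1 : β - α ≤ 2 * δ := by
      have := le_max_right 0 (t₀ - δ)
      have := min_le_right 1 (t₀ + δ)
      linarith
    have h2 : δ ≤ 1 / (4 * (M + 1)) := min_le_right _ _
    calc M * (β - α) ≤ M * (2 * (1 / (4 * (M + 1)))) := by gcongr; linarith
      _ = (M / (M + 1)) / 2 := by field_simp; ring
      _ ≤ 1 / 2 := by
        have : M / (M + 1) ≤ 1 := (div_le_one (by positivity)).2 (by linarith)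
        linarith
  · intro b hb t ht
    obtain ⟨h1, h2⟩ := hJO b hb t ht
    rw [norm_neg]
    exact ((Γ _).le_opNorm _).trans
      (mul_le_mul ((hM₀ _ h1).trans (le_abs_self _)) h2.le (norm_nonneg _) (abs_nonneg _))
  · intro b hb t ht s
    obtain ⟨h1, -⟩ := hJO b hb t ht
    have h3 := hPt b t (hJI ht)
    have hgeo := (hr.isGeodesicSegment b.2).isGeodesic
    have h4 : shortSegment n b t ∈ N := h3 ▸ h1
    have key := isParallelAt_iff_hasDerivWithinAt hE D (hJI ht) (γ := shortSegment n b)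
      (hgeo.mdifferentiableWithinAt (hJI ht)) (hNt h4) (hNs h4) (hΓ _ h4) s
    rw [key]
    have h5 : w (b, pr t) = dChart n p (shortSegment n b t) (velocity n (shortSegment n b) t) := by
      simp only [hw]
      rw [h3, hprI t (hJI ht)]
    change _ ↔ HasDerivWithinAt _ ((-Γ (P (b, pr t)) (w (b, pr t))) _) _ _
    rw [h5, h3]
    rfl
  · intro b hb t ht
    obtain ⟨h1, h2, h3⟩ := hΓd _ (hJO b hb t ht).1 (w (b, pr t))
    refine ⟨fun a c => ?_, fun a => ?_, fun z a => ?_⟩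
    · simp only [_root_.neg_apply, h1]
      noncomm_ring
    · simp only [_root_.neg_apply, h2, star_neg]
    · simp only [_root_.neg_apply, h3, smul_neg]
  · intro a
    have h1 : ContinuousOn (fun q => Γ (P q) (w q) a) (P ⁻¹' N) :=
      continuousOn_clm_apply_of_bound (Λ := fun q => Γ (P q)) (fun q hq => hM₀ _ hq)
        (fun v a => (hΓc v a).comp hPc.continuousOn fun q hq => hq) hwc a
    have h2 : Continuous (fun q : shortPairs r × ℝ => (q.1, pr q.2)) :=
      continuous_fst.prodMk (continuous_projIcc.comp continuous_snd)
    refine ((h1.comp h2.continuousOn fun q hq => ?_).neg).congr fun q hq => ?_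
    · exact (hJO _ hq.1 _ hq.2).1
    · simp [Function.comp]

variable {D : HermitianConnection n A E} {r : X → ℝ} {p : X} {B : Set (shortPairs r)} {α β M : ℝ}
  {L : shortPairs r → ℝ → A →L[ℝ] A}

theorem ParallelODE.hasDerivWithinAt (h : ParallelODE D p B α β M L) {b : shortPairs r}
    (hb : b ∈ B) {s : ∀ t, E (shortSegment n b t)} {t : ℝ} (ht : t ∈ Icc α β)
    (hs : D.IsParallelAt (shortSegment n b) s t) :
    HasDerivWithinAt (fun t => fibreCoord A p (s t)) (L b t (fibreCoord A p (s t))) (Icc α β) t :=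
  ((h.iff b hb t ht s).1 hs).mono h.subset

theorem ParallelODE.exists_solution (h : ParallelODE D p B α β M L) {b : shortPairs r}
    (hb : b ∈ B) {t₁ : ℝ} (ht₁ : t₁ ∈ Icc α β) (a : E (shortSegment n b t₁)) :
    ∃ s : ∀ t, E (shortSegment n b t), s t₁ = a ∧ ∀ t ∈ Icc α β,
      HasDerivWithinAt (fun t => fibreCoord A p (s t)) (L b t (fibreCoord A p (s t)))
        (Icc α β) t := by
  obtain ⟨c, hc1, hc⟩ := exists_linear_ode_solution h.nonneg h.small (h.bound b hb)
    (fun a => (h.continuousOn a).comp (Continuous.prodMk_right b).continuousOn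
      fun t ht => ⟨hb, ht⟩) ht₁ (fibreCoord A p a)
  have hcc : ∀ t ∈ Icc α β, fibreCoord A p (ofFibreCoord E p (shortSegment n b t) (c t)) = c t :=
    fun t ht => fibreCoord_ofFibreCoord (h.mem_trivSet b hb t ht) _
  refine ⟨fun t => ofFibreCoord E p _ (c t), ?_, fun t ht => ?_⟩
  · change ofFibreCoord E p _ (c t₁) = a
    rw [hc1, ofFibreCoord_fibreCoord (h.mem_trivSet b hb t₁ ht₁)]
  · rw [hcc t ht]
    exact (hc t ht).congr (fun t ht => hcc t ht) (hcc t ht)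

/-- Uniqueness for the parallel equation on a short interval. -/
theorem ParallelODE.eqOn (h : ParallelODE D p B α β M L)
    {b : shortPairs r} (hb : b ∈ B)
    {s s' : ∀ t, E (shortSegment n b t)}
    (hs : ∀ t ∈ Icc α β, HasDerivWithinAt (fun t => fibreCoord A p (s t))
      (L b t (fibreCoord A p (s t))) (Icc α β) t)
    (hs' : ∀ t ∈ Icc α β, HasDerivWithinAt (fun t => fibreCoord A p (s' t))
      (L b t (fibreCoord A p (s' t))) (Icc α β) t) {t₁ : ℝ} (ht₁ : t₁ ∈ Icc α β)
    (h1 : s t₁ = s' t₁) : ∀ t ∈ Icc α β, s t = s' t := by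
  intro t ht
  have key := norm_le_of_linear_ode (w := fun t => fibreCoord A p (s t) - fibreCoord A p (s' t))
    (f := fun _ => 0) (ε := 0) h.nonneg h.small (h.bound b hb)
    (fun t ht => ((hs t ht).sub (hs' t ht)).congr_deriv (by rw [map_sub, add_zero]))
    (fun t _ => by simp) ht₁ t ht
  rw [h1, sub_self, norm_zero, mul_zero, add_zero, mul_zero] at key
  exact fibreCoord_injective (h.mem_trivSet b hb t ht)
    (sub_eq_zero.1 (norm_le_zero_iff.1 key))

end ParallelODE

/-! ### Existence and algebra of parallel sections -/

section ParallelSections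
open Filter Topology

variable {n : ℕ} {X : Type*} [EMetricSpace X] [ChartedSpace (EuclideanSpace ℝ (Fin n)) X]
  [IsManifold (𝓡 n) ∞ X] [RiemannianBundle (fun x : X => TangentSpace (𝓡 n) x)]
  [IsContMDiffRiemannianBundle (𝓡 n) ∞ (EuclideanSpace ℝ (Fin n))
      (fun x : X => TangentSpace (𝓡 n) x)] [IsRiemannianManifold (𝓡 n) X] [CompleteSpace X]
  {A : Type*} [NonUnitalCStarAlgebra A] {E : X → Type*} [∀ x, NonUnitalCStarAlgebra (E x)]
  [TopologicalSpace (TotalSpace A E)] [FiberBundle A E] [VectorBundle ℝ A E]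
  [ContMDiffVectorBundle ∞ A E (𝓡 n)]
  {G : Type*} [Group G] [MulAction G X]

/-- A local property propagates along the unit interval. -/
theorem forall_unitInterval_of_local {P : ℝ → ℝ → Prop}
    (h : ∀ t₀ ∈ Icc (0 : ℝ) 1, ∃ J : Set ℝ, (∀ᶠ t in 𝓝[Icc 0 1] t₀, J ∈ 𝓝[Icc 0 1] t) ∧
      ∀ t ∈ Icc (0 : ℝ) 1, ∀ t' ∈ Icc (0 : ℝ) 1, J ∈ 𝓝[Icc 0 1] t → J ∈ 𝓝[Icc 0 1] t' → P t t')
    (htrans : ∀ t, ∀ t' ∈ Icc (0 : ℝ) 1, ∀ t'', P t t' → P t' t'' → P t t'') {t t' : ℝ} (ht : t ∈ Icc (0 : ℝ) 1)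
    (ht' : t' ∈ Icc (0 : ℝ) 1) : P t t' := by
  refine isPreconnected_Icc.induction₂' P (fun x hx => ?_)
    (fun x y z _ hy _ => htrans x y hy z) ht ht'
  obtain ⟨J, hJ, hP⟩ := h x hx
  filter_upwards [hJ, self_mem_nhdsWithin] with y hy hyI
  have := hJ.self_of_nhdsWithin hx
  exact ⟨hP x hx y hyI this hy, hP y hyI x hx hy this⟩

variable {D : HermitianConnection n A E} {r : X → ℝ}

/-- Being parallel is a condition on derivatives within `[0, 1]`; for solutions on the short
interval `[α, β]` it holds at times of which `[α, β]` is a neighbourhood in `[0, 1]`. -/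
theorem ParallelODE.isParallelAt {p : X} {B : Set (shortPairs r)} {α β M : ℝ}
    {L : shortPairs r → ℝ → A →L[ℝ] A} (h : ParallelODE D p B α β M L) {b : shortPairs r}
    (hb : b ∈ B) {s : ∀ t, E (shortSegment n b t)}
    (hs : ∀ t ∈ Icc α β, HasDerivWithinAt (fun t => fibreCoord A p (s t))
      (L b t (fibreCoord A p (s t))) (Icc α β) t) {t : ℝ} (ht : t ∈ Icc (0 : ℝ) 1)
    (htJ : Icc α β ∈ 𝓝[Icc 0 1] t) : D.IsParallelAt (shortSegment n b) s t := by
  have h1 := mem_of_mem_nhdsWithin ht htJ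
  exact (h.iff b hb t h1 s).2 ((hs t h1).mono_of_mem_nhdsWithin htJ)

/-- A parallel section along a geodesic segment is determined by its value at one time. -/
theorem eq_of_isParallelAlong (hE : IsCStarBundle A E) (hr : IsGeodesicRadius n G r)
    {b : shortPairs r} {s s' : ∀ t, E (shortSegment n b t)}
    (hs : D.IsParallelAlong (shortSegment n b) s) (hs' : D.IsParallelAlong (shortSegment n b) s')
    {t t' : ℝ} (ht : t ∈ Icc (0 : ℝ) 1) (h : s t = s' t) (ht' : t' ∈ Icc (0 : ℝ) 1) :
    s t' = s' t' := by
  refine forall_unitInterval_of_local (P := fun t t' => s t = s' t → s t' = s' t') ?_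
    (fun _ _ _ _ h1 h2 h3 => h2 (h1 h3)) ht ht' h
  intro t₀ ht₀
  obtain ⟨p, B, α, β, M, L, hB, hJ, hode⟩ := exists_parallelODE hE D hr b ht₀
  refine ⟨Icc α β, hJ, fun t ht t' ht' h1 h2 h3 => ?_⟩
  have hb := mem_of_mem_nhds hB
  exact hode.eqOn hb (fun t ht => hode.hasDerivWithinAt hb ht (hs t (hode.subset ht)))
    (fun t ht => hode.hasDerivWithinAt hb ht (hs' t (hode.subset ht)))
    (mem_of_mem_nhdsWithin ht h1) h3 t' (mem_of_mem_nhdsWithin ht' h2)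

/-- Local solutions are continued step by step: the property that a solution with initial value `a`
exists beyond the time `t` propagates along the unit interval. -/
theorem exists_isParallelAlong_zero (hE : IsCStarBundle A E) (D : HermitianConnection n A E)
    (hr : IsGeodesicRadius n G r) {b : shortPairs r} (a : E (shortSegment n b 0)) :
    ∃ s, D.IsParallelAlong (shortSegment n b) s ∧ s 0 = a := by
  have h0 : (0 : ℝ) ∈ Icc (0 : ℝ) 1 := left_mem_Icc.2 zero_le_one
  set Q : ℝ → Prop := fun t => ∃ s : ∀ t, E (shortSegment n b t), s 0 = a ∧ ∃ ε > 0,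
    ∀ τ ∈ Icc (0 : ℝ) 1, τ < t + ε → D.IsParallelAt (shortSegment n b) s τ with hQ
  have hQ0 : Q 0 := by
    obtain ⟨p, B, α, β, M, L, hB, hJ, hode⟩ := exists_parallelODE hE D hr b h0
    have hb := mem_of_mem_nhds hB
    obtain ⟨s, hs0, hs⟩ := hode.exists_solution hb
      (mem_of_mem_nhdsWithin h0 (hJ.self_of_nhdsWithin h0)) a
    obtain ⟨ε, hε, h1⟩ := Metric.mem_nhdsWithin_iff.1 hJ
    refine ⟨s, hs0, ε, hε, fun τ hτ hτε => hode.isParallelAt hb hs hτ (h1 ⟨?_, hτ⟩)⟩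
    rw [zero_add] at hτε
    rw [Metric.mem_ball, Real.dist_eq, sub_zero, abs_of_nonneg hτ.1]
    exact hτε
  suffices h : Q 0 → Q 1 by
    obtain ⟨s, hs0, ε, hε, hs⟩ := h hQ0
    exact ⟨s, fun t ht => hs t ht (by linarith [ht.2]), hs0⟩
  refine forall_unitInterval_of_local (P := fun t t' => Q t → Q t') ?_
    (fun _ _ _ _ h1 h2 h3 => h2 (h1 h3)) h0 (right_mem_Icc.2 zero_le_one)
  intro t₀ ht₀
  obtain ⟨p, B, α, β, M, L, hB, hJ, hode⟩ := exists_parallelODE hE D hr b ht₀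
  have hb := mem_of_mem_nhds hB
  refine ⟨Icc α β, hJ, ?_⟩
  rintro t ht t' ht' h1 h2 ⟨s, hs0, ε, hε, hs⟩
  rcases le_or_gt t' t with htt | htt
  · exact ⟨s, hs0, ε, hε, fun τ hτ hτε => hs τ hτ (by linarith)⟩
  -- continue `s` beyond the time `t` by a local solution
  have htJ := mem_of_mem_nhdsWithin ht h1
  have htJ' := mem_of_mem_nhdsWithin ht' h2
  obtain ⟨s₂, hs₂t, hs₂⟩ := hode.exists_solution hb htJ (s t)
  obtain ⟨ε₁, hε₁, h1'⟩ := Metric.mem_nhdsWithin_iff.1 h1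
  obtain ⟨ε₂, hε₂, h2'⟩ := Metric.mem_nhdsWithin_iff.1 h2
  have hnhds : ∀ τ ∈ Icc (0 : ℝ) 1, t ≤ τ → τ < t' + ε₂ → Icc α β ∈ 𝓝[Icc 0 1] τ := by
    intro τ hτ hτ1 hτ2
    filter_upwards [self_mem_nhdsWithin, mem_nhdsWithin_of_mem_nhds
      (Ioo_mem_nhds (show t - ε₁ < τ by linarith) hτ2)] with u hu hu'
    rcases le_or_gt u t with h3 | h3
    · refine h1' ⟨?_, hu⟩
      rw [Metric.mem_ball, Real.dist_eq, abs_lt]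
      constructor <;> linarith [hu'.1]
    rcases le_or_gt u t' with h4 | h4
    · exact ⟨htJ.1.trans h3.le, h4.trans htJ'.2⟩
    · refine h2' ⟨?_, hu⟩
      rw [Metric.mem_ball, Real.dist_eq, abs_lt]
      constructor <;> linarith [hu'.2]
  set s' : ∀ t, E (shortSegment n b t) := fun τ => if τ ≤ t then s τ else s₂ τ with hs'
  have hle : ∀ τ, τ ≤ t → s' τ = s τ := fun τ h => if_pos h
  have hge : ∀ τ, t ≤ τ → s' τ = s₂ τ := by
    intro τ h
    rcases h.eq_or_lt with rfl | h
    · rw [hle _ le_rfl, hs₂t]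
    · exact if_neg (not_le.2 h)
  refine ⟨s', (hle 0 ht.1).trans hs0, ε₂, hε₂, fun τ hτ hτε => ?_⟩
  rcases lt_trichotomy τ t with h3 | h3 | h3
  · refine (hs τ hτ (by linarith)).congr hτ ?_
    filter_upwards [mem_nhdsWithin_of_mem_nhds (Iio_mem_nhds h3)] with u hu using hle u (le_of_lt hu)
  · subst h3
    rw [hode.iff b hb τ htJ]
    have h4 := (hode.iff b hb τ htJ s).1 (hs τ hτ (by linarith))
    have h5 : HasDerivWithinAt (fun t => fibreCoord A p (s₂ t)) (L b τ (fibreCoord A p (s τ)))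
        (Icc 0 1) τ :=
      hs₂t ▸ (hs₂ τ htJ).mono_of_mem_nhdsWithin h1
    have h6 : HasDerivWithinAt (fun t => fibreCoord A p (s' t)) (L b τ (fibreCoord A p (s τ)))
        (Icc 0 1 ∩ Iic τ ∪ Icc 0 1 ∩ Ici τ) τ := by
      refine HasDerivWithinAt.union ?_ ?_
      · exact (h4.mono inter_subset_left).congr (fun u hu => by rw [hle u hu.2])
          (by rw [hle τ le_rfl])
      · exact (h5.mono inter_subset_left).congr (fun u hu => by rw [hge u hu.2])
          (by rw [hge τ le_rfl])
    rw [← inter_union_distrib_left, Iic_union_Ici, inter_univ] at h6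
    rw [hle τ le_rfl]
    exact h6
  · refine (hode.isParallelAt hb hs₂ hτ (hnhds τ hτ h3.le hτε)).congr hτ ?_
    filter_upwards [mem_nhdsWithin_of_mem_nhds (Ioi_mem_nhds h3)] with u hu using hge u (le_of_lt hu)

/-- Parallel sections exist with a prescribed value at any time. Starting from the time `0`, this
propagates: for a value at `t'`, a local solution on an interval that contains `t` and `t'` is
traced back to `t`, where the assertion is known. -/
theorem exists_isParallelAlong (hE : IsCStarBundle A E) (D : HermitianConnection n A E)
    (hr : IsGeodesicRadius n G r) {b : shortPairs r} {t : ℝ} (ht : t ∈ Icc (0 : ℝ) 1)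
    (a : E (shortSegment n b t)) : ∃ s, D.IsParallelAlong (shortSegment n b) s ∧ s t = a := by
  refine forall_unitInterval_of_local (P := fun t t' =>
    (∀ a : E (shortSegment n b t), ∃ s, D.IsParallelAlong (shortSegment n b) s ∧ s t = a) →
    ∀ a : E (shortSegment n b t'), ∃ s, D.IsParallelAlong (shortSegment n b) s ∧ s t' = a) ?_
    (fun _ _ _ _ h1 h2 h3 => h2 (h1 h3)) (left_mem_Icc.2 zero_le_one) ht
    (exists_isParallelAlong_zero hE D hr) a
  intro t₀ ht₀
  obtain ⟨p, B, α, β, M, L, hB, hJ, hode⟩ := exists_parallelODE hE D hr b ht₀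
  have hb := mem_of_mem_nhds hB
  refine ⟨Icc α β, hJ, fun t ht t' ht' h1 h2 h3 a => ?_⟩
  have htJ := mem_of_mem_nhdsWithin ht h1
  have htJ' := mem_of_mem_nhdsWithin ht' h2
  obtain ⟨s₂, hs₂t, hs₂⟩ := hode.exists_solution hb htJ' a
  obtain ⟨s, hs, hst⟩ := h3 (s₂ t)
  refine ⟨s, hs, ?_⟩
  rw [← hs₂t]
  exact hode.eqOn hb (fun t ht => hode.hasDerivWithinAt hb ht (hs t (hode.subset ht))) hs₂ htJ hst
    t' htJ'

/-- Since the parallel equation is given by *-derivations, the pointwise operations of the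
C*-algebras `E x` preserve parallel sections. -/
theorem isParallelAlong_of_coord (hE : IsCStarBundle A E) (hr : IsGeodesicRadius n G r)
    {b : shortPairs r} {s : ∀ t, E (shortSegment n b t)}
    (h : ∀ (p : X) (J : Set ℝ) (δ : ℝ → A →L[ℝ] A),
      (∀ t ∈ J, (∀ a c, δ t (a * c) = a * δ t c + δ t a * c) ∧
        (∀ a, δ t (star a) = star (δ t a)) ∧ ∀ (z : ℂ) a, δ t (z • a) = z • δ t a) →
      (∀ t ∈ J, shortSegment n b t ∈ trivSet A E p) →
      (∀ t ∈ J, ∀ s, D.IsParallelAlong (shortSegment n b) s →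
        HasDerivWithinAt (fun t => fibreCoord A p (s t)) (δ t (fibreCoord A p (s t))) J t) →
      ∀ t ∈ J, HasDerivWithinAt (fun t => fibreCoord A p (s t)) (δ t (fibreCoord A p (s t))) J t) :
    D.IsParallelAlong (shortSegment n b) s := by
  intro t₀ ht₀
  obtain ⟨p, B, α, β, M, L, hB, hJ, hode⟩ := exists_parallelODE hE D hr b ht₀
  have hb := mem_of_mem_nhds hB
  refine hode.isParallelAt hb (h p (Icc α β) (L b) (hode.derivation b hb) (hode.mem_trivSet b hb)
    fun t ht s hs => hode.hasDerivWithinAt hb ht (hs t (hode.subset ht))) ht₀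
    (hJ.self_of_nhdsWithin ht₀)

variable (hE : IsCStarBundle A E) (hr : IsGeodesicRadius n G r)
include hE hr

theorem isParallelAlong_add {b : shortPairs r} {s s' : ∀ t, E (shortSegment n b t)}
    (hs : D.IsParallelAlong (shortSegment n b) s) (hs' : D.IsParallelAlong (shortSegment n b) s') :
    D.IsParallelAlong (shortSegment n b) (fun t => s t + s' t) := by
  refine isParallelAlong_of_coord hE hr fun p J δ hδ hJ hpar t ht => ?_
  rw [fibreCoord_add hE (hJ t ht), map_add]
  exact ((hpar t ht s hs).add (hpar t ht s' hs')).congr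
    (fun u hu => fibreCoord_add hE (hJ u hu) _ _) (fibreCoord_add hE (hJ t ht) _ _)

theorem isParallelAlong_mul {b : shortPairs r} {s s' : ∀ t, E (shortSegment n b t)}
    (hs : D.IsParallelAlong (shortSegment n b) s) (hs' : D.IsParallelAlong (shortSegment n b) s') :
    D.IsParallelAlong (shortSegment n b) (fun t => s t * s' t) := by
  refine isParallelAlong_of_coord hE hr fun p J δ hδ hJ hpar t ht => ?_
  rw [fibreCoord_mul hE (hJ t ht), (hδ t ht).1]
  exact ((ContinuousLinearMap.mul ℝ A).hasDerivWithinAt_of_bilinear (hpar t ht s hs)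
    (hpar t ht s' hs')).congr
    (fun u hu => fibreCoord_mul hE (hJ u hu) _ _) (fibreCoord_mul hE (hJ t ht) _ _)

theorem isParallelAlong_star {b : shortPairs r} {s : ∀ t, E (shortSegment n b t)}
    (hs : D.IsParallelAlong (shortSegment n b) s) :
    D.IsParallelAlong (shortSegment n b) (fun t => star (s t)) := by
  refine isParallelAlong_of_coord hE hr fun p J δ hδ hJ hpar t ht => ?_
  rw [fibreCoord_star hE (hJ t ht), (hδ t ht).2.1]
  exact ((hpar t ht s hs).star).congr
    (fun u hu => fibreCoord_star hE (hJ u hu) _) (fibreCoord_star hE (hJ t ht) _)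

theorem isParallelAlong_smul {b : shortPairs r} {s : ∀ t, E (shortSegment n b t)} (z : ℂ)
    (hs : D.IsParallelAlong (shortSegment n b) s) :
    D.IsParallelAlong (shortSegment n b) (fun t => z • s t) := by
  refine isParallelAlong_of_coord hE hr fun p J δ hδ hJ hpar t ht => ?_
  rw [fibreCoord_smul hE (hJ t ht), (hδ t ht).2.2]
  exact ((hpar t ht s hs).const_smul z).congr
    (fun u hu => fibreCoord_smul hE (hJ u hu) _ _) (fibreCoord_smul hE (hJ t ht) _ _)

omit hE hr in
/-- The value at time `t'` of the parallel section with a given value at time `t`. -/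
theorem exists_transport (hE : IsCStarBundle A E) (D : HermitianConnection n A E)
    (hr : IsGeodesicRadius n G r) (b : shortPairs r) {t t' : ℝ}
    (ht : t ∈ Icc (0 : ℝ) 1) (ht' : t' ∈ Icc (0 : ℝ) 1) :
    ∃ φ : E (shortSegment n b t) ≃⋆ₐ[ℂ] E (shortSegment n b t'),
      ∀ s, D.IsParallelAlong (shortSegment n b) s → φ (s t) = s t' := by
  choose S hS hSt using fun a : E (shortSegment n b t) => exists_isParallelAlong hE D hr ht a
  have key : ∀ a s, D.IsParallelAlong (shortSegment n b) s → s t = a → S a t' = s t' :=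
    fun a s hs h => eq_of_isParallelAlong hE hr (hS a) hs ht ((hSt a).trans h.symm) ht'
  -- uniqueness and the closure of parallel sections under the operations make the transport a
  -- homomorphism
  let f : E (shortSegment n b t) →⋆ₙₐ[ℂ] E (shortSegment n b t') :=
    { toFun := fun a => S a t'
      map_smul' := fun z a => key _ _ (isParallelAlong_smul hE hr z (hS a)) (by rw [hSt])
      map_zero' := (key _ _ (isParallelAlong_smul hE hr 0 (hS 0)) (by rw [zero_smul])).trans
        (zero_smul _ _)
      map_add' := fun a c => key _ _ (isParallelAlong_add hE hr (hS a) (hS c)) (by rw [hSt, hSt])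
      map_mul' := fun a c => key _ _ (isParallelAlong_mul hE hr (hS a) (hS c)) (by rw [hSt, hSt])
      map_star' := fun a => key _ _ (isParallelAlong_star hE hr (hS a)) (by rw [hSt]) }
  have hf : Function.Bijective f := by
    refine ⟨fun a c hac => ?_, fun a => ?_⟩
    · rw [← hSt a, ← hSt c]
      exact eq_of_isParallelAlong hE hr (hS a) (hS c) ht' hac ht
    · obtain ⟨s, hs, hsa⟩ := exists_isParallelAlong hE D hr ht' a
      exact ⟨s t, (key _ s hs rfl).trans hsa⟩
  exact ⟨StarAlgEquiv.ofBijective f hf, fun s hs => key _ s hs rfl⟩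

end ParallelSections

/-! ### Continuity of parallel transport -/

section TransportContinuity
open Filter Topology

variable {n : ℕ} {X : Type*} [EMetricSpace X] [ChartedSpace (EuclideanSpace ℝ (Fin n)) X]
  [IsManifold (𝓡 n) ∞ X] [RiemannianBundle (fun x : X => TangentSpace (𝓡 n) x)]
  [IsContMDiffRiemannianBundle (𝓡 n) ∞ (EuclideanSpace ℝ (Fin n))
      (fun x : X => TangentSpace (𝓡 n) x)] [IsRiemannianManifold (𝓡 n) X] [CompleteSpace X]
  {A : Type*} [NonUnitalCStarAlgebra A] {E : X → Type*} [∀ x, NonUnitalCStarAlgebra (E x)]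
  [TopologicalSpace (TotalSpace A E)] [FiberBundle A E] [VectorBundle ℝ A E]
  [ContMDiffVectorBundle ∞ A E (𝓡 n)]
  {G : Type*} [Group G] [MulAction G X]
  {D : HermitianConnection n A E} {r : X → ℝ}

theorem tendsto_totalSpace_iff {ι : Type*} {l : Filter ι} {x : ι → X} {v : ∀ i, E (x i)} {p y : X}
    {w : E y} (hy : y ∈ trivSet A E p) :
    Tendsto (fun i => (⟨x i, v i⟩ : TotalSpace A E)) l (𝓝 ⟨y, w⟩) ↔
      Tendsto x l (𝓝 y) ∧ Tendsto (fun i => fibreCoord A p (v i)) l (𝓝 (fibreCoord A p w)) :=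
  (trivializationAt A E p).tendsto_nhds_iff
    ((trivializationAt A E p).mem_source.2 hy)

/-- The coefficients of the parallel equation along a varying segment converge uniformly in time,
when they are applied to a fixed section. -/
theorem ParallelODE.eventually_norm_sub_le {p : X} {B : Set (shortPairs r)} {α β M : ℝ}
    {L : shortPairs r → ℝ → A →L[ℝ] A} (h : ParallelODE D p B α β M L) {b₀ : shortPairs r}
    (hB : B ∈ 𝓝 b₀) {c : ℝ → A} (hc : ContinuousOn c (Icc α β)) {ε : ℝ} (hε : 0 < ε) :
    ∀ᶠ b in 𝓝 b₀, ∀ t ∈ Icc α β, ‖L b t (c t) - L b₀ t (c t)‖ ≤ ε := by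
  have hb₀ := mem_of_mem_nhds hB
  -- joint continuity, from strong continuity and the uniform bound
  have hcont : ContinuousOn (fun q : shortPairs r × ℝ => L q.1 q.2 (c q.2)) (B ×ˢ Icc α β) := by
    have := continuousOn_clm_apply_of_bound (V := A) (F := ℝ) (F' := A)
      (S := B ×ˢ Icc α β) (M := M) (w := fun q => c q.2)
      (Λ := fun q : shortPairs r × ℝ =>
        (ContinuousLinearMap.smulRightL ℝ ℝ A (ContinuousLinearMap.id ℝ ℝ)).comp (L q.1 q.2))
      (fun q hq => ?_) (fun v a => ?_) (hc.comp continuous_snd.continuousOn fun q hq => hq.2) 1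
    · simpa using this
    · refine ContinuousLinearMap.opNorm_le_bound _ h.nonneg fun a => ?_
      simp only [ContinuousLinearMap.comp_apply]
      refine (le_of_eq ?_).trans (((L q.1 q.2).le_opNorm a).trans
        (by gcongr; exact h.bound _ hq.1 _ hq.2))
      simp [ContinuousLinearMap.norm_smulRight_apply]
    · exact ((continuous_const_smul (a : ℝ)).comp_continuousOn (h.continuousOn v)).congr
        fun q _ => by simp
  have hK : IsCompact (Icc α β) := isCompact_Icc
  have := hK.eventually_forall_of_forall_eventually (x₀ := b₀)
    (P := fun b t => t ∈ Icc α β → ‖L b t (c t) - L b₀ t (c t)‖ ≤ ε) fun t ht => by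
    have h1 : ContinuousWithinAt (fun q : shortPairs r × ℝ =>
        L q.1 q.2 (c q.2) - L b₀ q.2 (c q.2)) (B ×ˢ Icc α β) (b₀, t) := by
      refine (hcont _ ⟨hb₀, ht⟩).sub ?_
      have h2 := hcont (b₀, t) ⟨hb₀, ht⟩
      refine ContinuousWithinAt.comp (f := fun q : shortPairs r × ℝ => (b₀, q.2))
        (g := fun q : shortPairs r × ℝ => L q.1 q.2 (c q.2)) (x := (b₀, t)) h2
        (by fun_prop) fun q hq => ⟨hb₀, hq.2⟩
    have h2 : ∀ᶠ q in 𝓝[B ×ˢ Icc α β] (b₀, t),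
        ‖L q.1 q.2 (c q.2) - L b₀ q.2 (c q.2)‖ < ε :=
      h1.norm.eventually (Iio_mem_nhds (by simpa using hε))
    have h3 : ∀ᶠ q in 𝓝 (b₀, t), q.1 ∈ B := (continuous_fst.tendsto (b₀, t)).eventually hB
    filter_upwards [eventually_nhdsWithin_iff.1 h2, h3] with q h4 h5 h6
    exact (h4 ⟨h5, h6⟩).le
  filter_upwards [this] with b hb t ht using hb t ht ht

/-- Parallel transport depends continuously on the segment: convergence of the values of parallel
sections at one time implies convergence at all times. -/
theorem tendsto_parallel (hE : IsCStarBundle A E) (hr : IsGeodesicRadius n G r) {ι : Type*}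
    {l : Filter ι} {b : ι → shortPairs r} {b₀ : shortPairs r} (hb : Tendsto b l (𝓝 b₀))
    {s : ∀ i, ∀ t, E (shortSegment n (b i) t)} {s₀ : ∀ t, E (shortSegment n b₀ t)}
    (hs : ∀ i, D.IsParallelAlong (shortSegment n (b i)) (s i))
    (hs₀ : D.IsParallelAlong (shortSegment n b₀) s₀) {τ : ι → ℝ} {t₁ : ℝ}
    (hτI : ∀ i, τ i ∈ Icc (0 : ℝ) 1) (hτ : Tendsto τ l (𝓝 t₁))
    (hlim : Tendsto (fun i => (⟨_, s i (τ i)⟩ : TotalSpace A E)) l (𝓝 ⟨_, s₀ t₁⟩))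
    (ht₁ : t₁ ∈ Icc (0 : ℝ) 1) {τ' : ι → ℝ} {t₂ : ℝ} (hτI' : ∀ i, τ' i ∈ Icc (0 : ℝ) 1)
    (hτ' : Tendsto τ' l (𝓝 t₂)) (ht₂ : t₂ ∈ Icc (0 : ℝ) 1) :
    Tendsto (fun i => (⟨_, s i (τ' i)⟩ : TotalSpace A E)) l (𝓝 ⟨_, s₀ t₂⟩) := by
  -- `R t` says that the values converge at all times converging to `t`, and `R' t` that they
  -- converge at some such times; it is enough to propagate from `R'` to `R` locally
  set R : ℝ → Prop := fun t => ∀ τ : ι → ℝ, (∀ i, τ i ∈ Icc (0 : ℝ) 1) → Tendsto τ l (𝓝 t) →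
    Tendsto (fun i => (⟨_, s i (τ i)⟩ : TotalSpace A E)) l (𝓝 ⟨_, s₀ t⟩) with hR
  set R' : ℝ → Prop := fun t => ∃ τ : ι → ℝ, (∀ i, τ i ∈ Icc (0 : ℝ) 1) ∧ Tendsto τ l (𝓝 t) ∧
    Tendsto (fun i => (⟨_, s i (τ i)⟩ : TotalSpace A E)) l (𝓝 ⟨_, s₀ t⟩) with hR'
  have hRR : ∀ t ∈ Icc (0 : ℝ) 1, R t → R' t := fun t ht h =>
    ⟨fun _ => t, fun _ => ht, tendsto_const_nhds, h _ (fun _ => ht) tendsto_const_nhds⟩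
  suffices h : R' t₁ → R t₂ from h ⟨τ, hτI, hτ, hlim⟩ τ' hτI' hτ'
  refine forall_unitInterval_of_local (P := fun t t' => R' t → R t') ?_
    (fun _ t' ht' _ h1 h2 h3 => h2 (hRR t' ht' (h1 h3))) ht₁ ht₂
  intro t₀ ht₀
  obtain ⟨p, B, α, β, M, L, hB, hJ, hode⟩ := exists_parallelODE hE D hr b₀ ht₀
  refine ⟨Icc α β, hJ, ?_⟩
  rintro t ht t' ht' htJ ht'J ⟨τ, hτI, hτ, hlim⟩ τ' hτI' hτ'
  have hb₀ := mem_of_mem_nhds hB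
  have htm := mem_of_mem_nhdsWithin ht htJ
  have htm' := mem_of_mem_nhdsWithin ht' ht'J
  have hτe : ∀ᶠ i in l, τ i ∈ Icc α β :=
    (tendsto_nhdsWithin_iff.2 ⟨hτ, Eventually.of_forall hτI⟩).eventually htJ
  have hτe' : ∀ᶠ i in l, τ' i ∈ Icc α β :=
    (tendsto_nhdsWithin_iff.2 ⟨hτ', Eventually.of_forall hτI'⟩).eventually ht'J
  have hbe : ∀ᶠ i in l, b i ∈ B := hb.eventually hB
  set c₀ : ℝ → A := fun t => fibreCoord A p (s₀ t) with hc₀def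
  have hc₀ : ∀ u ∈ Icc α β, HasDerivWithinAt c₀ (L b₀ u (c₀ u)) (Icc α β) u := fun u hu =>
    hode.hasDerivWithinAt hb₀ hu (hs₀ u (hode.subset hu))
  have hc₀c : ContinuousOn c₀ (Icc α β) := fun u hu => (hc₀ u hu).continuousWithinAt
  have hJne : α ≤ β := htm.1.trans htm.2
  -- values of the fixed parallel section at converging times
  have hconv : ∀ (σ : ι → ℝ) (u : ℝ), u ∈ Icc α β → Tendsto σ l (𝓝 u) →
      (∀ᶠ i in l, σ i ∈ Icc α β) → Tendsto (fun i => c₀ (σ i)) l (𝓝 (c₀ u)) := fun σ u hu hσ hσJ =>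
    (hc₀c u hu).tendsto.comp (tendsto_nhdsWithin_iff.2 ⟨hσ, hσJ⟩)
  rw [tendsto_totalSpace_iff (hode.mem_trivSet b₀ hb₀ t htm)] at hlim
  rw [tendsto_totalSpace_iff (hode.mem_trivSet b₀ hb₀ t' htm')]
  constructor
  · have h2 : Tendsto (fun i => ((b i, ⟨τ' i, hτI' i⟩) : shortPairs r × unitInterval)) l
        (𝓝 (b₀, ⟨t', ht'⟩)) := hb.prodMk_nhds (tendsto_subtype_rng.2 hτ')
    exact ((continuous_geodesicHomotopy hr).tendsto _).comp h2
  · -- the difference of the sections at the time `τ i`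
    have hd : Tendsto (fun i => fibreCoord A p (s i (τ i)) - c₀ (τ i)) l (𝓝 0) := by
      have h1 := hlim.2.sub (hconv τ t htm hτ hτe)
      rwa [show fibreCoord A p (s₀ t) = c₀ t from rfl, sub_self] at h1
    have hd' : Tendsto (fun i => fibreCoord A p (s i (τ' i)) - c₀ (τ' i)) l (𝓝 0) := by
      rw [Metric.tendsto_nhds]
      intro ε hε
      set ε' := ε / (4 * (1 + (β - α))) with hε'
      have hβα : 0 ≤ β - α := sub_nonneg.2 hJne
      have hε'0 : 0 < ε' := by positivity
      filter_upwards [hτe, hτe', hbe, hb.eventually (hode.eventually_norm_sub_le hB hc₀c hε'0),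
        hd.norm.eventually (Iio_mem_nhds (by simpa using hε'0))] with i h1 h2 h3 h4 h5
      have key := norm_le_of_linear_ode (w := fun t => fibreCoord A p (s i t) - c₀ t)
        (f := fun t => L (b i) t (c₀ t) - L b₀ t (c₀ t)) (ε := ε') hode.nonneg hode.small
        (hode.bound _ h3) (fun u hu => ((hode.hasDerivWithinAt h3 hu
          (hs i u (hode.subset hu))).sub (hc₀ u hu)).congr_deriv (by rw [map_sub]; abel))
        h4 h1 (τ' i) h2
      rw [dist_zero_right]
      refine key.trans_lt ?_
      have h6 : ‖fibreCoord A p (s i (τ i)) - c₀ (τ i)‖ < ε' := h5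
      calc 2 * (‖fibreCoord A p (s i (τ i)) - c₀ (τ i)‖ + (β - α) * ε')
          ≤ 2 * (ε' + (β - α) * ε') := by gcongr
        _ = ε / 2 := by rw [hε']; field_simp; ring
        _ < ε := by linarith
    simpa using hd'.add (hconv τ' t' htm' hτ' hτe')

end TransportContinuity

/-! ### Equivariance of parallel transport -/

section TransportEquivariance
open Filter Topology

variable {n : ℕ} {G X : Type*} [Group G] [EMetricSpace X]
  [ChartedSpace (EuclideanSpace ℝ (Fin n)) X] [IsManifold (𝓡 n) ∞ X] [MulAction G X]
  {A : Type*} [NonUnitalCStarAlgebra A] {E : X → Type*} [∀ x, NonUnitalCStarAlgebra (E x)]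
  [TopologicalSpace (TotalSpace A E)] [FiberBundle A E] [VectorBundle ℝ A E]
  [ContMDiffVectorBundle ∞ A E (𝓡 n)] [MulAction G (TotalSpace A E)]

theorem totalSpace_mk_eq {x y : X} {v : E x} {w : E y}
    (h : (⟨x, v⟩ : TotalSpace A E) = ⟨y, w⟩) (p : X) : fibreCoord A p v = fibreCoord A p w := by
  cases h
  rfl

/-- The action of `g` maps parallel sections to parallel sections. -/
theorem isParallelAlong_smul_group (hG : ∀ g : G, ContMDiff (𝓡 n) (𝓡 n) ∞ (fun x : X => g • x))
    (hE : IsCStarBundle A E)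
    (hGE : IsSmoothEquivariantBundle n G A E) {D : HermitianConnection n A E}
    (hD : D.IsInvariant G) (g : G) {γ γ' : ℝ → X}
    (hγ : ∀ t ∈ Icc (0 : ℝ) 1, MDifferentiableWithinAt 𝓘(ℝ, ℝ) (𝓡 n) γ (Icc 0 1) t)
    (hγ' : ∀ t ∈ Icc (0 : ℝ) 1, γ' t = g • γ t) {s : ∀ t, E (γ t)} {s' : ∀ t, E (γ' t)}
    (hs : D.IsParallelAlong γ s)
    (hss : ∀ t ∈ Icc (0 : ℝ) 1, (⟨γ' t, s' t⟩ : TotalSpace A E) = g • ⟨γ t, s t⟩) :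
    D.IsParallelAlong γ' s' := by
  intro t₀ ht₀ V' σ' hV' hσ'
  obtain ⟨V, hV⟩ := exists_smul_field hG g⁻¹ V'
  obtain ⟨σ, hσ⟩ := exists_smul_section hG hGE g⁻¹ σ'
  have hpt := hγ' t₀ ht₀
  -- `V'` and `σ'` are the translates of `V` and `σ`
  have hσσ : ∀ x, (⟨g • x, σ' (g • x)⟩ : TotalSpace A E) = g • (⟨x, σ x⟩ : TotalSpace A E) := by
    intro x
    have h1 := hσ (g • x)
    rw [inv_smul_smul] at h1
    rw [h1, smul_inv_smul]
  have hdd : ∀ x (v : EuclideanSpace ℝ (Fin n)),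
      dMap n (fun x : X => g⁻¹ • x) (g • x) (dMap n (fun x : X => g • x) x v) = v := by
    intro x v
    have h1 : MDifferentiableAt (𝓡 n) (𝓡 n) (fun x : X => g⁻¹ • x) (g • x) :=
      (hG g⁻¹).mdifferentiable (by simp) _
    have h2 : MDifferentiableAt (𝓡 n) (𝓡 n) (fun x : X => g • x) x :=
      (hG g).mdifferentiable (by simp) _
    have h3 := mfderiv_comp x h1 h2
    have h4 : (fun x : X => g⁻¹ • x) ∘ (fun x : X => g • x) = id := by
      funext x
      exact inv_smul_smul g x
    rw [h4, mfderiv_id] at h3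
    exact (DFunLike.congr_fun h3 v).symm
  have hdd' : ∀ x (v : EuclideanSpace ℝ (Fin n)),
      dMap n (fun x : X => g • x) x (dMap n (fun x : X => g⁻¹ • x) (g • x) v) = v := by
    intro x v
    have h1 : MDifferentiableAt (𝓡 n) (𝓡 n) (fun x : X => g⁻¹ • x) (g • x) :=
      (hG g⁻¹).mdifferentiable (by simp) _
    have h2 : MDifferentiableAt (𝓡 n) (𝓡 n) (fun x : X => g • x) (g⁻¹ • g • x) :=
      (hG g).mdifferentiable (by simp) _
    have h3 := mfderiv_comp (g • x) h2 h1
    have h4 : (fun x : X => g • x) ∘ (fun x : X => g⁻¹ • x) = id := by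
      funext x
      exact smul_inv_smul g x
    rw [h4, mfderiv_id] at h3
    have h5 : dMap n (fun x : X => g • x) (g⁻¹ • g • x) (dMap n (fun x : X => g⁻¹ • x) (g • x) v) =
      v := (DFunLike.congr_fun h3 v).symm
    rwa [inv_smul_smul] at h5
  have hVx : ∀ x, V x = dMap n (fun x : X => g⁻¹ • x) (g • x) (V' (g • x)) := by
    intro x
    have h1 := hV (g • x)
    rw [inv_smul_smul] at h1
    exact h1
  have hVV : ∀ x, V' (g • x) = mfderiv (𝓡 n) (𝓡 n) (fun x : X => g • x) x (V x) := by
    intro x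
    refine Eq.trans ?_ (congrArg (dMap n (fun x : X => g • x) x) (hVx x)).symm
    exact (hdd' x _).symm
  have hDD := hD g V V' σ σ' hVV hσσ (γ t₀)
  -- the velocities correspond to each other
  have hvel : velocity n γ' t₀ = dMap n (fun x : X => g • x) (γ t₀) (velocity n γ t₀) := by
    have h1 : velocity n γ' t₀ = velocity n (fun t => g • γ t) t₀ := by
      have h2 : mfderivWithin 𝓘(ℝ, ℝ) (𝓡 n) γ' (Icc 0 1) t₀ =
        mfderivWithin 𝓘(ℝ, ℝ) (𝓡 n) (fun t => g • γ t) (Icc 0 1) t₀ := mfderivWithin_congr hγ' hpt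
      exact DFunLike.congr_fun h2 (1 : ℝ)
    rw [h1]
    have h2 : MDifferentiableAt (𝓡 n) (𝓡 n) (fun x : X => g • x) (γ t₀) :=
      (hG g).mdifferentiable (by simp) _
    have h3 := mfderiv_comp_mfderivWithin t₀ h2 (hγ t₀ ht₀)
      (uniqueDiffOn_unitInterval t₀ ht₀).uniqueMDiffWithinAt
    exact DFunLike.congr_fun h3 (1 : ℝ)
  have hV0 : V (γ t₀) = velocity n γ t₀ := by
    refine (hVx (γ t₀)).trans ?_
    have h1 : V' (g • γ t₀) = velocity n γ' t₀ := by
      have : ∀ y, γ' t₀ = y → V' y = velocity n γ' t₀ := by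
        rintro y rfl
        exact hV'
      exact this _ hpt
    refine (congrArg (dMap n (fun x : X => g⁻¹ • x) (g • γ t₀)) (h1.trans hvel)).trans (hdd _ _)
  have hinj : ∀ x (v w : E x), g • (⟨x, v⟩ : TotalSpace A E) = g • ⟨x, w⟩ → v = w := by
    intro x v w h
    have h1 := MulAction.injective g h
    exact eq_of_heq (TotalSpace.mk.inj h1).2
  have hmk : ∀ y (h : γ' t₀ = y), (⟨γ' t₀, σ' (γ' t₀)⟩ : TotalSpace A E) = ⟨y, σ' y⟩ := by
    rintro y rfl
    rfl
  have hσ0 : σ (γ t₀) = s t₀ := by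
    refine hinj _ _ _ ?_
    rw [← hσσ, ← hss t₀ ht₀, ← hmk _ hpt, hσ']
  have hpar := hs t₀ ht₀ V σ hV0 hσ0
  set p := γ t₀ with hp
  set q := γ' t₀ with hq
  -- the action of `g` maps the derivative of `s - σ`, which vanishes at `t₀`, to the derivative of
  -- the translated difference
  obtain ⟨H, hH, hHs⟩ := exists_smul_coord hG hE hGE g p q
  have hS : p ∈ trivSet A E p ∧ g • p ∈ trivSet A E q := ⟨mem_trivSet p, by
    rw [← hpt]; exact mem_trivSet q⟩
  have hSo : IsOpen {x | x ∈ trivSet A E p ∧ g • x ∈ trivSet A E q} :=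
    (isOpen_trivSet p).inter ((isOpen_trivSet q).preimage (hG g).continuous)
  have hHd : DifferentiableWithinAt ℝ (fun t => H (γ t)) (Icc 0 1) t₀ :=
    ((((hHs.contMDiffAt (hSo.mem_nhds hS)).mdifferentiableAt (by simp)).comp_mdifferentiableWithinAt
      t₀ (hγ t₀ ht₀))).differentiableWithinAt
  have h1 := hHd.hasDerivWithinAt.clm_apply hpar
  have h0 : (trivializationAt A E p ⟨γ t₀, s t₀⟩).2 -
      (trivializationAt A E p ⟨γ t₀, σ (γ t₀)⟩).2 = 0 := by
    rw [hσ0, sub_self]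
  have hHx : ∀ x, x ∈ trivSet A E p → g • x ∈ trivSet A E q → ∀ (v : E x) (y : X) (w : E y),
      (⟨y, w⟩ : TotalSpace A E) = g • ⟨x, v⟩ → H x (fibreCoord A p v) = fibreCoord A q w := by
    intro x hx1 hx2 v y w h
    rw [hH x hx1 hx2]
    rw [smul_mk hGE] at h
    exact (totalSpace_mk_eq h q).symm
  rw [h0, map_zero, zero_add, map_neg] at h1
  have h2 : H (γ t₀) ((trivializationAt A E p ⟨γ t₀, D.toFun V σ (γ t₀)⟩).2) =
      (trivializationAt A E q ⟨γ' t₀, D.toFun V' σ' (γ' t₀)⟩).2 := by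
    refine hHx _ hS.1 hS.2 _ _ _ (Eq.trans ?_ hDD)
    have : ∀ y, γ' t₀ = y → (⟨γ' t₀, D.toFun V' σ' (γ' t₀)⟩ : TotalSpace A E) =
        ⟨y, D.toFun V' σ' y⟩ := by
      rintro y rfl
      rfl
    exact this _ hpt
  rw [h2] at h1
  refine h1.congr_of_eventuallyEq ?_ ?_
  · filter_upwards [self_mem_nhdsWithin,
      (hγ t₀ ht₀).continuousWithinAt.eventually (hSo.mem_nhds hS)] with t ht htS
    rw [map_sub]
    have h3 : H (γ t) ((trivializationAt A E p ⟨γ t, s t⟩).2) =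
        (trivializationAt A E q ⟨γ' t, s' t⟩).2 := hHx _ htS.1 htS.2 _ _ _ (hss t ht)
    have h4 : H (γ t) ((trivializationAt A E p ⟨γ t, σ (γ t)⟩).2) =
        (trivializationAt A E q ⟨γ' t, σ' (γ' t)⟩).2 := by
      refine hHx _ htS.1 htS.2 _ _ _ (Eq.trans ?_ (hσσ _))
      have : ∀ y, γ' t = y → (⟨γ' t, σ' (γ' t)⟩ : TotalSpace A E) = ⟨y, σ' y⟩ := by
        rintro y rfl
        rfl
      exact this _ (hγ' t ht)
    rw [h3, h4]
  · rw [h0, map_zero, hσ', sub_self]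

end TransportEquivariance

/-! ### Feasibility from an invariant connection -/

section Feasibility
open Filter Topology

variable {n : ℕ} {X : Type*} [EMetricSpace X] [ChartedSpace (EuclideanSpace ℝ (Fin n)) X]
  [IsManifold (𝓡 n) ∞ X] [RiemannianBundle (fun x : X => TangentSpace (𝓡 n) x)]
  [IsContMDiffRiemannianBundle (𝓡 n) ∞ (EuclideanSpace ℝ (Fin n))
      (fun x : X => TangentSpace (𝓡 n) x)] [IsRiemannianManifold (𝓡 n) X] [CompleteSpace X]
  {A : Type*} [NonUnitalCStarAlgebra A] {E : X → Type*} [∀ x, NonUnitalCStarAlgebra (E x)]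
  [TopologicalSpace (TotalSpace A E)] [FiberBundle A E] [VectorBundle ℝ A E]
  [ContMDiffVectorBundle ∞ A E (𝓡 n)]
  {G : Type*} [Group G] [MulAction G X]

/-- The identification of the fibres over equal points. -/
theorem exists_castEquiv {x y : X} (h : x = y) :
    ∃ φ : E x ≃⋆ₐ[ℂ] E y, ∀ v, (⟨y, φ v⟩ : TotalSpace A E) = ⟨x, v⟩ := by
  subst h
  exact ⟨StarAlgEquiv.refl ℂ _, fun v => rfl⟩

theorem tendsto_pullback_iff {B : Type*} [TopologicalSpace B] {f : B → X} {ι : Type*}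
    {l : Filter ι} {v : ι → TotalSpace A (f *ᵖ E)} {w : TotalSpace A (f *ᵖ E)} :
    Tendsto v l (𝓝 w) ↔ Tendsto (fun i => (v i).1) l (𝓝 w.1) ∧
      Tendsto (fun i => (⟨f (v i).1, (v i).2⟩ : TotalSpace A E)) l (𝓝 ⟨f w.1, w.2⟩) := by
  rw [(inducing_pullbackTotalSpaceEmbedding A E f).tendsto_nhds_iff, nhds_prod_eq,
    tendsto_prod_iff']
  rfl

/-- Parallel transport along the geodesic segments is a bundle isomorphism. -/
theorem exists_pullbackIso (hE : IsCStarBundle A E) (D : HermitianConnection n A E) {r : X → ℝ}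
    (hr : IsGeodesicRadius n G r) :
    ∃ φ : PullbackIso A E (geodesicHomotopy n r) (geodesicHomotopyZero r),
      ∀ (b : shortPairs r) (s : ∀ t, E (shortSegment n b t)),
        D.IsParallelAlong (shortSegment n b) s → ∀ t : unitInterval,
          (⟨b.1.1, φ.fibre (b, t) (s t)⟩ : TotalSpace A E) = ⟨shortSegment n b 0, s 0⟩ := by
  have h0 : (0 : ℝ) ∈ Icc (0 : ℝ) 1 := left_mem_Icc.2 zero_le_one
  have hsrc : ∀ b : shortPairs r, shortSegment n b 0 = b.1.1 := fun b =>
    (hr.isGeodesicSegment b.2).source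
  choose T hT using fun q : shortPairs r × unitInterval =>
    exists_transport hE D hr q.1 (t := q.2) (t' := 0) q.2.2 h0
  choose κ hκ using fun b : shortPairs r => exists_castEquiv (A := A) (E := E) (hsrc b)
  set φ : ∀ q : shortPairs r × unitInterval,
      E (geodesicHomotopy n r q) ≃⋆ₐ[ℂ] E (geodesicHomotopyZero r q) := fun q =>
    (T q).trans (κ q.1) with hφ
  have key : ∀ (b : shortPairs r) (s : ∀ t, E (shortSegment n b t)),
        D.IsParallelAlong (shortSegment n b) s → ∀ t : unitInterval,
          (⟨b.1.1, φ (b, t) (s t)⟩ : TotalSpace A E) = ⟨shortSegment n b 0, s 0⟩ := by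
    intro b s hs t
    exact (hκ b _).trans (congrArg (TotalSpace.mk (F := A) _) (hT (b, t) s hs))
  refine ⟨⟨φ, ?_, ?_⟩, key⟩
  · rw [continuous_iff_continuousAt]
    intro v₀
    choose s hs hst using fun v : TotalSpace A (geodesicHomotopy n r *ᵖ E) =>
      exists_isParallelAlong hE D hr (b := v.1.1) v.1.2.2 v.2
    have hid := tendsto_pullback_iff.1 (tendsto_id (x := 𝓝 v₀))
    refine tendsto_pullback_iff.2 ⟨hid.1, ?_⟩
    have hval : ∀ v : TotalSpace A (geodesicHomotopy n r *ᵖ E),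
        (⟨geodesicHomotopyZero r v.1, φ v.1 v.2⟩ : TotalSpace A E) =
          ⟨shortSegment n v.1.1 0, s v 0⟩ := by
      intro v
      rw [← key v.1.1 (s v) (hs v) v.1.2, hst]
      rfl
    have hb : Tendsto (fun v : TotalSpace A (geodesicHomotopy n r *ᵖ E) => v.1.1) (𝓝 v₀)
      (𝓝 v₀.1.1) := (continuous_fst.tendsto _).comp hid.1
    have hτ : Tendsto (fun v : TotalSpace A (geodesicHomotopy n r *ᵖ E) => (v.1.2 : ℝ)) (𝓝 v₀)
      (𝓝 v₀.1.2) := ((continuous_subtype_val.comp continuous_snd).tendsto _).comp hid.1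
    have h1 := tendsto_parallel hE hr hb hs (hs v₀) (fun v => v.1.2.2) hτ (by
      rw [hst v₀]
      simp only [hst]
      exact hid.2) v₀.1.2.2 (fun _ => h0) tendsto_const_nhds h0
    rw [← hval v₀] at h1
    exact h1.congr fun v => (hval v).symm
  · rw [continuous_iff_continuousAt]
    intro v₀
    choose s hs hst using fun v : TotalSpace A (geodesicHomotopyZero r *ᵖ E) =>
      exists_isParallelAlong hE D hr (b := v.1.1) h0 ((κ v.1.1).symm v.2)
    have hid := tendsto_pullback_iff.1 (tendsto_id (x := 𝓝 v₀))
    refine tendsto_pullback_iff.2 ⟨hid.1, ?_⟩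
    have hval : ∀ v : TotalSpace A (geodesicHomotopyZero r *ᵖ E),
        (φ v.1).symm v.2 = s v v.1.2 := by
      intro v
      have h2 : v.2 = φ v.1 (s v v.1.2) := by
        refine Eq.symm ((congrArg (κ v.1.1) (hT v.1 (s v) (hs v))).trans ?_)
        rw [hst]
        exact (κ v.1.1).apply_symm_apply _
      exact (congrArg (φ v.1).symm h2).trans ((φ v.1).symm_apply_apply _)
    have h0val : ∀ v : TotalSpace A (geodesicHomotopyZero r *ᵖ E),
        (⟨shortSegment n v.1.1 0, s v 0⟩ : TotalSpace A E) = ⟨geodesicHomotopyZero r v.1, v.2⟩ := by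
      intro v
      rw [← hκ, hst]
      exact congrArg (TotalSpace.mk (F := A) _) ((κ v.1.1).apply_symm_apply _)
    have hb : Tendsto (fun v : TotalSpace A (geodesicHomotopyZero r *ᵖ E) => v.1.1) (𝓝 v₀)
      (𝓝 v₀.1.1) := (continuous_fst.tendsto _).comp hid.1
    have hτ : Tendsto (fun v : TotalSpace A (geodesicHomotopyZero r *ᵖ E) => (v.1.2 : ℝ)) (𝓝 v₀)
      (𝓝 v₀.1.2) := ((continuous_subtype_val.comp continuous_snd).tendsto _).comp hid.1
    have h1 := tendsto_parallel hE hr hb hs (hs v₀) (fun _ => h0) tendsto_const_nhds (by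
      rw [h0val v₀]
      exact hid.2.congr fun v => (h0val v).symm) h0 (fun v => v.1.2.2) hτ v₀.1.2.2
    change Tendsto (fun v : TotalSpace A (geodesicHomotopyZero r *ᵖ E) =>
      (⟨geodesicHomotopy n r v.1, (φ v.1).symm v.2⟩ : TotalSpace A E)) (𝓝 v₀)
      (𝓝 ⟨geodesicHomotopy n r v₀.1, (φ v₀.1).symm v₀.2⟩)
    rw [hval v₀]
    refine h1.congr fun v => ?_
    rw [hval v]
    rfl

variable [MulAction G (TotalSpace A E)]

/-- For an invariant connection, the inverse parallel transport is an equivariant isomorphism. -/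
theorem exists_pullbackIso_of_isInvariant (hGX : IsIsometricAction n G X) (hE : IsCStarBundle A E)
    (hGE : IsSmoothEquivariantBundle n G A E) {D : HermitianConnection n A E}
    (hD : D.IsInvariant G) {r : X → ℝ} (hr : IsGeodesicRadius n G r) :
    ∃ φ : PullbackIso A E (geodesicHomotopy n r) (geodesicHomotopyZero r),
      φ.IsEquivariant G ∧ φ.IsInverseParallelTransport D := by
  have h0 : (0 : ℝ) ∈ Icc (0 : ℝ) 1 := left_mem_Icc.2 zero_le_one
  have hsrc : ∀ b : shortPairs r, shortSegment n b 0 = b.1.1 := fun b =>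
    (hr.isGeodesicSegment b.2).source
  obtain ⟨φ, hφ⟩ := exists_pullbackIso hE D hr
  refine ⟨φ, fun g b => ?_, fun b => ⟨fun a => ?_, hφ b⟩⟩
  · set q : shortPairs r := ⟨(g • b.1.1, g • b.1.2), hr.smul_mem hGX g b.2⟩
    refine ⟨q, rfl, fun t v => ?_⟩
    obtain ⟨s, hs, hsv⟩ := exists_isParallelAlong hE D hr (b := b) t.2 v
    have hseg : ∀ u ∈ Icc (0 : ℝ) 1, shortSegment n q u = g • shortSegment n b u := fun u hu =>
      hr.geodesicSegment_smul hGX g b.2 hu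
    have hex : ∀ u, ∃ w : E (shortSegment n q u), u ∈ Icc (0 : ℝ) 1 →
        (⟨shortSegment n q u, w⟩ : TotalSpace A E) = g • ⟨shortSegment n b u, s u⟩ := by
      intro u
      by_cases hu : u ∈ Icc (0 : ℝ) 1
      · obtain ⟨κ, hκ⟩ := exists_castEquiv (A := A) (E := E) (hseg u hu).symm
        refine ⟨κ (fibreSMul hGE g _ (s u)), fun _ => ?_⟩
        rw [hκ, smul_mk hGE]
      · exact ⟨0, fun h => absurd h hu⟩
    choose s' hs' using hex
    have hpar : D.IsParallelAlong (shortSegment n q) s' :=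
      isParallelAlong_smul_group hGX.contMDiff_smul hE hGE hD g
        (fun u hu => (hr.isGeodesicSegment b.2).isGeodesic.mdifferentiableWithinAt hu) hseg hs hs'
    refine ⟨s' t, ?_, ?_⟩
    · refine (hs' t t.2).trans ?_
      rw [hsv]
      rfl
    · refine (hφ q s' hpar t).trans ((hs' 0 h0).trans ?_)
      rw [← hφ b s hs t, hsv]
      rfl
  · obtain ⟨κ, hκ⟩ := exists_castEquiv (A := A) (E := E) (hsrc b).symm
    obtain ⟨s, hs, hsa⟩ := exists_isParallelAlong hE D hr (b := b) h0 (κ a)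
    refine ⟨s, hs, ?_⟩
    refine Eq.trans ?_ (hκ a)
    rw [← hsa]
    rfl

/-- Feasibility does not refer to the connection: the isomorphism only has to exist. -/
theorem isFeasible_of_isInvariant (hGX : IsIsometricAction n G X) (hE : IsCStarBundle A E)
    (hGE : IsSmoothEquivariantBundle n G A E) {D : HermitianConnection n A E}
    (hD : D.IsInvariant G) : IsFeasible n G A E := fun _ hr => by
  obtain ⟨φ, hφ, -⟩ := exists_pullbackIso_of_isInvariant hGX hE hGE hD hr
  exact ⟨continuous_geodesicHomotopy hr, φ, hφ⟩

end Feasibility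

/-! ### Directional derivatives of vector-valued functions -/

section DirectionalDerivatives
open Filter Topology

variable {n : ℕ} {X : Type*} [EMetricSpace X] [ChartedSpace (EuclideanSpace ℝ (Fin n)) X]
  [IsManifold (𝓡 n) ∞ X] {F F' F'' : Type*} [NormedAddCommGroup F] [NormedSpace ℝ F]
  [NormedAddCommGroup F'] [NormedSpace ℝ F'] [NormedAddCommGroup F''] [NormedSpace ℝ F'']

/-- The derivative at `x` of a function on `X` with values in a normed space. -/
def dirDeriv (n : ℕ) {X : Type*} [EMetricSpace X] [ChartedSpace (EuclideanSpace ℝ (Fin n)) X]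
    {F : Type*} [NormedAddCommGroup F] [NormedSpace ℝ F] (f : X → F) (x : X) :
    EuclideanSpace ℝ (Fin n) →L[ℝ] F :=
  mfderiv (𝓡 n) 𝓘(ℝ, F) f x

/-- The value of a vector field, as an element of the model space. -/
def fieldValue {n : ℕ} {X : Type*} [EMetricSpace X] [ChartedSpace (EuclideanSpace ℝ (Fin n)) X]
    [IsManifold (𝓡 n) ∞ X] (V : SmoothVectorField n X) (x : X) : EuclideanSpace ℝ (Fin n) :=
  V x

theorem dirDeriv_congr {f f' : X → F} {x : X} (h : f =ᶠ[𝓝 x] f') :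
    dirDeriv n f x = dirDeriv n f' x := h.mfderiv_eq

theorem dirDeriv_comp_smul {ψ : X → X} (hψ : ContMDiff (𝓡 n) (𝓡 n) ∞ ψ) {f : X → F} {x : X}
    (hf : ContMDiffAt (𝓡 n) 𝓘(ℝ, F) ∞ f (ψ x)) (v : EuclideanSpace ℝ (Fin n)) :
    dirDeriv n (fun y => f (ψ y)) x v = dirDeriv n f (ψ x) (dMap n ψ x v) := by
  have h := mfderiv_comp x (hf.mdifferentiableAt (by simp)) (hψ.mdifferentiable (by simp) x)
  exact DFunLike.congr_fun h v

theorem ContMDiffAt.contDiffAt_comp_chart {f : X → F} {p x : X}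
    (hx : x ∈ (extChartAt (𝓡 n) p).source)
    (hf : ContMDiffAt (𝓡 n) 𝓘(ℝ, F) ∞ f x) :
    ContDiffAt ℝ ∞ (fun u => f ((extChartAt (𝓡 n) p).symm u)) (extChartAt (𝓡 n) p x) := by
  have h1 : ContMDiffAt (𝓡 n) 𝓘(ℝ, F) ∞ f ((extChartAt (𝓡 n) p).symm (extChartAt (𝓡 n) p x)) := by
    rwa [(extChartAt (𝓡 n) p).left_inv hx]
  exact (h1.comp _ (contMDiffAt_extChartAt_symm_of_mem
    ((extChartAt (𝓡 n) p).map_source hx))).contDiffAt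

theorem dirDeriv_eq_fderiv {f : X → F} {p x : X} (hx : x ∈ (extChartAt (𝓡 n) p).source)
    (hf : ContMDiffAt (𝓡 n) 𝓘(ℝ, F) ∞ f x) (v : EuclideanSpace ℝ (Fin n)) :
    dirDeriv n f x v = fderiv ℝ (fun u => f ((extChartAt (𝓡 n) p).symm u))
      (extChartAt (𝓡 n) p x) (dChart n p x v) := by
  set φ := extChartAt (𝓡 n) p
  have h2 : ContMDiffAt 𝓘(ℝ, EuclideanSpace ℝ (Fin n)) 𝓘(ℝ, F) ∞ (fun u => f (φ.symm u)) (φ x) :=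
    (hf.contDiffAt_comp_chart hx).contMDiffAt
  have h3 := mfderiv_comp x (h2.mdifferentiableAt (by simp))
    ((contMDiffAt_extChartAt_of_mem hx).mdifferentiableAt (by simp))
  rw [mfderiv_eq_fderiv] at h3
  have h4 : f =ᶠ[𝓝 x] (fun u => f (φ.symm u)) ∘ φ := by
    filter_upwards [(isOpen_extChartAt_source (I := 𝓡 n) p).mem_nhds hx] with y hy
    exact congrArg f (φ.left_inv hy).symm
  rw [dirDeriv_congr h4]
  exact DFunLike.congr_fun h3 v

theorem dirDeriv_clm (L : F →L[ℝ] F') {f : X → F} {x : X}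
    (hf : ContMDiffAt (𝓡 n) 𝓘(ℝ, F) ∞ f x) (v : EuclideanSpace ℝ (Fin n)) :
    dirDeriv n (fun y => L (f y)) x v = L (dirDeriv n f x v) := by
  have hx := mem_extChartAt_source (I := 𝓡 n) x
  rw [dirDeriv_eq_fderiv hx hf, dirDeriv_eq_fderiv (f := fun y => L (f y)) hx
    (L.contMDiff.contMDiffAt.comp x hf)]
  have h1 := (hf.contDiffAt_comp_chart hx).differentiableAt (by simp)
  exact DFunLike.congr_fun (L.hasFDerivAt.comp _ h1.hasFDerivAt).fderiv _

/-- The product rule for a continuous bilinear map. -/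
theorem dirDeriv_bilinear (B : F →L[ℝ] F' →L[ℝ] F'') {f : X → F} {h : X → F'} {x : X}
    (hf : ContMDiffAt (𝓡 n) 𝓘(ℝ, F) ∞ f x) (hh : ContMDiffAt (𝓡 n) 𝓘(ℝ, F') ∞ h x)
    (v : EuclideanSpace ℝ (Fin n)) :
    dirDeriv n (fun y => B (f y) (h y)) x v =
      B (f x) (dirDeriv n h x v) + B (dirDeriv n f x v) (h x) := by
  have hx := mem_extChartAt_source (I := 𝓡 n) x
  have hB : ContMDiffAt (𝓡 n) 𝓘(ℝ, F'') ∞ (fun y => B (f y) (h y)) x :=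
    (B.contMDiff.contMDiffAt.comp x hf).clm_apply hh
  rw [dirDeriv_eq_fderiv hx hf, dirDeriv_eq_fderiv hx hh, dirDeriv_eq_fderiv hx hB]
  have h1 := (hf.contDiffAt_comp_chart hx).differentiableAt (by simp)
  have h2 := (hh.contDiffAt_comp_chart hx).differentiableAt (by simp)
  have h3 := B.hasFDerivAt_of_bilinear h1.hasFDerivAt h2.hasFDerivAt
  rw [h3.fderiv]
  simp

theorem dirDeriv_add {f h : X → F} {x : X}
    (hf : ContMDiffAt (𝓡 n) 𝓘(ℝ, F) ∞ f x) (hh : ContMDiffAt (𝓡 n) 𝓘(ℝ, F) ∞ h x)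
    (v : EuclideanSpace ℝ (Fin n)) :
    dirDeriv n (fun y => f y + h y) x v = dirDeriv n f x v + dirDeriv n h x v := by
  have hx := mem_extChartAt_source (I := 𝓡 n) x
  rw [dirDeriv_eq_fderiv hx hf, dirDeriv_eq_fderiv hx hh,
    dirDeriv_eq_fderiv (f := fun y => f y + h y) hx (hf.add hh)]
  have h1 := (hf.contDiffAt_comp_chart hx).differentiableAt (by simp)
  have h2 := (hh.contDiffAt_comp_chart hx).differentiableAt (by simp)
  exact DFunLike.congr_fun (h1.hasFDerivAt.add h2.hasFDerivAt).fderiv _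

theorem contMDiffOn_dirDeriv_apply {f : X → F} {O : Set X} (hO : IsOpen O)
    (hf : ContMDiffOn (𝓡 n) 𝓘(ℝ, F) ∞ f O) (V : SmoothVectorField n X) :
    ContMDiffOn (𝓡 n) 𝓘(ℝ, F) ∞ (fun x => dirDeriv n f x (fieldValue V x)) O := by
  intro x₀ hx₀
  refine ContMDiffAt.contMDiffWithinAt ?_
  set φ := extChartAt (𝓡 n) x₀
  have hx := mem_extChartAt_source (I := 𝓡 n) x₀
  have h1 := (hf.contMDiffAt (hO.mem_nhds hx₀)).contDiffAt_comp_chart hx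
  have h2 : ContDiffAt ℝ ∞ (fderiv ℝ fun u => f (φ.symm u)) (φ x₀) := h1.fderiv_right (by simp)
  have h3 : ContMDiffAt (𝓡 n) 𝓘(ℝ, F) ∞ (fun x => fderiv ℝ (fun u => f (φ.symm u)) (φ x)
      (dChart n x₀ x (fieldValue V x))) x₀ :=
    (h2.contMDiffAt.comp x₀ (contMDiffAt_extChartAt (n := ∞))).clm_apply
      ((contMDiffOn_dChart_apply x₀ V).contMDiffAt
        ((isOpen_extChartAt_source (I := 𝓡 n) x₀).mem_nhds hx))
  refine h3.congr_of_eventuallyEq ?_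
  filter_upwards [hO.mem_nhds hx₀, (isOpen_extChartAt_source (I := 𝓡 n) x₀).mem_nhds hx] with x h4 h5
  exact dirDeriv_eq_fderiv h5 (hf.contMDiffAt (hO.mem_nhds h4)) _

end DirectionalDerivatives

/-! ### Weighted connections and their sums -/

section WeightedConnections
open Filter Topology

variable {n : ℕ} {G X : Type*} [Group G] [EMetricSpace X]
  [ChartedSpace (EuclideanSpace ℝ (Fin n)) X] [IsManifold (𝓡 n) ∞ X]
  {A : Type*} [NonUnitalCStarAlgebra A] {E : X → Type*} [∀ x, NonUnitalCStarAlgebra (E x)]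
  [TopologicalSpace (TotalSpace A E)] [FiberBundle A E] [VectorBundle ℝ A E]

/-- Operators with the algebraic properties of a Hermitian connection, except that the Leibniz rule
for multiplication by functions holds with a weight `w`: these are the summands of connections. -/
structure IsWeightedConnection (w : X → ℝ)
    (T : SmoothVectorField n X → SmoothSection n A E → SmoothSection n A E) : Prop where
  add_field : ∀ (U V W : SmoothVectorField n X) (a : SmoothSection n A E),
    (∀ x, U x = V x + W x) → ∀ x, T U a x = T V a x + T W a x
  smul_field : ∀ (f : X → ℝ) (V W : SmoothVectorField n X) (a : SmoothSection n A E),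
    ContMDiff (𝓡 n) 𝓘(ℝ, ℝ) ∞ f → (∀ x, W x = f x • V x) → ∀ x, T W a x = f x • T V a x
  add_section : ∀ (V : SmoothVectorField n X) (a b c : SmoothSection n A E),
    (∀ x, c x = a x + b x) → ∀ x, T V c x = T V a x + T V b x
  smul_section : ∀ (z : ℂ) (V : SmoothVectorField n X) (a b : SmoothSection n A E),
    (∀ x, b x = z • a x) → ∀ x, T V b x = z • T V a x
  leibniz : ∀ (f : X → ℝ) (V : SmoothVectorField n X) (a b : SmoothSection n A E),
    ContMDiff (𝓡 n) 𝓘(ℝ, ℝ) ∞ f → (∀ x, b x = f x • a x) →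
      ∀ x, T V b x = f x • T V a x + (w x * dirDeriv n f x (fieldValue V x)) • a x
  mul_section : ∀ (V : SmoothVectorField n X) (a b c : SmoothSection n A E),
    (∀ x, c x = a x * b x) → ∀ x, T V c x = a x * T V b x + T V a x * b x
  star_section : ∀ (V : SmoothVectorField n X) (a b : SmoothSection n A E),
    (∀ x, b x = star (a x)) → ∀ x, T V b x = star (T V a x)

variable [ContMDiffVectorBundle ∞ A E (𝓡 n)]

/-- A locally finite sum of weighted connections, with weights that sum up to one, is a Hermitian
connection. -/
theorem exists_connection_of_finsum {ι : Type*} {w : ι → X → ℝ}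
    {T : ι → SmoothVectorField n X → SmoothSection n A E → SmoothSection n A E}
    (hT : ∀ i, IsWeightedConnection (w i) (T i)) {S : ι → Set X} (hS : LocallyFinite S)
    (hTS : ∀ i V σ x, x ∉ S i → T i V σ x = 0) (hwS : ∀ i x, x ∉ S i → w i x = 0)
    (hw : ∀ x, ∑ᶠ i, w i x = 1) :
    ∃ D : HermitianConnection n A E, ∀ V σ x, D.toFun V σ x = ∑ᶠ i, T i V σ x := by
  have hlf : ∀ V σ, LocallyFinite fun i => {x | T i V σ x ≠ 0} := fun V σ =>
    hS.subset fun i x hx => by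
      by_contra h
      exact hx (hTS i V σ x h)
  have hfin : ∀ x, {i | x ∈ S i}.Finite := fun x => hS.point_finite x
  have hsum : ∀ V σ x, ∑ᶠ i, T i V σ x = ∑ i ∈ (hfin x).toFinset, T i V σ x := fun V σ x =>
    finsum_eq_sum_of_support_subset _ fun i hi => by
      rw [Finite.coe_toFinset]
      by_contra h
      exact hi (hTS i V σ x h)
  have hwsum : ∀ x, ∑ i ∈ (hfin x).toFinset, w i x = 1 := fun x => by
    rw [← hw x]
    refine (finsum_eq_sum_of_support_subset _ fun i hi => ?_).symm
    rw [Finite.coe_toFinset]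
    by_contra h
    exact hi (hwS i x h)
  refine ⟨{ toFun := fun V σ => ⟨fun x => ∑ᶠ i, T i V σ x,
              ContMDiff.finsum_section_of_locallyFinite (hlf V σ) fun i => (T i V σ).contMDiff⟩
            add_field := fun V W a x => ?_
            smul_field := fun f V W a hf h x => ?_
            add_section := fun V a b x => ?_
            smul_section := fun z V a b h x => ?_
            leibniz := fun f V a b hf h x => ?_
            mul_section := fun V a b c h x => ?_
            star_section := fun V a b h x => ?_ }, fun _ _ _ => rfl⟩ <;>
    simp only [ContMDiffSection.coeFn_mk, hsum]
  · rw [← Finset.sum_add_distrib]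
    exact Finset.sum_congr rfl fun i _ => (hT i).add_field _ V W a (fun _ => rfl) x
  · rw [Finset.smul_sum]
    exact Finset.sum_congr rfl fun i _ => (hT i).smul_field f V W a hf h x
  · rw [← Finset.sum_add_distrib]
    exact Finset.sum_congr rfl fun i _ => (hT i).add_section V a b _ (fun _ => rfl) x
  · rw [Finset.smul_sum]
    exact Finset.sum_congr rfl fun i _ => (hT i).smul_section z V a b h x
  · rw [Finset.sum_congr rfl fun i _ => (hT i).leibniz f V a b hf h x, Finset.sum_add_distrib,
      ← Finset.smul_sum, ← Finset.sum_smul, ← Finset.sum_mul, hwsum, one_mul]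
    rfl
  · rw [Finset.mul_sum, Finset.sum_mul, ← Finset.sum_add_distrib]
    exact Finset.sum_congr rfl fun i _ => (hT i).mul_section V a b c h x
  · rw [star_sum]
    exact Finset.sum_congr rfl fun i _ => (hT i).star_section V a b h x

/-- The trivial connection in the trivialization at `p`, multiplied with a cutoff function. -/
theorem exists_cutoff_connection (hE : IsCStarBundle A E) (p : X) {ρ : X → ℝ}
    (hρ : ContMDiff (𝓡 n) 𝓘(ℝ, ℝ) ∞ ρ) (hρp : tsupport ρ ⊆ trivSet A E p) :
    ∃ T : SmoothVectorField n X → SmoothSection n A E → SmoothSection n A E,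
      IsWeightedConnection ρ T ∧ ∀ V σ x, T V σ x = ρ x • ofFibreCoord E p x
        (dirDeriv n (fun y => fibreCoord A p (σ y)) x (fieldValue V x)) := by
  choose T hT using fun (V : SmoothVectorField n X) (σ : SmoothSection n A E) =>
    exists_cutoff_section (E := E) hρ (isOpen_trivSet p) subset_rfl hρp
      (contMDiffOn_dirDeriv_apply (isOpen_trivSet p) (contMDiffOn_fibreCoord p σ) V)
  refine ⟨T, ?_, hT⟩
  -- outside of the domain of the trivialization everything vanishes
  have hred : ∀ (x : X) (P : Prop), (ρ x = 0 → P) → (x ∈ trivSet A E p → P) → P := by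
    intro x P h1 h2
    by_cases hx : x ∈ trivSet A E p
    · exact h2 hx
    · exact h1 (image_eq_zero_of_notMem_tsupport fun h => hx (hρp h))
  have hsm : ∀ (σ : SmoothSection n A E) {x}, x ∈ trivSet A E p →
      ContMDiffAt (𝓡 n) 𝓘(ℝ, A) ∞ (fun y => fibreCoord A p (σ y)) x := fun σ x hx =>
    (contMDiffOn_fibreCoord p σ).contMDiffAt ((isOpen_trivSet p).mem_nhds hx)
  have hev : ∀ {x}, x ∈ trivSet A E p → ∀ᶠ y in 𝓝 x, y ∈ trivSet A E p := fun hx =>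
    (isOpen_trivSet p).mem_nhds hx
  constructor
  · intro U V W a h x
    refine hred x _ (fun h0 => by simp [hT, h0]) fun hx => ?_
    have h1 : dirDeriv n (fun y => fibreCoord A p (a y)) x (fieldValue U x) =
        dirDeriv n (fun y => fibreCoord A p (a y)) x (fieldValue V x) +
          dirDeriv n (fun y => fibreCoord A p (a y)) x (fieldValue W x) :=
      (congrArg (dirDeriv n (fun y => fibreCoord A p (a y)) x) (h x)).trans (map_add _ _ _)
    rw [hT, hT, hT, h1, ofFibreCoord_add hE hx, smul_add]
  · intro f V W a hf h x
    refine hred x _ (fun h0 => by simp [hT, h0]) fun hx => ?_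
    have h1 : dirDeriv n (fun y => fibreCoord A p (a y)) x (fieldValue W x) =
        f x • dirDeriv n (fun y => fibreCoord A p (a y)) x (fieldValue V x) :=
      (congrArg (dirDeriv n (fun y => fibreCoord A p (a y)) x) (h x)).trans (map_smul _ _ _)
    rw [hT, hT, h1, ofFibreCoord_real_smul hE hx, smul_comm]
  · intro V a b c h x
    refine hred x _ (fun h0 => by simp [hT, h0]) fun hx => ?_
    have h1 : (fun y => fibreCoord A p (c y)) =ᶠ[𝓝 x]
        fun y => fibreCoord A p (a y) + fibreCoord A p (b y) :=
      (hev hx).mono fun y hy => by simp only [h, fibreCoord_add hE hy]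
    rw [hT, hT, hT, dirDeriv_congr h1, dirDeriv_add (hsm a hx) (hsm b hx),
      ofFibreCoord_add hE hx, smul_add]
  · intro z V a b h x
    refine hred x _ (fun h0 => by simp [hT, h0]) fun hx => ?_
    have h1 : (fun y => fibreCoord A p (b y)) =ᶠ[𝓝 x] fun y =>
        (z • ContinuousLinearMap.id ℝ A) (fibreCoord A p (a y)) :=
      (hev hx).mono fun y hy => by simp [h, fibreCoord_smul hE hy]
    rw [hT, hT, dirDeriv_congr h1, dirDeriv_clm _ (hsm a hx)]
    simp only [_root_.smul_apply, ContinuousLinearMap.id_apply, ofFibreCoord_smul hE hx]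
    rw [smul_comm]
  · intro f V a b hf h x
    refine hred x _ (fun h0 => by simp [hT, h0]) fun hx => ?_
    have h1 : (fun y => fibreCoord A p (b y)) =ᶠ[𝓝 x] fun y =>
        ContinuousLinearMap.lsmul ℝ ℝ (f y) (fibreCoord A p (a y)) :=
      (hev hx).mono fun y hy => by simp [h, fibreCoord_real_smul hE hy]
    rw [hT, hT, dirDeriv_congr h1, dirDeriv_bilinear _ hf.contMDiffAt (hsm a hx)]
    simp only [ContinuousLinearMap.lsmul_apply, ofFibreCoord_add hE hx,
      ofFibreCoord_real_smul hE hx, ofFibreCoord_fibreCoord hx, smul_add]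
    rw [smul_comm, mul_smul (ρ x)]
  · intro V a b c h x
    refine hred x _ (fun h0 => by simp [hT, h0]) fun hx => ?_
    have h1 : (fun y => fibreCoord A p (c y)) =ᶠ[𝓝 x] fun y =>
        ContinuousLinearMap.mul ℝ A (fibreCoord A p (a y)) (fibreCoord A p (b y)) :=
      (hev hx).mono fun y hy => by simp [h, fibreCoord_mul hE hy]
    rw [hT, hT, hT, dirDeriv_congr h1, dirDeriv_bilinear _ (hsm a hx) (hsm b hx)]
    simp only [ContinuousLinearMap.mul_apply', ofFibreCoord_add hE hx,
      ofFibreCoord_mul hE hx, ofFibreCoord_fibreCoord hx, smul_add, mul_smul_comm, smul_mul_assoc]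
  · intro V a b h x
    refine hred x _ (fun h0 => by simp [hT, h0]) fun hx => ?_
    have h1 : (fun y => fibreCoord A p (b y)) =ᶠ[𝓝 x] fun y =>
        ((starL' ℝ : A ≃L[ℝ] A) : A →L[ℝ] A) (fibreCoord A p (a y)) :=
      (hev hx).mono fun y hy => by simp [h, fibreCoord_star hE hy]
    rw [hT, hT, dirDeriv_congr h1, dirDeriv_clm _ (hsm a hx)]
    simp [ofFibreCoord_star hE hx, star_smul]

end WeightedConnections

/-! ### Translates of weighted connections -/

section TranslatedConnections
open Filter Topology

variable {n : ℕ} {G X : Type*} [Group G] [EMetricSpace X]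
  [ChartedSpace (EuclideanSpace ℝ (Fin n)) X] [IsManifold (𝓡 n) ∞ X] [MulAction G X]
  {A : Type*} [NonUnitalCStarAlgebra A] {E : X → Type*} [∀ x, NonUnitalCStarAlgebra (E x)]
  [TopologicalSpace (TotalSpace A E)] [FiberBundle A E] [VectorBundle ℝ A E]
  [ContMDiffVectorBundle ∞ A E (𝓡 n)] [MulAction G (TotalSpace A E)]

/-- The translate `(g σ)(g x) = g (σ x)` of a smooth section `σ`. -/
def smulSection (hG : ∀ g : G, ContMDiff (𝓡 n) (𝓡 n) ∞ (fun x : X => g • x))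
    (hGE : IsSmoothEquivariantBundle n G A E) (g : G) (σ : SmoothSection n A E) :
    SmoothSection n A E :=
  (exists_smul_section hG hGE g σ).choose

/-- The translate `(g V)(g x) = dg (V x)` of a smooth vector field `V`. -/
def smulField (hG : ∀ g : G, ContMDiff (𝓡 n) (𝓡 n) ∞ (fun x : X => g • x)) (g : G)
    (V : SmoothVectorField n X) : SmoothVectorField n X :=
  (exists_smul_field hG g V).choose

variable (hG : ∀ g : G, ContMDiff (𝓡 n) (𝓡 n) ∞ (fun x : X => g • x))

theorem fieldValue_smulField (g : G) (V : SmoothVectorField n X) (x : X) :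
    fieldValue (smulField hG g V) (g • x) = dMap n (fun x : X => g • x) x (fieldValue V x) :=
  (exists_smul_field hG g V).choose_spec x

theorem fieldValue_smulField_inv (g : G) (V : SmoothVectorField n X) (x : X) :
    fieldValue (smulField hG g⁻¹ V) x =
      dMap n (fun x : X => g⁻¹ • x) (g • x) (fieldValue V (g • x)) := by
  have h := fieldValue_smulField hG g⁻¹ V (g • x)
  rwa [inv_smul_smul] at h

include hG in
theorem dMap_smul_dMap_inv_smul (g : G) (x : X) (v : EuclideanSpace ℝ (Fin n)) :
    dMap n (fun x : X => g • x) x (dMap n (fun x : X => g⁻¹ • x) (g • x) v) = v := by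
  have h1 : MDifferentiableAt (𝓡 n) (𝓡 n) (fun x : X => g⁻¹ • x) (g • x) :=
    (hG g⁻¹).mdifferentiable (by simp) _
  have h2 : MDifferentiableAt (𝓡 n) (𝓡 n) (fun x : X => g • x) (g⁻¹ • g • x) :=
    (hG g).mdifferentiable (by simp) _
  have h3 := mfderiv_comp (g • x) h2 h1
  have h4 : (fun x : X => g • x) ∘ (fun x : X => g⁻¹ • x) = id := by
    funext x
    exact smul_inv_smul g x
  rw [h4, mfderiv_id] at h3
  have h5 : dMap n (fun x : X => g • x) (g⁻¹ • g • x) (dMap n (fun x : X => g⁻¹ • x) (g • x) v) =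
    v := (DFunLike.congr_fun h3 v).symm
  rwa [inv_smul_smul] at h5

variable (hGE : IsSmoothEquivariantBundle n G A E)

theorem smulSection_smul (g : G) (σ : SmoothSection n A E) (x : X) :
    smulSection hG hGE g σ (g • x) = fibreSMul hGE g x (σ x) := by
  have h := (exists_smul_section hG hGE g σ).choose_spec x
  rw [smul_mk hGE] at h
  exact eq_of_heq (TotalSpace.mk.inj h).2

/-- The translate by `g⁻¹` of a section, moved back by `g`. -/
theorem fibreSMul_smulSection_inv (g : G) (σ : SmoothSection n A E) (x : X) :
    fibreSMul hGE g x (smulSection hG hGE g⁻¹ σ x) = σ (g • x) := by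
  have h : ∀ x, (⟨g • x, σ (g • x)⟩ : TotalSpace A E) =
      g • (⟨x, smulSection hG hGE g⁻¹ σ x⟩ : TotalSpace A E) := by
    intro x
    have h1 := (exists_smul_section hG hGE g⁻¹ σ).choose_spec (g • x)
    rw [inv_smul_smul] at h1
    refine Eq.symm ((congrArg (g • ·) h1).trans ?_)
    exact smul_inv_smul _ _
  have h1 := h x
  rw [smul_mk hGE] at h1
  exact (eq_of_heq (TotalSpace.mk.inj h1).2).symm

/-- The translate of an operator `T` on fields and sections by the action of `g`. -/
def translateOp (g : G)
    (T : SmoothVectorField n X → SmoothSection n A E → SmoothSection n A E)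
    (V : SmoothVectorField n X) (σ : SmoothSection n A E) : SmoothSection n A E :=
  smulSection hG hGE g (T (smulField hG g⁻¹ V) (smulSection hG hGE g⁻¹ σ))

theorem translateOp_smul (g : G)
    (T : SmoothVectorField n X → SmoothSection n A E → SmoothSection n A E)
    (V : SmoothVectorField n X) (σ : SmoothSection n A E) (x : X) :
    translateOp hG hGE g T V σ (g • x) =
      fibreSMul hGE g x (T (smulField hG g⁻¹ V) (smulSection hG hGE g⁻¹ σ) x) :=
  smulSection_smul hG hGE _ _ _

include hG in
/-- The action by diffeomorphisms and isomorphisms of the fibres transports all algebraic properties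
of connections, and the weight is translated. -/
theorem isWeightedConnection_translateOp {w : X → ℝ}
    {T : SmoothVectorField n X → SmoothSection n A E → SmoothSection n A E}
    (hT : IsWeightedConnection w T) (g : G) :
    IsWeightedConnection (fun x => w (g⁻¹ • x)) (translateOp hG hGE g T) := by
  have hall : ∀ {P : X → Prop}, (∀ x, P (g • x)) → ∀ x, P x := fun h x => by
    simpa using h (g⁻¹ • x)
  have hS := fibreSMul_smulSection_inv hG hGE g
  have hinj : ∀ x {v w : E x}, fibreSMul hGE g x v = fibreSMul hGE g x w → v = w := fun x v w h =>
    (fibreSMul hGE g x).injective h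
  have hF := fieldValue_smulField_inv hG g
  have hreal : ∀ x (c : ℝ) (v : E x), fibreSMul hGE g x (c • v) = c • fibreSMul hGE g x v :=
    fun x c v => map_smul (fibreSMul hGE g x) (c : ℂ) v
  have hsm : ∀ {f : X → ℝ}, ContMDiff (𝓡 n) 𝓘(ℝ, ℝ) ∞ f →
      ContMDiff (𝓡 n) 𝓘(ℝ, ℝ) ∞ fun x => f (g • x) := fun hf => hf.comp (hG g)
  constructor
  · intro U V W a h
    refine hall fun x => ?_
    simp only [translateOp_smul]
    rw [hT.add_field _ (smulField hG g⁻¹ V) (smulField hG g⁻¹ W) _ (fun y => ?_) x, map_add]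
    have h1 : fieldValue U (g • y) = fieldValue V (g • y) + fieldValue W (g • y) := h _
    have h2 : fieldValue (smulField hG g⁻¹ U) y =
        fieldValue (smulField hG g⁻¹ V) y + fieldValue (smulField hG g⁻¹ W) y := by
      rw [hF, hF, hF, h1, map_add]
    exact h2
  · intro f V W a hf h
    refine hall fun x => ?_
    simp only [translateOp_smul]
    rw [hT.smul_field _ (smulField hG g⁻¹ V) _ _ (hsm hf) (fun y => ?_) x, hreal]
    have h1 : fieldValue W (g • y) = f (g • y) • fieldValue V (g • y) := h _
    have h2 : fieldValue (smulField hG g⁻¹ W) y =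
        f (g • y) • fieldValue (smulField hG g⁻¹ V) y := by
      rw [hF, hF, h1, map_smul]
    exact h2
  · intro V a b c h
    refine hall fun x => ?_
    simp only [translateOp_smul]
    rw [hT.add_section _ (smulSection hG hGE g⁻¹ a) (smulSection hG hGE g⁻¹ b) _
      (fun y => hinj y (by rw [map_add, hS, hS, hS, h])) x, map_add]
  · intro z V a b h
    refine hall fun x => ?_
    simp only [translateOp_smul]
    rw [hT.smul_section z _ (smulSection hG hGE g⁻¹ a) _
      (fun y => hinj y (by rw [map_smul, hS, hS, h])) x, map_smul]
  · intro f V a b hf h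
    refine hall fun x => ?_
    simp only [translateOp_smul]
    rw [hT.leibniz _ _ (smulSection hG hGE g⁻¹ a) _ (hsm hf)
      (fun y => hinj y (by rw [hreal, hS, hS, h])) x, map_add, hreal, hreal, hS,
      dirDeriv_comp_smul (hG g) hf.contMDiffAt, hF, dMap_smul_dMap_inv_smul hG, inv_smul_smul]
  · intro V a b c h
    refine hall fun x => ?_
    simp only [translateOp_smul]
    rw [hT.mul_section _ (smulSection hG hGE g⁻¹ a) (smulSection hG hGE g⁻¹ b) _
      (fun y => hinj y (by rw [map_mul, hS, hS, hS, h])) x, map_add, map_mul, map_mul, hS, hS]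
  · intro V a b h
    refine hall fun x => ?_
    simp only [translateOp_smul]
    rw [hT.star_section _ (smulSection hG hGE g⁻¹ a) _
      (fun y => hinj y (by rw [map_star, hS, hS, h])) x, map_star]

end TranslatedConnections

/-! ### Invariant connections for proper actions of discrete groups -/

section DiscreteGroups
open Filter Topology

variable {n : ℕ} {G X : Type*} [Group G] [EMetricSpace X]
  [ChartedSpace (EuclideanSpace ℝ (Fin n)) X] [IsManifold (𝓡 n) ∞ X] [MulAction G X]
  {A : Type*} [NonUnitalCStarAlgebra A] {E : X → Type*} [∀ x, NonUnitalCStarAlgebra (E x)]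
  [TopologicalSpace (TotalSpace A E)] [FiberBundle A E] [VectorBundle ℝ A E]
  [ContMDiffVectorBundle ∞ A E (𝓡 n)] [MulAction G (TotalSpace A E)]

/-- Translates of operators are permuted by the action of the group. -/
theorem translateOp_mul (hG : ∀ g : G, ContMDiff (𝓡 n) (𝓡 n) ∞ (fun x : X => g • x))
    (hGE : IsSmoothEquivariantBundle n G A E)
    (T : SmoothVectorField n X → SmoothSection n A E → SmoothSection n A E) (g h : G)
    {V V' : SmoothVectorField n X} {a a' : SmoothSection n A E}
    (hV : ∀ x, V' (g • x) = mfderiv (𝓡 n) (𝓡 n) (fun x : X => g • x) x (V x))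
    (ha : ∀ x, (⟨g • x, a' (g • x)⟩ : TotalSpace A E) = g • (⟨x, a x⟩ : TotalSpace A E)) (x : X) :
    translateOp hG hGE (g * h) T V' a' (g • x) = fibreSMul hGE g x (translateOp hG hGE h T V a x) := by
  have hfield : smulField hG (g * h)⁻¹ V' = smulField hG h⁻¹ V := by
    ext1 z
    have hinj : Function.Injective (dMap n (fun x : X => (g * h) • x) z) := by
      refine Function.LeftInverse.injective
        (g := dMap n (fun x : X => (g * h)⁻¹ • x) ((g * h) • z)) fun v => ?_
      have h1 := dMap_smul_dMap_inv_smul hG (g * h)⁻¹ ((g * h) • z) v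
      rwa [inv_smul_smul, inv_inv] at h1
    refine hinj ?_
    have h1 : dMap n (fun x : X => (g * h) • x) z (fieldValue (smulField hG (g * h)⁻¹ V') z) =
        fieldValue V' ((g * h) • z) := by
      rw [fieldValue_smulField_inv, dMap_smul_dMap_inv_smul hG]
    have h2 : dMap n (fun x : X => (g * h) • x) z (fieldValue (smulField hG h⁻¹ V) z) =
        fieldValue V' ((g * h) • z) := by
      have h3 := mfderiv_comp z ((hG g).mdifferentiable (by simp) (h • z))
        ((hG h).mdifferentiable (by simp) z)
      have h4 : (fun x : X => g • x) ∘ (fun x : X => h • x) = fun x => (g * h) • x := by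
        funext x
        exact (mul_smul g h x).symm
      rw [h4] at h3
      have h5 : dMap n (fun x : X => (g * h) • x) z (fieldValue (smulField hG h⁻¹ V) z) =
          dMap n (fun x : X => g • x) (h • z) (dMap n (fun x : X => h • x) z
            (fieldValue (smulField hG h⁻¹ V) z)) := DFunLike.congr_fun h3 _
      rw [h5, fieldValue_smulField_inv, dMap_smul_dMap_inv_smul hG, mul_smul]
      exact (hV _).symm
    exact h1.trans h2.symm
  have hsec : smulSection hG hGE (g * h)⁻¹ a' = smulSection hG hGE h⁻¹ a := by
    ext1 z
    have hinj : ∀ {v w : E z}, fibreSMul hGE (g * h) z v = fibreSMul hGE (g * h) z w → v = w :=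
      fun h => (fibreSMul hGE _ z).injective h
    refine hinj ?_
    rw [fibreSMul_smulSection_inv]
    have h1 : (⟨(g * h) • z, a' ((g * h) • z)⟩ : TotalSpace A E) =
        (g * h) • (⟨z, smulSection hG hGE h⁻¹ a z⟩ : TotalSpace A E) := by
      rw [mul_smul, mul_smul, ha, smul_mk hGE h, fibreSMul_smulSection_inv]
    rw [smul_mk hGE] at h1
    exact eq_of_heq (TotalSpace.mk.inj h1).2
  have h1 : (⟨g • x, translateOp hG hGE (g * h) T V' a' (g • x)⟩ : TotalSpace A E) =
      g • ⟨x, translateOp hG hGE h T V a x⟩ := by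
    obtain ⟨y, rfl⟩ := MulAction.surjective h x
    rw [← mul_smul, translateOp_smul, ← smul_mk hGE, hfield, hsec, translateOp_smul,
      ← smul_mk hGE h, mul_smul]
  rw [smul_mk hGE] at h1
  exact eq_of_heq (TotalSpace.mk.inj h1).2

/-- If the translates of a family of functions form a locally finite partition of unity, then the
translates of the corresponding local connections add up to an invariant connection. -/
theorem exists_invariant_connection_of_partition
    (hG : ∀ g : G, ContMDiff (𝓡 n) (𝓡 n) ∞ (fun x : X => g • x)) (hE : IsCStarBundle A E)
    (hGE : IsSmoothEquivariantBundle n G A E) {ι : Type*} {p : ι → X} {ρ : ι → X → ℝ}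
    (hρ : ∀ i, ContMDiff (𝓡 n) 𝓘(ℝ, ℝ) ∞ (ρ i)) (hρp : ∀ i, tsupport (ρ i) ⊆ trivSet A E (p i))
    (hlf : LocallyFinite fun i : ι × G => {x : X | ρ i.1 (i.2⁻¹ • x) ≠ 0})
    (hsum : ∀ x, ∑ᶠ i : ι × G, ρ i.1 (i.2⁻¹ • x) = 1) :
    ∃ D : HermitianConnection n A E, D.IsInvariant G := by
  choose T hT hTv using fun i => exists_cutoff_connection hE (p i) (hρ i) (hρp i)
  obtain ⟨D, hD⟩ := exists_connection_of_finsum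
    (T := fun i : ι × G => translateOp hG hGE i.2 (T i.1))
    (fun i => isWeightedConnection_translateOp hG hGE (hT i.1) i.2) hlf
    (fun i V σ x hx => by
      obtain ⟨y, rfl⟩ := MulAction.surjective i.2 x
      have hx0 : ρ i.1 y = 0 := by simpa using hx
      rw [translateOp_smul, hTv, hx0, zero_smul, map_zero])
    (fun i x hx => by simpa using hx) hsum
  refine ⟨D, fun g V V' a a' hV ha x => ?_⟩
  rw [smul_mk hGE, hD, hD]
  congr 1
  rw [AddEquivClass.map_finsum (fibreSMul hGE g x)]
  rw [← finsum_comp_equiv ((Equiv.refl ι).prodCongr (Equiv.mulLeft g))]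
  exact finsum_congr fun i => translateOp_mul hG hGE _ g i.2 hV ha x

/-- A discrete group that acts properly admits partitions of unity that consist of the translates of
functions with small supports. -/
theorem exists_translate_partition [SecondCountableTopology X] [TopologicalSpace G]
    [DiscreteTopology G] [ContinuousConstSMul G X]
    [ProperSMul G X] (hG : ∀ g : G, ContMDiff (𝓡 n) (𝓡 n) ∞ (fun x : X => g • x)) {O : X → Set X}
    (hO : ∀ x, O x ∈ 𝓝 x) [Nonempty X] :
    ∃ (p : ℕ → X) (ρ : ℕ → X → ℝ), (∀ i, ContMDiff (𝓡 n) 𝓘(ℝ, ℝ) ∞ (ρ i)) ∧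
      (∀ i, tsupport (ρ i) ⊆ O (p i)) ∧
      (LocallyFinite fun i : ℕ × G => {x : X | ρ i.1 (i.2⁻¹ • x) ≠ 0}) ∧
      ∀ x, ∑ᶠ i : ℕ × G, ρ i.1 (i.2⁻¹ • x) = 1 := by
  have : LocallyCompactSpace X := ChartedSpace.locallyCompactSpace (EuclideanSpace ℝ (Fin n)) X
  have hpd : ProperlyDiscontinuousSMul G X := properlyDiscontinuousSMul_iff_properSMul.2 inferInstance
  choose f hf hfO hfc hf1 hf01 using fun x => exists_cutoff n (hO x)
  obtain ⟨s, hs, hsc⟩ := TopologicalSpace.countable_cover_nhds hf1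
  have hsne : s.Nonempty := by
    obtain ⟨x⟩ := ‹Nonempty X›
    have hx : x ∈ ⋃ y ∈ s, {x | f y x = 1} := hsc ▸ mem_univ x
    obtain ⟨y, hy, -⟩ := mem_iUnion₂.1 hx
    exact ⟨y, hy⟩
  obtain ⟨p, rfl⟩ := hs.exists_eq_range hsne
  have hpc : ∀ x, ∃ i, f (p i) x = 1 := fun x => by
    have hx : x ∈ ⋃ y ∈ range p, {x | f y x = 1} := hsc ▸ mem_univ x
    obtain ⟨y, ⟨i, rfl⟩, hy⟩ := mem_iUnion₂.1 hx
    exact ⟨i, hy⟩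
  have hact : ∀ g : G, ContMDiff (𝓡 n) (𝓡 n) ∞ (fun x : X => g⁻¹ • x) := fun g => hG g⁻¹
  -- for every function, only finitely many translates meet a small open set
  have hfin : ∀ (L : Set X), IsCompact L → ∀ i,
      {g : G | ∃ x ∈ L, f (p i) (g⁻¹ • x) ≠ 0}.Finite := by
    intro L hL i
    refine (hpd.finite_disjoint_inter_image (hfc (p i)).isCompact hL).subset ?_
    rintro g ⟨x, hx, hgx⟩
    exact ⟨x, ⟨g⁻¹ • x, subset_tsupport _ hgx, smul_inv_smul g x⟩, hx⟩
  set F : ℕ → X → ℝ := fun i x => ∑ᶠ g : G, f (p i) (g⁻¹ • x) with hF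
  have hFs : ∀ i, ContMDiff (𝓡 n) 𝓘(ℝ, ℝ) ∞ (F i) := by
    intro i
    refine contMDiff_finsum (fun g => (hf (p i)).comp (hact g)) fun x => ?_
    obtain ⟨L, hL, hLx⟩ := exists_compact_mem_nhds x
    exact ⟨L, hLx, (hfin L hL i).subset fun g ⟨y, hy1, hy2⟩ => ⟨y, hy2, hy1⟩⟩
  have hFinv : ∀ i (g : G) x, F i (g • x) = F i x := by
    intro i g x
    simp only [hF]
    rw [← finsum_comp_equiv (Equiv.mulLeft g)]
    exact finsum_congr fun h => by simp [mul_smul]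
  have hFnn : ∀ i x, 0 ≤ F i x := fun i x => finsum_nonneg fun g => (hf01 (p i) _).1
  have hFpos : ∀ i x, f (p i) x = 1 → 0 < F i x := by
    intro i x hx
    have h1 := (hfin {x} isCompact_singleton i)
    have h2 := single_le_finsum (f := fun g : G => f (p i) (g⁻¹ • x)) 1
      (h1.subset fun g hg => ⟨x, rfl, hg⟩) fun g => (hf01 (p i) _).1
    simp only [inv_one, one_smul, hx] at h2
    exact lt_of_lt_of_le one_pos h2
  -- the invariant function `ψ i` vanishes where one of the previous `F j` is at least `1 / i`
  set ψ : ℕ → X → ℝ := fun i x =>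
    ∏ j ∈ Finset.range i, Real.smoothTransition (1 - i * F j x) with hψ
  have hψs : ∀ i, ContMDiff (𝓡 n) 𝓘(ℝ, ℝ) ∞ (ψ i) := fun i =>
    contMDiff_finsetProd fun j _ => (Real.smoothTransition.contDiff (n := ⊤)).contMDiff.comp
      (contMDiff_const.sub (contMDiff_const.mul (hFs j)))
  have hψinv : ∀ i (g : G) x, ψ i (g • x) = ψ i x := fun i g x => by simp only [hψ, hFinv]
  have hψnn : ∀ i x, 0 ≤ ψ i x := fun i x =>
    Finset.prod_nonneg fun j _ => Real.smoothTransition.nonneg _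
  set c : ℕ → X → ℝ := fun i x => ψ i x * f (p i) x with hc
  have hcs : ∀ i, ContMDiff (𝓡 n) 𝓘(ℝ, ℝ) ∞ (c i) := fun i => (hψs i).mul (hf (p i))
  have hclf : LocallyFinite fun i : ℕ × G => {x : X | c i.1 (i.2⁻¹ • x) ≠ 0} := by
    intro x
    obtain ⟨j, hj⟩ := hpc x
    obtain ⟨L, hL, hLx⟩ := exists_compact_mem_nhds x
    have hFj : ∀ᶠ y in 𝓝 x, F j x / 2 < F j y :=
      (hFs j).continuous.continuousAt.eventually (Ioi_mem_nhds (by linarith [hFpos j x hj]))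
    obtain ⟨N, hN⟩ := exists_nat_gt (max (j : ℝ) (2 / F j x))
    refine ⟨L ∩ {y | F j x / 2 < F j y}, inter_mem hLx hFj, ?_⟩
    refine ((Finset.range N).finite_toSet.biUnion fun i _ =>
      ((hfin L hL i).image (Prod.mk i))).subset ?_
    rintro ⟨i, g⟩ ⟨y, hy, hyL, hyF⟩
    have hy1 : f (p i) (g⁻¹ • y) ≠ 0 := right_ne_zero_of_mul hy
    have hy2 : ψ i y ≠ 0 := by
      rw [← hψinv i g⁻¹]
      exact left_ne_zero_of_mul hy
    refine mem_iUnion₂.2 ⟨i, ?_, g, ⟨y, hyL, hy1⟩, rfl⟩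
    rw [Finset.mem_coe, Finset.mem_range]
    by_contra hi
    have hi' : (N : ℝ) ≤ i := by exact_mod_cast not_lt.1 hi
    have hji : j < i := by
      have := (le_max_left (j : ℝ) (2 / F j x)).trans_lt (hN.trans_le hi')
      exact_mod_cast this
    refine hy2 (Finset.prod_eq_zero (Finset.mem_range.2 hji)
      (Real.smoothTransition.zero_of_nonpos ?_))
    have h1 : 2 / F j x < i := (le_max_right _ _).trans_lt (hN.trans_le hi')
    rw [div_lt_iff₀ (hFpos j x hj)] at h1
    have h2 : F j x / 2 < F j y := hyF
    have h3 : (i : ℝ) * (F j x / 2) ≤ i * F j y := by gcongr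
    linarith
  set S : X → ℝ := fun x => ∑ᶠ i : ℕ × G, c i.1 (i.2⁻¹ • x) with hS
  have hSs : ContMDiff (𝓡 n) 𝓘(ℝ, ℝ) ∞ S :=
    contMDiff_finsum (fun i => (hcs i.1).comp (hact i.2)) hclf
  have hSinv : ∀ (g : G) x, S (g • x) = S x := by
    intro g x
    simp only [hS]
    rw [← finsum_comp_equiv ((Equiv.refl ℕ).prodCongr (Equiv.mulLeft g))]
    exact finsum_congr fun h => by simp [mul_smul]
  have hSpos : ∀ x, 0 < S x := by
    intro x
    classical
    have hex : ∃ j, 0 < F j x := by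
      obtain ⟨j, hj⟩ := hpc x
      exact ⟨j, hFpos j x hj⟩
    -- for the first positive `F j x`, the factor `ψ j x` is one
    have hψ1 : ψ (Nat.find hex) x = 1 := Finset.prod_eq_one fun j hj => by
      have h1 : F j x = 0 := le_antisymm
        (not_lt.1 (Nat.find_min hex (Finset.mem_range.1 hj))) (hFnn j x)
      rw [h1, mul_zero, sub_zero, Real.smoothTransition.one]
    obtain ⟨g, hg⟩ : ∃ g : G, f (p (Nat.find hex)) (g⁻¹ • x) ≠ 0 := by
      by_contra! h
      have h1 : F (Nat.find hex) x = 0 := by simp only [hF, h, finsum_zero]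
      exact (Nat.find_spec hex).ne' h1
    have h2 := single_le_finsum (f := fun i : ℕ × G => c i.1 (i.2⁻¹ • x)) (Nat.find hex, g)
      (hclf.point_finite x) fun i => mul_nonneg (hψnn _ _) (hf01 _ _).1
    refine lt_of_lt_of_le ?_ h2
    simp only [hc, hψinv, hψ1, one_mul]
    exact lt_of_le_of_ne (hf01 _ _).1 hg.symm
  refine ⟨p, fun i x => (S x)⁻¹ * c i x, fun i => ?_, fun i => ?_, ?_, fun x => ?_⟩
  · exact (hSs.inv₀ fun x => (hSpos x).ne').mul (hcs i)
  · refine Subset.trans (closure_mono fun x hx => ?_) (hfO (p i))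
    exact right_ne_zero_of_mul (right_ne_zero_of_mul hx)
  · exact hclf.subset fun i x hx => right_ne_zero_of_mul hx
  · simp only [hSinv]
    rw [← finsum_congr fun i : ℕ × G => smul_eq_mul (S x)⁻¹ (c i.1 (i.2⁻¹ • x)), ← smul_finsum]
    exact inv_mul_cancel₀ (hSpos x).ne'

/-- The invariant connection is the sum of the translates of local trivial connections whose weights
are a partition of unity by translates. -/
theorem exists_invariant_connection_of_discrete [SecondCountableTopology X] [TopologicalSpace G]
    [DiscreteTopology G] [ContinuousConstSMul G X] [ProperSMul G X]
    (hG : ∀ g : G, ContMDiff (𝓡 n) (𝓡 n) ∞ (fun x : X => g • x)) (hE : IsCStarBundle A E)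
    (hGE : IsSmoothEquivariantBundle n G A E) :
    ∃ D : HermitianConnection n A E, D.IsInvariant G := by
  rcases isEmpty_or_nonempty X with hX | hX
  · exact exists_invariant_connection_of_partition hG hE hGE (ι := Empty) (p := Empty.elim)
      (ρ := Empty.elim) (fun i => i.elim) (fun i => i.elim) (fun x => hX.elim x) fun x => hX.elim x
  · obtain ⟨p, ρ, h1, h2, h3, h4⟩ := exists_translate_partition (G := G) hG
      fun x : X => (isOpen_trivSet x).mem_nhds (mem_trivSet (A := A) (E := E) x)
    exact exists_invariant_connection_of_partition hG hE hGE h1 h2 h3 h4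

end DiscreteGroups

/-! ### Strongly continuous families of operators -/

section OperatorsIntoContinuousFunctions
open Filter Topology

variable {G : Type*} [TopologicalSpace G] [CompactSpace G] {W W' W'' : Type*}
  [NormedAddCommGroup W] [NormedSpace ℝ W] [NormedAddCommGroup W'] [NormedSpace ℝ W']
  [NormedAddCommGroup W''] [NormedSpace ℝ W'']

/-- A bounded operator `Y : W → C(G, W')` is a strongly continuous family of operators `W → W'`. It
acts on `C(G, W)` pointwise. -/
def pointwiseApply : (W →L[ℝ] C(G, W')) →L[ℝ] C(G, W) →L[ℝ] C(G, W') :=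
  LinearMap.mkContinuous₂
    (LinearMap.mk₂ ℝ (fun Y f => ⟨fun g => Y (f g) g, by fun_prop⟩)
      (fun _ _ _ => rfl) (fun _ _ _ => rfl)
      (fun Y f f' => by ext g; simp) (fun c Y f => by ext g; simp)) 1 fun Y f => by
    rw [one_mul]
    refine (ContinuousMap.norm_le _ (by positivity)).2 fun g => ?_
    calc ‖Y (f g) g‖ ≤ ‖Y (f g)‖ := (Y (f g)).norm_coe_le_norm g
      _ ≤ ‖Y‖ * ‖f g‖ := Y.le_opNorm _
      _ ≤ ‖Y‖ * ‖f‖ := by gcongr; exact f.norm_coe_le_norm g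

@[simp]
theorem pointwiseApply_apply (Y : W →L[ℝ] C(G, W')) (f : C(G, W)) (g : G) :
    pointwiseApply Y f g = Y (f g) g := rfl

/-- The family of operators `χ(g) K`. -/
def scalarFamily (χ : C(G, ℝ)) : (W →L[ℝ] W') →L[ℝ] W →L[ℝ] C(G, W') :=
  ContinuousLinearMap.compL ℝ W W' C(G, W') (LinearMap.mkContinuous
    { toFun := fun w => ⟨fun g => χ g • w, by fun_prop⟩
      map_add' := fun v w => by ext g; simp
      map_smul' := fun c w => by ext g; simp [smul_comm c] } ‖χ‖ fun w => by
    refine (ContinuousMap.norm_le _ (by positivity)).2 fun g => ?_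
    calc ‖χ g • w‖ = ‖χ g‖ * ‖w‖ := norm_smul _ _
      _ ≤ ‖χ‖ * ‖w‖ := by gcongr; exact χ.norm_coe_le_norm g)

@[simp]
theorem scalarFamily_apply (χ : C(G, ℝ)) (K : W →L[ℝ] W') (w : W) (g : G) :
    scalarFamily χ K w g = χ g • K w := rfl

/-- Multiplication of a family of operators by the function `χ`. -/
def mulFamily (χ : C(G, ℝ)) : (W →L[ℝ] C(G, W')) →L[ℝ] W →L[ℝ] C(G, W') :=
  ContinuousLinearMap.compL ℝ W C(G, W') C(G, W')
    (pointwiseApply (scalarFamily χ (ContinuousLinearMap.id ℝ W')))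

@[simp]
theorem mulFamily_apply (χ : C(G, ℝ)) (Y : W →L[ℝ] C(G, W')) (w : W) (g : G) :
    mulFamily χ Y w g = χ g • Y w g := rfl

/-- The operator at `g` of a family of operators. -/
def evalFamily (g : G) : (W →L[ℝ] C(G, W')) →L[ℝ] W →L[ℝ] W' :=
  ContinuousLinearMap.compL ℝ W C(G, W') W' (ContinuousMap.evalCLM ℝ g)

@[simp]
theorem evalFamily_apply (g : G) (Y : W →L[ℝ] C(G, W')) (w : W) :
    evalFamily g Y w = Y w g := rfl

/-- Composition of functions on `G` with a continuous map. -/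
def compFunction (τ : C(G, G)) : C(G, W) →L[ℝ] C(G, W) :=
  LinearMap.mkContinuous
    { toFun := fun f => f.comp τ
      map_add' := fun _ _ => rfl
      map_smul' := fun _ _ => rfl } 1 fun f => by
    rw [one_mul]
    exact (ContinuousMap.norm_le _ (norm_nonneg _)).2 fun g => f.norm_coe_le_norm (τ g)

@[simp]
theorem compFunction_apply (τ : C(G, G)) (f : C(G, W)) (g : G) :
    compFunction τ f g = f (τ g) := rfl

end OperatorsIntoContinuousFunctions

/-! ### Automatic smoothness of families permuted by a compact group -/

section SmoothFamilies
open Filter Topology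

variable {G : Type*} [Group G] [TopologicalSpace G] [IsTopologicalGroup G] [CompactSpace G]
  [T2Space G] {W W' : Type*}
  [NormedAddCommGroup W] [NormedSpace ℝ W] [NormedAddCommGroup W'] [NormedSpace ℝ W']
  {V : Type*} [NormedAddCommGroup V] [NormedSpace ℝ V] [FiniteDimensional ℝ V]

/-- For `k = 0` no regularity of `f` is needed. -/
theorem iteratedFDeriv_clm_comp {Y Y' : Type*} [NormedAddCommGroup Y] [NormedSpace ℝ Y]
    [NormedAddCommGroup Y'] [NormedSpace ℝ Y'] (L : Y →L[ℝ] Y') {f : V → Y} {k : ℕ} {w : V}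
    (hf : k ≠ 0 → ContDiffAt ℝ k f w) :
    iteratedFDeriv ℝ k (fun u => L (f u)) w =
      L.compContinuousMultilinearMap (iteratedFDeriv ℝ k f w) := by
  rcases eq_or_ne k 0 with rfl | hk
  · ext m
    simp
  · exact L.iteratedFDeriv_comp_left (hf hk) le_rfl

/-- Although the operator at `g` depends on `g` only strongly continuously, its norm is lower
semicontinuous; hence norm estimates define closed sets, as Baire's theorem requires. -/
theorem isClosed_setOf_norm_evalFamily_le {k : ℕ}
    (D : V [×k]→L[ℝ] (W →L[ℝ] C(G, W'))) {c : ℝ} (hc : 0 ≤ c) :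
    IsClosed {g : G | ‖(evalFamily g).compContinuousMultilinearMap D‖ ≤ c} := by
  have h : {g : G | ‖(evalFamily g).compContinuousMultilinearMap D‖ ≤ c} =
      ⋂ (m : Fin k → V) (a : W), {g : G | ‖D m a g‖ ≤ (c * ∏ i, ‖m i‖) * ‖a‖} := by
    ext g
    simp only [mem_ofPred_eq, mem_iInter]
    rw [ContinuousMultilinearMap.opNorm_le_iff hc]
    refine forall_congr' fun m => ?_
    rw [ContinuousLinearMap.opNorm_le_iff (by positivity)]
    rfl
  rw [h]
  exact isClosed_iInter fun m => isClosed_iInter fun a =>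
    isClosed_le (by fun_prop) continuous_const

/-- The norm of a family of operators is the supremum of the norms of its members, of which only
those with `χ g ≠ 0` count after multiplication with `χ`. -/
theorem norm_mulFamily_comp_le {k : ℕ} (D : V [×k]→L[ℝ] (W →L[ℝ] C(G, W'))) {c : ℝ} (hc : 0 ≤ c)
    {χ : C(G, ℝ)} (hχ : ∀ g, χ g ∈ Icc (0 : ℝ) 1)
    (h : ∀ g, χ g ≠ 0 → ‖(evalFamily g).compContinuousMultilinearMap D‖ ≤ c) :
    ‖(mulFamily χ).compContinuousMultilinearMap D‖ ≤ c := by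
  refine (ContinuousMultilinearMap.opNorm_le_iff hc).2 fun m => ?_
  refine (ContinuousLinearMap.opNorm_le_iff (by positivity)).2 fun a => ?_
  refine (ContinuousMap.norm_le _ (by positivity)).2 fun g => ?_
  change ‖χ g • D m a g‖ ≤ _
  by_cases hg : χ g = 0
  · rw [hg, zero_smul, norm_zero]
    positivity
  · have h1 : ‖D m a g‖ ≤ (c * ∏ i, ‖m i‖) * ‖a‖ :=
      (((evalFamily g).compContinuousMultilinearMap D) m).le_of_opNorm_le
        (((evalFamily g).compContinuousMultilinearMap D).le_of_opNorm_le (h g hg) m) a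
    rw [norm_smul, Real.norm_of_nonneg (hχ g).1]
    exact (mul_le_of_le_one_left (norm_nonneg _) (hχ g).2).trans h1

/-- If the members of finitely many families are smooth, Baire's theorem yields uniform estimates
of their derivatives for the parameters in an open subset of `G`; therefore the parts of the families
with parameters in this subset gain one order of differentiability. -/
theorem exists_contDiffOn_mulFamily [CompleteSpace W'] {J : Type*} (t : Finset J) {c : J → V}
    {ε : J → ℝ} {U : J → Set V} (hU : ∀ j, IsOpen (U j))
    (hεU : ∀ j, Metric.closedBall (c j) (ε j) ⊆ U j)
    {F : J → V → W →L[ℝ] C(G, W')} {C : ℝ} (hC : ∀ j, ∀ u ∈ U j, ‖F j u‖ ≤ C)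
    (hev : ∀ j g, ContDiffOn ℝ ∞ (fun u => evalFamily g (F j u)) (U j))
    {k : ℕ} (hk : k ≠ 0 → ∀ j, ContDiffOn ℝ k (F j) (U j)) :
    ∃ (χ : C(G, ℝ)) (g₀ : G), (∀ g, χ g ∈ Icc (0 : ℝ) 1) ∧ χ g₀ = 1 ∧
      ∀ j ∈ t, ContDiffOn ℝ (k + 1 : ℕ) (fun u => mulFamily χ (F j u))
        (Metric.ball (c j) (ε j)) := by
  have hat : ∀ j, ∀ w ∈ U j, k ≠ 0 → ContDiffAt ℝ k (F j) w := fun j w hw h =>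
    (hk h j).contDiffAt ((hU j).mem_nhds hw)
  have hitev : ∀ j, ∀ w ∈ U j, ∀ g, iteratedFDeriv ℝ k (fun u => evalFamily g (F j u)) w =
      (evalFamily g).compContinuousMultilinearMap (iteratedFDeriv ℝ k (F j) w) := fun j w hw g =>
    iteratedFDeriv_clm_comp _ (hat j w hw)
  -- the deviation of the `k`-th derivative from a linear interpolation
  set D : J → V → V → ℝ → V [×k]→L[ℝ] (W →L[ℝ] C(G, W')) := fun j w v s =>
    iteratedFDeriv ℝ k (F j) (w + s • v) - iteratedFDeriv ℝ k (F j) w -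
      s • (iteratedFDeriv ℝ k (F j) (w + v) - iteratedFDeriv ℝ k (F j) w) with hD
  set Q : ℕ → Set G := fun M => ⋂ j ∈ t, ⋂ w ∈ Metric.closedBall (c j) (ε j), ⋂ v,
    ⋂ (_ : w + v ∈ Metric.closedBall (c j) (ε j)), ⋂ s ∈ Icc (0 : ℝ) 1,
      {g | ‖(evalFamily g).compContinuousMultilinearMap (D j w v s)‖ ≤ M * s * ‖v‖ ^ 2} with hQ
  have hQc : ∀ M, IsClosed (Q M) := fun M => by
    refine isClosed_biInter fun j _ => isClosed_biInter fun w _ => isClosed_iInter fun v =>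
      isClosed_iInter fun _ => isClosed_biInter fun s hs => ?_
    have := hs.1
    exact isClosed_setOf_norm_evalFamily_le _ (by positivity)
  have hQU : ⋃ M, Q M = univ := by
    refine eq_univ_of_forall fun g => ?_
    have hb : ∀ j, ∃ M : ℝ, 0 ≤ M ∧ ∀ w ∈ Metric.closedBall (c j) (ε j), ∀ v,
        w + v ∈ Metric.closedBall (c j) (ε j) → ∀ s ∈ Icc (0 : ℝ) 1,
        ‖(evalFamily g).compContinuousMultilinearMap (D j w v s)‖ ≤ M * s * ‖v‖ ^ 2 := by
      intro j
      have h1 : ContDiffOn ℝ 2 (iteratedFDeriv ℝ k fun u => evalFamily g (F j u)) (U j) :=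
        fun w hw => ((contDiffAt_infty.1 ((hev j g).contDiffAt ((hU _).mem_nhds hw))
          (2 + k)).iteratedFDeriv_right (m := 2) (i := k) (by push_cast; rfl)).contDiffWithinAt
      obtain ⟨M, hM0, hM⟩ := exists_interpolation_bound (isCompact_closedBall _ _)
        (convex_closedBall _ _) (hU j) (hεU j) h1
      refine ⟨M, hM0, fun w hw v hv s hs => ?_⟩
      have hws : w + s • v ∈ Metric.closedBall (c j) (ε j) := by
        have := (convex_closedBall (c j) (ε j)) hw hv (sub_nonneg.2 hs.2) hs.1 (by ring)
        convert this using 1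
        module
      have h2 := hM w hw v hv s hs
      rw [hitev _ _ (hεU j hw), hitev _ _ (hεU j hv), hitev _ _ (hεU j hws)] at h2
      refine (congrArg norm ?_).trans_le h2
      ext m a
      simp [hD]
    choose M hM0 hM using hb
    obtain ⟨N, hN⟩ := exists_nat_ge (∑ j ∈ t, M j)
    refine mem_iUnion.2 ⟨N, ?_⟩
    simp only [hQ, mem_iInter]
    intro j hj w hw v hv s hs
    have h1 : M j ≤ N := (Finset.single_le_sum (fun j _ => hM0 j) hj).trans hN
    have := hs.1
    exact (hM j w hw v hv s hs).trans (by gcongr)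
  -- `Q M` contains the parameters with interpolation constant `M`; these sets are closed and
  -- exhaust the group, since every single member of the families is smooth
  obtain ⟨M, g₀, hg₀⟩ := nonempty_interior_of_iUnion_of_closed hQc hQU
  obtain ⟨χ, hχ0, hχ1, hχ⟩ := exists_continuous_zero_one_of_isClosed
    (isOpen_interior (s := Q M)).isClosed_compl (isClosed_singleton (x := g₀))
    (disjoint_singleton_right.2 fun h => h hg₀)
  have hχQ : ∀ g, χ g ≠ 0 → g ∈ Q M := fun g hg => by
    by_contra h
    exact hg (hχ0 fun h' => h (interior_subset h'))
  refine ⟨χ, g₀, hχ, hχ1 rfl, fun j hj => ?_⟩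
  set L : (W →L[ℝ] C(G, W')) →L[ℝ] W →L[ℝ] C(G, W') := mulFamily χ with hL
  have hsub : Metric.ball (c j) (ε j) ⊆ U j := Metric.ball_subset_closedBall.trans (hεU j)
  have hit : ∀ w ∈ U j, iteratedFDeriv ℝ k (fun u => L (F j u)) w =
      L.compContinuousMultilinearMap (iteratedFDeriv ℝ k (F j) w) := fun w hw =>
    iteratedFDeriv_clm_comp _ (hat j w hw)
  have hk' : k ≠ 0 → ContDiffOn ℝ k (fun u => L (F j u)) (U j) := fun h =>
    L.contDiff.comp_contDiffOn (hk h j)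
  refine contDiffOn_succ_of_iteratedFDeriv Metric.isOpen_ball k (fun h => (hk' h).mono hsub) ?_
  obtain ⟨B, hB⟩ : ∃ B, ∀ w ∈ Metric.ball (c j) (ε j),
      ‖iteratedFDeriv ℝ k (fun u => L (F j u)) w‖ ≤ B := by
    rcases eq_or_ne k 0 with rfl | h
    · refine ⟨‖L‖ * C, fun w hw => ?_⟩
      rw [norm_iteratedFDeriv_zero]
      exact L.le_opNorm_of_le (hC _ _ (hsub hw))
    · have h1 : ContinuousOn (iteratedFDeriv ℝ k (fun u => L (F j u))) (U j) := fun w hw =>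
        (((hk' h).contDiffAt ((hU _).mem_nhds hw)).iteratedFDeriv_right
          (m := 0) (i := k) (by simp)).continuousAt.continuousWithinAt
      obtain ⟨B, hB⟩ := (isCompact_closedBall (c j) (ε j)).exists_bound_of_continuousOn
        (h1.mono (hεU j))
      exact ⟨B, fun w hw => hB w (Metric.ball_subset_closedBall hw)⟩
  refine contDiffOn_one_of_interpolation (M := M) Metric.isOpen_ball hB fun w hw v hv s hs => ?_
  have hws : w + s • v ∈ Metric.ball (c j) (ε j) := by
    have := (convex_ball (c j) (ε j)) hw hv (sub_nonneg.2 hs.2) hs.1 (by ring)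
    convert this using 1
    module
  rw [hit _ (hsub hw), hit _ (hsub hv), hit _ (hsub hws)]
  have := hs.1
  have h1 := norm_mulFamily_comp_le (D j w v s) (c := M * s * ‖v‖ ^ 2) (by positivity) hχ
    fun g hg => by
      have h2 := hχQ g hg
      simp only [hQ, mem_iInter] at h2
      exact h2 j hj w (Metric.ball_subset_closedBall hw) v (Metric.ball_subset_closedBall hv) s hs
  refine (congrArg norm ?_).trans_le h1
  ext1 m
  simp [hD, hL]

variable {X ι : Type*} [TopologicalSpace X] [MulAction G X] [ContinuousSMul G X]

/-- The translations by `G` carry the estimates for the parameters in an open subset of `G`, which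
hold along the whole orbit of a point, to all parameters. -/
theorem contDiffAt_family_succ [CompleteSpace W'] {φ : ι → X → V} {U : ι → Set V}
    (hU : ∀ q, IsOpen (U q))
    {S : ι → Set X} (hcover : ∀ y, ∃ q, ∃ ε > 0, Metric.closedBall (φ q y) ε ⊆ U q ∧
      {x | x ∈ S q ∧ φ q x ∈ Metric.ball (φ q y) ε} ∈ 𝓝 y)
    {F : ι → V → W →L[ℝ] C(G, W')} {C : ℝ} (hC : ∀ q, ∀ u ∈ U q, ‖F q u‖ ≤ C)
    (hev : ∀ q g, ContDiffOn ℝ ∞ (fun u => evalFamily g (F q u)) (U q))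
    (htr : ∀ z q x (h : G), x ∈ S z → h • x ∈ S q → ∃ (ψ : V → V) (K : V → W' →L[ℝ] W')
      (H : V → W →L[ℝ] W), ContDiffAt ℝ ∞ ψ (φ z x) ∧ ContDiffAt ℝ ∞ K (φ z x) ∧
        ContDiffAt ℝ ∞ H (φ z x) ∧ ψ (φ z x) = φ q (h • x) ∧ ∀ᶠ u in 𝓝 (φ z x), ∀ a g,
          F z u a (h⁻¹ * g) = K u (F q (ψ u) (H u a) g))
    {k : ℕ} (hk : k ≠ 0 → ∀ q, ContDiffOn ℝ k (F q) (U q)) {z : ι} {x : X} (hx : x ∈ S z) :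
    ContDiffAt ℝ (k + 1 : ℕ) (F z) (φ z x) := by
  choose q ε hε hεU hN using hcover
  -- the orbit of `x` is covered by finitely many balls
  obtain ⟨t, ht⟩ : ∃ t : Finset X, ∀ h : G, ∃ y ∈ t,
      h • x ∈ {x | x ∈ S (q y) ∧ φ (q y) x ∈ Metric.ball (φ (q y) y) (ε y)} := by
    have h1 : IsCompact (range fun h : G => h • x) := isCompact_range (by fun_prop)
    obtain ⟨t, -, ht⟩ := h1.elim_nhds_subcover _ fun y _ => hN y
    refine ⟨t, fun h => ?_⟩
    obtain ⟨y, hy, hxy⟩ := mem_iUnion₂.1 (ht ⟨h, rfl⟩)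
    exact ⟨y, hy, hxy⟩
  obtain ⟨χ, g₀, hχ, hg₀1, hball⟩ := exists_contDiffOn_mulFamily t (fun y => hU (q y)) hεU
    (fun y => hC (q y)) (fun y => hev (q y)) (fun h y => hk h (q y))
  set χh : G → C(G, ℝ) := fun h => ⟨fun g => χ (h * g), by fun_prop⟩ with hχh
  -- the part of the family with parameters near `h⁻¹ g₀` is a smooth transform of the part near
  -- `g₀` at the point `h • x` of the orbit
  have hloc : ∀ h : G, ContDiffAt ℝ (k + 1 : ℕ) (fun u => mulFamily (χh h) (F z u)) (φ z x) := by
    intro h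
    obtain ⟨y, hy, hyS, hyb⟩ := ht h
    obtain ⟨ψ, K, H, hψ, hK, hH, hψx, hF⟩ := htr z (q y) x h hx hyS
    have h1 : ContDiffAt ℝ (k + 1 : ℕ) (fun u => mulFamily χ (F (q y) (ψ u))) (φ z x) := by
      have h2 : ContDiffAt ℝ (k + 1 : ℕ) (fun u => mulFamily χ (F (q y) u)) (ψ (φ z x)) :=
        hψx ▸ (hball y hy).contDiffAt (Metric.isOpen_ball.mem_nhds hyb)
      exact h2.comp (φ z x) (contDiffAt_infty.1 hψ _)
    set L := (pointwiseApply (G := G) (W := W') (W' := W')).comp (scalarFamily 1) with hL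
    have h3 : ContDiffAt ℝ (k + 1 : ℕ) (fun u => L (K u)) (φ z x) :=
      L.contDiff.contDiffAt.comp _ (contDiffAt_infty.1 hK _)
    have h4 := (contDiffAt_const (c := compFunction (W := W') (ContinuousMap.mulLeft h))).clm_comp
      (h3.clm_comp (h1.clm_comp (contDiffAt_infty.1 hH _)))
    refine h4.congr_of_eventuallyEq ?_
    filter_upwards [hF] with u hu
    ext a g
    have h5 := hu a (h * g)
    rw [inv_mul_cancel_left] at h5
    simp [hχh, hL, h5]
  obtain ⟨s, hs⟩ : ∃ s : Finset G, ∀ g, ∃ h ∈ s, 0 < χ (h * g) := by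
    have h1 : ∀ g ∈ (univ : Set G), {g' | 0 < χ (g₀ * g⁻¹ * g')} ∈ 𝓝 g := fun g _ =>
      (isOpen_lt continuous_const (by fun_prop)).mem_nhds <| by
        change 0 < χ (g₀ * g⁻¹ * g)
        rw [inv_mul_cancel_right, hg₀1]
        exact one_pos
    obtain ⟨s, -, hs⟩ := isCompact_univ.elim_nhds_subcover _ h1
    classical
    refine ⟨s.image fun g => g₀ * g⁻¹, fun g => ?_⟩
    obtain ⟨g', hg', h2⟩ := mem_iUnion₂.1 (hs (mem_univ g))
    exact ⟨_, Finset.mem_image_of_mem _ hg', h2⟩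
  -- finitely many of these parts cover the group; dividing by the sum of the cutoff functions
  -- recovers the whole family
  have hpos : ∀ g, 0 < ∑ h ∈ s, χ (h * g) := fun g => by
    obtain ⟨h, hh, hh0⟩ := hs g
    exact hh0.trans_le (Finset.single_le_sum (f := fun h => χ (h * g)) (fun h _ => (hχ _).1) hh)
  set θ : C(G, ℝ) := ⟨fun g => (∑ h ∈ s, χ (h * g))⁻¹,
    Continuous.inv₀ (by fun_prop) fun g => (hpos g).ne'⟩ with hθ
  have h1 : ContDiffAt ℝ (k + 1 : ℕ) (fun u => ∑ h ∈ s, mulFamily (χh h) (F z u)) (φ z x) :=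
    ContDiffAt.sum fun h _ => hloc h
  set L : (W →L[ℝ] C(G, W')) →L[ℝ] W →L[ℝ] C(G, W') := mulFamily θ with hL
  have h2 := L.contDiff.contDiffAt.comp _ h1
  refine h2.congr_of_eventuallyEq (Eventually.of_forall fun u => ?_)
  ext a g
  have h3 := inv_mul_cancel₀ (hpos g).ne'
  simp [hθ, hχh, hL, ← Finset.sum_smul, smul_smul]
  rw [← Finset.mul_sum, h3, one_smul]

/-- A family of operators that is indexed by a compact group is smooth, with values in the strongly
continuous families, if its members are smooth and translations by the group permute it. -/
theorem contDiffOn_family [CompleteSpace W'] {φ : ι → X → V} {U : ι → Set V}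
    (hU : ∀ q, IsOpen (U q))
    {S : ι → Set X} (hUS : ∀ q, ∀ u ∈ U q, ∃ x ∈ S q, φ q x = u)
    (hcover : ∀ y, ∃ q, ∃ ε > 0, Metric.closedBall (φ q y) ε ⊆ U q ∧
      {x | x ∈ S q ∧ φ q x ∈ Metric.ball (φ q y) ε} ∈ 𝓝 y)
    {F : ι → V → W →L[ℝ] C(G, W')} {C : ℝ} (hC : ∀ q, ∀ u ∈ U q, ‖F q u‖ ≤ C)
    (hev : ∀ q g, ContDiffOn ℝ ∞ (fun u => evalFamily g (F q u)) (U q))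
    (htr : ∀ z q x (h : G), x ∈ S z → h • x ∈ S q → ∃ (ψ : V → V) (K : V → W' →L[ℝ] W')
      (H : V → W →L[ℝ] W), ContDiffAt ℝ ∞ ψ (φ z x) ∧ ContDiffAt ℝ ∞ K (φ z x) ∧
        ContDiffAt ℝ ∞ H (φ z x) ∧ ψ (φ z x) = φ q (h • x) ∧ ∀ᶠ u in 𝓝 (φ z x), ∀ a g,
          F z u a (h⁻¹ * g) = K u (F q (ψ u) (H u a) g)) (q : ι) :
    ContDiffOn ℝ ∞ (F q) (U q) := by
  have h : ∀ k : ℕ, k ≠ 0 → ∀ q, ContDiffOn ℝ k (F q) (U q) := by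
    intro k
    induction k with
    | zero => exact fun h => (h rfl).elim
    | succ k ih =>
      intro _ q u hu
      obtain ⟨x, hx, rfl⟩ := hUS q u hu
      exact (contDiffAt_family_succ hU hcover hC hev htr ih hx).contDiffWithinAt
  exact contDiffOn_infty.2 fun k => (h (k + 1) (by simp) q).of_le (by exact_mod_cast k.le_succ)

end SmoothFamilies

/-! ### Smooth families over a manifold with a group action -/

section SmoothFamiliesOnManifolds
open Filter Topology

variable {n : ℕ} {G X : Type*} [Group G] [TopologicalSpace G] [IsTopologicalGroup G]
  [CompactSpace G] [T2Space G] [EMetricSpace X]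
  [ChartedSpace (EuclideanSpace ℝ (Fin n)) X] [IsManifold (𝓡 n) ∞ X] [MulAction G X]
  [ContinuousSMul G X] {W W' : Type*}
  [NormedAddCommGroup W] [NormedSpace ℝ W] [NormedAddCommGroup W'] [NormedSpace ℝ W']

/-- The smoothness of families of operators that are permuted by the action of a compact group, for
families over open subsets `O q` of a manifold. -/
theorem contMDiffOn_family [CompleteSpace W']
    (hG : ∀ g : G, ContMDiff (𝓡 n) (𝓡 n) ∞ (fun x : X => g • x)) {O : X → Set X}
    (hO : ∀ q, IsOpen (O q)) (hqO : ∀ q, q ∈ O q)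
    {F : X → X → W →L[ℝ] C(G, W')} {C : ℝ} (hC : ∀ q, ∀ x ∈ O q, ‖F q x‖ ≤ C)
    (hev : ∀ q g, ContMDiffOn (𝓡 n) 𝓘(ℝ, W →L[ℝ] W') ∞ (fun x => evalFamily g (F q x)) (O q))
    (htr : ∀ z q (h : G), ∃ (K : X → W' →L[ℝ] W') (H : X → W →L[ℝ] W),
      ContMDiffOn (𝓡 n) 𝓘(ℝ, W' →L[ℝ] W') ∞ K {x | x ∈ O z ∧ h • x ∈ O q} ∧
      ContMDiffOn (𝓡 n) 𝓘(ℝ, W →L[ℝ] W) ∞ H {x | x ∈ O z ∧ h • x ∈ O q} ∧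
      ∀ x ∈ O z, h • x ∈ O q → ∀ a g,
        F z x a (h⁻¹ * g) = K x (F q (h • x) (H x a) g)) (q : X) :
    ContMDiffOn (𝓡 n) 𝓘(ℝ, W →L[ℝ] C(G, W')) ∞ (F q) (O q) := by
  set φ : X × X → X → EuclideanSpace ℝ (Fin n) := fun j => extChartAt (𝓡 n) j.1
  set S : X × X → Set X := fun j => (extChartAt (𝓡 n) j.1).source ∩ O j.2 with hS
  set U : X × X → Set (EuclideanSpace ℝ (Fin n)) := fun j =>
    (extChartAt (𝓡 n) j.1).target ∩ (extChartAt (𝓡 n) j.1).symm ⁻¹' O j.2 with hU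
  have hUo : ∀ j, IsOpen (U j) := fun j =>
    (continuousOn_extChartAt_symm j.1).isOpen_inter_preimage (isOpen_extChartAt_target j.1) (hO j.2)
  have hSo : ∀ j, IsOpen (S j) := fun j => (isOpen_extChartAt_source j.1).inter (hO j.2)
  have hSU : ∀ j, ∀ x ∈ S j, φ j x ∈ U j := fun j x hx =>
    ⟨(extChartAt (𝓡 n) j.1).map_source hx.1, by
      change (extChartAt (𝓡 n) j.1).symm (extChartAt (𝓡 n) j.1 x) ∈ O j.2
      rw [(extChartAt (𝓡 n) j.1).left_inv hx.1]
      exact hx.2⟩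
  have hsymm : ∀ j, ∀ u ∈ U j, ContMDiffAt 𝓘(ℝ, EuclideanSpace ℝ (Fin n)) (𝓡 n) ∞
      (extChartAt (𝓡 n) j.1).symm u := fun j u hu => contMDiffAt_extChartAt_symm_of_mem hu.1
  -- the index of a local representative is a pair of a chart and one of the sets `O q`
  have key := contDiffOn_family (φ := φ) (U := U) (S := S) hUo
    (F := fun j u => F j.2 ((extChartAt (𝓡 n) j.1).symm u)) (C := C)
    (fun j u hu => ⟨(extChartAt (𝓡 n) j.1).symm u,
      ⟨(extChartAt (𝓡 n) j.1).map_target hu.1, hu.2⟩, (extChartAt (𝓡 n) j.1).right_inv hu.1⟩)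
    (fun y => by
      have hyS : y ∈ S (y, y) := ⟨mem_extChartAt_source y, hqO y⟩
      obtain ⟨ε, hε, h1⟩ := Metric.nhds_basis_closedBall.mem_iff.1
        ((hUo (y, y)).mem_nhds (hSU _ _ hyS))
      exact ⟨(y, y), ε, hε, h1, inter_mem ((hSo (y, y)).mem_nhds hyS)
        ((continuousAt_extChartAt y).preimage_mem_nhds (Metric.ball_mem_nhds _ hε))⟩)
    (fun j u hu => hC j.2 _ hu.2)
    (fun j g u hu => (((hev j.2 g).contMDiffAt ((hO j.2).mem_nhds hu.2)).comp u
      (hsymm j u hu)).contDiffAt.contDiffWithinAt)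
    (fun j l x h hx hhx => by
      obtain ⟨K, H, hK, hH, hF⟩ := htr j.2 l.2 h
      have hxU := hSU j x hx
      have hinv : (extChartAt (𝓡 n) j.1).symm (φ j x) = x := (extChartAt (𝓡 n) j.1).left_inv hx.1
      have hN : {x | x ∈ O j.2 ∧ h • x ∈ O l.2} ∈ 𝓝 x :=
        ((hO j.2).inter ((hO l.2).preimage (hG h).continuous)).mem_nhds ⟨hx.2, hhx.2⟩
      refine ⟨fun u => φ l (h • (extChartAt (𝓡 n) j.1).symm u),
        fun u => K ((extChartAt (𝓡 n) j.1).symm u), fun u => H ((extChartAt (𝓡 n) j.1).symm u),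
        ?_, ?_, ?_, ?_, ?_⟩
      · have h1 : ContMDiffAt (𝓡 n) 𝓘(ℝ, EuclideanSpace ℝ (Fin n)) ∞ (φ l)
            (h • (extChartAt (𝓡 n) j.1).symm (φ j x)) := by
          rw [hinv]
          exact contMDiffAt_extChartAt_of_mem hhx.1
        exact (h1.comp (φ j x) ((hG h).contMDiffAt.comp _ (hsymm j _ hxU))).contDiffAt
      · have h1 := hK.contMDiffAt hN
        rw [← hinv] at h1
        exact (h1.comp _ (hsymm j _ hxU)).contDiffAt
      · have h1 := hH.contMDiffAt hN
        rw [← hinv] at h1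
        exact (h1.comp _ (hsymm j _ hxU)).contDiffAt
      · simp only [hinv]
      · have h1 := (hsymm j _ hxU).continuousAt
        have h2 : {x | x ∈ O j.2 ∧ h • x ∈ S l} ∈ 𝓝 ((extChartAt (𝓡 n) j.1).symm (φ j x)) := by
          rw [hinv]
          exact ((hO j.2).inter ((hSo l).preimage (hG h).continuous)).mem_nhds ⟨hx.2, hhx⟩
        filter_upwards [h1.preimage_mem_nhds h2] with u hu a g
        have h3 : (extChartAt (𝓡 n) l.1).symm (φ l (h • (extChartAt (𝓡 n) j.1).symm u)) =
          h • (extChartAt (𝓡 n) j.1).symm u := (extChartAt (𝓡 n) l.1).left_inv hu.2.1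
        simp only [h3]
        exact hF _ hu.1 hu.2.2 a g)
  intro x hx
  have hxS : x ∈ S (x, q) := ⟨mem_extChartAt_source x, hx⟩
  have h1 := ((key (x, q)).contDiffAt ((hUo (x, q)).mem_nhds (hSU _ _ hxS))).contMDiffAt
  have h2 := h1.comp x (contMDiffAt_extChartAt (I := 𝓡 n) (n := ∞) (x := x))
  refine (h2.congr_of_eventuallyEq ?_).contMDiffWithinAt
  filter_upwards [(isOpen_extChartAt_source (I := 𝓡 n) x).mem_nhds (mem_extChartAt_source x)]
    with y hy
  exact congrArg (F q) ((extChartAt (𝓡 n) x).left_inv hy).symm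

/-- A function that is smooth near the support of a cutoff function `f` only becomes smooth by
multiplication with `f`. -/
theorem contMDiffOn_smul_of_tsupport {F : Type*} [NormedAddCommGroup F] [NormedSpace ℝ F]
    {f : X → ℝ} (hf : ContMDiff (𝓡 n) 𝓘(ℝ, ℝ) ∞ f) {O O' : Set X} (hO : IsOpen O)
    (hO' : IsOpen O') (hfO : tsupport f ⊆ O') {h : X → F}
    (hh : ContMDiffOn (𝓡 n) 𝓘(ℝ, F) ∞ h (O ∩ O')) :
    ContMDiffOn (𝓡 n) 𝓘(ℝ, F) ∞ (fun x => f x • h x) O := by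
  intro x hx
  by_cases hxf : x ∈ tsupport f
  · exact (hf.contMDiffAt.smul
      (hh.contMDiffAt ((hO.inter hO').mem_nhds ⟨hx, hfO hxf⟩))).contMDiffWithinAt
  · refine ((contMDiffAt_const (c := (0 : F))).congr_of_eventuallyEq ?_).contMDiffWithinAt
    filter_upwards [(isClosed_tsupport f).isOpen_compl.mem_nhds hxf] with y hy
    rw [image_eq_zero_of_notMem_tsupport hy, zero_smul]

/-- A pointwise bounded and strongly continuous family of linear maps, as a bounded operator with
values in the continuous functions. -/
theorem exists_family_of_bound {P : W → G → W'} {C : ℝ} (hC : 0 ≤ C)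
    (hadd : ∀ a b g, P (a + b) g = P a g + P b g)
    (hsmul : ∀ (c : ℝ) a g, P (c • a) g = c • P a g) (hcont : ∀ a, Continuous (P a))
    (hb : ∀ a g, ‖P a g‖ ≤ C * ‖a‖) :
    ∃ L : W →L[ℝ] C(G, W'), ‖L‖ ≤ C ∧ ∀ a g, L a g = P a g :=
  ⟨LinearMap.mkContinuous
    { toFun := fun a => ⟨P a, hcont a⟩
      map_add' := fun a b => by
        ext g
        exact hadd a b g
      map_smul' := fun c a => by
        ext g
        exact hsmul c a g } C fun a => (ContinuousMap.norm_le _ (by positivity)).2 (hb a),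
    LinearMap.mkContinuous_norm_le _ hC _, fun _ _ => rfl⟩

end SmoothFamiliesOnManifolds

/-! ### The translates of a cutoff trivialization -/

section OrbitFamilies
open Filter Topology

variable {n : ℕ} {G X : Type*} [Group G] [TopologicalSpace G] [IsTopologicalGroup G]
  [EMetricSpace X]
  [ChartedSpace (EuclideanSpace ℝ (Fin n)) X] [IsManifold (𝓡 n) ∞ X] [MulAction G X]
  [ContinuousSMul G X]
  {A : Type*} [NonUnitalCStarAlgebra A] {E : X → Type*} [∀ x, NonUnitalCStarAlgebra (E x)]
  [TopologicalSpace (TotalSpace A E)] [FiberBundle A E] [VectorBundle ℝ A E]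
  [ContMDiffVectorBundle ∞ A E (𝓡 n)] [MulAction G (TotalSpace A E)]
  [ContinuousSMul G (TotalSpace A E)]

/-- The coordinate in `A` of a point of the total space, with respect to the preferred
trivialization at `p`. -/
def totalCoord (p : X) (e : TotalSpace A E) : A := (trivializationAt A E p e).2

theorem continuousAt_totalCoord {p : X} {e : TotalSpace A E} (he : e.1 ∈ trivSet A E p) :
    ContinuousAt (totalCoord (A := A) (E := E) p) e :=
  continuous_snd.continuousAt.comp ((trivializationAt A E p).continuousAt
    ((trivializationAt A E p).mem_source.2 he))

/-- Between trivializations, the action of `g` on a fibre is an automorphism of the typical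
fibre. -/
theorem exists_totalCoord_smul_eq (hE : IsCStarBundle A E) (hGE : IsSmoothEquivariantBundle n G A E)
    (g : G) {p q x : X} (hx : x ∈ trivSet A E q) (hgx : g • x ∈ trivSet A E p) :
    ∃ L : A ≃⋆ₐ[ℂ] A, ∀ a, totalCoord p (g • (⟨x, ofFibreCoord E q x a⟩ : TotalSpace A E)) = L a := by
  refine ⟨((coordEquiv hE hx).symm.trans (fibreSMul hGE g x)).trans (coordEquiv hE hgx), fun a => ?_⟩
  rw [smul_mk hGE]
  simp only [StarAlgEquiv.trans_apply, coordEquiv_symm_apply, coordEquiv_apply]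
  rfl

/-- The action of a single `g` between two trivializations is given by a norm-smooth family of
operators. Nothing is claimed about the dependence on `g`. -/
theorem exists_smul_totalCoord (hG : ∀ g : G, ContMDiff (𝓡 n) (𝓡 n) ∞ (fun x : X => g • x))
    (hE : IsCStarBundle A E) (hGE : IsSmoothEquivariantBundle n G A E) (g : G) (p q : X) :
    ∃ H : X → A →L[ℝ] A,
      (∀ e : TotalSpace A E, e.1 ∈ trivSet A E p → g • e.1 ∈ trivSet A E q →
        H e.1 (totalCoord p e) = totalCoord q (g • e)) ∧
      ContMDiffOn (𝓡 n) 𝓘(ℝ, A →L[ℝ] A) ∞ H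
        {x | x ∈ trivSet A E p ∧ g • x ∈ trivSet A E q} := by
  obtain ⟨H, hH, hHs⟩ := exists_smul_coord hG hE hGE g p q
  refine ⟨H, fun e h1 h2 => ?_, hHs⟩
  obtain ⟨x, v⟩ := e
  rw [smul_mk hGE]
  exact hH x h1 h2 v

include n in
theorem totalSpace_smul_fst (hGE : IsSmoothEquivariantBundle n G A E) (g : G) (e : TotalSpace A E) :
    (g • e).1 = g • e.1 := by
  obtain ⟨x, v⟩ := e
  rw [smul_mk hGE]

theorem ofFibreCoord_totalCoord {q : X} {e : TotalSpace A E} (he : e.1 ∈ trivSet A E q) :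
    (⟨e.1, ofFibreCoord E q e.1 (totalCoord q e)⟩ : TotalSpace A E) = e := by
  obtain ⟨x, v⟩ := e
  exact congrArg (TotalSpace.mk x) (ofFibreCoord_fibreCoord he v)

theorem totalCoord_ofFibreCoord {q x : X} (hx : x ∈ trivSet A E q) (a : A) :
    totalCoord q (⟨x, ofFibreCoord E q x a⟩ : TotalSpace A E) = a :=
  fibreCoord_ofFibreCoord hx a

variable [CompactSpace G] [T2Space G]

/-- The translates of the vectors with constant coordinates to a fixed trivialization form a smooth
family of operators, when they are multiplied with a cutoff function. -/
theorem exists_family_to_trivialization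
    (hG : ∀ g : G, ContMDiff (𝓡 n) (𝓡 n) ∞ (fun x : X => g • x))
    (hE : IsCStarBundle A E) (hGE : IsSmoothEquivariantBundle n G A E) {p : X} {ρ : X → ℝ}
    (hρ : ContMDiff (𝓡 n) 𝓘(ℝ, ℝ) ∞ ρ) (hρp : tsupport ρ ⊆ trivSet A E p)
    (hρ1 : ∀ x, ρ x ∈ Icc (0 : ℝ) 1) :
    ∃ F : X → X → A →L[ℝ] C(G, A),
      (∀ q, ContMDiffOn (𝓡 n) 𝓘(ℝ, A →L[ℝ] C(G, A)) ∞ (F q) (trivSet A E q)) ∧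
      ∀ q, ∀ x ∈ trivSet A E q, ∀ a g, F q x a g = ρ (g⁻¹ • x) •
        totalCoord p (g⁻¹ • (⟨x, ofFibreCoord E q x a⟩ : TotalSpace A E)) := by
  have hcases : ∀ (y : X), ρ y = 0 ∨ y ∈ trivSet A E p := fun y => by
    by_cases hy : y ∈ trivSet A E p
    · exact Or.inr hy
    · exact Or.inl (image_eq_zero_of_notMem_tsupport fun h => hy (hρp h))
  have hex : ∀ q x, ∃ L : A →L[ℝ] C(G, A), x ∈ trivSet A E q → ‖L‖ ≤ 1 ∧ ∀ a g,
      L a g = ρ (g⁻¹ • x) • totalCoord p (g⁻¹ • (⟨x, ofFibreCoord E q x a⟩ : TotalSpace A E)) := by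
    intro q x
    by_cases hx : x ∈ trivSet A E q
    swap
    · exact ⟨0, fun h => (hx h).elim⟩
    obtain ⟨L, hL1, hL⟩ := exists_family_of_bound (W := A) (W' := A) (C := 1) (P := fun a (g : G) => ρ (g⁻¹ • x) •
        totalCoord p (g⁻¹ • (⟨x, ofFibreCoord E q x a⟩ : TotalSpace A E))) zero_le_one
      (fun a b g => by
        rcases hcases (g⁻¹ • x) with h | h
        · simp [h]
        · obtain ⟨L, hL⟩ := exists_totalCoord_smul_eq hE hGE g⁻¹ hx h
          simp only [hL, map_add, smul_add])
      (fun c a g => by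
        rcases hcases (g⁻¹ • x) with h | h
        · simp [h]
        · obtain ⟨L, hL⟩ := exists_totalCoord_smul_eq hE hGE g⁻¹ hx h
          have h1 : L (c • a) = c • L a := map_smul L (c : ℂ) a
          simp only [hL, h1, smul_comm c])
      (fun a => by
        rw [continuous_iff_continuousAt]
        intro g
        by_cases h : g⁻¹ • x ∈ tsupport ρ
        · have h1 : ContinuousAt (fun g : G =>
              g⁻¹ • (⟨x, ofFibreCoord E q x a⟩ : TotalSpace A E)) g := by fun_prop
          have h2 : ContinuousAt (fun g : G => ρ (g⁻¹ • x)) g :=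
            (hρ.continuous.comp (by fun_prop : Continuous fun g : G => g⁻¹ • x)).continuousAt
          have h3 : ContinuousAt (totalCoord (A := A) (E := E) p)
              (g⁻¹ • (⟨x, ofFibreCoord E q x a⟩ : TotalSpace A E)) :=
            continuousAt_totalCoord (by rw [totalSpace_smul_fst hGE]; exact hρp h)
          exact h2.smul (ContinuousAt.comp (f := fun g : G =>
            g⁻¹ • (⟨x, ofFibreCoord E q x a⟩ : TotalSpace A E)) h3 h1)
        · refine (continuousAt_const (y := (0 : A))).congr ?_
          have h1 : ContinuousAt (fun g : G => g⁻¹ • x) g := by fun_prop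
          filter_upwards [h1.preimage_mem_nhds
            ((isClosed_tsupport ρ).isOpen_compl.mem_nhds h)] with g' hg'
          rw [image_eq_zero_of_notMem_tsupport hg', zero_smul])
      (fun a g => by
        rcases hcases (g⁻¹ • x) with h | h
        · simp [h]
        · obtain ⟨L, hL⟩ := exists_totalCoord_smul_eq hE hGE g⁻¹ hx h
          rw [hL, norm_smul, Real.norm_of_nonneg (hρ1 _).1, StarAlgEquiv.norm_map]
          gcongr
          exact (hρ1 _).2)
    exact ⟨L, fun _ => ⟨hL1, hL⟩⟩
  choose F hF using hex
  refine ⟨F, fun q => ?_, fun q x hx => (hF q x hx).2⟩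
  refine contMDiffOn_family hG (O := trivSet A E) isOpen_trivSet mem_trivSet
    (fun q x hx => (hF q x hx).1) (fun q g => ?_) (fun z q h => ?_) q
  · obtain ⟨H, hH, hHs⟩ := exists_smul_totalCoord hG hE hGE g⁻¹ q p
    have h1 : ContMDiffOn (𝓡 n) 𝓘(ℝ, A →L[ℝ] A) ∞ (fun x => ρ (g⁻¹ • x) • H x) (trivSet A E q) :=
      contMDiffOn_smul_of_tsupport (hρ.comp (hG g⁻¹)) (isOpen_trivSet q)
        ((isOpen_trivSet p).preimage (hG g⁻¹).continuous)
        ((tsupport_comp_subset_preimage ρ (hG g⁻¹).continuous).trans (preimage_mono hρp)) hHs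
    refine h1.congr fun x hx => ?_
    ext a
    rw [evalFamily_apply, (hF q x hx).2, _root_.smul_apply]
    rcases hcases (g⁻¹ • x) with h | h
    · rw [h, zero_smul, zero_smul]
    · rw [← hH ⟨x, ofFibreCoord E q x a⟩ hx h, totalCoord_ofFibreCoord hx]
  · obtain ⟨H, hH, hHs⟩ := exists_smul_totalCoord hG hE hGE h z q
    refine ⟨fun _ => ContinuousLinearMap.id ℝ A, H, contMDiffOn_const, hHs, fun x hx hhx a g => ?_⟩
    have h1 := hH ⟨x, ofFibreCoord E z x a⟩ hx hhx
    rw [totalCoord_ofFibreCoord hx] at h1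
    have h2 := ofFibreCoord_totalCoord (q := q)
      (e := h • (⟨x, ofFibreCoord E z x a⟩ : TotalSpace A E)) (by rwa [totalSpace_smul_fst hGE])
    rw [totalSpace_smul_fst hGE] at h2
    rw [(hF z x hx).2, ContinuousLinearMap.id_apply, (hF q _ hhx).2, h1, h2, mul_inv_rev, inv_inv,
      mul_smul, mul_smul]

/-- The translates of the vectors with constant coordinates in a fixed trivialization form a smooth
family of operators, when they are multiplied with a cutoff function. -/
theorem exists_family_from_trivialization
    (hG : ∀ g : G, ContMDiff (𝓡 n) (𝓡 n) ∞ (fun x : X => g • x))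
    (hE : IsCStarBundle A E) (hGE : IsSmoothEquivariantBundle n G A E) {p : X} {ρ : X → ℝ}
    (hρ : ContMDiff (𝓡 n) 𝓘(ℝ, ℝ) ∞ ρ) (hρp : tsupport ρ ⊆ trivSet A E p)
    (hρ1 : ∀ x, ρ x ∈ Icc (0 : ℝ) 1) :
    ∃ B : X → X → A →L[ℝ] C(G, A),
      (∀ q, ContMDiffOn (𝓡 n) 𝓘(ℝ, A →L[ℝ] C(G, A)) ∞ (B q) (trivSet A E q)) ∧
      ∀ q, ∀ x ∈ trivSet A E q, ∀ a g, B q x a g = ρ (g⁻¹ • x) •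
        totalCoord q (g • (⟨g⁻¹ • x, ofFibreCoord E p (g⁻¹ • x) a⟩ : TotalSpace A E)) := by
  have hcases : ∀ (y : X), ρ y = 0 ∨ y ∈ trivSet A E p := fun y => by
    by_cases hy : y ∈ trivSet A E p
    · exact Or.inr hy
    · exact Or.inl (image_eq_zero_of_notMem_tsupport fun h => hy (hρp h))
  have hmem : ∀ {q x : X} (g : G), x ∈ trivSet A E q → g • g⁻¹ • x ∈ trivSet A E q :=
    fun g hx => by rwa [smul_inv_smul]
  have hex : ∀ q x, ∃ L : A →L[ℝ] C(G, A), x ∈ trivSet A E q → ‖L‖ ≤ 1 ∧ ∀ a g,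
      L a g = ρ (g⁻¹ • x) • totalCoord q
        (g • (⟨g⁻¹ • x, ofFibreCoord E p (g⁻¹ • x) a⟩ : TotalSpace A E)) := by
    intro q x
    by_cases hx : x ∈ trivSet A E q
    swap
    · exact ⟨0, fun h => (hx h).elim⟩
    obtain ⟨L, hL1, hL⟩ := exists_family_of_bound (W := A) (W' := A) (C := 1) (P := fun a (g : G) => ρ (g⁻¹ • x) •
        totalCoord q (g • (⟨g⁻¹ • x, ofFibreCoord E p (g⁻¹ • x) a⟩ : TotalSpace A E))) zero_le_one
      (fun a b g => by
        rcases hcases (g⁻¹ • x) with h | h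
        · simp [h]
        · obtain ⟨L, hL⟩ := exists_totalCoord_smul_eq hE hGE g h (hmem g hx)
          simp only [hL, map_add, smul_add])
      (fun c a g => by
        rcases hcases (g⁻¹ • x) with h | h
        · simp [h]
        · obtain ⟨L, hL⟩ := exists_totalCoord_smul_eq hE hGE g h (hmem g hx)
          have h1 : L (c • a) = c • L a := map_smul L (c : ℂ) a
          simp only [hL, h1, smul_comm c])
      (fun a => by
        rw [continuous_iff_continuousAt]
        intro g
        have hc : ContinuousAt (fun g : G => g⁻¹ • x) g := by fun_prop
        by_cases h : g⁻¹ • x ∈ tsupport ρ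
        · have h1 : ContinuousAt (fun g : G =>
              (⟨g⁻¹ • x, ofFibreCoord E p (g⁻¹ • x) a⟩ : TotalSpace A E)) g := by
            have h2 : ContinuousAt (fun y : X => (trivializationAt A E p).toOpenPartialHomeomorph.symm
                (y, a)) (g⁻¹ • x) :=
              ContinuousAt.comp (f := fun y : X => (y, a))
                ((trivializationAt A E p).toOpenPartialHomeomorph.continuousAt_symm
                ((trivializationAt A E p).mem_target.2 (hρp h))) (by fun_prop)
            refine (ContinuousAt.comp (f := fun g : G => g⁻¹ • x) h2 hc).congr ?_
            filter_upwards [hc.preimage_mem_nhds ((isOpen_trivSet p).mem_nhds (hρp h))] with g' hg'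
            exact ((trivializationAt A E p).mk_symm hg' a).symm
          have h2 : ContinuousAt (fun g : G => ρ (g⁻¹ • x)) g :=
            ContinuousAt.comp (f := fun g : G => g⁻¹ • x) hρ.continuous.continuousAt hc
          have h3 : ContinuousAt (totalCoord (A := A) (E := E) q)
              (g • (⟨g⁻¹ • x, ofFibreCoord E p (g⁻¹ • x) a⟩ : TotalSpace A E)) :=
            continuousAt_totalCoord (by rw [totalSpace_smul_fst hGE]; exact hmem g hx)
          exact h2.smul (ContinuousAt.comp (f := fun g : G =>
            g • (⟨g⁻¹ • x, ofFibreCoord E p (g⁻¹ • x) a⟩ : TotalSpace A E)) h3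
            (continuousAt_id.smul h1))
        · refine (continuousAt_const (y := (0 : A))).congr ?_
          filter_upwards [hc.preimage_mem_nhds
            ((isClosed_tsupport ρ).isOpen_compl.mem_nhds h)] with g' hg'
          rw [image_eq_zero_of_notMem_tsupport hg', zero_smul])
      (fun a g => by
        rcases hcases (g⁻¹ • x) with h | h
        · simp [h]
        · obtain ⟨L, hL⟩ := exists_totalCoord_smul_eq hE hGE g h (hmem g hx)
          rw [hL, norm_smul, Real.norm_of_nonneg (hρ1 _).1, StarAlgEquiv.norm_map]
          gcongr
          exact (hρ1 _).2)
    exact ⟨L, fun _ => ⟨hL1, hL⟩⟩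
  choose B hB using hex
  refine ⟨B, fun q => ?_, fun q x hx => (hB q x hx).2⟩
  refine contMDiffOn_family hG (O := trivSet A E) isOpen_trivSet mem_trivSet
    (fun q x hx => (hB q x hx).1) (fun q g => ?_) (fun z q h => ?_) q
  · obtain ⟨H, hH, hHs⟩ := exists_smul_totalCoord hG hE hGE g p q
    have h1 : ContMDiffOn (𝓡 n) 𝓘(ℝ, A →L[ℝ] A) ∞ (fun x => ρ (g⁻¹ • x) • H (g⁻¹ • x))
        (trivSet A E q) :=
      contMDiffOn_smul_of_tsupport (hρ.comp (hG g⁻¹)) (isOpen_trivSet q)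
        ((isOpen_trivSet p).preimage (hG g⁻¹).continuous)
        ((tsupport_comp_subset_preimage ρ (hG g⁻¹).continuous).trans (preimage_mono hρp))
        (hHs.comp (hG g⁻¹).contMDiffOn fun x hx => ⟨hx.2, hmem g hx.1⟩)
    refine h1.congr fun x hx => ?_
    ext a
    rw [evalFamily_apply, (hB q x hx).2, _root_.smul_apply]
    rcases hcases (g⁻¹ • x) with h | h
    · rw [h, zero_smul, zero_smul]
    · rw [← hH ⟨g⁻¹ • x, ofFibreCoord E p (g⁻¹ • x) a⟩ h (hmem g hx), totalCoord_ofFibreCoord h]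
  · obtain ⟨K, hK, hKs⟩ := exists_smul_totalCoord hG hE hGE h⁻¹ q z
    refine ⟨fun x => K (h • x), fun _ => ContinuousLinearMap.id ℝ A,
      hKs.comp (hG h).contMDiffOn fun x hx => ⟨hx.2, by simpa using hx.1⟩, contMDiffOn_const,
      fun x hx hhx a g => ?_⟩
    have h1 : (h⁻¹ * g)⁻¹ • x = g⁻¹ • h • x := by rw [mul_inv_rev, inv_inv, mul_smul]
    have h2 := hK (g • (⟨g⁻¹ • h • x, ofFibreCoord E p (g⁻¹ • h • x) a⟩ : TotalSpace A E))
    rw [totalSpace_smul_fst hGE] at h2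
    simp only [smul_inv_smul, inv_smul_smul] at h2
    rw [(hB z x hx).2, ContinuousLinearMap.id_apply, (hB q _ hhx).2, h1, map_smul, h2 hhx hx, mul_smul]

end OrbitFamilies

/-! ### Invariant connections for actions of compact groups -/

section AveragedConnections
open Filter Topology MeasureTheory

/-- Isomorphisms of C*-algebras, as bounded real linear maps. -/
def StarAlgEquiv.toRealCLM {A B : Type*} [NonUnitalCStarAlgebra A] [NonUnitalCStarAlgebra B]
    (φ : A ≃⋆ₐ[ℂ] B) : A →L[ℝ] B :=
  LinearMap.mkContinuous
    { toFun := φ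
      map_add' := map_add φ
      map_smul' := fun c a => map_smul φ (c : ℂ) a } 1 fun a => by
    rw [one_mul]
    exact (StarAlgEquiv.norm_map φ a).le

@[simp]
theorem StarAlgEquiv.toRealCLM_apply {A B : Type*} [NonUnitalCStarAlgebra A]
    [NonUnitalCStarAlgebra B] (φ : A ≃⋆ₐ[ℂ] B) (a : A) : φ.toRealCLM a = φ a := rfl

variable {n : ℕ} {G X : Type*} [Group G] [TopologicalSpace G] [IsTopologicalGroup G]
  [CompactSpace G] [T2Space G] [EMetricSpace X] [SecondCountableTopology X]
  [ChartedSpace (EuclideanSpace ℝ (Fin n)) X] [IsManifold (𝓡 n) ∞ X] [MulAction G X]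
  [ContinuousSMul G X]
  {A : Type*} [NonUnitalCStarAlgebra A] {E : X → Type*} [∀ x, NonUnitalCStarAlgebra (E x)]
  [TopologicalSpace (TotalSpace A E)] [FiberBundle A E] [VectorBundle ℝ A E]
  [ContMDiffVectorBundle ∞ A E (𝓡 n)] [MulAction G (TotalSpace A E)]
  [ContinuousSMul G (TotalSpace A E)]

/-- A second cutoff function which is one near the support of the first one, so that multiplication
with it does not affect derivatives there. -/
theorem exists_cutoff_eq_one_near_tsupport (n : ℕ) {X : Type*} [EMetricSpace X]
    [SecondCountableTopology X] [ChartedSpace (EuclideanSpace ℝ (Fin n)) X]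
    [IsManifold (𝓡 n) ∞ X] {ρ : X → ℝ} {O : Set X} (hO : IsOpen O) (hρO : tsupport ρ ⊆ O) :
    ∃ θ : X → ℝ, ContMDiff (𝓡 n) 𝓘(ℝ, ℝ) ∞ θ ∧ tsupport θ ⊆ O ∧
      (∀ x ∈ tsupport ρ, ∀ᶠ y in 𝓝 x, θ y = 1) ∧ ∀ x, θ x ∈ Icc (0 : ℝ) 1 := by
  have : LocallyCompactSpace X := ChartedSpace.locallyCompactSpace (EuclideanSpace ℝ (Fin n)) X
  obtain ⟨θ, h0, h1, h01⟩ := exists_contMDiffMap_zero_one_nhds_of_isClosed (n := ⊤) (𝓡 n)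
    hO.isClosed_compl (isClosed_tsupport ρ) (disjoint_left.2 fun x hx hx' => hx (hρO hx'))
  refine ⟨θ, θ.contMDiff, fun x hx => ?_, fun x hx => h1.filter_mono (nhds_le_nhdsSet hx), h01⟩
  by_contra h
  exact notMem_tsupport_iff_eventuallyEq.2 (h0.filter_mono (nhds_le_nhdsSet h)) hx

/-- The translates of a local connection by all elements of `G` are, in a trivialization, the values
of a smooth function with values in `C(G, A)`. -/
theorem exists_contMDiffOn_translateOp
    (hG : ∀ g : G, ContMDiff (𝓡 n) (𝓡 n) ∞ (fun x : X => g • x)) (hE : IsCStarBundle A E)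
    (hGE : IsSmoothEquivariantBundle n G A E) {p : X} {ρ : X → ℝ}
    (hρ : ContMDiff (𝓡 n) 𝓘(ℝ, ℝ) ∞ ρ) (hρp : tsupport ρ ⊆ trivSet A E p)
    (hρ1 : ∀ x, ρ x ∈ Icc (0 : ℝ) 1)
    {T : SmoothVectorField n X → SmoothSection n A E → SmoothSection n A E}
    (hT : ∀ V σ x, T V σ x = ρ x • ofFibreCoord E p x
      (dirDeriv n (fun y => fibreCoord A p (σ y)) x (fieldValue V x)))
    (V : SmoothVectorField n X) (σ : SmoothSection n A E) (q : X) :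
    ∃ Φ : X → C(G, A), ContMDiffOn (𝓡 n) 𝓘(ℝ, C(G, A)) ∞ Φ (trivSet A E q) ∧
      ∀ x ∈ trivSet A E q, ∀ g, Φ x g = fibreCoord A q (translateOp hG hGE g T V σ x) := by
  obtain ⟨θ, hθ, hθp, hθρ, hθ1⟩ := exists_cutoff_eq_one_near_tsupport n (isOpen_trivSet p) hρp
  obtain ⟨F, hFs, hF⟩ := exists_family_to_trivialization hG hE hGE hθ hθp hθ1
  obtain ⟨B, hBs, hB⟩ := exists_family_from_trivialization hG hE hGE hρ hρp hρ1
  have hσ : ContMDiffOn (𝓡 n) 𝓘(ℝ, C(G, A)) ∞ (fun y => F q y (fibreCoord A q (σ y)))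
      (trivSet A E q) := (hFs q).clm_apply (contMDiffOn_fibreCoord q σ)
  -- `F` moves the section to the trivialization at `p`, where it is differentiated, and `B` moves
  -- the derivative back; both are smooth families, and the derivative in the direction of a field
  -- commutes with the evaluation at `g`
  refine ⟨fun x => pointwiseApply (B q x)
    (dirDeriv n (fun y => F q y (fibreCoord A q (σ y))) x (fieldValue V x)), ?_, ?_⟩
  · exact (pointwiseApply.contMDiff.comp_contMDiffOn (hBs q)).clm_apply
      (contMDiffOn_dirDeriv_apply (isOpen_trivSet q) hσ V)
  intro x hx g
  obtain ⟨y, rfl⟩ := MulAction.surjective g x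
  have hN : trivSet A E q ∈ 𝓝 (g • y) := (isOpen_trivSet q).mem_nhds hx
  rw [pointwiseApply_apply, hB q _ hx, inv_smul_smul, translateOp_smul, hT]
  set σ' := smulSection hG hGE g⁻¹ σ with hσ'
  have h1 : fibreCoord A q (fibreSMul hGE g y (ρ y • ofFibreCoord E p y
      (dirDeriv n (fun y => fibreCoord A p (σ' y)) y (fieldValue (smulField hG g⁻¹ V) y)))) =
      ρ y • totalCoord q (g • (⟨y, ofFibreCoord E p y (dirDeriv n
        (fun y => fibreCoord A p (σ' y)) y (fieldValue (smulField hG g⁻¹ V) y))⟩ :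
          TotalSpace A E)) := by
    rw [smul_mk hGE]
    exact (congrArg _ (map_smul (fibreSMul hGE g y) ((ρ y : ℝ) : ℂ) _)).trans
      (fibreCoord_real_smul hE hx _ _)
  refine Eq.trans ?_ h1.symm
  by_cases hy : ρ y = 0
  · rw [hy, zero_smul, zero_smul]
  have hys : y ∈ tsupport ρ := subset_tsupport ρ hy
  congr 5
  -- near `y` the cutoff function is one, and the family `F` is the coordinate of the translate
  have h2 : (fun z => F q z (fibreCoord A q (σ z)) g) =ᶠ[𝓝 (g • y)]
      fun z => fibreCoord A p (σ' (g⁻¹ • z)) := by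
    have h3 : ∀ᶠ z in 𝓝 (g • y), θ (g⁻¹ • z) = 1 := by
      have h4 : ContinuousAt (fun z : X => g⁻¹ • z) (g • y) := (hG g⁻¹).continuous.continuousAt
      have h5 : ∀ᶠ z in 𝓝 (g⁻¹ • g • y), θ z = 1 := by
        rw [inv_smul_smul]
        exact hθρ y hys
      exact h4.eventually h5
    filter_upwards [h3, hN] with z hz1 hz2
    rw [hF q z hz2, hz1, one_smul, ofFibreCoord_fibreCoord hz2, smul_mk hGE,
      ← smulSection_smul hG]
    rfl
  have h5 : dirDeriv n (fun z => F q z (fibreCoord A q (σ z)) g) (g • y) (fieldValue V (g • y)) =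
      (dirDeriv n (fun y => F q y (fibreCoord A q (σ y))) (g • y) (fieldValue V (g • y))) g :=
    dirDeriv_clm (ContinuousMap.evalCLM ℝ g) (hσ.contMDiffAt hN) _
  rw [← h5, dirDeriv_congr h2, dirDeriv_comp_smul (hG g⁻¹) (f := fun z => fibreCoord A p (σ' z)),
    fieldValue_smulField_inv, inv_smul_smul]
  rw [inv_smul_smul]
  exact (contMDiffOn_fibreCoord p σ').contMDiffAt ((isOpen_trivSet p).mem_nhds (hρp hys))

variable [MeasurableSpace G] [BorelSpace G] (μ : Measure G) [IsProbabilityMeasure μ]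

include μ in
/-- The average of the translates of a local connection over a compact group. -/
theorem exists_averaged_connection
    (hG : ∀ g : G, ContMDiff (𝓡 n) (𝓡 n) ∞ (fun x : X => g • x)) (hE : IsCStarBundle A E)
    (hGE : IsSmoothEquivariantBundle n G A E) {p : X} {ρ : X → ℝ}
    (hρ : ContMDiff (𝓡 n) 𝓘(ℝ, ℝ) ∞ ρ) (hρp : tsupport ρ ⊆ trivSet A E p)
    (hρ1 : ∀ x, ρ x ∈ Icc (0 : ℝ) 1)
    {T : SmoothVectorField n X → SmoothSection n A E → SmoothSection n A E}
    (hT : IsWeightedConnection ρ T)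
    (hTv : ∀ V σ x, T V σ x = ρ x • ofFibreCoord E p x
      (dirDeriv n (fun y => fibreCoord A p (σ y)) x (fieldValue V x))) :
    (∀ V σ x, Integrable (fun g => translateOp hG hGE g T V σ x) μ) ∧
    ∃ R : SmoothVectorField n X → SmoothSection n A E → SmoothSection n A E,
      IsWeightedConnection (fun x => ∫ g, ρ (g⁻¹ • x) ∂μ) R ∧
      ∀ V σ x, R V σ x = ∫ g, translateOp hG hGE g T V σ x ∂μ := by
  have hint : ∀ V σ x, Integrable (fun g => translateOp hG hGE g T V σ x) μ := by
    intro V σ x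
    obtain ⟨Φ, -, hΦ⟩ := exists_contMDiffOn_translateOp hG hE hGE hρ hρp hρ1 hTv V σ x
    have hx := mem_trivSet (A := A) (E := E) x
    have h1 : (fun g => translateOp hG hGE g T V σ x) =
        fun g => (coordEquiv hE hx).symm.toRealCLM (Φ x g) := by
      funext g
      rw [StarAlgEquiv.toRealCLM_apply, hΦ x hx, coordEquiv_symm_apply, ofFibreCoord_fibreCoord hx]
    rw [h1]
    exact Continuous.integrable_of_hasCompactSupport (by fun_prop) (.of_compactSpace _)
  have hsm : ∀ V σ, ContMDiff (𝓡 n) ((𝓡 n).prod 𝓘(ℝ, A)) ∞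
      (fun x => (⟨x, ∫ g, translateOp hG hGE g T V σ x ∂μ⟩ : TotalSpace A E)) := by
    intro V σ q
    obtain ⟨Φ, hΦs, hΦ⟩ := exists_contMDiffOn_translateOp hG hE hGE hρ hρp hρ1 hTv V σ q
    have hint' : ∀ f : C(G, A), Integrable f μ := fun f =>
      f.continuous.integrable_of_hasCompactSupport (.of_compactSpace _)
    set I : C(G, A) →L[ℝ] A := LinearMap.mkContinuous
      { toFun := fun f => ∫ g, f g ∂μ
        map_add' := fun f f' => integral_add (hint' f) (hint' f')
        map_smul' := fun c f => integral_smul c f } 1 (fun f => by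
        have h1 := norm_integral_le_of_norm_le_const (μ := μ)
          (Eventually.of_forall fun g => f.norm_coe_le_norm g)
        rwa [probReal_univ, mul_comm] at h1) with hI
    have h1 : ContMDiffOn (𝓡 n) ((𝓡 n).prod 𝓘(ℝ, A)) ∞
        (fun x => (⟨x, ∫ g, translateOp hG hGE g T V σ x ∂μ⟩ : TotalSpace A E))
        (trivSet A E q) := by
      refine ((trivializationAt A E q).contMDiffOn_section_iff (isOpen_trivSet q) subset_rfl).2 ?_
      refine (I.contMDiff.comp_contMDiffOn hΦs).congr fun x hx => ?_
      change fibreCoord A q (∫ g, translateOp hG hGE g T V σ x ∂μ) = ∫ g, Φ x g ∂μ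
      simp only [hΦ x hx, ← coordEquiv_apply hE hx, ← StarAlgEquiv.toRealCLM_apply]
      exact ((coordEquiv hE hx).toRealCLM.integral_comp_comm (hint V σ x)).symm
    exact h1.contMDiffAt ((isOpen_trivSet q).mem_nhds (mem_trivSet q))
  have hW := fun g => isWeightedConnection_translateOp hG hGE hT g
  have hw : ∀ x, Integrable (fun g : G => ρ (g⁻¹ • x)) μ := fun x =>
    (hρ.continuous.comp (by fun_prop : Continuous fun g : G => g⁻¹ • x))
      |>.integrable_of_hasCompactSupport (.of_compactSpace _)
  refine ⟨hint, fun V σ => ⟨_, hsm V σ⟩, ⟨?_, ?_, ?_, ?_, ?_, ?_, ?_⟩, fun _ _ _ => rfl⟩ <;>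
    simp only [ContMDiffSection.coeFn_mk]
  · intro U V W a h x
    simp only [fun g => (hW g).add_field U V W a h x]
    exact integral_add (hint V a x) (hint W a x)
  · intro f V W a hf h x
    simp only [fun g => (hW g).smul_field f V W a hf h x]
    exact integral_smul _ _
  · intro V a b c h x
    simp only [fun g => (hW g).add_section V a b c h x]
    exact integral_add (hint V a x) (hint V b x)
  · intro z V a b h x
    simp only [fun g => (hW g).smul_section z V a b h x]
    exact integral_smul _ _
  · intro f V a b hf h x
    simp only [fun g => (hW g).leibniz f V a b hf h x]
    refine (integral_add (by exact (hint V a x).smul (f x))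
      (((hw x).mul_const _).smul_const _)).trans ?_
    rw [integral_smul, integral_smul_const, integral_mul_const]
  · intro V a b c h x
    simp only [fun g => (hW g).mul_section V a b c h x]
    have h1 := (ContinuousLinearMap.mul ℝ (E x) (a x)).integral_comp_comm (hint V b x)
    have h2 := ((ContinuousLinearMap.mul ℝ (E x)).flip (b x)).integral_comp_comm (hint V a x)
    exact (integral_add ((ContinuousLinearMap.mul ℝ (E x) (a x)).integrable_comp (hint V b x))
      (((ContinuousLinearMap.mul ℝ (E x)).flip (b x)).integrable_comp (hint V a x))).trans
      (congrArg₂ (· + ·) h1 h2)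
  · intro V a b h x
    simp only [fun g => (hW g).star_section V a b h x]
    exact ((starL' ℝ : E x ≃L[ℝ] E x) : E x →L[ℝ] E x).integral_comp_comm (hint V a x)

omit [MeasurableSpace G] [BorelSpace G] in
/-- A connection that is patched from local trivial connections becomes invariant by averaging its
translates over the normalized Haar measure. The averages of the cutoff functions still add up to
one, and they are locally finite because the orbits of compact sets are compact. -/
theorem exists_invariant_connection_of_compact
    (hG : ∀ g : G, ContMDiff (𝓡 n) (𝓡 n) ∞ (fun x : X => g • x)) (hE : IsCStarBundle A E)
    (hGE : IsSmoothEquivariantBundle n G A E) :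
    ∃ D : HermitianConnection n A E, D.IsInvariant G := by
  let _ : MeasurableSpace G := borel G
  have : BorelSpace G := ⟨rfl⟩
  have : LocallyCompactSpace X := ChartedSpace.locallyCompactSpace (EuclideanSpace ℝ (Fin n)) X
  set μ : Measure G := Measure.haarMeasure ⊤ with hμ
  have : IsProbabilityMeasure μ := ⟨Measure.haarMeasure_self⟩
  obtain ⟨ρ, hρs⟩ := SmoothPartitionOfUnity.exists_isSubordinate (𝓡 n) isClosed_univ
    (fun x : X => trivSet A E x) isOpen_trivSet fun x _ => mem_iUnion.2 ⟨x, mem_trivSet x⟩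
  have hρ1 : ∀ i x, ρ i x ∈ Icc (0 : ℝ) 1 := fun i x => ⟨ρ.nonneg i x, ρ.le_one i x⟩
  choose T hT hTv using fun i => exists_cutoff_connection hE i (ρ i).contMDiff (hρs i)
  choose hint R hR hRv using fun i => exists_averaged_connection μ hG hE hGE (ρ i).contMDiff (hρs i)
    (hρ1 i) (hT i) (hTv i)
  -- the orbit of a compact neighbourhood of `x` is compact, and it meets the supports of only
  -- finitely many members of the partition of unity
  have hlf : LocallyFinite fun i : X => {x : X | ∃ g : G, ρ i (g⁻¹ • x) ≠ 0} := by
    intro x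
    obtain ⟨L, hL, hLx⟩ := exists_compact_mem_nhds x
    have hK : IsCompact ((fun z : G × X => z.1⁻¹ • z.2) '' (univ ×ˢ L)) :=
      (isCompact_univ.prod hL).image (by fun_prop)
    refine ⟨L, hLx, (ρ.locallyFinite.finite_nonempty_inter_compact hK).subset ?_⟩
    rintro i ⟨y, ⟨g, hg⟩, hy⟩
    exact ⟨g⁻¹ • y, hg, (g, y), ⟨mem_univ _, hy⟩, rfl⟩
  have hzero : ∀ {i x}, x ∉ {x : X | ∃ g : G, ρ i (g⁻¹ • x) ≠ 0} → ∀ g : G, ρ i (g⁻¹ • x) = 0 :=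
    fun hx g => by
      by_contra h
      exact hx ⟨g, h⟩
  obtain ⟨D, hD⟩ := exists_connection_of_finsum hR hlf
    (fun i V σ x hx => by
      rw [hRv]
      refine integral_eq_zero_of_ae (Eventually.of_forall fun g => ?_)
      obtain ⟨y, rfl⟩ := MulAction.surjective g x
      have hx0 : ρ i y = 0 := by simpa using hzero hx g
      change translateOp hG hGE g (T i) V σ (g • y) = 0
      rw [translateOp_smul, hTv, hx0, zero_smul, map_zero])
    (fun i x hx => by simp [hzero hx])
    (fun x => by
      have hfin := hlf.point_finite x
      have h1 : ∀ g : G, ∑ i ∈ hfin.toFinset, ρ i (g⁻¹ • x) = 1 := fun g => by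
        rw [← ρ.sum_eq_one (mem_univ (g⁻¹ • x))]
        refine (finsum_eq_sum_of_support_subset _ fun i hi => ?_).symm
        rw [Finite.coe_toFinset]
        exact ⟨g, hi⟩
      rw [finsum_eq_sum_of_support_subset (s := hfin.toFinset) _ fun i hi => by
        rw [Finite.coe_toFinset]
        by_contra h
        exact hi (by simp [hzero h])]
      rw [← integral_finsetSum]
      · simp [h1]
      · intro i _
        exact ((ρ i).contMDiff.continuous.comp (by fun_prop : Continuous fun g : G => g⁻¹ • x))
          |>.integrable_of_hasCompactSupport (.of_compactSpace _))
  refine ⟨D, fun h V V' a a' hV ha x => ?_⟩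
  rw [smul_mk hGE, hD, hD]
  congr 1
  rw [AddEquivClass.map_finsum (fibreSMul hGE h x)]
  refine finsum_congr fun i => ?_
  rw [hRv, hRv, ← integral_mul_left_eq_self _ h]
  simp only [fun g => translateOp_mul hG hGE (T i) h g hV ha x]
  exact (fibreSMul hGE h x).toRealCLM.integral_comp_comm (hint i V a x)

end AveragedConnections

end

theorem mainTheorem10
    (n : ℕ) (G : Type*) [Group G] [TopologicalSpace G] [IsTopologicalGroup G]
    [LocallyCompactSpace G] [T2Space G]
    (X : Type*) [EMetricSpace X] [SecondCountableTopology X]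
    [ChartedSpace (EuclideanSpace ℝ (Fin n)) X] [IsManifold (𝓡 n) ∞ X]
    [RiemannianBundle (fun x : X => TangentSpace (𝓡 n) x)]
    [IsContMDiffRiemannianBundle (𝓡 n) ∞ (EuclideanSpace ℝ (Fin n))
      (fun x : X => TangentSpace (𝓡 n) x)]
    [IsRiemannianManifold (𝓡 n) X] [CompleteSpace X]
    [MulAction G X] [ContinuousSMul G X] (_hGX : IsIsometricAction n G X)
    (A : Type*) [NonUnitalCStarAlgebra A]
    (E : X → Type*) [∀ x, NonUnitalCStarAlgebra (E x)] [TopologicalSpace (TotalSpace A E)]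
    [FiberBundle A E] [VectorBundle ℝ A E] [ContMDiffVectorBundle ∞ A E (𝓡 n)]
    (_hE : IsCStarBundle A E)
    [MulAction G (TotalSpace A E)] [ContinuousSMul G (TotalSpace A E)]
    (_hGE : IsSmoothEquivariantBundle n G A E) :
    (∀ D : HermitianConnection n A E, D.IsInvariant G →
      IsFeasible n G A E ∧
      ∀ r : X → ℝ, IsGeodesicRadius n G r →
        ∃ φ : PullbackIso A E (geodesicHomotopy n r) (geodesicHomotopyZero r),
          φ.IsEquivariant G ∧ φ.IsInverseParallelTransport D) ∧
    (CompactSpace G ∨ (DiscreteTopology G ∧ ProperSMul G X) →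
      (∃ D : HermitianConnection n A E, D.IsInvariant G) ∧ IsFeasible n G A E) := by
  refine ⟨fun D hD => ⟨isFeasible_of_isInvariant _hGX _hE _hGE hD, fun r hr =>
    exists_pullbackIso_of_isInvariant _hGX _hE _hGE hD hr⟩, fun h => ?_⟩
  suffices hD : ∃ D : HermitianConnection n A E, D.IsInvariant G from
    ⟨hD, hD.elim fun D hD => isFeasible_of_isInvariant _hGX _hE _hGE hD⟩
  rcases h with hG | ⟨hG, hX⟩
  · exact exists_invariant_connection_of_compact _hGX.contMDiff_smul _hE _hGE
  · exact exists_invariant_connection_of_discrete _hGX.contMDiff_smul _hE _hGE
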